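/- Let $\Bbbk$ be a commutative ring. Nonsymmetric (ns) operads are graded cohomologically; a complete dg ns operad is one whose components carry a decreasing filtration $F_0\supseteq F_1\supseteq\cdots$, with $F_0$ everything, compatible with compositions and differential, and which are complete in each arity and degree. **The operad $\mathrm{ncBV}$.** For $n\ge 1$, $\mathrm{ncBV}(n)$ is the free graded $\Bbbk$-module on the *bamboos with tadpoles*: graphs on the vertices $1,\dots,n$ whose edges are some of the pairs $\{j,j+1\}$ together with at most one tadpole at each vertex; edges and tadpoles have degree $1$, their default order is edges from left to right and then tadpoles from left to right, and reordering them produces the sign; $\mathrm{ncBV}(0)=0$. The composition $\Gamma_1\circ_i\Gamma_2$ inserts $\Gamma_2$ at the vertex $i$ of $\Gamma_1$; the edges of $\Gamma_1$ at $i$ are attached to the first, respectively last, vertex of $\Gamma_2$, and a tadpole of $\Gamma_1$ at $i$ is replaced by the sum of all tadpoles at vertices of $\Gamma_2$ and all edges between consecutive vertices of $\Gamma_2$ (a graph with a repeated edge or tadpole being $0$); the edges and tadpoles of $\Gamma_1$ precede those of $\Gamma_2$. The filtration is trivial and the differential is $0$. Let $b\in\mathrm{ncBV}(2)$ be the bamboo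 with one edge and no tadpole; it satisfies $b\circ_1b+b\circ_2b=0$. **The twisted operad.** $\mathrm{Tw}\,\mathrm{ncBV}$ is the complete coproduct $\mathrm{ncBV}\,\hat\vee\,\alpha$, with $\alpha$ of arity $0$ and degree $0$ placed in $F_1$, with the differential $\nu\mapsto d\nu+\mu\circ_1\nu-(-1)^{|\nu|}\sum_i\nu\circ_i\mu$, where $\mu=b(\alpha,-)+b(-,\alpha)$ and $d$ is the derivation with $d\alpha=-b(\alpha,\alpha)$ and $d=0$ on $\mathrm{ncBV}$. Its elements are series of bamboos with tadpoles whose vertices are white (inputs) or black (filled by $\alpha$). **The operad $\mathcal S^{-1}\mathrm{As}^{++}$.** Let $\mathcal S^{-1}\mathrm{As}$ be the ns operad generated by an operation $b$ of arity $2$ and degree $1$ with the relation $b\circ_1b+b\circ_2b=0$. Let $\gamma$ and $\zeta$ have arity $0$ and degrees $0$ and $1$, with $\zeta$ placed in $F_1$ and $\gamma$ placed in $F_w$, where $w\in\{1,2\}$, and put $$\mathcal S^{-1}\mathrm{As}^{++}=\frac{\mathcal S^{-1}\mathrm{As}\,\hat\vee\,\gamma\,\hat\vee\,\zeta}{\bigl(b(\gamma,-),\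 b(-,\gamma),\ b(\zeta,-)+b(-,\zeta)\bigr)}\,.$$ **Theorem.** $\mathrm{Tw}\,\mathrm{ncBV}$ and its cohomology (with the induced filtration) are complete dg ns operads, and so are $\mathcal S^{-1}\mathrm{As}\,\hat\vee\,\gamma\,\hat\vee\,\zeta$ and $\mathcal S^{-1}\mathrm{As}^{++}$ (with zero differential); the former is the universal complete dg ns operad with cocycles $b$, $\gamma\in F_w$, $\zeta\in F_1$ of the above arities and degrees such that $b\circ_1b+b\circ_2b=0$. There is a unique morphism of complete dg ns operads $$\Phi:\mathcal S^{-1}\mathrm{As}\,\hat\vee\,\gamma\,\hat\vee\,\zeta\longrightarrow\mathrm{Tw}\,\mathrm{ncBV}$$ sending $b$ to two white vertices joined by an edge, $\gamma$ to two disconnected black vertices, and $\zeta$ to one black vertex with a tadpole. Its values are cocycles, and it induces a morphism of complete ns operads $$\Psi:\mathcal S^{-1}\mathrm{As}^{++}\longrightarrow \mathrm H(\mathrm{Tw}\,\mathrm{ncBV})$$ which is bijective in every arity and degree and satisfies $F_{a+2-w}\,\mathrm H(\mathrm{Tw}\,\mathrm{ncBV})\subseteq\Psi(F_a\,\mathcal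 S^{-1}\mathrm{As}^{++})$ for all $a\ge 0$. In particular $\Psi$ is an isomorphism of ns operads and a homeomorphism for both values of $w$, and for $w=2$ it is an isomorphism of filtered operads. -/

import Mathlib

universe u

noncomputable section

/-! ### Complete differential graded nonsymmetric operads -/

/-- The data underlying a filtered dg nonsymmetric operad over `k`, in cohomological degrees `≥ 0`:
`V n p` is the module of operations of arity `n` and degree `p`, `comp i` is the partial composition
at the input number `i` (inputs are numbered `0, …, m - 1`), `d` is the differential of degree `+1`
and `F n p q` is the `q`-th step of the decreasing filtration of `V n p`. Arities and degrees of
results are variables subject to an equation, which avoids casts. The laws are in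
`NSOp.IsCompleteDGOperad`. -/
structure NSOp (k : Type u) [CommRing k] where
  V : ℕ → ℕ → Type u
  [addCommGroup : ∀ n p, AddCommGroup (V n p)]
  [module : ∀ n p, Module k (V n p)]
  one : V 1 0
  comp : ∀ {m n l p q r : ℕ} (i : ℕ), i < m → m + n = l + 1 → p + q = r →
    (V m p →ₗ[k] V n q →ₗ[k] V l r)
  d : ∀ {n p q : ℕ}, p + 1 = q → (V n p →ₗ[k] V n q)
  F : ∀ n p : ℕ, ℕ → Submodule k (V n p)

attribute [instance] NSOp.addCommGroup NSOp.module

namespace NSOp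

variable {k : Type u} [CommRing k]

/-- The laws of a complete dg ns operad. -/
structure IsCompleteDGOperad (P : NSOp k) : Prop where
  one_comp : ∀ {n p : ℕ} (x : P.V n p),
    P.comp 0 one_pos (Nat.add_comm 1 n) (Nat.zero_add p) P.one x = x
  comp_one : ∀ {n p : ℕ} (x : P.V n p) (i : ℕ) (hi : i < n),
    P.comp i hi rfl (Nat.add_zero p) x P.one = x
  /-- sequential composition: `(x ∘ᵢ y) ∘ᵢ₊ⱼ z = x ∘ᵢ (y ∘ⱼ z)` -/
  comp_seq : ∀ {m n s l t e p q r pq qr pqr : ℕ} (i j : ℕ) (hi : i < m) (hj : j < n)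
    (hij : i + j < l) (hl : m + n = l + 1) (he : l + s = e + 1) (ht : n + s = t + 1)
    (he' : m + t = e + 1) (h₁ : p + q = pq) (h₂ : pq + r = pqr) (h₃ : q + r = qr)
    (h₄ : p + qr = pqr) (x : P.V m p) (y : P.V n q) (z : P.V s r),
    P.comp (i + j) hij he h₂ (P.comp i hi hl h₁ x y) z
      = P.comp i hi he' h₄ x (P.comp j hj ht h₃ y z)
  /-- parallel composition: `(x ∘ᵢ y) ∘ⱼ₊ₙ₋₁ z = (-1)^(|y||z|) (x ∘ⱼ z) ∘ᵢ y` for `i < j` -/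
  comp_par : ∀ {m n s l t e p q r pq pr pqr : ℕ} (i j j' : ℕ) (_ : i < j) (hj : j < m)
    (_ : j' + 1 = j + n) (hi : i < m) (hjl : j' < l) (hit : i < t)
    (hl : m + n = l + 1) (he : l + s = e + 1) (ht : m + s = t + 1)
    (he' : t + n = e + 1) (h₁ : p + q = pq) (h₂ : pq + r = pqr) (h₃ : p + r = pr)
    (h₄ : pr + q = pqr) (x : P.V m p) (y : P.V n q) (z : P.V s r),
    P.comp j' hjl he h₂ (P.comp i hi hl h₁ x y) z
      = (-1 : k) ^ (q * r) • P.comp i hit he' h₄ (P.comp j hj ht h₃ x z) y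
  d_d : ∀ {n p q r : ℕ} (hp : p + 1 = q) (hq : q + 1 = r) (x : P.V n p), P.d hq (P.d hp x) = 0
  d_one : ∀ {q : ℕ} (hq : 0 + 1 = q), P.d hq P.one = 0
  d_comp : ∀ {m n l p q r p' q' r' : ℕ} (i : ℕ) (hi : i < m) (hl : m + n = l + 1)
    (hr : p + q = r) (hp' : p + 1 = p') (hq' : q + 1 = q') (hr' : r + 1 = r')
    (h₁ : p' + q = r') (h₂ : p + q' = r') (x : P.V m p) (y : P.V n q),
    P.d hr' (P.comp i hi hl hr x y)
      = P.comp i hi hl h₁ (P.d hp' x) y + (-1 : k) ^ p • P.comp i hi hl h₂ x (P.d hq' y)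
  F_zero : ∀ n p : ℕ, P.F n p 0 = ⊤
  F_antitone : ∀ n p : ℕ, Antitone (P.F n p)
  comp_F : ∀ {m n l p q r a b : ℕ} (i : ℕ) (hi : i < m) (hl : m + n = l + 1) (hr : p + q = r)
    (x : P.V m p) (y : P.V n q), x ∈ P.F m p a → y ∈ P.F n q b →
    P.comp i hi hl hr x y ∈ P.F l r (a + b)
  d_F : ∀ {n p q a : ℕ} (hq : p + 1 = q) (x : P.V n p), x ∈ P.F n p a → P.d hq x ∈ P.F n q a
  /-- the canonical map from `V n p` to the limit of the quotients `V n p / F_a` is bijective -/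
  complete : ∀ (n p : ℕ) (x : ℕ → P.V n p), (∀ a, x (a + 1) - x a ∈ P.F n p a) →
    ∃! y : P.V n p, ∀ a, y - x a ∈ P.F n p a

/-- Morphisms of complete dg ns operads. -/
@[ext]
structure Hom (P Q : NSOp k) where
  toFun : ∀ n p : ℕ, P.V n p →ₗ[k] Q.V n p
  map_one : toFun 1 0 P.one = Q.one
  map_comp : ∀ {m n l p q r : ℕ} (i : ℕ) (hi : i < m) (hl : m + n = l + 1) (hr : p + q = r)
    (x : P.V m p) (y : P.V n q),
    toFun l r (P.comp i hi hl hr x y) = Q.comp i hi hl hr (toFun m p x) (toFun n q y)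
  map_d : ∀ {n p q : ℕ} (hq : p + 1 = q) (x : P.V n p),
    toFun n q (P.d hq x) = Q.d hq (toFun n p x)
  map_F : ∀ {n p a : ℕ} (x : P.V n p), x ∈ P.F n p a → toFun n p x ∈ Q.F n p a

/-! ### Quotients by closed operadic ideals -/

/-- The closed dg operadic ideal generated by a collection `R` of elements. -/
inductive InIdeal (P : NSOp k) (R : ∀ n p : ℕ, P.V n p → Prop) : ∀ {n p : ℕ}, P.V n p → Prop
  | of {n p : ℕ} (x : P.V n p) : R n p x → InIdeal P R x
  | zero {n p : ℕ} : InIdeal P R (0 : P.V n p)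
  | add {n p : ℕ} (x y : P.V n p) : InIdeal P R x → InIdeal P R y → InIdeal P R (x + y)
  | smul {n p : ℕ} (c : k) (x : P.V n p) : InIdeal P R x → InIdeal P R (c • x)
  | comp_left {m n l p q r : ℕ} (i : ℕ) (hi : i < m) (hl : m + n = l + 1) (hr : p + q = r)
      (x : P.V m p) (y : P.V n q) : InIdeal P R x → InIdeal P R (P.comp i hi hl hr x y)
  | comp_right {m n l p q r : ℕ} (i : ℕ) (hi : i < m) (hl : m + n = l + 1) (hr : p + q = r)
      (x : P.V m p) (y : P.V n q) : InIdeal P R y → InIdeal P R (P.comp i hi hl hr x y)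
  | d {n p q : ℕ} (hq : p + 1 = q) (x : P.V n p) : InIdeal P R x → InIdeal P R (P.d hq x)
  | closed {n p : ℕ} (x : P.V n p) (y : ℕ → P.V n p) : (∀ a, InIdeal P R (y a)) →
      (∀ a, x - y a ∈ P.F n p a) → InIdeal P R x

/-- The arity `n` and degree `p` component of the closed ideal generated by `R`. -/
def ideal (P : NSOp k) (R : ∀ n p : ℕ, P.V n p → Prop) (n p : ℕ) : Submodule k (P.V n p) where
  carrier := {x | InIdeal P R x}
  zero_mem' := .zero
  add_mem' := fun hx hy => .add _ _ hx hy
  smul_mem' := fun c _ hx => .smul c _ hx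

/-- The bilinear map induced on quotients. -/
def quotBilin {M N L : Type*} [AddCommGroup M] [AddCommGroup N] [AddCommGroup L]
    [Module k M] [Module k N] [Module k L] (A : Submodule k M) (B : Submodule k N)
    (C : Submodule k L) (f : M →ₗ[k] N →ₗ[k] L) (hA : ∀ x ∈ A, ∀ y, f x y ∈ C)
    (hB : ∀ x, ∀ y ∈ B, f x y ∈ C) : (M ⧸ A) →ₗ[k] (N ⧸ B) →ₗ[k] (L ⧸ C) :=
  A.liftQ
    (LinearMap.mk₂ k (fun x y => B.mapQ C (f x) (fun y hy => hB x y hy) y)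
      (fun x x' y => by
        obtain ⟨y, rfl⟩ := Submodule.Quotient.mk_surjective _ y; simp)
      (fun c x y => by
        obtain ⟨y, rfl⟩ := Submodule.Quotient.mk_surjective _ y; simp)
      (fun x y y' => by simp)
      (fun c x y => by simp))
    (fun x hx => by
      rw [LinearMap.mem_ker]
      ext y
      simpa using hA x hx y)

theorem quotBilin_mk {M N L : Type*} [AddCommGroup M] [AddCommGroup N] [AddCommGroup L]
    [Module k M] [Module k N] [Module k L] (A : Submodule k M) (B : Submodule k N)
    (C : Submodule k L) (f : M →ₗ[k] N →ₗ[k] L) (hA : ∀ x ∈ A, ∀ y, f x y ∈ C)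
    (hB : ∀ x, ∀ y ∈ B, f x y ∈ C) (x : M) (y : N) :
    quotBilin A B C f hA hB (A.mkQ x) (B.mkQ y) = C.mkQ (f x y) := rfl

/-- The quotient of `P` by the closed ideal generated by `R`, with the quotient filtration. -/
def quot (P : NSOp k) (R : ∀ n p : ℕ, P.V n p → Prop) : NSOp k where
  V n p := P.V n p ⧸ P.ideal R n p
  one := (P.ideal R 1 0).mkQ P.one
  comp {m n l p q r} i hi hl hr :=
    quotBilin (P.ideal R m p) (P.ideal R n q) (P.ideal R l r) (P.comp i hi hl hr)
      (fun x hx y => InIdeal.comp_left i hi hl hr x y hx)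
      (fun x y hy => InIdeal.comp_right i hi hl hr x y hy)
  d {n p q} hq := (P.ideal R n p).mapQ (P.ideal R n q) (P.d hq) (fun x hx => InIdeal.d hq x hx)
  F n p a := (P.F n p a).map (P.ideal R n p).mkQ

/-- The projection onto the quotient. -/
def proj (P : NSOp k) (R : ∀ n p : ℕ, P.V n p → Prop) {n p : ℕ} :
    P.V n p →ₗ[k] (P.quot R).V n p := (P.ideal R n p).mkQ

/-- The element `b ∘₁ b + b ∘₂ b`. -/
def assoc (P : NSOp k) (b : P.V 2 1) : P.V 3 2 :=
  P.comp 0 two_pos (by omega) (by omega) b b + P.comp 1 one_lt_two (by omega) (by omega) b b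

/-! ### Cohomology -/

/-- Cocycles. -/
def cocycles (P : NSOp k) (n p : ℕ) : Submodule k (P.V n p) :=
  LinearMap.ker (P.d (n := n) (rfl : p + 1 = p + 1))

/-- Coboundaries, as a submodule of the module of cocycles. -/
def coboundaries (P : NSOp k) (n p : ℕ) : Submodule k (P.cocycles n p) where
  carrier := {x | x.1 = 0 ∨ ∃ (q : ℕ) (hq : q + 1 = p) (y : P.V n q), P.d hq y = x.1}
  zero_mem' := Or.inl rfl
  add_mem' := by
    rintro ⟨x, _⟩ ⟨x', _⟩ (rfl | ⟨q, hq, y, rfl⟩) (rfl | ⟨q', hq', y', rfl⟩)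
    · exact Or.inl (add_zero _)
    · exact Or.inr ⟨q', hq', y', (zero_add _).symm⟩
    · exact Or.inr ⟨q, hq, y, (add_zero _).symm⟩
    · obtain rfl : q = q' := by omega
      exact Or.inr ⟨q, hq, y + y', map_add _ _ _⟩
  smul_mem' := by
    rintro c ⟨x, _⟩ (rfl | ⟨q, hq, y, rfl⟩)
    · exact Or.inl (smul_zero _)
    · exact Or.inr ⟨q, hq, c • y, map_smul _ _ _⟩

theorem d_of_mem_cocycles (P : NSOp k) {n p q : ℕ} (hq : p + 1 = q) (x : P.cocycles n p) :
    P.d hq x.1 = 0 := by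
  subst hq; exact x.2

/-- The partial composition of cocycles. -/
def cocyclesComp (P : NSOp k) (h : P.IsCompleteDGOperad) {m n l p q r : ℕ} (i : ℕ) (hi : i < m)
    (hl : m + n = l + 1) (hr : p + q = r) :
    P.cocycles m p →ₗ[k] P.cocycles n q →ₗ[k] P.cocycles l r :=
  LinearMap.mk₂ k
    (fun x y => ⟨P.comp i hi hl hr x.1 y.1, by
      refine LinearMap.mem_ker.2 ?_
      rw [h.d_comp i hi hl hr rfl rfl rfl (by omega) (by omega), P.d_of_mem_cocycles rfl x,
        P.d_of_mem_cocycles rfl y]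
      simp⟩)
    (fun _ _ _ => Subtype.ext (by simp)) (fun _ _ _ => Subtype.ext (by simp))
    (fun _ _ _ => Subtype.ext (by simp)) (fun _ _ _ => Subtype.ext (by simp))

theorem cocyclesComp_left (P : NSOp k) (h : P.IsCompleteDGOperad) {m n l p q r : ℕ} (i : ℕ)
    (hi : i < m) (hl : m + n = l + 1) (hr : p + q = r) (x : P.cocycles m p)
    (hx : x ∈ P.coboundaries m p) (y : P.cocycles n q) :
    P.cocyclesComp h i hi hl hr x y ∈ P.coboundaries l r := by
  obtain ⟨x, hx'⟩ := x
  rcases hx with hx | ⟨s, hs, z, hz⟩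
  · obtain rfl : x = 0 := hx
    exact Or.inl (by simp [cocyclesComp])
  · obtain rfl : P.d hs z = x := hz
    refine Or.inr ⟨s + q, by omega, P.comp i hi hl rfl z y.1, ?_⟩
    rw [h.d_comp i hi hl rfl hs rfl (by omega) hr (by omega), P.d_of_mem_cocycles rfl y]
    simp [cocyclesComp]

theorem cocyclesComp_right (P : NSOp k) (h : P.IsCompleteDGOperad) {m n l p q r : ℕ} (i : ℕ)
    (hi : i < m) (hl : m + n = l + 1) (hr : p + q = r) (x : P.cocycles m p)
    (y : P.cocycles n q) (hy : y ∈ P.coboundaries n q) :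
    P.cocyclesComp h i hi hl hr x y ∈ P.coboundaries l r := by
  obtain ⟨y, hy'⟩ := y
  rcases hy with hy | ⟨s, hs, z, hz⟩
  · obtain rfl : y = 0 := hy
    exact Or.inl (by simp [cocyclesComp])
  · obtain rfl : P.d hs z = y := hz
    refine Or.inr ⟨p + s, by omega, (-1 : k) ^ p • P.comp i hi hl rfl x.1 z, ?_⟩
    rw [map_smul, h.d_comp i hi hl rfl rfl hs (by omega) (by omega) hr,
      P.d_of_mem_cocycles rfl x]
    simp [cocyclesComp, smul_smul, ← mul_pow]

/-- The cohomology operad of a complete dg ns operad: cocycles modulo coboundaries, with the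
induced compositions, the zero differential and the induced filtration (a class lies in `F a` when
it has a representing cocycle in `F a`). -/
def cohomology (P : NSOp k) (h : P.IsCompleteDGOperad) : NSOp k where
  V n p := P.cocycles n p ⧸ P.coboundaries n p
  one := (P.coboundaries 1 0).mkQ ⟨P.one, h.d_one rfl⟩
  comp {m n l p q r} i hi hl hr :=
    quotBilin (P.coboundaries m p) (P.coboundaries n q) (P.coboundaries l r)
      (P.cocyclesComp h i hi hl hr) (P.cocyclesComp_left h i hi hl hr)
      (P.cocyclesComp_right h i hi hl hr)
  d _ := 0
  F n p a := ((P.F n p a).comap (P.cocycles n p).subtype).map (P.coboundaries n p).mkQ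

/-- The cohomology class of a cocycle. -/
def cohomologyClass (P : NSOp k) (h : P.IsCompleteDGOperad) {n p : ℕ} (x : P.V n p)
    (hx : P.d rfl x = 0) : (P.cohomology h).V n p :=
  (P.coboundaries n p).mkQ ⟨x, hx⟩

/-! ### Operadic twisting -/

/-- The module of operations of arity `n` and degree `p` of the complete coproduct of `P` with an
operation `α` of arity `0` and degree `0`: series of operations of `P` with copies of `α` plugged at
some of their inputs. An input is recorded by `true` when it is free and by `false` when it is
filled by `α`; a word `w` with `n` letters `true` is a pattern of arity `n`. -/
abbrev Series (P : NSOp k) (n p : ℕ) : Type u :=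
  (w : {w : List Bool // w.count true = n}) → P.V w.1.length p

/-- The element of `P ∨ α` obtained by plugging `α` in the inputs of `x` according to `w`. -/
def plug (P : NSOp k) {n p : ℕ} (w : List Bool) (hw : w.count true = n) (x : P.V w.length p) :
    P.Series n p := Pi.single ⟨w, hw⟩ x

theorem count_cut (w : List Bool) {a c i m n l : ℕ} (hw : w.count true = l) (hl : m + n = l + 1)
    (h : a ≤ c ∧ c ≤ w.length ∧ (w.take a).count true = i ∧
      ((w.take c).drop a).count true = n) :
    (w.take a ++ true :: w.drop c).count true = m := by
  obtain ⟨h₁, h₂, h₃, h₄⟩ := h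
  have e : w = w.take a ++ ((w.take c).drop a ++ w.drop c) := by
    conv_lhs => rw [← List.take_append_drop c w, ← List.take_append_drop a (w.take c)]
    rw [List.take_take, min_eq_left h₁, List.append_assoc]
  have e' := congrArg (List.count true) e
  simp only [List.count_append] at e'
  simp only [List.count_append, List.count_cons_self]
  omega

/-- Partial composition of series at the input `i`. The coefficient at `w` is the sum over the ways
to obtain `w` by replacing the `i`-th letter `true` of a word `u` by a word `v`; here `v` is made up
of the letters of `w` at the positions `a, …, c - 1`. -/
def seriesComp (P : NSOp k) {m n l p q r : ℕ} (i : ℕ) (hl : m + n = l + 1) (hr : p + q = r) :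
    P.Series m p →ₗ[k] P.Series n q →ₗ[k] P.Series l r :=
  LinearMap.mk₂ k
    (fun x y w => ∑ a ∈ Finset.range (w.1.length + 1), ∑ c ∈ Finset.range (w.1.length + 1),
      if h : a ≤ c ∧ c ≤ w.1.length ∧ (w.1.take a).count true = i ∧
          ((w.1.take c).drop a).count true = n then
        P.comp (m := (w.1.take a ++ true :: w.1.drop c).length)
          (n := ((w.1.take c).drop a).length) (l := w.1.length) a
          (by simp; omega) (by simp; omega) hr
          (x ⟨w.1.take a ++ true :: w.1.drop c, count_cut w.1 w.2 hl h⟩)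
          (y ⟨(w.1.take c).drop a, h.2.2.2⟩)
      else 0)
    (fun x x' y => by
      funext w
      simp only [Pi.add_apply, ← Finset.sum_add_distrib]
      refine Finset.sum_congr rfl fun a _ => Finset.sum_congr rfl fun c _ => ?_
      split_ifs <;> simp)
    (fun t x y => by
      funext w
      simp only [Pi.smul_apply, Finset.smul_sum]
      refine Finset.sum_congr rfl fun a _ => Finset.sum_congr rfl fun c _ => ?_
      split_ifs <;> simp)
    (fun x y y' => by
      funext w
      simp only [Pi.add_apply, ← Finset.sum_add_distrib]
      refine Finset.sum_congr rfl fun a _ => Finset.sum_congr rfl fun c _ => ?_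
      split_ifs <;> simp)
    (fun t x y => by
      funext w
      simp only [Pi.smul_apply, Finset.smul_sum]
      refine Finset.sum_congr rfl fun a _ => Finset.sum_congr rfl fun c _ => ?_
      split_ifs <;> simp)

theorem cut_two (w : List Bool) {a : ℕ} (h : (w.drop a).take 2 = [false, false]) :
    w = w.take a ++ false :: false :: w.drop (a + 2) := by
  conv_lhs => rw [← List.take_append_drop a w, ← List.take_append_drop 2 (w.drop a), h,
    List.drop_drop]
  rfl

theorem count_cut_two (w : List Bool) {a n : ℕ} (hw : w.count true = n)
    (h : (w.drop a).take 2 = [false, false]) :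
    (w.take a ++ false :: w.drop (a + 2)).count true = n := by
  have e := congrArg (List.count true) (cut_two w h)
  simp only [List.count_append, List.count_cons] at e ⊢
  simpa [hw] using e.symm

theorem length_cut_two (w : List Bool) {a : ℕ} (h : (w.drop a).take 2 = [false, false]) :
    a + 2 ≤ w.length := by
  have e := congrArg List.length h
  simp at e
  omega

/-- The differential of `MC P`: the derivation which extends the differential of `P` by
`d α = - b(α, α)`. The summand with index `a` is the contribution of two consecutive `α`'s created
at the positions `a` and `a + 1`. -/
def mcD (P : NSOp k) (b : P.V 2 1) {n p q : ℕ} (hq : p + 1 = q) :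
    P.Series n p →ₗ[k] P.Series n q where
  toFun x w := P.d hq (x w) - (-1 : k) ^ p • ∑ a ∈ Finset.range w.1.length,
    if h : (w.1.drop a).take 2 = [false, false] then
      P.comp (m := (w.1.take a ++ false :: w.1.drop (a + 2)).length) (l := w.1.length) a
        (by have := length_cut_two w.1 h; simp; omega)
        (by have := length_cut_two w.1 h; simp; omega) hq
        (x ⟨w.1.take a ++ false :: w.1.drop (a + 2), count_cut_two w.1 w.2 h⟩) b
    else 0
  map_add' x x' := by
    funext w
    simp only [Pi.add_apply, map_add]
    rw [sub_add_sub_comm, ← smul_add, ← Finset.sum_add_distrib]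
    congr 2
    refine Finset.sum_congr rfl fun a _ => ?_
    split_ifs <;> simp
  map_smul' c x := by
    funext w
    simp only [Pi.smul_apply, map_smul, RingHom.id_apply]
    rw [smul_sub, smul_comm c, Finset.smul_sum (r := c)]
    congr 2
    refine Finset.sum_congr rfl fun a _ => ?_
    split_ifs <;> simp

/-- The operad `MC P = (P ∨ α, d)` of a complete dg ns operad `P` with a chosen operation `b` of
arity `2` and degree `1`, where `α` has arity `0`, degree `0`, lies in `F 1` and satisfies
`d α = - b(α, α)`. -/
def MC (P : NSOp k) (b : P.V 2 1) : NSOp k where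
  V n p := P.Series n p
  one := P.plug [true] rfl P.one
  comp i _ hl hr := P.seriesComp i hl hr
  d hq := P.mcD b hq
  F _ p a :=
    { carrier := {x | ∀ w, x w ∈ P.F w.1.length p (a - w.1.count false)}
      zero_mem' := fun _ => Submodule.zero_mem _
      add_mem' := fun hx hy w => Submodule.add_mem _ (hx w) (hy w)
      smul_mem' := fun c _ hx w => Submodule.smul_mem _ c (hx w) }

/-- The operad `P` with the differential twisted by `μ`:
`ν ↦ d ν + μ ∘ ν - (-1)^|ν| ∑ᵢ ν ∘ᵢ μ`. -/
def twist (P : NSOp k) (μ : P.V 1 1) : NSOp k where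
  V := P.V
  one := P.one
  comp := P.comp
  d {n p _} hq := P.d hq + P.comp 0 one_pos (Nat.add_comm 1 n) (by omega) μ
    - (-1 : k) ^ p • ∑ i : Fin n, (P.comp i.1 i.2 rfl hq).flip μ
  F := P.F

/-- The Maurer–Cartan element `b(α, -) + b(-, α)` of `MC P`. -/
def muAlpha (P : NSOp k) (b : P.V 2 1) : (P.MC b).V 1 1 :=
  ((P.plug [false, true] rfl b : P.Series 1 1) + (P.plug [true, false] rfl b : P.Series 1 1))

/-- The twisted operad `Tw P` of a complete dg ns operad under the operad of shifted (homotopy)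
associative algebras, when the shifted associative product is `b` and the higher operations act
by zero. -/
def Tw (P : NSOp k) (b : P.V 2 1) : NSOp k := (P.MC b).twist (P.muAlpha b)

end NSOp

/-! ### The nonsymmetric operad `ncBV` -/

namespace NcBV

/-- Edges and tadpoles: `Sum.inlₗ j` is the edge from the vertex `j` to the vertex `j + 1` and
`Sum.inrₗ j` is the tadpole at the vertex `j` (vertices are numbered from `0`). The order is the
default order on edges and tadpoles: edges from left to right first, then tadpoles from left to
right. -/
abbrev Slot : Type := ℕ ⊕ₗ ℕ

/-- The edge from `j` to `j + 1`. -/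
abbrev edge (j : ℕ) : Slot := Sum.inlₗ j

/-- The tadpole at `j`. -/
abbrev tadpole (j : ℕ) : Slot := Sum.inrₗ j

/-- The edges and tadpoles that a bamboo with `n` vertices can have. -/
def slots (n : ℕ) : Finset Slot :=
  (Finset.range (n - 1)).image edge ∪ (Finset.range n).image tadpole

variable (k : Type u) [CommRing k]

/-- Linear combinations of edges and tadpoles. -/
abbrev Gen : Type u := Slot →₀ k

/-- The exterior algebra on all edges and tadpoles: products of edges and tadpoles, where
reordering generates the sign and where a product with a repeated edge or tadpole vanishes. -/
abbrev Ext : Type u := ExteriorAlgebra k (Gen k)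

/-- The bamboo with set `s` of edges and tadpoles, in the default order. -/
def bamboo (s : Finset Slot) : Ext k :=
  Module.Basis.ExteriorAlgebra (Finsupp.basisSingleOne : Module.Basis Slot k (Gen k)) s

theorem bamboo_linearIndependent : LinearIndependent k (bamboo k) :=
  Module.Basis.linearIndependent _

/-- Linear combinations of the bamboos with `n ≥ 1` vertices and a total of `p` edges and tadpoles;
this is a free module on these bamboos, see `bamboo_linearIndependent`. -/
def component (n p : ℕ) : Submodule k (Ext k) :=
  Submodule.span k (bamboo k '' {s | 0 < n ∧ s ⊆ slots n ∧ s.card = p})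

/-- The effect on the edges and tadpoles of a bamboo of the replacement of the vertex `i` by a
bamboo with `n` vertices. A tadpole at `i` becomes the sum of the tadpoles at the new vertices
`i, …, i + n - 1` and of the edges between two consecutive ones. -/
def insertMap (i n : ℕ) : Gen k →ₗ[k] Gen k :=
  Finsupp.linearCombination k fun s : Slot =>
    match ofLex s with
    | Sum.inl j => if j < i then Finsupp.single (edge j) 1
        else Finsupp.single (edge (j + n - 1)) 1
    | Sum.inr j => if j < i then Finsupp.single (tadpole j) 1
        else if i < j then Finsupp.single (tadpole (j + n - 1)) 1
        else ∑ t ∈ Finset.range n, Finsupp.single (tadpole (i + t)) 1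
          + ∑ t ∈ Finset.range (n - 1), Finsupp.single (edge (i + t)) 1

/-- The relabelling of the edges and tadpoles of a bamboo whose first vertex becomes the vertex
`i`. -/
def shiftMap (i : ℕ) : Gen k →ₗ[k] Gen k :=
  Finsupp.linearCombination k fun s : Slot =>
    match ofLex s with
    | Sum.inl j => Finsupp.single (edge (i + j)) 1
    | Sum.inr j => Finsupp.single (tadpole (i + j)) 1

variable {k}

/-- The composition at the vertex `i` with a bamboo with `n` vertices: the edges and tadpoles of
the first bamboo followed by those of the second one. -/
def compExt (i n : ℕ) (x y : Ext k) : Ext k :=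
  ExteriorAlgebra.map (insertMap k i n) x * ExteriorAlgebra.map (shiftMap k i) y

theorem bamboo_empty : bamboo k ∅ = 1 := by
  have h := ExteriorAlgebra.basis_apply_ofCard
    (Finsupp.basisSingleOne : Module.Basis Slot k (Gen k)) (s := ∅) (n := 0) rfl
  rw [bamboo, h]
  simp [ExteriorAlgebra.ιMulti_family]

theorem bamboo_singleton (a : Slot) :
    bamboo k {a} = ExteriorAlgebra.ι k (Finsupp.single a 1) := by
  have h := ExteriorAlgebra.basis_apply_ofCard
    (Finsupp.basisSingleOne : Module.Basis Slot k (Gen k)) (s := {a}) (n := 1) rfl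
  rw [bamboo, h]
  rw [ExteriorAlgebra.ιMulti_family, ExteriorAlgebra.ιMulti_apply]
  have h' : ∀ j, Set.powersetCard.ofFinEmbEquiv.symm
      (Set.powersetCard.ofCard (Finset.card_singleton a)) j = a := by
    intro j
    have := (Set.powersetCard.mem_range_ofFinEmbEquiv_symm_iff_mem
      (Set.powersetCard.ofCard (Finset.card_singleton a)) _).1 ⟨j, rfl⟩
    simpa [Set.powersetCard.ofCard] using this
  simp [h']

theorem bamboo_mul (a : Slot) (s : Finset Slot) :
    (a ∈ s ∧ bamboo k {a} * bamboo k s = 0) ∨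
      (a ∉ s ∧ ∃ e : ℤˣ, bamboo k {a} * bamboo k s = e • bamboo k (insert a s)) := by
  by_cases ha : a ∈ s
  · refine Or.inl ⟨ha, ?_⟩
    exact ExteriorAlgebra.basis_mul_of_not_disjoint
      (Finsupp.basisSingleOne : Module.Basis Slot k (Gen k))
      (Set.powersetCard.ofCard (Finset.card_singleton a)) (Set.powersetCard.ofCard (s := s) rfl)
      (by simpa using ha)
  · refine Or.inr ⟨ha, ?_⟩
    have hd : Disjoint (Set.powersetCard.ofCard (Finset.card_singleton a)).val
      (Set.powersetCard.ofCard (s := s) rfl).val := by simpa using ha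
    have := ExteriorAlgebra.basis_mul_of_disjoint
      (Finsupp.basisSingleOne : Module.Basis Slot k (Gen k))
      (Set.powersetCard.ofCard (Finset.card_singleton a)) (Set.powersetCard.ofCard (s := s) rfl)
      hd
    have hu : (Set.powersetCard.disjUnion hd).val = insert a s := by
      ext t; simp [Set.powersetCard.disjUnion, Set.powersetCard.ofCard]
    rw [hu] at this
    exact ⟨_, this⟩

/-- The span of the edges and tadpoles that a bamboo with `n` vertices can have. -/
def slotSpan (k : Type u) [CommRing k] (n : ℕ) : Submodule k (Ext k) :=
  Submodule.span k ((fun a => ExteriorAlgebra.ι k (Finsupp.single a (1 : k))) '' slots n)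

theorem bamboo_mem (n : ℕ) (s : Finset Slot) (hs : s ⊆ slots n) :
    bamboo k s ∈ slotSpan k n ^ s.card := by
  induction s using Finset.induction_on with
  | empty => simp [bamboo_empty]
  | insert a s ha ih =>
    rcases bamboo_mul (k := k) a s with ⟨h, _⟩ | ⟨_, e, he⟩
    · exact absurd h ha
    · have h' : bamboo k (insert a s) = e⁻¹ • (bamboo k {a} * bamboo k s) := by
        rw [he, inv_smul_smul]
      rw [h', Finset.card_insert_of_notMem ha, pow_succ', Units.smul_def]
      refine zsmul_mem (Submodule.mul_mem_mul ?_ (ih fun x hx => hs (Finset.mem_insert_of_mem hx))) _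
      rw [bamboo_singleton]
      exact Submodule.subset_span ⟨a, hs (Finset.mem_insert_self a s), rfl⟩

theorem slotSpan_pow_le {n : ℕ} (hn : 0 < n) (p : ℕ) : slotSpan k n ^ p ≤ component k n p := by
  induction p with
  | zero =>
    rw [pow_zero, Submodule.one_eq_span, Submodule.span_le, Set.singleton_subset_iff,
      ← bamboo_empty]
    exact Submodule.subset_span (Set.mem_image_of_mem _ ⟨hn, by simp, rfl⟩)
  | succ p ih =>
    rw [pow_succ']
    refine (mul_le_mul' le_rfl ih).trans ?_
    rw [slotSpan, component, Submodule.span_mul_span, Submodule.span_le]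
    rintro _ ⟨_, ⟨a, ha, rfl⟩, _, ⟨s, ⟨_, hs, rfl⟩, rfl⟩, rfl⟩
    simp only [← bamboo_singleton]
    rcases bamboo_mul (k := k) a s with ⟨_, h⟩ | ⟨h, e, he⟩
    · rw [h]; exact Submodule.zero_mem _
    · rw [he, Units.smul_def]
      have h₁ : bamboo k (insert a s) ∈ component k n (s.card + 1) :=
        Submodule.subset_span ⟨insert a s,
          ⟨hn, Finset.insert_subset ha hs, Finset.card_insert_of_notMem h⟩, rfl⟩
      exact SetLike.mem_coe.2 (zsmul_mem h₁ (e : ℤ))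

theorem component_le (n p : ℕ) : component k n p ≤ slotSpan k n ^ p := by
  refine Submodule.span_le.2 ?_
  rintro _ ⟨s, ⟨_, hs, rfl⟩, rfl⟩
  exact bamboo_mem n s hs

theorem edge_mem_slots {n j : ℕ} : edge j ∈ slots n ↔ j + 1 < n := by
  simp [slots]; omega

theorem tadpole_mem_slots {n j : ℕ} : tadpole j ∈ slots n ↔ j < n := by
  simp [slots]

theorem map_mem {m n p : ℕ} (f : Gen k →ₗ[k] Gen k)
    (hf : ∀ a ∈ slots m, ExteriorAlgebra.ι k (f (Finsupp.single a 1)) ∈ slotSpan k n)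
    {x : Ext k} (hx : x ∈ slotSpan k m ^ p) : ExteriorAlgebra.map f x ∈ slotSpan k n ^ p := by
  have h : (slotSpan k m).map (ExteriorAlgebra.map f).toLinearMap ≤ slotSpan k n := by
    rw [slotSpan, Submodule.map_span, Submodule.span_le]
    rintro _ ⟨_, ⟨a, ha, rfl⟩, rfl⟩
    simpa using hf a ha
  have h' := Submodule.mem_map_of_mem (f := (ExteriorAlgebra.map f).toLinearMap) hx
  rw [Submodule.map_pow] at h'
  exact pow_le_pow_left' h p h'

theorem single_mem {n : ℕ} {a : Slot} (ha : a ∈ slots n) :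
    ExteriorAlgebra.ι k (Finsupp.single a (1 : k)) ∈ slotSpan k n :=
  Submodule.subset_span ⟨a, ha, rfl⟩

theorem compExt_mem {m n l p q r : ℕ} (i : ℕ) (hi : i < m) (hl : m + n = l + 1) (hr : p + q = r)
    {x y : Ext k} (hx : x ∈ component k m p) (hy : y ∈ component k n q) :
    compExt i n x y ∈ component k l r := by
  rcases Nat.eq_zero_or_pos n with rfl | hn
  · obtain rfl : y = 0 := by simpa [component] using hy
    simp [compExt]
  · refine slotSpan_pow_le (by omega) r ?_
    rw [← hr, pow_add]
    refine Submodule.mul_mem_mul (map_mem _ ?_ (component_le _ _ hx))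
      (map_mem _ ?_ (component_le _ _ hy))
    · intro a ha
      rw [insertMap, Finsupp.linearCombination_single, one_smul]
      obtain ⟨j, rfl⟩ | ⟨j, rfl⟩ : (∃ j, a = edge j) ∨ ∃ j, a = tadpole j := by
        rcases h : ofLex a with j | j
        · exact Or.inl ⟨j, h⟩
        · exact Or.inr ⟨j, h⟩
      · have := edge_mem_slots.1 ha
        simp only [ofLex_toLex]
        split_ifs
        · exact single_mem (edge_mem_slots.2 (by omega))
        · exact single_mem (edge_mem_slots.2 (by omega))
      · have := tadpole_mem_slots.1 ha
        simp only [ofLex_toLex]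
        split_ifs
        · exact single_mem (tadpole_mem_slots.2 (by omega))
        · exact single_mem (tadpole_mem_slots.2 (by omega))
        · rw [map_add, map_sum, map_sum]
          refine add_mem (sum_mem fun t ht => ?_) (sum_mem fun t ht => ?_) <;>
            rw [Finset.mem_range] at ht
          · exact single_mem (tadpole_mem_slots.2 (by omega))
          · exact single_mem (edge_mem_slots.2 (by omega))
    · intro a ha
      rw [shiftMap, Finsupp.linearCombination_single, one_smul]
      obtain ⟨j, rfl⟩ | ⟨j, rfl⟩ : (∃ j, a = edge j) ∨ ∃ j, a = tadpole j := by
        rcases h : ofLex a with j | j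
        · exact Or.inl ⟨j, h⟩
        · exact Or.inr ⟨j, h⟩
      · have := edge_mem_slots.1 ha
        exact single_mem (edge_mem_slots.2 (by omega))
      · have := tadpole_mem_slots.1 ha
        exact single_mem (tadpole_mem_slots.2 (by omega))

theorem bamboo_mem_component {n p : ℕ} (s : Finset Slot) (hn : 0 < n) (hs : s ⊆ slots n)
    (hp : s.card = p) : bamboo k s ∈ component k n p :=
  Submodule.subset_span ⟨s, ⟨hn, hs, hp⟩, rfl⟩

end NcBV

section ncBV

variable (k : Type u) [CommRing k]

/-- The ns operad `ncBV`, with zero differential and the trivial filtration. -/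
def ncBV : NSOp k where
  V n p := NcBV.component k n p
  one := ⟨NcBV.bamboo k ∅, NcBV.bamboo_mem_component ∅ one_pos (by simp) rfl⟩
  comp {m n l p q r} i hi hl hr :=
    LinearMap.mk₂ k (fun x y => ⟨NcBV.compExt i n x.1 y.1, NcBV.compExt_mem i hi hl hr x.2 y.2⟩)
      (fun _ _ _ => Subtype.ext (by simp [NcBV.compExt, add_mul]))
      (fun _ _ _ => Subtype.ext (by simp [NcBV.compExt]))
      (fun _ _ _ => Subtype.ext (by simp [NcBV.compExt, mul_add]))
      (fun _ _ _ => Subtype.ext (by simp [NcBV.compExt]))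
  d _ := 0
  F _ _ a := if a = 0 then ⊤ else ⊥

/-- The connected bamboo with two vertices and no tadpole. -/
def ncBV.b : (ncBV k).V 2 1 :=
  ⟨NcBV.bamboo k {NcBV.edge 0}, NcBV.bamboo_mem_component _ two_pos
    (Finset.singleton_subset_iff.2 (NcBV.edge_mem_slots.2 (by omega))) rfl⟩

/-- The bamboo with two vertices, no edge and no tadpole. -/
def ncBV.points : (ncBV k).V 2 0 :=
  ⟨NcBV.bamboo k ∅, NcBV.bamboo_mem_component ∅ two_pos (by simp) rfl⟩

/-- The bamboo with one vertex, carrying a tadpole. -/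
def ncBV.loop : (ncBV k).V 1 1 :=
  ⟨NcBV.bamboo k {NcBV.tadpole 0}, NcBV.bamboo_mem_component _ one_pos
    (Finset.singleton_subset_iff.2 (NcBV.tadpole_mem_slots.2 (by omega))) rfl⟩

/-- The twisted operad `Tw ncBV`. In a word, `true` stands for a white vertex and `false` for a
black one. -/
def TwNcBV : NSOp k := (ncBV k).Tw (ncBV.b k)

/-- Two white vertices connected by an edge. -/
def TwNcBV.b : (TwNcBV k).V 2 1 := (ncBV k).plug [true, true] rfl (ncBV.b k)

/-- Two disconnected black vertices. -/
def TwNcBV.γ : (TwNcBV k).V 0 0 := (ncBV k).plug [false, false] rfl (ncBV.points k)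

/-- One black vertex with a tadpole. -/
def TwNcBV.ζ : (TwNcBV k).V 0 1 := (ncBV k).plug [false] rfl (ncBV.loop k)

end ncBV

/-! ### The operads generated by `b`, `γ` and `ζ` -/

/-- Planar trees with vertices labelled by `b` (arity `2`, degree `1`), `γ` (arity `0`, degree `0`)
and `ζ` (arity `0`, degree `1`). -/
inductive BTree : Type
  | leaf : BTree
  | γ : BTree
  | ζ : BTree
  | b : BTree → BTree → BTree

namespace BTree

/-- The number of leaves. -/
def arity : BTree → ℕ
  | leaf => 1
  | γ => 0
  | ζ => 0
  | b s t => s.arity + t.arity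

/-- The total degree of the vertices. -/
def degree : BTree → ℕ
  | leaf => 0
  | γ => 0
  | ζ => 1
  | b s t => 1 + s.degree + t.degree

/-- The weight, when `γ` has weight `w`, `ζ` has weight `1` and `b` has weight `0`. -/
def weight (w : ℕ) : BTree → ℕ
  | leaf => 0
  | γ => w
  | ζ => 1
  | b s t => s.weight w + t.weight w

/-- Grafting of a tree at the `i`-th leaf (leaves are numbered from `0`, from left to right). -/
def graft : BTree → ℕ → BTree → BTree
  | leaf, _, u => u
  | γ, _, _ => γ
  | ζ, _, _ => ζ
  | b s t, i, u => if i < s.arity then b (s.graft i u) t else b s (t.graft (i - s.arity) u)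

/-- The total degree of the vertices which come after the `i`-th leaf, in the order where a vertex
comes before the vertices above it and these are ordered from left to right. -/
def degreeAfter : BTree → ℕ → ℕ
  | leaf, _ => 0
  | γ, _ => 0
  | ζ, _ => 0
  | b s t, i => if i < s.arity then s.degreeAfter i + t.degree else t.degreeAfter (i - s.arity)

theorem arity_graft (s : BTree) (i : ℕ) (u : BTree) (h : i < s.arity) :
    (s.graft i u).arity + 1 = s.arity + u.arity := by
  induction s generalizing i with
  | leaf => simp [graft, arity]; omega
  | γ => simp [arity] at h
  | ζ => simp [arity] at h
  | b s t ihs iht =>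
    simp only [graft, arity] at h ⊢
    split_ifs with h'
    · have := ihs i h'
      simp only [arity]; omega
    · have := iht (i - s.arity) (by omega)
      simp only [arity]; omega

theorem degree_graft (s : BTree) (i : ℕ) (u : BTree) (h : i < s.arity) :
    (s.graft i u).degree = s.degree + u.degree := by
  induction s generalizing i with
  | leaf => simp [graft, degree]
  | γ => simp [arity] at h
  | ζ => simp [arity] at h
  | b s t ihs iht =>
    simp only [graft, degree, arity] at h ⊢
    split_ifs with h'
    · have := ihs i h'
      simp only [degree]; omega
    · have := iht (i - s.arity) (by omega)
      simp only [degree]; omega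

end BTree

section generated

variable (k : Type u) [CommRing k] (w : ℕ)

/-- The free ns operad on `b`, `γ` and `ζ`, with zero differential and filtered by the weight, where
`γ` is placed in `F w`. The sign of a composite is the Koszul sign for moving the vertices of the
second tree past the vertices of the first tree which come after the chosen leaf. For each arity
and degree there are only finitely many trees, so that this free operad is complete. -/
def FreeOp : NSOp k where
  V n p := {t : BTree // t.arity = n ∧ t.degree = p} →₀ k
  one := Finsupp.single ⟨.leaf, rfl, rfl⟩ 1
  comp {m n l p q r} i hi hl hr :=
    Finsupp.linearCombination k fun s : {t : BTree // t.arity = m ∧ t.degree = p} =>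
      Finsupp.linearCombination k fun t : {t : BTree // t.arity = n ∧ t.degree = q} =>
        Finsupp.single (⟨s.1.graft i t.1, by
            have := s.1.arity_graft i t.1 (by omega); omega, by
            have := s.1.degree_graft i t.1 (by omega); omega⟩ :
              {t : BTree // t.arity = l ∧ t.degree = r})
          ((-1 : k) ^ (t.1.degree * s.1.degreeAfter i))
  d _ := 0
  F n p a := Finsupp.supported k k {t | a ≤ t.1.weight w}

/-- The generator `b` of the free operad. -/
def FreeOp.b : (FreeOp k w).V 2 1 := Finsupp.single ⟨.b .leaf .leaf, rfl, rfl⟩ 1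

/-- The generator `γ` of the free operad. -/
def FreeOp.γ : (FreeOp k w).V 0 0 := Finsupp.single ⟨.γ, rfl, rfl⟩ 1

/-- The generator `ζ` of the free operad. -/
def FreeOp.ζ : (FreeOp k w).V 0 1 := Finsupp.single ⟨.ζ, rfl, rfl⟩ 1

/-- The relation of `S⁻¹As`. -/
inductive AssocRel : ∀ n p : ℕ, (FreeOp k w).V n p → Prop
  | assoc : AssocRel 3 2 ((FreeOp k w).assoc (FreeOp.b k w))

/-- The complete coproduct `S⁻¹As ∨ γ ∨ ζ`, where `S⁻¹As` is presented by the generator `b` and the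
relation `b ∘₁ b + b ∘₂ b = 0`. -/
def SAsγζ : NSOp k := (FreeOp k w).quot (AssocRel k w)

/-- The generator `b`. -/
def SAsγζ.b : (SAsγζ k w).V 2 1 := (FreeOp k w).proj (AssocRel k w) (FreeOp.b k w)

/-- The generator `γ`. -/
def SAsγζ.γ : (SAsγζ k w).V 0 0 := (FreeOp k w).proj (AssocRel k w) (FreeOp.γ k w)

/-- The generator `ζ`. -/
def SAsγζ.ζ : (SAsγζ k w).V 0 1 := (FreeOp k w).proj (AssocRel k w) (FreeOp.ζ k w)

/-- The relations `b(γ, -)`, `b(-, γ)` and `b(ζ, -) + b(-, ζ)`. -/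
inductive PPRel : ∀ n p : ℕ, (SAsγζ k w).V n p → Prop
  | γ_left : PPRel 1 1 ((SAsγζ k w).comp 0 two_pos (by omega) (by omega) (SAsγζ.b k w) (SAsγζ.γ k w))
  | γ_right : PPRel 1 1 ((SAsγζ k w).comp 1 one_lt_two (by omega) (by omega) (SAsγζ.b k w) (SAsγζ.γ k w))
  | ζ_comm : PPRel 1 2 ((SAsγζ k w).comp 0 two_pos (by omega) (by omega) (SAsγζ.b k w) (SAsγζ.ζ k w)
      + (SAsγζ k w).comp 1 one_lt_two (by omega) (by omega) (SAsγζ.b k w) (SAsγζ.ζ k w))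

/-- The complete operad `S⁻¹As⁺⁺`. -/
def SAsPP : NSOp k := (SAsγζ k w).quot (PPRel k w)

end generated

end

/-! A bamboo with black and white vertices is a word in five letters: a black or white vertex
without tadpole (`bk`, `wh`) or with one (`bkT`, `whT`), and `gap` for a missing edge between
neighbours. The number of edges and tadpoles plus one is additive under juxtaposition, and for this
grading the twisted differential becomes a derivation of the free algebra on the letters: `bk ↦ bk
bk`, `wh ↦ 0`, `bkT ↦ 0`, `whT ↦ bkT wh - wh bkT`, `gap ↦ bk gap + gap bk`. Indeed, splitting off a
black neighbour at consecutive connected vertices telescopes, and for a tadpole the edge summand of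
the insertion rule dies because it repeats the new edge. This translation is `dRight_col` and
`dFam_RT_wd`. It also gives `d² = 0` on `Tw ncBV`, since `δ² = 0` is checked on letters
(`dFam_dFam`).

The cohomology of the word complex is found with three explicit contractions. The homotopy `h`
removes a `bk` standing before a `bk` or a `gap` and retracts all words onto those in `wh`, `bkT`,
`whT`. It leaves the words that describe bamboos only by creating a leading `gap`. The resulting
defect is a solution of `δ z = bk z`; the homotopy `h'` shows that it contributes a single class,
that of `bk gap bk`. On the words in `wh`, `bkT`, `whT` the letter `whT` resolves the commutator of
`bkT` and `wh`, and `s` contracts onto the normal forms `bkT ^ j wh ^ n`. The result is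
`exists_primitive`.

In fixed arity and degree there can be infinitely many words, and elements are infinite series. The
differential however preserves the number of gaps, and fixing this number leaves finitely many
words. Primitives are therefore chosen gap number by gap number and assembled
(`exists_primitive_family`). Each component of the cohomology is thus zero or free on one class: a
normal form when `n + 2 j = p + 1`, and `bk gap bk` when `n = p = 0`. Freeness is witnessed by
functionals which kill coboundaries: the symmetrization `P` followed by a coefficient, or a single
coefficient in degree `0`.

On the side of `S⁻¹As⁺⁺` only a spanning set is needed. The relations reduce every tree to `γ`, to
zero, or up to sign to a right comb with all `ζ` in front of all leaves (`tree_cases`,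
`treeEq_comb_perm`), so each component is spanned by at most one element. The comparison map sends
it to the free generator up to sign (`val_evalAt_comb`), and a linear map sending a spanning element
to a free generator is bijective.

The filtration is handled by the same functionals. A normal form with `j` black vertices is detected
by a functional vanishing on `F (j + 1)`, so `F (j + 1)` of that component is zero, while the comb
has weight exactly `j`. The class of `γ` has two black vertices but weight `w`, which is the origin
of the shift `2 - w`. -/

noncomputable section

/-! ### The operad `ncBV`: compositions in the exterior algebra. -/

namespace NcBV

variable {k : Type u} [CommRing k]

theorem slot_cases (a : Slot) : (∃ j, a = edge j) ∨ ∃ j, a = tadpole j := by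
  rcases h : ofLex a with j | j
  · exact Or.inl ⟨j, h⟩
  · exact Or.inr ⟨j, h⟩

/-- The generator of `Gen k` given by an edge. -/
abbrev se (k : Type u) [CommRing k] (j : ℕ) : Gen k := Finsupp.single (edge j) 1

/-- The generator of `Gen k` given by a tadpole. -/
abbrev st (k : Type u) [CommRing k] (j : ℕ) : Gen k := Finsupp.single (tadpole j) 1

theorem gen_ext {M : Type*} [AddCommMonoid M] [Module k M] {f g : Gen k →ₗ[k] M}
    (he : ∀ j, f (se k j) = g (se k j)) (ht : ∀ j, f (st k j) = g (st k j)) : f = g := by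
  refine Finsupp.lhom_ext' fun a => LinearMap.ext_ring ?_
  rcases slot_cases a with ⟨j, rfl⟩ | ⟨j, rfl⟩
  · exact he j
  · exact ht j

theorem insertMap_edge_lt {i n j : ℕ} (h : j < i) : insertMap k i n (se k j) = se k j := by
  simp [insertMap, Finsupp.linearCombination_single, h]

theorem insertMap_edge_ge {i n j : ℕ} (h : i ≤ j) :
    insertMap k i n (se k j) = se k (j + n - 1) := by
  simp [insertMap, Finsupp.linearCombination_single, h.not_gt]

theorem insertMap_tadpole_lt {i n j : ℕ} (h : j < i) :
    insertMap k i n (st k j) = st k j := by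
  simp [insertMap, Finsupp.linearCombination_single, h]

theorem insertMap_tadpole_gt {i n j : ℕ} (h : i < j) :
    insertMap k i n (st k j) = st k (j + n - 1) := by
  simp [insertMap, Finsupp.linearCombination_single, h, h.not_gt]

theorem insertMap_tadpole_eq (i n : ℕ) : insertMap k i n (st k i) =
    ∑ t ∈ Finset.range n, st k (i + t) + ∑ t ∈ Finset.range (n - 1), se k (i + t) := by
  simp [insertMap, Finsupp.linearCombination_single]

@[simp] theorem shiftMap_edge (i j : ℕ) : shiftMap k i (se k j) = se k (i + j) := by
  simp [shiftMap, Finsupp.linearCombination_single]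

@[simp] theorem shiftMap_tadpole (i j : ℕ) : shiftMap k i (st k j) = st k (i + j) := by
  simp [shiftMap, Finsupp.linearCombination_single]

@[simp] theorem shiftMap_zero : shiftMap k 0 = LinearMap.id := gen_ext (by simp) (by simp)

theorem shiftMap_comp (i j : ℕ) : shiftMap k i ∘ₗ shiftMap k j = shiftMap k (i + j) :=
  gen_ext (by simp [add_assoc]) (by simp [add_assoc])

@[simp] theorem insertMap_one (i : ℕ) : insertMap k i 1 = LinearMap.id := by
  refine gen_ext (fun j => ?_) (fun j => ?_)
  · rcases lt_or_ge j i with h | h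
    · simp [insertMap_edge_lt h]
    · simp [insertMap_edge_ge h]
  · rcases lt_trichotomy j i with h | rfl | h
    · simp [insertMap_tadpole_lt h]
    · simp [insertMap_tadpole_eq]
    · simp [insertMap_tadpole_gt h]

/-- Positivity of `s` excludes the truncated subtraction `0 + 0 - 1` in the label of an edge.
Nothing is lost later, since the arity `0` part of `ncBV` vanishes. -/
theorem insertMap_comp_shiftMap (i j s : ℕ) (hs : 0 < s) :
    insertMap k (i + j) s ∘ₗ shiftMap k i = shiftMap k i ∘ₗ insertMap k j s := by
  refine gen_ext (fun e => ?_) (fun e => ?_)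
  · rcases lt_or_ge e j with h | h
    · simp [insertMap_edge_lt h, insertMap_edge_lt (Nat.add_lt_add_left h i)]
    · simp [insertMap_edge_ge h, insertMap_edge_ge (Nat.add_le_add_left h i)]
      congr 2; omega
  · rcases lt_trichotomy e j with h | rfl | h
    · simp [insertMap_tadpole_lt h, insertMap_tadpole_lt (Nat.add_lt_add_left h i)]
    · simp [insertMap_tadpole_eq, add_assoc]
    · simp [insertMap_tadpole_gt h, insertMap_tadpole_gt (Nat.add_lt_add_left h i)]
      congr 2; omega

theorem insertMap_comp_shiftMap_of_lt {i j : ℕ} (n : ℕ) (h : i < j) :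
    insertMap k i n ∘ₗ shiftMap k j = shiftMap k (j + n - 1) := by
  refine gen_ext (fun e => ?_) (fun e => ?_)
  · rw [LinearMap.comp_apply, shiftMap_edge, insertMap_edge_ge (by omega), shiftMap_edge]
    congr 2; omega
  · rw [LinearMap.comp_apply, shiftMap_tadpole, insertMap_tadpole_gt (by omega), shiftMap_tadpole]
    congr 2; omega

/-- The only substantial case is the tadpole at `i`. It is spread over the `n` new vertices and
their edges, and its summand at `i + j` is spread once more; together these are all vertices and
edges of the larger inserted bamboo. -/
theorem insertMap_comp_insertMap {i j n s : ℕ} (hj : j < n) (hs : 0 < s) :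
    insertMap k (i + j) s ∘ₗ insertMap k i n = insertMap k i (n + s - 1) := by
  refine gen_ext (fun e => ?_) (fun e => ?_)
  · rcases lt_or_ge e i with h | h
    · simp [insertMap_edge_lt h, insertMap_edge_lt (show e < i + j by omega)]
    · rw [LinearMap.comp_apply, insertMap_edge_ge h, insertMap_edge_ge (by omega),
        insertMap_edge_ge h]
      congr 2; omega
  · rcases lt_trichotomy e i with h | rfl | h
    · simp [insertMap_tadpole_lt h, insertMap_tadpole_lt (show e < i + j by omega)]
    -- The `n` vertices are `j` to the left of the second insertion, the vertex itself, and `m` to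
    -- the right. After the second insertion the vertices split as `j + (s + 1) + m` and the edges
    -- as `j + s + m`.
    · obtain ⟨m, rfl⟩ : ∃ m, n = j + 1 + m := ⟨n - j - 1, by omega⟩
      obtain ⟨s, rfl⟩ : ∃ r, s = r + 1 := ⟨s - 1, by omega⟩
      rw [LinearMap.comp_apply, insertMap_tadpole_eq, insertMap_tadpole_eq, map_add, map_sum,
        map_sum, show j + 1 + m + (s + 1) - 1 = j + (s + 1) + m by omega,
        show j + (s + 1) + m - 1 = j + s + m by omega, show j + 1 + m - 1 = j + m by omega]
      rw [Finset.sum_range_add (n := j + 1), Finset.sum_range_succ,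
        Finset.sum_range_add (n := j + (s + 1)), Finset.sum_range_add (n := j) (m := s + 1),
        Finset.sum_range_add (n := j + s), Finset.sum_range_add (n := j) (m := s),
        Finset.sum_range_add (n := j) (m := m), insertMap_tadpole_eq]
      have h1 : ∀ t ∈ Finset.range j, insertMap k (e + j) (s + 1) (st k (e + t)) = st k (e + t) :=
        fun t ht => insertMap_tadpole_lt (by simpa using ht)
      have h2 : ∀ t ∈ Finset.range j, insertMap k (e + j) (s + 1) (se k (e + t)) = se k (e + t) :=
        fun t ht => insertMap_edge_lt (by simpa using ht)
      have h3 : ∀ t ∈ Finset.range m, insertMap k (e + j) (s + 1) (st k (e + (j + 1 + t))) =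
          st k (e + (j + (s + 1) + t)) := fun t _ => by
        rw [insertMap_tadpole_gt (by omega)]; congr 2; omega
      have h4 : ∀ t ∈ Finset.range m, insertMap k (e + j) (s + 1) (se k (e + (j + t))) =
          se k (e + (j + s + t)) := fun t _ => by
        rw [insertMap_edge_ge (by omega)]; congr 2; omega
      rw [Finset.sum_congr rfl h1, Finset.sum_congr rfl h2, Finset.sum_congr rfl h3,
        Finset.sum_congr rfl h4]
      simp only [add_assoc, Nat.add_sub_cancel]
      abel
    · rw [LinearMap.comp_apply, insertMap_tadpole_gt h, insertMap_tadpole_gt (by omega),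
        insertMap_tadpole_gt h]
      congr 2; omega

theorem insertMap_insertMap_comm {i j n s : ℕ} (hij : i < j) (hn : 0 < n) (hs : 0 < s) :
    insertMap k (j + n - 1) s ∘ₗ insertMap k i n = insertMap k i n ∘ₗ insertMap k j s := by
  refine gen_ext (fun e => ?_) (fun e => ?_) <;> simp only [LinearMap.comp_apply]
  · rcases lt_or_ge e i with h | h
    · rw [insertMap_edge_lt h, insertMap_edge_lt (by omega), insertMap_edge_lt (by omega),
        insertMap_edge_lt h]
    · rcases lt_or_ge e j with h' | h'
      · rw [insertMap_edge_ge h, insertMap_edge_lt h', insertMap_edge_lt (by omega),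
          insertMap_edge_ge h]
      · rw [insertMap_edge_ge h, insertMap_edge_ge h', insertMap_edge_ge (by omega),
          insertMap_edge_ge (by omega)]
        congr 2; omega
  · rcases lt_trichotomy e i with h | rfl | h
    · rw [insertMap_tadpole_lt h, insertMap_tadpole_lt (by omega),
        insertMap_tadpole_lt (by omega), insertMap_tadpole_lt h]
    · rw [insertMap_tadpole_lt hij, insertMap_tadpole_eq, map_add, map_sum, map_sum]
      congr 1 <;> refine Finset.sum_congr rfl fun t ht => ?_ <;> rw [Finset.mem_range] at ht
      · exact insertMap_tadpole_lt (by omega)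
      · exact insertMap_edge_lt (by omega)
    · rw [insertMap_tadpole_gt h]
      rcases lt_trichotomy e j with h' | rfl | h'
      · rw [insertMap_tadpole_lt h', insertMap_tadpole_lt (by omega), insertMap_tadpole_gt h]
      · rw [insertMap_tadpole_eq, insertMap_tadpole_eq, map_add, map_sum, map_sum]
        congr 1 <;> refine Finset.sum_congr rfl fun t ht => ?_
        · rw [insertMap_tadpole_gt (by omega)]; congr 2; omega
        · rw [insertMap_edge_ge (by omega)]; congr 2; omega
      · rw [insertMap_tadpole_gt h', insertMap_tadpole_gt (by omega),
          insertMap_tadpole_gt (by omega)]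
        congr 2; omega

theorem extMap_comp (f g : Gen k →ₗ[k] Gen k) (x : Ext k) :
    ExteriorAlgebra.map f (ExteriorAlgebra.map g x) = ExteriorAlgebra.map (f ∘ₗ g) x := by
  rw [← ExteriorAlgebra.map_comp_map]; rfl

/-- A component lies in a power of the span of the slots, so membership in a subalgebra may be
tested on single edges and tadpoles. -/
theorem component_induction {n p : ℕ} (hp : component k n p ≤ slotSpan k n ^ p := component_le n p)
    (S : Subalgebra k (Ext k))
    (h : ∀ a ∈ slots n, ExteriorAlgebra.ι k (Finsupp.single a (1 : k)) ∈ S) {x : Ext k}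
    (hx : x ∈ component k n p) : x ∈ S := by
  have h₁ : slotSpan k n ≤ S.toSubmodule := by
    refine Submodule.span_le.2 ?_
    rintro _ ⟨a, ha, rfl⟩
    exact h a ha
  have h₂ : ∀ q, slotSpan k n ^ q ≤ S.toSubmodule := by
    intro q
    induction q with
    | zero =>
      rw [pow_zero, Submodule.one_le]
      exact S.one_mem
    | succ q ih =>
      rw [pow_succ, Submodule.mul_le]
      exact fun a ha b hb => S.mul_mem (ih ha) (h₁ hb)
  exact h₂ p (hp hx)

theorem extMap_congr {n p : ℕ} {f g : Gen k →ₗ[k] Gen k}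
    (he : ∀ j, j + 1 < n → f (se k j) = g (se k j)) (ht : ∀ j < n, f (st k j) = g (st k j))
    {x : Ext k} (hx : x ∈ component k n p) :
    ExteriorAlgebra.map f x = ExteriorAlgebra.map g x := by
  refine component_induction (component_le n p)
    (AlgHom.equalizer (ExteriorAlgebra.map f) (ExteriorAlgebra.map g)) (fun a ha => ?_) hx
  rw [AlgHom.mem_equalizer]
  rcases slot_cases a with ⟨j, rfl⟩ | ⟨j, rfl⟩
  · simpa using congrArg (ExteriorAlgebra.ι k) (he j (edge_mem_slots.1 ha))
  · simpa using congrArg (ExteriorAlgebra.ι k) (ht j (tadpole_mem_slots.1 ha))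

theorem ι_mul_ι (a b : Gen k) : ExteriorAlgebra.ι k a * ExteriorAlgebra.ι k b =
    -(ExteriorAlgebra.ι k b * ExteriorAlgebra.ι k a) :=
  eq_neg_of_add_eq_zero_left (ExteriorAlgebra.ι_add_mul_swap a b)

/-- Graded commutativity with elements of degree `1`. -/
theorem ι_mul_of_mem {n p : ℕ} (a : Gen k) {x : Ext k} (hx : x ∈ slotSpan k n ^ p) :
    ExteriorAlgebra.ι k a * x = (-1 : k) ^ p • (x * ExteriorAlgebra.ι k a) := by
  induction p generalizing x with
  | zero =>
    rw [pow_zero, Submodule.mem_one] at hx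
    obtain ⟨c, rfl⟩ := hx
    simp [Algebra.commutes]
  | succ p ih =>
    rw [pow_succ] at hx
    induction hx using Submodule.mul_induction_on' with
    | mem_mul_mem y hy z hz =>
      have hz' : ExteriorAlgebra.ι k a * z = -(z * ExteriorAlgebra.ι k a) := by
        induction hz using Submodule.span_induction with
        | mem z hz => obtain ⟨b, _, rfl⟩ := hz; exact ι_mul_ι _ _
        | zero => simp
        | add y z _ _ hy hz => rw [mul_add, add_mul, hy, hz, neg_add]
        | smul c z _ hz => rw [mul_smul_comm, smul_mul_assoc, hz, smul_neg]
      rw [← mul_assoc, ih hy, smul_mul_assoc, mul_assoc, hz', pow_succ]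
      simp [mul_assoc]
    | add y _ z _ hy hz => rw [mul_add, add_mul, hy, hz, smul_add]

theorem mul_comm_of_mem {m n p q : ℕ} {x y : Ext k} (hx : x ∈ slotSpan k m ^ p)
    (hy : y ∈ slotSpan k n ^ q) : x * y = (-1 : k) ^ (p * q) • (y * x) := by
  induction p generalizing x with
  | zero =>
    rw [pow_zero, Submodule.mem_one] at hx
    obtain ⟨c, rfl⟩ := hx
    simp [Algebra.commutes]
  | succ p ih =>
    rw [pow_succ] at hx
    induction hx using Submodule.mul_induction_on' with
    | mem_mul_mem u hu z hz =>
      have hz' : z * y = (-1 : k) ^ q • (y * z) := by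
        induction hz using Submodule.span_induction with
        | mem z hz => obtain ⟨b, _, rfl⟩ := hz; exact ι_mul_of_mem _ hy
        | zero => simp
        | add y z _ _ hy hz => rw [mul_add, add_mul, hy, hz, smul_add]
        | smul c z _ hz => rw [mul_smul_comm, smul_mul_assoc, hz, smul_comm]
      rw [mul_assoc, hz', mul_smul_comm, ← mul_assoc, ih hu, smul_mul_assoc, smul_smul, mul_assoc]
      congr 1
      ring
    | add y _ z _ hy hz => rw [mul_add, add_mul, hy, hz, smul_add]

theorem map_shiftMap_mem {n p : ℕ} (i : ℕ) {x : Ext k} (hx : x ∈ component k n p) :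
    ExteriorAlgebra.map (shiftMap k i) x ∈ slotSpan k (i + n) ^ p := by
  have h : (slotSpan k n).map (ExteriorAlgebra.map (shiftMap k i)).toLinearMap ≤
      slotSpan k (i + n) := by
    rw [slotSpan, Submodule.map_span, Submodule.span_le]
    rintro _ ⟨_, ⟨a, ha, rfl⟩, rfl⟩
    rcases slot_cases a with ⟨j, rfl⟩ | ⟨j, rfl⟩
    · have := edge_mem_slots.1 ha
      simpa using single_mem (k := k) (edge_mem_slots.2 (show i + j + 1 < i + n by omega))
    · have := tadpole_mem_slots.1 ha
      simpa using single_mem (k := k) (tadpole_mem_slots.2 (show i + j < i + n by omega))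
  have h' := Submodule.mem_map_of_mem (f := (ExteriorAlgebra.map (shiftMap k i)).toLinearMap)
    (component_le _ _ hx)
  rw [Submodule.map_pow] at h'
  exact pow_le_pow_left' h p h'

theorem component_zero_left {p : ℕ} {x : Ext k} (hx : x ∈ component k 0 p) : x = 0 := by
  simpa [component] using hx

theorem compExt_zero_right (i n : ℕ) (x : Ext k) : compExt i n x 0 = 0 := by simp [compExt]

theorem compExt_zero_left (i n : ℕ) (y : Ext k) : compExt i n 0 y = 0 := by simp [compExt]

theorem one_compExt (n : ℕ) (x : Ext k) : compExt 0 n 1 x = x := by simp [compExt]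

theorem compExt_one (i : ℕ) (x : Ext k) : compExt i 1 x 1 = x := by simp [compExt]

/-- Since `ExteriorAlgebra.map` is functorial and multiplicative, the sequential axiom reduces to
identities between insertions and shifts on generators. -/
theorem compExt_seq {i j n s : ℕ} (hj : j < n) (hs : 0 < s) (x y z : Ext k) :
    compExt (i + j) s (compExt i n x y) z = compExt i (n + s - 1) x (compExt j s y z) := by
  simp only [compExt, map_mul, extMap_comp]
  rw [insertMap_comp_insertMap hj hs, insertMap_comp_shiftMap _ _ _ hs, shiftMap_comp, mul_assoc]

/-- The two sides have the same three factors with the last two exchanged; graded commutativity of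
the exterior algebra supplies the Koszul sign. -/
theorem compExt_par {i j n s q r : ℕ} (hij : i < j) (hn : 0 < n) (hs : 0 < s) (x : Ext k)
    {y z : Ext k} (hy : y ∈ component k n q) (hz : z ∈ component k s r) :
    compExt (j + n - 1) s (compExt i n x y) z =
      (-1 : k) ^ (q * r) • compExt i n (compExt j s x z) y := by
  simp only [compExt, map_mul, extMap_comp]
  rw [insertMap_insertMap_comm hij hn hs, insertMap_comp_shiftMap_of_lt n hij]
  -- The slots of `y`, shifted by `i`, all lie to the left of the vertex `j + n - 1` and are not
  -- moved by the insertion there.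
  rw [extMap_congr (f := insertMap k (j + n - 1) s ∘ₗ shiftMap k i) (g := shiftMap k i)
    (fun e he => by simpa using insertMap_edge_lt (by omega))
    (fun e he => by simpa using insertMap_tadpole_lt (by omega)) hy]
  rw [mul_assoc, mul_comm_of_mem (map_shiftMap_mem i hy) (map_shiftMap_mem (j + n - 1) hz),
    mul_smul_comm, mul_assoc]

end NcBV

theorem ncBV_F_zero {k : Type u} [CommRing k] (n p : ℕ) : (ncBV k).F n p 0 = ⊤ :=
  rfl

theorem ncBV_F_of_pos {k : Type u} [CommRing k] (n p : ℕ) {a : ℕ} (ha : 0 < a) :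
    (ncBV k).F n p a = ⊥ := if_neg ha.ne'

theorem ncBV_mem_F {k : Type u} [CommRing k] {n p a : ℕ} {x : (ncBV k).V n p} :
    x ∈ (ncBV k).F n p a ↔ a = 0 ∨ x = 0 := by
  rcases Nat.eq_zero_or_pos a with rfl | ha
  · simp [ncBV_F_zero]
  · rw [ncBV_F_of_pos n p ha, Submodule.mem_bot]
    simp [ha.ne']

open NcBV in
theorem ncBV_isCompleteDGOperad (k : Type u) [CommRing k] : (ncBV k).IsCompleteDGOperad where
  one_comp x := Subtype.ext (by
    change compExt 0 _ (bamboo k ∅) x.1 = x.1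
    rw [bamboo_empty, one_compExt])
  comp_one x i hi := Subtype.ext (by
    change compExt i 1 x.1 (bamboo k ∅) = x.1
    rw [bamboo_empty, compExt_one])
  comp_seq {m n s l t} _ _ _ _ _ _ _ i j hi hj hij hl he ht he' h₁ h₂ h₃ h₄ x y z :=
    Subtype.ext (by
      change compExt (i + j) s (compExt i n x.1 y.1) z.1 = compExt i t x.1 (compExt j s y.1 z.1)
      rcases Nat.eq_zero_or_pos s with rfl | hs
      · simp [component_zero_left z.2, compExt_zero_right]
      · rw [compExt_seq hj hs, show n + s - 1 = t by omega])
  comp_par {m n s l t} _ _ q r _ _ _ i j j' hij hj hj' hi hjl hit hl he ht he' h₁ h₂ h₃ h₄ x y z :=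
    Subtype.ext (by
      change compExt j' s (compExt i n x.1 y.1) z.1 =
        (-1 : k) ^ (q * r) • compExt i n (compExt j s x.1 z.1) y.1
      rcases Nat.eq_zero_or_pos s with rfl | hs
      · simp [component_zero_left z.2, compExt_zero_right, compExt_zero_left]
      rcases Nat.eq_zero_or_pos n with rfl | hn
      · simp [component_zero_left y.2, compExt_zero_right, compExt_zero_left]
      · rw [← compExt_par hij hn hs x.1 y.2 z.2, show j' = j + n - 1 by omega])
  d_d _ _ _ := rfl
  d_one _ := rfl
  d_comp {m n l p q r p' q' r'} i hi hl hr hp' hq' hr' h₁ h₂ x y := by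
    change 0 = (ncBV k).comp i hi hl h₁ 0 y + (-1 : k) ^ p • (ncBV k).comp i hi hl h₂ x 0
    rw [map_zero, map_zero, LinearMap.zero_apply, smul_zero, add_zero]
  F_zero n p := ncBV_F_zero n p
  F_antitone n p a b hab x hx := by
    rw [ncBV_mem_F] at hx ⊢
    exact hx.imp_left fun h => by omega
  comp_F {m n l p q r a b} i hi hl hr x y hx hy := by
    rw [ncBV_mem_F] at hx hy ⊢
    rcases hx with rfl | rfl
    · rcases hy with rfl | rfl
      · exact Or.inl rfl
      · exact Or.inr (map_zero _)
    · exact Or.inr (by rw [map_zero, LinearMap.zero_apply])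
  d_F hq x hx := Submodule.zero_mem _
  complete n p x hx := by
    -- The filtration is zero from step `1` on, so the sequence is constant from there.
    refine ⟨x 1, fun a => ?_, fun y hy => ?_⟩
    · rw [ncBV_mem_F]
      rcases a with _ | a
      · exact Or.inl rfl
      · refine Or.inr ?_
        induction a with
        | zero => exact sub_self _
        | succ b ih =>
          rw [sub_eq_zero.1 ih]
          refine sub_eq_zero.2 (sub_eq_zero.1 ?_).symm
          exact (ncBV_mem_F.1 (hx (b + 1))).resolve_left (by omega)
    · exact sub_eq_zero.1 ((ncBV_mem_F.1 (hy 1)).resolve_left one_ne_zero)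

/-- The two composites are the products of the same two edges in opposite orders. -/
theorem ncBV_assoc (k : Type u) [CommRing k] : (ncBV k).assoc (ncBV.b k) = 0 := by
  refine Subtype.ext ?_
  change NcBV.compExt 0 2 (NcBV.bamboo k {NcBV.edge 0}) (NcBV.bamboo k {NcBV.edge 0}) +
    NcBV.compExt 1 2 (NcBV.bamboo k {NcBV.edge 0}) (NcBV.bamboo k {NcBV.edge 0}) = 0
  simp only [NcBV.bamboo_singleton, NcBV.compExt, ExteriorAlgebra.map_apply_ι]
  rw [NcBV.insertMap_edge_ge le_rfl, NcBV.insertMap_edge_lt one_pos, NcBV.shiftMap_edge,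
    NcBV.shiftMap_edge, NcBV.ι_mul_ι]
  simp

end

noncomputable section

/-! ### Sums over the letters of a word -/

/-- The sum of `F l c r` over all decompositions `u = l ++ c :: r`. -/
def letterSum {M : Type*} [AddCommMonoid M] :
    List Bool → (List Bool → Bool → List Bool → M) → M
  | [], _ => 0
  | c :: u, F => F [] c u + letterSum u fun l c' r => F (c :: l) c' r

section letterSum

variable {M : Type*} [AddCommMonoid M]

theorem letterSum_congr {u : List Bool} {F G : List Bool → Bool → List Bool → M}
    (h : ∀ l c r, u = l ++ c :: r → F l c r = G l c r) : letterSum u F = letterSum u G := by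
  induction u generalizing F G with
  | nil => rfl
  | cons c u ih =>
    rw [letterSum, letterSum, h [] c u rfl]
    congr 1
    exact ih fun l c' r e => h _ _ _ (by simp [e])

theorem letterSum_append (u v : List Bool) (F : List Bool → Bool → List Bool → M) :
    letterSum (u ++ v) F = letterSum u (fun l c r => F l c (r ++ v)) +
      letterSum v (fun l c r => F (u ++ l) c r) := by
  induction u generalizing F with
  | nil => simp [letterSum]
  | cons c u ih => simp [letterSum, ih, add_assoc]

theorem map_letterSum {N A : Type*} [AddCommMonoid N] [FunLike A M N] [AddMonoidHomClass A M N]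
    (f : A) (u : List Bool) (F : List Bool → Bool → List Bool → M) :
    f (letterSum u F) = letterSum u fun l c r => f (F l c r) := by
  induction u generalizing F with
  | nil => simp [letterSum]
  | cons c u ih => simp [letterSum, ih]

theorem letterSum_add (u : List Bool) (F G : List Bool → Bool → List Bool → M) :
    letterSum u (fun l c r => F l c r + G l c r) = letterSum u F + letterSum u G := by
  induction u generalizing F G with
  | nil => simp [letterSum]
  | cons c u ih => simp only [letterSum, ih]; exact add_add_add_comm _ _ _ _

/-- Any upper bound `N` is allowed, so that sums over positions of words of different lengths can be
compared over a common range. -/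
theorem letterSum_eq_sum (u : List Bool) (F : List Bool → Bool → List Bool → M) {N : ℕ}
    (hN : u.length ≤ N) : letterSum u F = ∑ a ∈ Finset.range N,
      match u.drop a with
      | [] => 0
      | c :: r => F (u.take a) c r := by
  induction u generalizing F N with
  | nil => simp [letterSum]
  | cons c u ih =>
    obtain ⟨N, rfl⟩ : ∃ N', N = N' + 1 := ⟨N - 1, by simp at hN; omega⟩
    rw [Finset.sum_range_succ', letterSum, ih _ (by simpa using hN), add_comm]
    rfl

/-- Summation over the letters `true` only. -/
theorem sum_range_count (u : List Bool) (H : ℕ → M) :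
    ∑ i ∈ Finset.range (u.count true), H i =
      letterSum u fun l c _ => if c = true then H (l.count true) else 0 := by
  induction u generalizing H with
  | nil => simp [letterSum]
  | cons c u ih =>
    cases c
    · simp [letterSum, ih]
    · rw [List.count_cons_self, Finset.sum_range_succ', letterSum, ih, add_comm]
      simp

end letterSum

theorem exists_split_of_lt_count {u : List Bool} {i : ℕ} (h : i < u.count true) :
    ∃ l r, u = l ++ true :: r ∧ l.count true = i := by
  induction u generalizing i with
  | nil => simp at h
  | cons c u ih =>
    cases c
    · obtain ⟨l, r, rfl, rfl⟩ := ih (by simpa using h)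
      exact ⟨false :: l, r, rfl, by simp⟩
    · rcases i with _ | i
      · exact ⟨[], u, rfl, rfl⟩
      · obtain ⟨l, r, rfl, rfl⟩ := ih (i := i) (by simpa using h)
        exact ⟨true :: l, r, rfl, by simp⟩

theorem split_unique {l r l' r' : List Bool} (h : l ++ true :: r = l' ++ true :: r')
    (hc : l.count true = l'.count true) : l = l' ∧ r = r' := by
  induction l generalizing l' with
  | nil =>
    cases l' with
    | nil => simpa using h
    | cons c l' =>
      obtain ⟨rfl, _⟩ : true = c ∧ _ := by simpa using h
      simp at hc
  | cons c l ih =>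
    cases l' with
    | nil =>
      obtain ⟨rfl, _⟩ : c = true ∧ _ := by simpa using h
      simp at hc
    | cons c' l' =>
      obtain rfl : c = c' := (List.cons.inj h).1
      replace h := (List.cons.inj h).2
      obtain ⟨rfl, rfl⟩ := ih h (by simpa [List.count_cons] using hc)
      exact ⟨rfl, rfl⟩

theorem take_mid_drop (w : List Bool) {a c : ℕ} (h : a ≤ c) :
    w.take a ++ (w.take c).drop a ++ w.drop c = w := by
  conv_rhs => rw [← List.take_append_drop c w, ← List.take_append_drop a (w.take c)]
  rw [List.take_take, min_eq_left h]

/-! ### Families of bamboos indexed by colour words, and local operators. -/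

namespace NcBV

variable (k : Type u) [CommRing k]

/-- Families of elements of the exterior algebra indexed by words. -/
abbrev Fam : Type u := List Bool → Ext k

variable {k}

/-- The family which is concentrated at the word `u`. -/
def pl (u : List Bool) : Ext k →ₗ[k] Fam k := LinearMap.single k (fun _ => Ext k) u

theorem pl_same (u : List Bool) (X : Ext k) : pl u X u = X := by simp [pl]

theorem pl_ne {u w : List Bool} (h : w ≠ u) (X : Ext k) : pl u X w = 0 := by simp [pl, h]

/-- `compExt` as a bilinear map. -/
def compBilin (i n : ℕ) : Ext k →ₗ[k] Ext k →ₗ[k] Ext k :=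
  LinearMap.mk₂ k (compExt i n) (fun _ _ _ => by simp [compExt, add_mul])
    (fun _ _ _ => by simp [compExt]) (fun _ _ _ => by simp [compExt, mul_add])
    (fun _ _ _ => by simp [compExt])

/-- The partial composition of families, at an input `i` and with a second factor of arity `n`, at
the word `w`. -/
def famCompAt (i n : ℕ) (f g : Fam k) (w : List Bool) : Ext k :=
  ∑ a ∈ Finset.range (w.length + 1), ∑ c ∈ Finset.range (w.length + 1),
    if a ≤ c ∧ c ≤ w.length ∧ (w.take a).count true = i ∧ ((w.take c).drop a).count true = n then
      compBilin a ((w.take c).drop a).length (f (w.take a ++ true :: w.drop c))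
        (g ((w.take c).drop a))
    else 0

/-- The partial composition of families, at an input `i` and with a second factor of arity `n`. -/
def famComp (i n : ℕ) : Fam k →ₗ[k] Fam k →ₗ[k] Fam k :=
  LinearMap.mk₂ k (famCompAt i n)
    (fun x x' y => by
      funext w
      simp only [famCompAt, Pi.add_apply, ← Finset.sum_add_distrib]
      refine Finset.sum_congr rfl fun a _ => Finset.sum_congr rfl fun c _ => ?_
      split_ifs <;> simp only [map_add, LinearMap.add_apply, add_zero])
    (fun t x y => by
      funext w
      simp only [famCompAt, Pi.smul_apply, Finset.smul_sum]
      refine Finset.sum_congr rfl fun a _ => Finset.sum_congr rfl fun c _ => ?_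
      split_ifs <;> simp only [map_smul, LinearMap.smul_apply, smul_zero])
    (fun x y y' => by
      funext w
      simp only [famCompAt, Pi.add_apply, ← Finset.sum_add_distrib]
      refine Finset.sum_congr rfl fun a _ => Finset.sum_congr rfl fun c _ => ?_
      split_ifs <;> simp only [map_add, add_zero])
    (fun t x y => by
      funext w
      simp only [famCompAt, Pi.smul_apply, Finset.smul_sum]
      refine Finset.sum_congr rfl fun a _ => Finset.sum_congr rfl fun c _ => ?_
      split_ifs <;> simp only [map_smul, smul_zero])

theorem famComp_apply (i n : ℕ) (f g : Fam k) (w : List Bool) :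
    famComp i n f g w = famCompAt i n f g w := rfl

theorem famComp_apply_eq_zero {i n : ℕ} {f g : Fam k} {w : List Bool}
    (h : ∀ l v r, w = l ++ v ++ r → l.count true = i → v.count true = n →
      f (l ++ true :: r) = 0 ∨ g v = 0) : famComp i n f g w = 0 := by
  rw [famComp_apply, famCompAt]
  refine Finset.sum_eq_zero fun a _ => Finset.sum_eq_zero fun c _ => ?_
  split_ifs with hc
  · rcases h _ _ _ (take_mid_drop w hc.1).symm hc.2.2.1 hc.2.2.2 with h | h <;> rw [h]
    · rw [map_zero, LinearMap.zero_apply]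
    · rw [map_zero]
  · rfl

/-- Composition of families which are concentrated at one word. -/
theorem famComp_pl (l r v : List Bool) (X Y : Ext k) :
    famComp (l.count true) (v.count true) (pl (l ++ true :: r) X) (pl v Y) =
      pl (l ++ v ++ r) (compExt l.length v.length X Y) := by
  funext w
  by_cases hw : w = l ++ v ++ r
  · subst hw
    rw [pl_same]
    have ht : (l ++ v ++ r).take l.length = l := by simp
    have hm : ((l ++ v ++ r).take (l.length + v.length)).drop l.length = v := by
      rw [← List.length_append, List.take_left, List.drop_left]
    have hd : (l ++ v ++ r).drop (l.length + v.length) = r := by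
      rw [← List.length_append]; simp
    rw [famComp_apply, famCompAt]
    -- Only the cut `a = |l|`, `c = |l| + |v|` survives: another `c` gives a middle word of the
    -- wrong length, and another `a` contradicts `split_unique`.
    rw [Finset.sum_eq_single l.length, Finset.sum_eq_single (l.length + v.length), if_pos, ht, hm,
      hd, pl_same, pl_same]
    · rfl
    · rw [ht, hm]; simp
    · intro c _ hc
      split_ifs with h
      · rw [pl_ne (u := v) (w := List.drop l.length _), map_zero]
        intro e
        have := congrArg List.length e
        simp at this h
        omega
      · rfl
    · intro h; simp at h
    · intro a _ ha
      refine Finset.sum_eq_zero fun c _ => ?_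
      split_ifs with h
      · rw [pl_ne, map_zero, LinearMap.zero_apply]
        intro e
        have h' := congrArg List.length (split_unique e h.2.2.1).1
        have h1 := h.1.trans h.2.1
        simp at h' h1
        omega
      · rfl
    · intro h; simp at h
  · rw [pl_ne hw]
    refine famComp_apply_eq_zero fun l' v' r' e hl hv => ?_
    by_contra! hne
    have h1 : l' ++ true :: r' = l ++ true :: r := by
      by_contra h; exact hne.1 (pl_ne h _)
    have h2 : v' = v := by
      by_contra h; exact hne.2 (pl_ne h _)
    obtain ⟨rfl, rfl⟩ := split_unique h1 hl
    exact hw (h2 ▸ e)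

theorem famComp_pl' {i n : ℕ} {l r v : List Bool} (hi : l.count true = i) (hn : v.count true = n)
    (X Y : Ext k) : famComp i n (pl (l ++ true :: r) X) (pl v Y) =
      pl (l ++ v ++ r) (compExt l.length v.length X Y) := by
  subst hi hn; exact famComp_pl l r v X Y

variable (k) in
/-- The families which are elements of arity `n` and degree `p` of the twisted operad. -/
def famOf (n p : ℕ) : Submodule k (Fam k) :=
  Submodule.pi Set.univ fun w => if w.count true = n then component k w.length p else ⊥

theorem mem_famOf {n p : ℕ} {f : Fam k} : f ∈ famOf k n p ↔
    ∀ w, f w ∈ component k w.length p ∧ (w.count true ≠ n → f w = 0) := by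
  simp only [famOf, Submodule.mem_pi, Set.mem_univ, true_implies]
  refine forall_congr' fun w => ?_
  split_ifs with h
  · simp [h]
  · rw [Submodule.mem_bot]
    exact ⟨fun e => ⟨e ▸ Submodule.zero_mem _, fun _ => e⟩, fun e => e.2 h⟩

theorem pl_mem {n p : ℕ} {u : List Bool} (hu : u.count true = n) {X : Ext k}
    (hX : X ∈ component k u.length p) : pl u X ∈ famOf k n p := by
  rw [mem_famOf]
  intro w
  by_cases h : w = u
  · subst h
    rw [pl_same]
    exact ⟨hX, fun h => absurd hu h⟩
  · rw [pl_ne h]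
    exact ⟨Submodule.zero_mem _, fun _ => rfl⟩

/-- Operators on families whose value at a word depends on words of bounded length only. -/
def IsLocal (A : Fam k →ₗ[k] Fam k) : Prop :=
  ∃ c, ∀ (N : ℕ) (f : Fam k), (∀ u, u.length ≤ N + c → f u = 0) → ∀ w, w.length ≤ N → A f w = 0

namespace IsLocal

variable {A B : Fam k →ₗ[k] Fam k}

theorem comp (hA : IsLocal A) (hB : IsLocal B) : IsLocal (A ∘ₗ B) := by
  obtain ⟨a, ha⟩ := hA
  obtain ⟨b, hb⟩ := hB
  exact ⟨a + b, fun N f hf w hw => ha N (B f) (hb (N + a) f (by rwa [add_assoc])) w hw⟩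

theorem add (hA : IsLocal A) (hB : IsLocal B) : IsLocal (A + B) := by
  obtain ⟨a, ha⟩ := hA
  obtain ⟨b, hb⟩ := hB
  refine ⟨a + b, fun N f hf w hw => ?_⟩
  rw [LinearMap.add_apply, Pi.add_apply, ha N f (fun u hu => hf u (by omega)) w hw,
    hb N f (fun u hu => hf u (by omega)) w hw, add_zero]

theorem smul (c : k) (hA : IsLocal A) : IsLocal (c • A) := by
  obtain ⟨a, ha⟩ := hA
  refine ⟨a, fun N f hf w hw => ?_⟩
  rw [LinearMap.smul_apply, Pi.smul_apply, ha N f hf w hw, smul_zero]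

theorem neg (hA : IsLocal A) : IsLocal (-A) := by
  obtain ⟨a, ha⟩ := hA
  refine ⟨a, fun N f hf w hw => ?_⟩
  rw [LinearMap.neg_apply, Pi.neg_apply, ha N f hf w hw, neg_zero]

theorem sub (hA : IsLocal A) (hB : IsLocal B) : IsLocal (A - B) := by
  rw [sub_eq_add_neg]; exact hA.add hB.neg

theorem zero : IsLocal (0 : Fam k →ₗ[k] Fam k) := ⟨0, fun _ _ _ _ _ => rfl⟩

theorem id : IsLocal (LinearMap.id : Fam k →ₗ[k] Fam k) := ⟨0, fun _ _ hf w hw => hf w hw⟩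

theorem sum {ι : Type*} (s : Finset ι) (A : ι → Fam k →ₗ[k] Fam k) (hA : ∀ i, IsLocal (A i)) :
    IsLocal (∑ i ∈ s, A i) := by
  classical
  induction s using Finset.induction_on with
  | empty => exact zero
  | insert a s ha ih => rw [Finset.sum_insert ha]; exact (hA a).add ih

/-- A local operator vanishes when it vanishes on families concentrated at one word. -/
theorem eq_zero {n p : ℕ} (hA : IsLocal A)
    (h : ∀ u X, u.count true = n → X ∈ component k u.length p → A (pl u X) = 0) {f : Fam k}
    (hf : f ∈ famOf k n p) : A f = 0 := by
  obtain ⟨c, hc⟩ := hA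
  funext w
  -- Up to the length that influences the value at `w`, the family agrees with a finite sum of
  -- families concentrated at one word.
  have hfin := List.finite_length_le Bool (w.length + c)
  have h1 : A (f - ∑ u ∈ hfin.toFinset, pl u (f u)) w = 0 := by
    refine hc w.length _ (fun u hu => ?_) w le_rfl
    rw [Pi.sub_apply, Finset.sum_apply, Finset.sum_eq_single u, pl_same, sub_self]
    · intro v _ hv; exact pl_ne hv.symm _
    · intro h; exact absurd (hfin.mem_toFinset.2 hu) h
  rw [map_sub, map_sum, Pi.sub_apply, sub_eq_zero] at h1
  rw [h1, Finset.sum_eq_zero]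
  intro u _
  by_cases hu : u.count true = n
  · exact h u _ hu (mem_famOf.1 hf u).1
  · rw [(mem_famOf.1 hf u).2 hu, map_zero, map_zero]

theorem eq {n p : ℕ} (hA : IsLocal A) (hB : IsLocal B)
    (h : ∀ u X, u.count true = n → X ∈ component k u.length p → A (pl u X) = B (pl u X))
    {f : Fam k} (hf : f ∈ famOf k n p) : A f = B f :=
  sub_eq_zero.1 ((hA.sub hB).eq_zero
    (fun u X hu hX => by rw [LinearMap.sub_apply, h u X hu hX, sub_self]) hf)

theorem famComp_flip (i n : ℕ) (g : Fam k) : IsLocal ((famComp i n).flip g) := by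
  -- The constant is `1` because `l ++ true :: r` is one letter longer than `w` when `v` is empty.
  refine ⟨1, fun N f hf w hw => ?_⟩
  rw [LinearMap.flip_apply]
  refine famComp_apply_eq_zero fun l v r e _ _ => Or.inl (hf _ ?_)
  rw [e] at hw; simp at hw ⊢; omega

theorem famComp (i n : ℕ) (f : Fam k) : IsLocal (famComp i n f) := by
  refine ⟨0, fun N g hg w hw => ?_⟩
  refine famComp_apply_eq_zero fun l v r e _ _ => Or.inr (hg _ ?_)
  rw [e] at hw; simp at hw; omega

end IsLocal

theorem famComp_seq_pl {m n s r i j t : ℕ} (hi : i < m) (hj : j < n) (ht : n + s = t + 1)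
    {u v x : List Bool} (hu : u.count true = m) (hv : v.count true = n) (hx : x.count true = s)
    (X Y : Ext k) {Z : Ext k} (hZ : Z ∈ component k x.length r) :
    famComp (i + j) s (famComp i n (pl u X) (pl v Y)) (pl x Z) =
      famComp i t (pl u X) (famComp j s (pl v Y) (pl x Z)) := by
  obtain ⟨l, r, rfl, hl⟩ := exists_split_of_lt_count (hu ▸ hi)
  obtain ⟨l', r', rfl, hl'⟩ := exists_split_of_lt_count (hv ▸ hj)
  have e : l ++ (l' ++ true :: r') ++ r = (l ++ l') ++ true :: (r' ++ r) := by simp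
  rw [famComp_pl' hl hv, famComp_pl' hl' hx, e, famComp_pl' (by simp [hl, hl']) hx,
    famComp_pl' hl (by simp at hv ⊢; omega)]
  rcases Nat.eq_zero_or_pos x.length with h0 | h0
  · rw [h0] at hZ
    rw [component_zero_left hZ, compExt_zero_right, compExt_zero_right, compExt_zero_right,
      map_zero, map_zero]
  · rw [List.length_append, compExt_seq (by simp) h0]
    rw [show (l' ++ true :: r').length + x.length - 1 = (l' ++ x ++ r').length by simp; omega]
    simp only [List.append_assoc]

/-- Both sides are local in each argument separately, so the three families may be replaced one
after the other by families concentrated at one word. -/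
theorem famComp_seq {m n s p q r i j t : ℕ} (hi : i < m) (hj : j < n) (ht : n + s = t + 1)
    {f g h : Fam k} (hf : f ∈ famOf k m p) (hg : g ∈ famOf k n q) (hh : h ∈ famOf k s r) :
    famComp (i + j) s (famComp i n f g) h = famComp i t f (famComp j s g h) := by
  refine IsLocal.eq (A := (famComp (i + j) s).flip h ∘ₗ (famComp i n).flip g)
    (B := (famComp i t).flip (famComp j s g h))
    ((IsLocal.famComp_flip _ _ _).comp (IsLocal.famComp_flip _ _ _))
    (IsLocal.famComp_flip _ _ _) (fun u X hu hX => ?_) hf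
  refine IsLocal.eq (A := (famComp (i + j) s).flip h ∘ₗ famComp i n (pl u X))
    (B := famComp i t (pl u X) ∘ₗ (famComp j s).flip h)
    ((IsLocal.famComp_flip _ _ _).comp (IsLocal.famComp _ _ _))
    ((IsLocal.famComp _ _ _).comp (IsLocal.famComp_flip _ _ _)) (fun v Y hv hY => ?_) hg
  refine IsLocal.eq (A := famComp (i + j) s (famComp i n (pl u X) (pl v Y)))
    (B := famComp i t (pl u X) ∘ₗ famComp j s (pl v Y)) (IsLocal.famComp _ _ _)
    ((IsLocal.famComp _ _ _).comp (IsLocal.famComp _ _ _)) (fun x Z hx hZ => ?_) hh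
  exact famComp_seq_pl hi hj ht hu hv hx X Y hZ

theorem famComp_par_pl {m n s q r i j j' : ℕ} (hij : i < j) (hj : j < m) (hj' : j' + 1 = j + n)
    {u v x : List Bool} (hu : u.count true = m) (hv : v.count true = n) (hx : x.count true = s)
    (X : Ext k) {Y Z : Ext k} (hY : Y ∈ component k v.length q) (hZ : Z ∈ component k x.length r) :
    famComp j' s (famComp i n (pl u X) (pl v Y)) (pl x Z) =
      (-1 : k) ^ (q * r) • famComp i n (famComp j s (pl u X) (pl x Z)) (pl v Y) := by
  obtain ⟨l, r, rfl, hl⟩ := exists_split_of_lt_count (i := i) (hu ▸ hij.trans hj)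
  obtain ⟨l', r', rfl, hl'⟩ := exists_split_of_lt_count (u := r) (i := j - i - 1) (by
    simp at hu; omega)
  have e1 : l ++ v ++ (l' ++ true :: r') = (l ++ v ++ l') ++ true :: r' := by simp
  have e2 : l ++ true :: (l' ++ true :: r') = (l ++ true :: l') ++ true :: r' := by simp
  have e3 : (l ++ true :: l') ++ x ++ r' = l ++ true :: (l' ++ x ++ r') := by simp
  rw [famComp_pl' hl hv, e1, famComp_pl' (by simp; omega) hx, e2,
    famComp_pl' (i := j) (by simp; omega) hx, e3, famComp_pl' hl hv]
  -- An empty word carries an element of `ncBV` of arity `0`, which is zero.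
  rcases Nat.eq_zero_or_pos x.length with h0 | h0
  · rw [h0] at hZ
    rw [component_zero_left hZ, compExt_zero_right, compExt_zero_right, compExt_zero_left,
      map_zero, map_zero, smul_zero]
  rcases Nat.eq_zero_or_pos v.length with h1 | h1
  · rw [h1] at hY
    rw [component_zero_left hY, compExt_zero_right, compExt_zero_right, compExt_zero_left,
      map_zero, map_zero, smul_zero]
  have := compExt_par (i := l.length) (j := (l ++ true :: l').length) (by simp) h1 h0 X hY hZ
  rw [show (l ++ v ++ l').length = (l ++ true :: l').length + v.length - 1 by simp; omega, this,
    map_smul]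
  simp only [List.append_assoc]

theorem famComp_par {m n s p q r i j j' : ℕ} (hij : i < j) (hj : j < m) (hj' : j' + 1 = j + n)
    {f g h : Fam k} (hf : f ∈ famOf k m p) (hg : g ∈ famOf k n q) (hh : h ∈ famOf k s r) :
    famComp j' s (famComp i n f g) h = (-1 : k) ^ (q * r) • famComp i n (famComp j s f h) g := by
  refine IsLocal.eq (A := (famComp j' s).flip h ∘ₗ (famComp i n).flip g)
    (B := (-1 : k) ^ (q * r) • ((famComp i n).flip g ∘ₗ (famComp j s).flip h))
    ((IsLocal.famComp_flip _ _ _).comp (IsLocal.famComp_flip _ _ _))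
    (((IsLocal.famComp_flip _ _ _).comp (IsLocal.famComp_flip _ _ _)).smul _)
    (fun u X hu hX => ?_) hf
  refine IsLocal.eq (A := (famComp j' s).flip h ∘ₗ famComp i n (pl u X))
    (B := (-1 : k) ^ (q * r) • famComp i n (famComp j s (pl u X) h))
    ((IsLocal.famComp_flip _ _ _).comp (IsLocal.famComp _ _ _))
    ((IsLocal.famComp _ _ _).smul _) (fun v Y hv hY => ?_) hg
  refine IsLocal.eq (A := famComp j' s (famComp i n (pl u X) (pl v Y)))
    (B := (-1 : k) ^ (q * r) • ((famComp i n).flip (pl v Y) ∘ₗ famComp j s (pl u X)))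
    (IsLocal.famComp _ _ _)
    (((IsLocal.famComp_flip _ _ _).comp (IsLocal.famComp _ _ _)).smul _)
    (fun x Z hx hZ => ?_) hh
  exact famComp_par_pl hij hj hj' hu hv hx X hY hZ

theorem famComp_one_left {n p : ℕ} {f : Fam k} (hf : f ∈ famOf k n p) :
    famComp 0 n (pl [true] 1) f = f := by
  refine IsLocal.eq (A := famComp 0 n (pl [true] 1)) (B := LinearMap.id)
    (IsLocal.famComp _ _ _) IsLocal.id (fun u X hu hX => ?_) hf
  have := famComp_pl' (k := k) (i := 0) (l := []) (r := []) rfl hu 1 X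
  simp only [List.nil_append, List.append_nil] at this
  rw [this, List.length_nil, one_compExt]
  rfl

theorem famComp_one_right {n p i : ℕ} (hi : i < n) {f : Fam k} (hf : f ∈ famOf k n p) :
    famComp i 1 f (pl [true] 1) = f := by
  refine IsLocal.eq (A := (famComp i 1).flip (pl [true] 1)) (B := LinearMap.id)
    (IsLocal.famComp_flip _ _ _) IsLocal.id (fun u X hu hX => ?_) hf
  obtain ⟨l, r, rfl, hl⟩ := exists_split_of_lt_count (hu ▸ hi)
  rw [LinearMap.flip_apply, famComp_pl' hl (by simp), List.length_singleton, compExt_one]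
  simp

end NcBV

end

noncomputable section

/-! ### The twisted differential on families and the Leibniz rule. -/

namespace NcBV

variable {k : Type u} [CommRing k]

variable (k) in
/-- The edge from `j` to `j + 1` in the exterior algebra. -/
def eE (j : ℕ) : Ext k := ExteriorAlgebra.ι k (se k j)

variable (k) in
/-- The tadpole at `j` in the exterior algebra. -/
def tE (j : ℕ) : Ext k := ExteriorAlgebra.ι k (st k j)

theorem eE_mem {j n : ℕ} (h : j + 1 < n) : eE k j ∈ component k n 1 := by
  rw [eE, ← bamboo_singleton]
  exact bamboo_mem_component _ (by omega)
    (Finset.singleton_subset_iff.2 (edge_mem_slots.2 h)) (Finset.card_singleton _)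

/-- The differential of `MC ncBV` on families. -/
def mcFamAt (p : ℕ) (f : Fam k) (w : List Bool) : Ext k :=
  -((-1 : k) ^ p • ∑ a ∈ Finset.range w.length, if (w.drop a).take 2 = [false, false] then
    compBilin a 2 (f (w.take a ++ false :: w.drop (a + 2))) (eE k 0) else 0)

/-- The differential of `MC ncBV` on families, as a linear map. -/
def mcFam (p : ℕ) : Fam k →ₗ[k] Fam k where
  toFun := mcFamAt p
  map_add' f g := by
    funext w
    simp only [mcFamAt, Pi.add_apply]
    rw [← neg_add, ← smul_add, ← Finset.sum_add_distrib]
    congr 2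
    refine Finset.sum_congr rfl fun a _ => ?_
    split_ifs
    · rw [map_add, LinearMap.add_apply]
    · rw [add_zero]
  map_smul' c f := by
    funext w
    simp only [mcFamAt, Pi.smul_apply, RingHom.id_apply]
    rw [smul_neg, smul_comm c, Finset.smul_sum (r := c)]
    congr 2
    refine Finset.sum_congr rfl fun a _ => ?_
    split_ifs
    · rw [map_smul, LinearMap.smul_apply]
    · rw [smul_zero]

theorem mcFam_apply (p : ℕ) (f : Fam k) (w : List Bool) : mcFam p f w = mcFamAt p f w := rfl

variable (k) in
/-- The family of the twisting element `b(α, -) + b(-, α)`. -/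
def muFam : Fam k := pl [false, true] (eE k 0) + pl [true, false] (eE k 0)

/-- The differential of the twisted operad on families of arity `n` and degree `p`. -/
def dFam (n p : ℕ) : Fam k →ₗ[k] Fam k :=
  mcFam p + famComp 0 n (muFam k) -
    (-1 : k) ^ p • ∑ i ∈ Finset.range n, (famComp i 1).flip (muFam k)

theorem isLocal_mcFam (p : ℕ) : IsLocal (mcFam p : Fam k →ₗ[k] Fam k) := by
  refine ⟨0, fun N f hf w hw => ?_⟩
  rw [mcFam_apply, mcFamAt, Finset.sum_eq_zero, smul_zero, neg_zero]
  intro a ha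
  split_ifs with h
  · rw [hf, map_zero, LinearMap.zero_apply]
    have := NSOp.length_cut_two w h
    simp; omega
  · rfl

theorem isLocal_dFam (n p : ℕ) : IsLocal (dFam n p : Fam k →ₗ[k] Fam k) :=
  ((isLocal_mcFam p).add (IsLocal.famComp _ _ _)).sub
    ((IsLocal.sum _ _ fun _ => IsLocal.famComp_flip _ _ _).smul _)

/-- The replacement of a letter of a word by a pair of letters, in all possible ways: a black vertex
is replaced by two black ones, and a white vertex by a black and a white one. -/
def splitPl (l : List Bool) (c : Bool) (r : List Bool) : Ext k →ₗ[k] Fam k :=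
  if c = true then pl (l ++ false :: true :: r) + pl (l ++ true :: false :: r)
  else pl (l ++ false :: false :: r)

theorem exists_split_of_drop_eq {u : List Bool} {a : ℕ} {c : Bool} {r : List Bool}
    (h : u.drop a = c :: r) : ∃ l, u = l ++ c :: r ∧ l.length = a := by
  refine ⟨u.take a, by rw [← h, List.take_append_drop], ?_⟩
  rw [List.length_take, min_eq_left]
  by_contra h'
  rw [List.drop_eq_nil_of_le (by omega)] at h
  cases h

theorem exists_split_of_take_two {w : List Bool} {a : ℕ}
    (h : (w.drop a).take 2 = [false, false]) :
    ∃ l r, w = l ++ false :: false :: r ∧ l.length = a := by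
  have := NSOp.length_cut_two w h
  exact ⟨_, _, NSOp.cut_two w h, by simp; omega⟩

/-- A single position is compared: two black letters of `w` at `a`, `a + 1` contribute exactly when
`w` arises from `u` by doubling a black letter at `a`. -/
theorem mcFam_pl_aux (a : ℕ) (u w : List Bool) (X : Ext k) :
    (if (w.drop a).take 2 = [false, false] then
      compBilin a 2 (pl u X (w.take a ++ false :: w.drop (a + 2))) (eE k 0) else 0) =
    match u.drop a with
    | [] => 0
    | c :: r => (if c = true then 0 else
        splitPl (u.take a) c r (compExt (u.take a).length 2 X (eE k 0)) : Fam k) w := by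
  have key : ∀ l r : List Bool, l.length = a →
      (l ++ false :: false :: r).take a ++ false :: (l ++ false :: false :: r).drop (a + 2) =
        l ++ false :: r := by
    rintro l r rfl
    have h : l ++ false :: false :: r = (l ++ [false, false]) ++ r := by simp
    rw [List.take_left' rfl, h, List.drop_left' (by simp)]
  rcases hd : u.drop a with _ | ⟨c, r⟩
  · split_ifs with h
    · obtain ⟨l, r, rfl, hl⟩ := exists_split_of_take_two h
      rw [key l r hl, pl_ne, map_zero, LinearMap.zero_apply]
      rintro rfl
      simp [List.drop_left' hl] at hd
    · rfl
  · obtain ⟨l, rfl, hl⟩ := exists_split_of_drop_eq hd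
    cases c
    · simp only [Bool.false_eq_true, if_false, splitPl]
      rw [List.take_left' hl]
      split_ifs with h
      · obtain ⟨l', r', rfl, hl'⟩ := exists_split_of_take_two h
        rw [key l' r' hl']
        by_cases e : l' ++ false :: r' = l ++ false :: r
        · obtain ⟨rfl, h2⟩ := List.append_inj e (by omega)
          obtain rfl : r' = r := by simpa using h2
          rw [pl_same, pl_same, hl]
          rfl
        · rw [pl_ne e, pl_ne, map_zero, LinearMap.zero_apply]
          intro e'
          obtain ⟨rfl, h2⟩ := List.append_inj e' (by omega)
          obtain rfl : r' = r := by simpa using h2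
          exact e rfl
      · rw [pl_ne]
        rintro rfl
        rw [List.drop_left' hl] at h
        exact h rfl
    · simp only [if_true, Pi.zero_apply]
      split_ifs with h
      · obtain ⟨l', r', rfl, hl'⟩ := exists_split_of_take_two h
        rw [key l' r' hl', pl_ne, map_zero, LinearMap.zero_apply]
        intro e
        have := (List.append_inj e (by omega)).2
        simp at this
      · rfl

theorem mcFam_pl (p : ℕ) (u : List Bool) (X : Ext k) : mcFam p (pl u X) =
    -((-1 : k) ^ p • letterSum u fun l c r =>
      if c = true then 0 else splitPl l c r (compExt l.length 2 X (eE k 0))) := by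
  funext w
  rw [mcFam_apply, mcFamAt, Pi.neg_apply, Pi.smul_apply,
    -- The left sum runs over positions of `w` and the right one over positions of `u`; both are
    -- extended to a range covering the two words.
    letterSum_eq_sum u _ (le_add_right le_rfl : u.length ≤ u.length + w.length),
    Finset.sum_apply,
    Finset.sum_subset (Finset.range_subset_range.2 (le_add_left le_rfl) :
      Finset.range w.length ⊆ Finset.range (u.length + w.length))]
  · congr 2
    refine Finset.sum_congr rfl fun a _ => ?_
    rw [mcFam_pl_aux]
    rcases u.drop a with _ | ⟨c, r⟩ <;> rfl
  · intro a _ ha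
    rw [if_neg]
    intro h
    rw [List.drop_eq_nil_of_le (by simpa using ha)] at h
    cases h

theorem famComp_muFam_left {n : ℕ} {u : List Bool} (hu : u.count true = n) (X : Ext k) :
    famComp 0 n (muFam k) (pl u X) = pl (false :: u) (compExt 1 u.length (eE k 0) X) +
      pl (u ++ [false]) (compExt 0 u.length (eE k 0) X) := by
  have h1 := famComp_pl' (k := k) (i := 0) (l := [false]) (r := []) (by simp) hu (eE k 0) X
  have h2 := famComp_pl' (k := k) (i := 0) (l := []) (r := [false]) (by simp) hu (eE k 0) X
  simp only [List.append_nil, List.nil_append, List.cons_append, List.length_singleton,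
    List.length_nil] at h1 h2
  rw [muFam, map_add, LinearMap.add_apply, h1, h2]

theorem famComp_muFam_right (l r : List Bool) (X : Ext k) :
    famComp (l.count true) 1 (pl (l ++ true :: r) X) (muFam k) =
      splitPl l true r (compExt l.length 2 X (eE k 0)) := by
  rw [muFam, map_add, famComp_pl' rfl (by simp), famComp_pl' rfl (by simp), splitPl, if_pos rfl,
    LinearMap.add_apply]
  simp

/-- The derivation with `d α = -b(α, α)` splits the black letters and the compositions with the
twisting element on the right split the white ones. Both carry the sign `-(-1) ^ p`, so they merge
into one sum over all letters; the left composition adds a black vertex at either end. -/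
theorem dFam_pl {n : ℕ} (p : ℕ) {u : List Bool} (hu : u.count true = n) (X : Ext k) :
    dFam n p (pl u X) =
      -((-1 : k) ^ p • letterSum u fun l c r => splitPl l c r (compExt l.length 2 X (eE k 0))) +
      pl (false :: u) (compExt 1 u.length (eE k 0) X) +
      pl (u ++ [false]) (compExt 0 u.length (eE k 0) X) := by
  have h : ∑ i ∈ Finset.range n, famComp i 1 (pl u X) (muFam k) = letterSum u fun l c r =>
      if c = true then splitPl l c r (compExt l.length 2 X (eE k 0)) else 0 := by
    rw [← hu, sum_range_count]
    refine letterSum_congr fun l c r e => ?_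
    split_ifs with hc
    · subst hc; subst e; exact famComp_muFam_right l r X
    · rfl
  have h' : (letterSum u fun l c r => splitPl l c r (compExt l.length 2 X (eE k 0))) =
      (letterSum u fun l c r =>
        if c = true then 0 else splitPl l c r (compExt l.length 2 X (eE k 0))) +
      letterSum u fun l c r =>
        if c = true then splitPl l c r (compExt l.length 2 X (eE k 0)) else 0 := by
    rw [← letterSum_add]
    refine letterSum_congr fun l c r _ => ?_
    split_ifs <;> simp
  rw [dFam, LinearMap.sub_apply, LinearMap.add_apply, mcFam_pl, famComp_muFam_left hu, h',
    LinearMap.smul_apply, LinearMap.sum_apply]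
  simp only [LinearMap.flip_apply]
  rw [h, smul_add]
  abel

theorem famComp_splitPl_left {l r v : List Bool} {i n : ℕ} (l' r' : List Bool) (c : Bool)
    (e : l = l' ++ c :: r') (hl : l.count true = i) (hv : v.count true = n) (W Y : Ext k) :
    famComp i n (splitPl l' c (r' ++ true :: r) W) (pl v Y) =
      splitPl l' c (r' ++ v ++ r) (compExt (l.length + 1) v.length W Y) := by
  subst e
  have aux : ∀ c1 c2 : Bool, (l' ++ c1 :: c2 :: r').count true = i →
      famComp i n (pl (l' ++ c1 :: c2 :: (r' ++ true :: r)) W) (pl v Y) =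
      pl (l' ++ c1 :: c2 :: (r' ++ v ++ r))
        (compExt ((l' ++ c :: r').length + 1) v.length W Y) := by
    intro c1 c2 hc
    have := famComp_pl' (r := r) hc hv W Y
    simpa [add_assoc] using this
  cases c
  · simp only [splitPl, Bool.false_eq_true, if_false]
    exact aux _ _ (by simpa using hl)
  · simp only [splitPl, if_true, LinearMap.add_apply, map_add]
    rw [aux _ _ (by simpa using hl), aux _ _ (by simpa using hl)]

theorem famComp_splitPl_right {l v : List Bool} {i n : ℕ} (l' r' : List Bool) (c : Bool)
    (hl : l.count true = i) (hv : v.count true = n) (W Y : Ext k) :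
    famComp i n (splitPl (l ++ true :: l') c r' W) (pl v Y) =
      splitPl (l ++ v ++ l') c r' (compExt l.length v.length W Y) := by
  have aux : ∀ c1 c2 : Bool,
      famComp i n (pl (l ++ true :: l' ++ c1 :: c2 :: r') W) (pl v Y) =
      pl (l ++ v ++ l' ++ c1 :: c2 :: r') (compExt l.length v.length W Y) := by
    intro c1 c2
    have := famComp_pl' (r := l' ++ c1 :: c2 :: r') hl hv W Y
    simpa using this
  cases c
  · simp only [splitPl, Bool.false_eq_true, if_false]
    exact aux _ _
  · simp only [splitPl, if_true, LinearMap.add_apply, map_add]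
    rw [aux, aux]

theorem famComp_splitPl {l r : List Bool} {i n : ℕ} (l' r' : List Bool) (c : Bool)
    (hl : l.count true = i) (hv : (l' ++ c :: r').count true = n) (X W : Ext k) :
    famComp i n (pl (l ++ true :: r) X) (splitPl l' c r' W) =
      splitPl (l ++ l') c (r' ++ r) (compExt l.length ((l' ++ c :: r').length + 1) X W) := by
  have aux : ∀ c1 c2 : Bool, (l' ++ c1 :: c2 :: r').count true = n →
      famComp i n (pl (l ++ true :: r) X) (pl (l' ++ c1 :: c2 :: r') W) =
      pl (l ++ l' ++ c1 :: c2 :: (r' ++ r))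
        (compExt l.length ((l' ++ c :: r').length + 1) X W) := by
    intro c1 c2 hc
    have := famComp_pl' (r := r) hl hc X W
    simpa [add_assoc] using this
  cases c
  · simp only [splitPl, Bool.false_eq_true, if_false]
    exact aux _ _ (by simpa using hv)
  · simp only [splitPl, if_true, LinearMap.add_apply, map_add]
    rw [aux _ _ (by simpa using hv), aux _ _ (by simpa using hv)]

theorem smul_letterSum (c : k) (u : List Bool) (F : List Bool → Bool → List Bool → Fam k) :
    c • letterSum u F = letterSum u fun l c' r => c • F l c' r :=
  map_letterSum (LinearMap.lsmul k (Fam k) c) u F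

theorem famComp_splitPl_true {l r v : List Bool} {i n : ℕ} (hl : l.count true = i)
    (hv : v.count true = n) (W Y : Ext k) :
    famComp i n (splitPl l true r W) (pl v Y) =
      pl (l ++ false :: (v ++ r)) (compExt (l.length + 1) v.length W Y) +
        pl (l ++ (v ++ false :: r)) (compExt l.length v.length W Y) := by
  have h1 := famComp_pl' (l := l ++ [false]) (r := r) (by simpa using hl) hv W Y
  have h2 := famComp_pl' (l := l) (r := false :: r) hl hv W Y
  simp only [List.append_assoc, List.cons_append, List.nil_append, List.length_append,
    List.length_singleton] at h1 h2
  rw [splitPl, if_pos rfl, LinearMap.add_apply, map_add, LinearMap.add_apply, h1, h2]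

/-- In the composite, letters coming from `l` and `r` are split by the differential of the first
factor, and letters of `v` by that of the second. What remains is the split of the vertex that
receives `v`, which cancels against the black vertices added at the two ends of `v`. The black
vertices at the ends of the composite come from the first factor. -/
theorem dFam_famComp_pl {m n l' p q i : ℕ} (hi : i < m) (hl' : m + n = l' + 1) {u v : List Bool}
    (hu : u.count true = m) (hv : v.count true = n) (X : Ext k) {Y : Ext k}
    (hY : Y ∈ component k v.length q) :
    dFam l' (p + q) (famComp i n (pl u X) (pl v Y)) =
      famComp i n (dFam m p (pl u X)) (pl v Y) +
        (-1 : k) ^ p • famComp i n (pl u X) (dFam n q (pl v Y)) := by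
  rcases Nat.eq_zero_or_pos v.length with h0 | h0
  · rw [h0] at hY
    rw [component_zero_left hY]
    simp only [map_zero, smul_zero, add_zero]
  obtain ⟨l, r, rfl, hl⟩ := exists_split_of_lt_count (hu ▸ hi)
  have hb : eE k 0 ∈ component k 2 1 := eE_mem (by omega)
  have e1 : l ++ v ++ r = l ++ (v ++ r) := List.append_assoc _ _ _
  have hs1 : ((-1 : k) ^ q) * (-1 : k) ^ q = 1 := by rw [← mul_pow]; simp
  rw [famComp_pl' hl hv, dFam_pl (n := l') _ (by simp at hu ⊢; omega), dFam_pl _ hu, dFam_pl _ hv,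
    e1]
  simp only [letterSum_append, letterSum]
  simp only [map_add, map_neg, map_smul, LinearMap.add_apply, LinearMap.neg_apply,
    LinearMap.smul_apply]
  -- positions before the vertex
  have A1 : famComp i n (letterSum l fun l₁ c r₁ => splitPl l₁ c (r₁ ++ true :: r)
        (compExt l₁.length 2 X (eE k 0))) (pl v Y) =
      (-1 : k) ^ q • letterSum l fun l₁ c r₁ => splitPl l₁ c (r₁ ++ (v ++ r))
        (compExt l₁.length 2 (compExt l.length v.length X Y) (eE k 0)) := by
    rw [← LinearMap.flip_apply, map_letterSum, smul_letterSum]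
    refine letterSum_congr fun l₁ c r₁ e => ?_
    rw [LinearMap.flip_apply, famComp_splitPl_left l₁ r₁ c e hl hv,
      show l.length + 1 = l.length + 2 - 1 from rfl,
      compExt_par (by rw [e]; simp) two_pos h0 X hb hY, map_smul, one_mul, List.append_assoc]
  have A2 : famComp i n (letterSum r fun l₁ c r₁ => splitPl (l ++ true :: l₁) c r₁
        (compExt (l ++ true :: l₁).length 2 X (eE k 0))) (pl v Y) =
      (-1 : k) ^ q • letterSum r fun l₁ c r₁ => splitPl (l ++ (v ++ l₁)) c r₁
        (compExt (l ++ (v ++ l₁)).length 2 (compExt l.length v.length X Y) (eE k 0)) := by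
    rw [← LinearMap.flip_apply, map_letterSum, smul_letterSum]
    refine letterSum_congr fun l₁ c r₁ e => ?_
    have := compExt_par (i := l.length) (j := (l ++ true :: l₁).length) (by simp) h0 two_pos X
      hY hb
    rw [LinearMap.flip_apply, famComp_splitPl_right l₁ r₁ c hl hv,
      show (l ++ (v ++ l₁)).length = (l ++ true :: l₁).length + v.length - 1 by simp; omega,
      this, map_smul, mul_one, smul_smul, hs1, one_smul, List.append_assoc]
  have A3 : famComp i n (pl (l ++ true :: r) X) (letterSum v fun l₁ c r₁ => splitPl l₁ c r₁
        (compExt l₁.length 2 Y (eE k 0))) =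
      letterSum v fun l₁ c r₁ => splitPl (l ++ l₁) c (r₁ ++ r)
        (compExt (l ++ l₁).length 2 (compExt l.length v.length X Y) (eE k 0)) := by
    rw [map_letterSum]
    refine letterSum_congr fun l₁ c r₁ e => ?_
    rw [famComp_splitPl l₁ r₁ c hl (e ▸ hv), ← e, List.length_append,
      compExt_seq (by rw [e]; simp) two_pos]
    rfl
  -- The splitting of the receiving vertex itself: its two terms are those of `A5` and `A6`, and
  -- occur with the opposite sign.
  have A4 : famComp i n (splitPl (l ++ []) true r (compExt (l ++ []).length 2 X (eE k 0)))
      (pl v Y) = pl (l ++ false :: (v ++ r))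
          (compExt l.length (v.length + 1) X (compExt 1 v.length (eE k 0) Y)) +
        pl (l ++ (v ++ false :: r))
          (compExt l.length (v.length + 1) X (compExt 0 v.length (eE k 0) Y)) := by
    rw [List.append_nil, famComp_splitPl_true hl hv, compExt_seq one_lt_two h0,
      show compExt l.length v.length (compExt l.length 2 X (eE k 0)) Y =
        compExt (l.length + 0) v.length (compExt l.length 2 X (eE k 0)) Y from rfl,
      compExt_seq two_pos h0, show 2 + v.length - 1 = v.length + 1 by omega]
  have A5 : famComp i n (pl (l ++ true :: r) X) (pl (false :: v) (compExt 1 v.length (eE k 0) Y)) =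
      pl (l ++ false :: (v ++ r))
          (compExt l.length (v.length + 1) X (compExt 1 v.length (eE k 0) Y)) := by
    rw [famComp_pl' hl (by simpa using hv)]
    simp
  have A6 : famComp i n (pl (l ++ true :: r) X)
        (pl (v ++ [false]) (compExt 0 v.length (eE k 0) Y)) =
      pl (l ++ (v ++ false :: r))
          (compExt l.length (v.length + 1) X (compExt 0 v.length (eE k 0) Y)) := by
    rw [famComp_pl' hl (by simpa using hv)]
    simp
  have A7 : famComp i n (pl (false :: (l ++ true :: r))
        (compExt 1 (l ++ true :: r).length (eE k 0) X)) (pl v Y) =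
      pl (false :: (l ++ (v ++ r)))
        (compExt 1 (l ++ (v ++ r)).length (eE k 0) (compExt l.length v.length X Y)) := by
    have := famComp_pl' (l := false :: l) (r := r) (by simpa using hl) hv
      (compExt 1 (l ++ true :: r).length (eE k 0) X) Y
    simp only [List.cons_append, List.length_cons, List.append_assoc] at this
    rw [this, add_comm l.length 1, compExt_seq (by simp) h0,
      show (l ++ true :: r).length + v.length - 1 = (l ++ (v ++ r)).length by simp; omega]
  have A8 : famComp i n (pl (l ++ true :: r ++ [false])
        (compExt 0 (l ++ true :: r).length (eE k 0) X)) (pl v Y) =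
      pl (l ++ (v ++ r) ++ [false])
        (compExt 0 (l ++ (v ++ r)).length (eE k 0) (compExt l.length v.length X Y)) := by
    have := famComp_pl' (l := l) (r := r ++ [false]) hl hv
      (compExt 0 (l ++ true :: r).length (eE k 0) X) Y
    have h2 := compExt_seq (i := 0) (j := l.length) (n := (l ++ true :: r).length) (by simp) h0
      (eE k 0) X Y
    rw [zero_add] at h2
    simp only [List.append_assoc, List.cons_append] at this h2 ⊢
    rw [this, h2,
      show (l ++ true :: r).length + v.length - 1 = (l ++ (v ++ r)).length by simp; omega]
  rw [A1, A2, A3, A4, A5, A6, A7, A8]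
  simp only [smul_add, smul_neg, smul_smul, ← pow_add]
  abel

end NcBV

end

noncomputable section

/-! ### The twisted operad realised by families of bamboos. -/

namespace NcBV

variable {k : Type u} [CommRing k]

theorem dFam_famComp_pl_left {m n l p q i : ℕ} (hi : i < m) (hl : m + n = l + 1) {u : List Bool}
    (hu : u.count true = m) (X : Ext k) {g : Fam k} (hg : g ∈ famOf k n q) :
    dFam l (p + q) (famComp i n (pl u X) g) =
      famComp i n (dFam m p (pl u X)) g + (-1 : k) ^ p • famComp i n (pl u X) (dFam n q g) := by
  have h := IsLocal.eq (n := n) (p := q) (A := dFam l (p + q) ∘ₗ famComp i n (pl u X))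
    (B := famComp i n (dFam m p (pl u X)) + (-1 : k) ^ p • (famComp i n (pl u X) ∘ₗ dFam n q))
    ((isLocal_dFam _ _).comp (IsLocal.famComp _ _ _))
    ((IsLocal.famComp _ _ _).add
      (((IsLocal.famComp _ _ _).comp (isLocal_dFam _ _)).smul _)) (fun v Y hv hY => by
        simp only [LinearMap.comp_apply, LinearMap.add_apply, LinearMap.smul_apply]
        exact dFam_famComp_pl hi hl hu hv X hY) hg
  simpa only [LinearMap.comp_apply, LinearMap.add_apply, LinearMap.smul_apply] using h

theorem dFam_famComp {m n l p q r i : ℕ} (hi : i < m) (hl : m + n = l + 1) (hr : p + q = r)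
    {f g : Fam k} (hf : f ∈ famOf k m p) (hg : g ∈ famOf k n q) :
    dFam l r (famComp i n f g) =
      famComp i n (dFam m p f) g + (-1 : k) ^ p • famComp i n f (dFam n q g) := by
  subst hr
  have h := IsLocal.eq (n := m) (p := p) (A := dFam l (p + q) ∘ₗ (famComp i n).flip g)
    (B := (famComp i n).flip g ∘ₗ dFam m p + (-1 : k) ^ p • (famComp i n).flip (dFam n q g))
    ((isLocal_dFam _ _).comp (IsLocal.famComp_flip _ _ _))
    (((IsLocal.famComp_flip _ _ _).comp (isLocal_dFam _ _)).add
      ((IsLocal.famComp_flip _ _ _).smul _)) (fun u X hu hX => by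
        simp only [LinearMap.comp_apply, LinearMap.add_apply, LinearMap.smul_apply,
          LinearMap.flip_apply]
        exact dFam_famComp_pl_left hi hl hu X hg) hf
  simpa only [LinearMap.comp_apply, LinearMap.add_apply, LinearMap.smul_apply,
    LinearMap.flip_apply] using h

theorem dFam_one : dFam 1 0 (pl [true] (1 : Ext k)) = 0 := by
  have h1 : compExt 0 2 1 (eE k 0) = eE k 0 := one_compExt _ _
  have h2 : compExt 1 1 (eE k 0) 1 = eE k 0 := compExt_one _ _
  have h3 : compExt 0 1 (eE k 0) 1 = eE k 0 := compExt_one _ _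
  rw [dFam_pl 0 (by simp)]
  simp [letterSum, splitPl, h1, h2, h3]

/-- The family of an element of the twisted operad. -/
def val {n p : ℕ} : (TwNcBV k).V n p →ₗ[k] Fam k where
  toFun x w := if h : w.count true = n then
    ((x : (ncBV k).Series n p) ⟨w, h⟩ : component k w.length p).1 else 0
  map_add' x y := by
    funext w
    rw [Pi.add_apply]
    split_ifs
    · rfl
    · rw [add_zero]
  map_smul' c x := by
    funext w
    rw [Pi.smul_apply]
    split_ifs
    · rfl
    · rw [smul_zero]

theorem val_apply {n p : ℕ} (x : (TwNcBV k).V n p) {w : List Bool} (h : w.count true = n) :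
    val x w = ((x : (ncBV k).Series n p) ⟨w, h⟩ : component k w.length p).1 := dif_pos h

theorem val_apply_of_ne {n p : ℕ} (x : (TwNcBV k).V n p) {w : List Bool} (h : w.count true ≠ n) :
    val x w = 0 := dif_neg h

theorem val_mem {n p : ℕ} (x : (TwNcBV k).V n p) : val x ∈ famOf k n p := by
  rw [mem_famOf]
  intro w
  by_cases h : w.count true = n
  · rw [val_apply x h]
    exact ⟨Subtype.property _, fun h' => absurd h h'⟩
  · rw [val_apply_of_ne x h]
    exact ⟨Submodule.zero_mem _, fun _ => rfl⟩

theorem val_injective {n p : ℕ} : Function.Injective (val (k := k) (n := n) (p := p)) := by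
  intro x y h
  funext ⟨w, hw⟩
  refine Subtype.ext ?_
  rw [← val_apply x hw, h, val_apply y hw]

/-- An element of the twisted operad from its coefficients. -/
def ofCoeff {n p : ℕ} (x : ∀ w : {w : List Bool // w.count true = n}, component k w.1.length p) :
    (TwNcBV k).V n p := (x : (ncBV k).Series n p)

theorem val_ofCoeff {n p : ℕ}
    (x : ∀ w : {w : List Bool // w.count true = n}, component k w.1.length p)
    {w : List Bool} (h : w.count true = n) : val (ofCoeff x) w = (x ⟨w, h⟩).1 := dif_pos h

theorem exists_val_eq {n p : ℕ} {f : Fam k} (hf : f ∈ famOf k n p) :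
    ∃ x : (TwNcBV k).V n p, val x = f := by
  refine ⟨ofCoeff fun w => ⟨f w.1, (mem_famOf.1 hf w.1).1⟩, ?_⟩
  funext w
  by_cases h : w.count true = n
  · rw [val_ofCoeff _ h]
  · rw [val_apply_of_ne _ h, (mem_famOf.1 hf w).2 h]

/-- An element of the twisted operad which is concentrated at the word `w`. -/
def plugTw {n p : ℕ} (w : List Bool) (hw : w.count true = n) (X : component k w.length p) :
    (TwNcBV k).V n p := (ncBV k).plug w hw X

theorem val_plugTw {n p : ℕ} (w : List Bool) (hw : w.count true = n) (X : component k w.length p) :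
    val (plugTw w hw X) = pl w X.1 := by
  have h : plugTw w hw X = ofCoeff (Pi.single ⟨w, hw⟩ X) := rfl
  funext w'
  by_cases h' : w'.count true = n
  · rw [h, val_ofCoeff _ h']
    by_cases e : w' = w
    · subst e
      rw [pl_same, Pi.single_eq_same]
    · rw [pl_ne e, Pi.single_eq_of_ne]
      · rfl
      · exact fun h => e (congrArg Subtype.val h)
  · rw [val_apply_of_ne _ h', pl_ne]
    rintro rfl
    exact h' hw

theorem val_comp {m n l p q r : ℕ} (i : ℕ) (hi : i < m) (hl : m + n = l + 1) (hr : p + q = r)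
    (x : (TwNcBV k).V m p) (y : (TwNcBV k).V n q) :
    val ((TwNcBV k).comp i hi hl hr x y) = famComp i n (val x) (val y) := by
  funext w
  by_cases hw : w.count true = l
  · rw [val_apply _ hw, famComp_apply, famCompAt]
    change ((∑ a ∈ Finset.range (w.length + 1), ∑ c ∈ Finset.range (w.length + 1), _ :
      component k w.length r) : Ext k) = _
    refine (Submodule.coe_sum _ _ _).trans ?_
    refine Finset.sum_congr rfl fun a _ => ?_
    refine (Submodule.coe_sum _ _ _).trans ?_
    refine Finset.sum_congr rfl fun c _ => ?_
    split_ifs with h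
    · rw [val_apply x (NSOp.count_cut w hw hl h), val_apply y h.2.2.2]
      rfl
    · rfl
  · rw [val_apply_of_ne _ hw, famComp_apply_eq_zero]
    intro a v c e ha hv
    refine Or.inl (val_apply_of_ne _ fun h => hw ?_)
    rw [e]
    simp at h ⊢
    omega

theorem bamboo_edge (j : ℕ) : bamboo k {edge j} = eE k j := bamboo_singleton _

theorem val_one : val (TwNcBV k).one = pl [true] (1 : Ext k) := by
  rw [← bamboo_empty]
  exact val_plugTw (k := k) [true] rfl ⟨bamboo k ∅, bamboo_mem_component ∅ one_pos (by simp) rfl⟩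

variable (k) in
/-- The twisting element. -/
def muTw : (TwNcBV k).V 1 1 := (ncBV k).muAlpha (ncBV.b k)

theorem val_muTw : val (muTw k) = muFam k := by
  have h : muTw k = 
      plugTw (n := 1) [false, true] rfl (ncBV.b k) +
        plugTw (n := 1) [true, false] rfl (ncBV.b k) := rfl
  rw [h, map_add, muFam, ← bamboo_edge]
  exact congrArg₂ (· + ·) (val_plugTw (n := 1) [false, true] rfl (ncBV.b k))
    (val_plugTw (n := 1) [true, false] rfl (ncBV.b k))

/-- The differential of `MC ncBV`. -/
def mcTw {n p q : ℕ} (hq : p + 1 = q) (x : (TwNcBV k).V n p) : (TwNcBV k).V n q :=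
  (ncBV k).mcD (ncBV.b k) hq x

theorem val_mcTw {n p q : ℕ} (hq : p + 1 = q) (x : (TwNcBV k).V n p) :
    val (mcTw hq x) = mcFam p (val x) := by
  funext w
  rw [mcFam_apply, mcFamAt]
  by_cases hw : w.count true = n
  · rw [val_apply _ hw]
    change (((0 : component k w.length q) - (-1 : k) ^ p • ∑ a ∈ Finset.range w.length, _ :
      component k w.length q) : Ext k) = _
    rw [zero_sub, Submodule.coe_neg, Submodule.coe_smul]
    congr 2
    refine (Submodule.coe_sum _ _ _).trans ?_
    refine Finset.sum_congr rfl fun a _ => ?_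
    split_ifs with h
    · rw [val_apply x (NSOp.count_cut_two w hw h), ← bamboo_edge]
      rfl
    · rfl
  · rw [val_apply_of_ne _ hw, Finset.sum_eq_zero, smul_zero, neg_zero]
    intro a _
    split_ifs with h
    · rw [val_apply_of_ne, map_zero, LinearMap.zero_apply]
      intro h'
      refine hw ?_
      rw [NSOp.cut_two w h]
      simpa [List.count_append, List.count_cons] using h'
    · rfl

theorem d_eq {n p q : ℕ} (hq : p + 1 = q) (x : (TwNcBV k).V n p) :
    (TwNcBV k).d hq x = mcTw hq x +
      (TwNcBV k).comp 0 one_pos (Nat.add_comm 1 n) (by omega) (muTw k) x -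
      (-1 : k) ^ p • ∑ i : Fin n, (TwNcBV k).comp i.1 i.2 rfl hq x (muTw k) := by
  have h' := LinearMap.sum_apply (R := k) Finset.univ (fun i : Fin n =>
    ((TwNcBV k).comp i.1 i.2 rfl hq).flip (muTw k)) x
  simp only [LinearMap.flip_apply] at h'
  rw [← h']
  rfl

theorem val_d {n p q : ℕ} (hq : p + 1 = q) (x : (TwNcBV k).V n p) :
    val ((TwNcBV k).d hq x) = dFam n p (val x) := by
  rw [d_eq, map_sub, map_add, map_smul, map_sum, val_mcTw, val_comp]
  simp only [val_comp, val_muTw]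
  rw [dFam, LinearMap.sub_apply, LinearMap.add_apply, LinearMap.smul_apply, LinearMap.sum_apply,
    Finset.sum_range]
  rfl

/-- The filtration of `ncBV` is trivial, so a coefficient at `w` is unrestricted if `w` has at least
`a` black letters and must vanish otherwise. -/
theorem mem_F_iff {n p a : ℕ} {x : (TwNcBV k).V n p} : x ∈ (TwNcBV k).F n p a ↔
    ∀ w : List Bool, w.count false < a → val x w = 0 := by
  constructor
  · intro h w hw
    by_cases hn : w.count true = n
    · rw [val_apply x hn]
      have := ncBV_mem_F.1 (h ⟨w, hn⟩)
      rw [this.resolve_left (by simp only; omega)]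
      rfl
    · exact val_apply_of_ne x hn
  · rintro h ⟨w, hn⟩
    refine ncBV_mem_F.2 ?_
    rcases lt_or_ge (w.count false) a with hw | hw
    · refine Or.inr (Subtype.ext ?_)
      have := h w hw
      rwa [val_apply x hn] at this
    · exact Or.inl (Nat.sub_eq_zero_of_le hw)

theorem famComp_eq_zero_of_count {i n a b : ℕ} {f g : Fam k}
    (hf : ∀ w : List Bool, w.count false < a → f w = 0)
    (hg : ∀ w : List Bool, w.count false < b → g w = 0) {w : List Bool}
    (hw : w.count false < a + b) : famComp i n f g w = 0 := by
  refine famComp_apply_eq_zero fun l v r e _ _ => ?_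
  rw [e] at hw
  simp at hw
  rcases lt_or_ge (v.count false) b with h | h
  · exact Or.inr (hg v h)
  · exact Or.inl (hf _ (by simp; omega))

theorem dFam_eq_zero_of_count {n p a : ℕ} {f : Fam k}
    (hf : ∀ w : List Bool, w.count false < a → f w = 0) {w : List Bool}
    (hw : w.count false < a) : dFam n p f w = 0 := by
  rw [dFam, LinearMap.sub_apply, LinearMap.add_apply, LinearMap.smul_apply, LinearMap.sum_apply,
    Pi.sub_apply, Pi.add_apply, Pi.smul_apply, Finset.sum_apply,
    famComp_eq_zero_of_count (a := 0) (b := a) (by simp) hf (by simpa using hw),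
    Finset.sum_eq_zero, mcFam_apply, mcFamAt, Finset.sum_eq_zero]
  · simp
  · intro c _
    split_ifs with h
    · rw [hf, map_zero, LinearMap.zero_apply]
      rw [NSOp.cut_two w h] at hw
      simp at hw ⊢
      omega
    · rfl
  · intro c _
    exact famComp_eq_zero_of_count (a := a) (b := 0) hf (by simp) (by simpa using hw)

/-- Every axiom is transported along the injection `val` to families. The equation `d² = 0` is kept
as a hypothesis because it is obtained later from the word model. -/
theorem TwNcBV_isCompleteDGOperad
    (hdd : ∀ (n p : ℕ) (f : Fam k), f ∈ famOf k n p → dFam n (p + 1) (dFam n p f) = 0) :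
    (TwNcBV k).IsCompleteDGOperad where
  one_comp x := val_injective (by rw [val_comp, val_one, famComp_one_left (val_mem x)])
  comp_one x i hi := val_injective (by rw [val_comp, val_one, famComp_one_right hi (val_mem x)])
  comp_seq i j hi hj hij hl he ht he' h₁ h₂ h₃ h₄ x y z := val_injective (by
    simp only [val_comp]
    exact famComp_seq hi hj ht (val_mem x) (val_mem y) (val_mem z))
  comp_par i j j' hij hj hj' hi hjl hit hl he ht he' h₁ h₂ h₃ h₄ x y z := val_injective (by
    rw [map_smul]
    simp only [val_comp]
    exact famComp_par hij hj hj' (val_mem x) (val_mem y) (val_mem z))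
  d_d {n p q r} hp hq x := val_injective (by
    subst hp
    rw [val_d, val_d, hdd n p _ (val_mem x), map_zero])
  d_one hq := val_injective (by rw [val_d, val_one, dFam_one, map_zero])
  d_comp i hi hl hr hp' hq' hr' h₁ h₂ x y := val_injective (by
    rw [map_add, map_smul]
    simp only [val_comp, val_d]
    exact dFam_famComp hi hl hr (val_mem x) (val_mem y))
  F_zero n p := by
    rw [eq_top_iff]
    exact fun x _ => mem_F_iff.2 fun w hw => absurd hw (Nat.not_lt_zero _)
  F_antitone n p a b hab x hx := by
    rw [mem_F_iff] at hx ⊢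
    exact fun w hw => hx w (hw.trans_le hab)
  comp_F i hi hl hr x y hx hy := by
    rw [mem_F_iff] at hx hy ⊢
    intro w hw
    rw [val_comp]
    exact famComp_eq_zero_of_count hx hy hw
  d_F hq x hx := by
    rw [mem_F_iff] at hx ⊢
    intro w hw
    rw [val_d]
    exact dFam_eq_zero_of_count hx hw
  complete n p x hx := by
    -- The coefficient at `w` is constant from the step `w.count false + 1` on, and this stable
    -- value defines the limit.
    have hstep : ∀ (w : List Bool) (a b : ℕ), w.count false < a → val (x (a + b)) w =
        val (x a) w := by
      intro w a b hw
      induction b with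
      | zero => rfl
      | succ b ih =>
        have := mem_F_iff.1 (hx (a + b)) w (by omega)
        rw [map_sub, Pi.sub_apply, sub_eq_zero] at this
        rw [← ih, ← this]; rfl
    obtain ⟨y, hy⟩ := exists_val_eq (k := k) (n := n) (p := p)
      (f := fun w => val (x (w.count false + 1)) w)
      (mem_famOf.2 fun w => mem_famOf.1 (val_mem (x (w.count false + 1))) w)
    refine ⟨y, fun a => ?_, fun y' hy' => val_injective ?_⟩
    · rw [mem_F_iff]
      intro w hw
      obtain ⟨b, rfl⟩ : ∃ b, a = w.count false + 1 + b := ⟨a - (w.count false + 1), by omega⟩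
      rw [map_sub, Pi.sub_apply, hy, hstep w _ b (by omega), sub_self]
    · funext w
      have := mem_F_iff.1 (hy' (w.count false + 1)) w (by omega)
      rw [map_sub, Pi.sub_apply, sub_eq_zero] at this
      rw [this, hy]

end NcBV

end

noncomputable section

/-! ### The word model -/

/-- Letters of the words which describe bamboos with black and white vertices: black and white
vertices without and with a tadpole, and a missing edge between two consecutive vertices. -/
inductive Letter : Type
  | bk : Letter
  | wh : Letter
  | bkT : Letter
  | whT : Letter
  | gap : Letter

namespace WordModel

open Letter

variable (k : Type u) [CommRing k]

/-- Linear combinations of words. -/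
abbrev T : Type u := List Letter →₀ k

variable {k}

/-- A word as a linear combination of words. -/
abbrev wd (ω : List Letter) : T k := Finsupp.single ω 1

theorem T_ext {M : Type*} [AddCommMonoid M] [Module k M] {f g : T k →ₗ[k] M}
    (h : ∀ ω, f (wd ω) = g (wd ω)) : f = g :=
  Finsupp.lhom_ext' fun ω => LinearMap.ext_ring (h ω)

/-- The linear extension of a map on words. -/
abbrev ext {M : Type*} [AddCommMonoid M] [Module k M] (f : List Letter → M) : T k →ₗ[k] M :=
  Finsupp.linearCombination k f

theorem ext_wd {M : Type*} [AddCommMonoid M] [Module k M] (f : List Letter → M) (ω : List Letter) :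
    ext f (wd ω : T k) = f ω := by simp [Finsupp.linearCombination_single]

/-- Adding a letter on the left. -/
def cons (v : Letter) : T k →ₗ[k] T k := Finsupp.lmapDomain k k (List.cons v)

@[simp] theorem cons_wd (v : Letter) (ω : List Letter) : cons v (wd ω : T k) = wd (v :: ω) := by
  simp [cons]

/-- The differential of a word. -/
def δw : List Letter → T k
  | [] => 0
  | bk :: u => wd (bk :: bk :: u) - cons bk (δw u)
  | wh :: u => -cons wh (δw u)
  | bkT :: u => cons bkT (δw u)
  | whT :: u => wd (bkT :: wh :: u) - wd (wh :: bkT :: u) + cons whT (δw u)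
  | gap :: u => wd (bk :: gap :: u) + wd (gap :: bk :: u) - cons gap (δw u)

/-- The differential of the word model. -/
def δ : T k →ₗ[k] T k := ext δw

@[simp] theorem δ_wd (ω : List Letter) : δ (wd ω : T k) = δw ω := ext_wd _ _

/-- The clauses of `δw` as identities of operators, applicable to tails which are linear
combinations. They say that `δ` is a graded derivation of the free algebra on the letters, with
`bk`, `wh`, `gap` odd and `bkT`, `whT` even. -/
theorem δ_bk (t : T k) : δ (cons bk t) = cons bk (cons bk t) - cons bk (δ t) := by
  refine LinearMap.congr_fun (f := δ ∘ₗ cons bk)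
    (g := cons bk ∘ₗ cons bk - cons bk ∘ₗ δ) (T_ext fun ω => ?_) t
  simp [δw]

theorem δ_wh (t : T k) : δ (cons wh t) = -cons wh (δ t) := by
  refine LinearMap.congr_fun (f := δ ∘ₗ cons wh) (g := -((cons wh : T k →ₗ[k] T k) ∘ₗ δ)) (T_ext fun ω => ?_) t
  simp [δw]

theorem δ_bkT (t : T k) : δ (cons bkT t) = cons bkT (δ t) := by
  refine LinearMap.congr_fun (f := δ ∘ₗ cons bkT) (g := cons bkT ∘ₗ δ) (T_ext fun ω => ?_) t
  simp [δw]

theorem δ_whT (t : T k) : δ (cons whT t) =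
    cons bkT (cons wh t) - cons wh (cons bkT t) + cons whT (δ t) := by
  refine LinearMap.congr_fun (f := δ ∘ₗ cons whT)
    (g := cons bkT ∘ₗ cons wh - cons wh ∘ₗ cons bkT + cons whT ∘ₗ δ) (T_ext fun ω => ?_) t
  simp [δw]

theorem δ_gap (t : T k) : δ (cons gap t) =
    cons bk (cons gap t) + cons gap (cons bk t) - cons gap (δ t) := by
  refine LinearMap.congr_fun (f := δ ∘ₗ cons gap)
    (g := cons bk ∘ₗ cons gap + cons gap ∘ₗ cons bk - cons gap ∘ₗ δ) (T_ext fun ω => ?_) t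
  simp [δw]

theorem δ_δ (t : T k) : δ (δ t) = 0 := by
  refine LinearMap.congr_fun (f := δ ∘ₗ δ) (g := 0) (T_ext fun ω => ?_) t
  simp only [LinearMap.comp_apply, LinearMap.zero_apply, δ_wd]
  induction ω with
  | nil => simp [δw]
  | cons v ω ih =>
    cases v <;>
      simp only [δw, map_add, map_sub, map_neg, ← cons_wd, δ_bk, δ_wh, δ_bkT, δ_whT, δ_gap, δ_wd,
        ih, map_zero] <;> abel

/-! #### The first homotopy -/

/-- The contraction of runs of black vertices, on words. -/
def hw : List Letter → T k
  | [] => 0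
  | [bk] => 0
  | bk :: bk :: u => wd (bk :: u)
  | bk :: gap :: u => wd (gap :: u)
  | bk :: wh :: _ => 0
  | bk :: bkT :: _ => 0
  | bk :: whT :: _ => 0
  | wh :: u => -cons wh (hw u)
  | bkT :: u => cons bkT (hw u)
  | whT :: u => cons whT (hw u)
  | gap :: _ => 0

/-- The contraction of runs of black vertices. -/
def h : T k →ₗ[k] T k := ext hw

@[simp] theorem h_wd (ω : List Letter) : h (wd ω : T k) = hw ω := ext_wd _ _

/-- The projection onto the words without the letters `bk` and `gap`, on words. -/
def πw : List Letter → T k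
  | [] => wd []
  | bk :: _ => 0
  | wh :: u => cons wh (πw u)
  | bkT :: u => cons bkT (πw u)
  | whT :: u => cons whT (πw u)
  | gap :: _ => 0

/-- The projection onto the words without the letters `bk` and `gap`. -/
def π : T k →ₗ[k] T k := ext πw

@[simp] theorem π_wd (ω : List Letter) : π (wd ω : T k) = πw ω := ext_wd _ _

theorem h_cons {v : Letter} (hv : v = bkT ∨ v = whT) (t : T k) :
    h (cons v t) = cons v (h t) := by
  refine LinearMap.congr_fun (f := h ∘ₗ cons v) (g := cons v ∘ₗ h) (T_ext fun ω => ?_) t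
  rcases hv with rfl | rfl <;> simp [hw]

theorem h_wh (t : T k) : h (cons wh t) = -cons wh (h t) := by
  refine LinearMap.congr_fun (f := h ∘ₗ cons wh) (g := -((cons wh : T k →ₗ[k] T k) ∘ₗ h)) (T_ext fun ω => ?_) t
  simp [hw]

theorem h_bkT (t : T k) : h (cons bkT t) = cons bkT (h t) := h_cons (Or.inl rfl) t

theorem h_whT (t : T k) : h (cons whT t) = cons whT (h t) := h_cons (Or.inr rfl) t

theorem h_gap (t : T k) : h (cons gap t) = 0 := by
  refine LinearMap.congr_fun (f := h ∘ₗ cons gap) (g := 0) (T_ext fun ω => ?_) t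
  simp [hw]

theorem h_bk_bk (t : T k) : h (cons bk (cons bk t)) = cons bk t := by
  refine LinearMap.congr_fun (f := h ∘ₗ cons bk ∘ₗ cons bk) (g := cons bk) (T_ext fun ω => ?_) t
  simp [hw]

theorem h_bk_gap (t : T k) : h (cons bk (cons gap t)) = cons gap t := by
  refine LinearMap.congr_fun (f := h ∘ₗ cons bk ∘ₗ cons gap) (g := cons gap)
    (T_ext fun ω => ?_) t
  simp [hw]

theorem h_bk_wh (t : T k) : h (cons bk (cons wh t)) = 0 := by
  refine LinearMap.congr_fun (f := h ∘ₗ cons bk ∘ₗ cons wh) (g := 0) (T_ext fun ω => ?_) t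
  simp [hw]

theorem h_bk_bkT (t : T k) : h (cons bk (cons bkT t)) = 0 := by
  refine LinearMap.congr_fun (f := h ∘ₗ cons bk ∘ₗ cons bkT) (g := 0) (T_ext fun ω => ?_) t
  simp [hw]

theorem h_bk_whT (t : T k) : h (cons bk (cons whT t)) = 0 := by
  refine LinearMap.congr_fun (f := h ∘ₗ cons bk ∘ₗ cons whT) (g := 0) (T_ext fun ω => ?_) t
  simp [hw]

/-- The operator `h` passes over an initial run of `wh`, `bkT`, `whT` and acts at the next `bk` or
`gap`, undoing the creation of a `bk` there by `δ`. A word with neither letter is untouched, which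
is the term `π`. -/
theorem δ_h_add_h_δ (t : T k) : δ (h t) + h (δ t) = t - π t := by
  refine LinearMap.congr_fun (f := δ ∘ₗ h + h ∘ₗ δ) (g := LinearMap.id - π) (T_ext fun ω => ?_) t
  simp only [LinearMap.add_apply, LinearMap.sub_apply, LinearMap.comp_apply, LinearMap.id_apply,
    δ_wd, h_wd, π_wd]
  induction ω with
  | nil => simp [hw, πw, δw]
  | cons v ω ih =>
    -- The induction hypothesis with the letter `v` put in front.
    have key : ∀ v : Letter, cons v (δ (hw ω)) =
        wd (v :: ω) - cons v (πw ω) - cons v (h (δw ω) : T k) := fun v => by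
      rw [← cons_wd, ← map_sub, ← map_sub, ← ih, add_sub_cancel_right]
    cases v with
    | bk =>
      -- After `bk` the value of `h` depends on the next letter, hence the second case distinction.
      rcases ω with _ | ⟨_ | _ | _ | _ | _, ω⟩ <;>
      simp only [δw, hw, πw, map_add, map_sub, map_neg, map_zero, ← cons_wd, δ_bk, δ_gap, δ_wd,
        h_bk_bk, h_bk_wh, h_bk_bkT, h_bk_whT, h_bk_gap] <;> abel
    | gap =>
      simp only [δw, hw, πw, map_add, map_sub, map_zero, ← cons_wd, h_bk_gap, h_gap]
      abel
    | wh =>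
      simp only [δw, hw, πw, map_neg, δ_wh, h_wh, neg_neg, key]
      abel
    | bkT =>
      simp only [δw, hw, πw, δ_bkT, h_bkT, key]
      abel
    | whT =>
      simp only [δw, hw, πw, δ_whT, h_whT, map_add, map_sub, ← cons_wd, h_wh, h_bkT, h_wd]
      rw [key]
      simp only [map_neg, ← cons_wd]
      abel

/-! #### The second homotopy -/

/-- The contraction at the leftmost end of a gap, on words. -/
def h'w : List Letter → T k
  | bk :: gap :: _ => 0
  | bk :: u => -wd u
  | _ => 0

/-- The contraction at the leftmost end of a gap. -/
def h' : T k →ₗ[k] T k := ext h'w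

@[simp] theorem h'_wd (ω : List Letter) : h' (wd ω : T k) = h'w ω := ext_wd _ _

theorem h'_of_ne {v : Letter} (hv : v ≠ bk) (t : T k) : h' (cons v t) = 0 := by
  refine LinearMap.congr_fun (f := h' ∘ₗ cons v) (g := 0) (T_ext fun ω => ?_) t
  cases v <;> simp [h'w] at hv ⊢

theorem h'_bk_gap (t : T k) : h' (cons bk (cons gap t)) = 0 := by
  refine LinearMap.congr_fun (f := h' ∘ₗ cons bk ∘ₗ cons gap) (g := 0) (T_ext fun ω => ?_) t
  simp [h'w]

theorem h'_bk_of_ne {v : Letter} (hv : v ≠ gap) (t : T k) :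
    h' (cons bk (cons v t)) = -cons v t := by
  refine LinearMap.congr_fun (f := h' ∘ₗ cons bk ∘ₗ cons v) (g := -(cons v : T k →ₗ[k] T k))
    (T_ext fun ω => ?_) t
  cases v <;> simp [h'w] at hv ⊢

/-- For the modified differential `δ - bk`, the removal of a leading `bk` is a contraction, up to
sign, as long as no word begins with a gap. The empty word is included, and the word `bk` contracts
to it. -/
theorem h'_identity_wd {ω : List Letter} (hω : ω.head? ≠ some gap) :
    δ (h'w ω) - cons bk (h'w ω) + h' (δw ω - cons bk (wd ω) : T k) = wd ω := by
  have e1 := h'_of_ne (k := k) (v := wh) (by simp)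
  have e2 := h'_of_ne (k := k) (v := bkT) (by simp)
  have e3 := h'_of_ne (k := k) (v := whT) (by simp)
  have e4 := h'_of_ne (k := k) (v := gap) (by simp)
  have f1 := h'_bk_of_ne (k := k) (v := wh) (by simp)
  have f2 := h'_bk_of_ne (k := k) (v := bkT) (by simp)
  have f3 := h'_bk_of_ne (k := k) (v := whT) (by simp)
  have f4 := h'_bk_of_ne (k := k) (v := bk) (by simp)
  have f5 := h'_bk_gap (k := k)
  rcases ω with _ | ⟨_ | _ | _ | _ | _, ω⟩
  · simp [h'w, δw]
  · rcases ω with _ | ⟨_ | _ | _ | _ | _, ω⟩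
    · simp [h'w, δw]
    all_goals
      simp only [h'w, δw, map_sub, map_add, map_neg, map_zero, δ_wd, ← cons_wd, δ_bk, δ_wh, δ_bkT,
        δ_whT, f1, f2, f3, f4, f5]
      abel
  · simp only [h'w, δw, map_sub, map_neg, map_zero, ← cons_wd, e1, f1]
    abel
  · simp only [h'w, δw, map_sub, map_zero, ← cons_wd, e2, f2]
    abel
  · simp only [h'w, δw, map_sub, map_add, map_zero, ← cons_wd, e1, e2, e3, f3]
    abel
  · simp at hω

/-! #### The third homotopy -/

/-- The word with `n` white vertices after `j` black vertices with a tadpole, all connected. -/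
def nfw (j n : ℕ) : List Letter := List.replicate j bkT ++ List.replicate n wh

/-- The linear combination of normal forms. -/
def nf : (ℕ × ℕ →₀ k) →ₗ[k] T k := Finsupp.linearCombination k fun a => wd (nfw a.1 a.2)

@[simp] theorem nf_single (a : ℕ × ℕ) : nf (Finsupp.single a 1 : ℕ × ℕ →₀ k) = wd (nfw a.1 a.2) := by
  simp [nf, Finsupp.linearCombination_single]

/-- The symmetrization of a word in the letters `wh` and `bkT`. -/
def Pw : List Letter → (ℕ × ℕ →₀ k)
  | [] => Finsupp.single (0, 0) 1
  | wh :: u => Finsupp.lmapDomain k k (fun a : ℕ × ℕ => (a.1, a.2 + 1)) (Pw u)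
  | bkT :: u => Finsupp.lmapDomain k k (fun a : ℕ × ℕ => (a.1 + 1, a.2)) (Pw u)
  | _ => 0

/-- The map onto the free module on the normal forms. -/
def P : T k →ₗ[k] (ℕ × ℕ →₀ k) := ext Pw

@[simp] theorem P_wd (ω : List Letter) : P (wd ω : T k) = Pw ω := ext_wd _ _

theorem P_wh (t : T k) :
    P (cons wh t) = Finsupp.lmapDomain k k (fun a : ℕ × ℕ => (a.1, a.2 + 1)) (P t) := by
  refine LinearMap.congr_fun (f := P ∘ₗ cons wh)
    (g := Finsupp.lmapDomain k k (fun a : ℕ × ℕ => (a.1, a.2 + 1)) ∘ₗ P) (T_ext fun ω => ?_) t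
  simp [Pw]

theorem P_bkT (t : T k) :
    P (cons bkT t) = Finsupp.lmapDomain k k (fun a : ℕ × ℕ => (a.1 + 1, a.2)) (P t) := by
  refine LinearMap.congr_fun (f := P ∘ₗ cons bkT)
    (g := Finsupp.lmapDomain k k (fun a : ℕ × ℕ => (a.1 + 1, a.2)) ∘ₗ P) (T_ext fun ω => ?_) t
  simp [Pw]

theorem P_of_ne {v : Letter} (h1 : v ≠ wh) (h2 : v ≠ bkT) (t : T k) : P (cons v t) = 0 := by
  refine LinearMap.congr_fun (f := P ∘ₗ cons v) (g := 0) (T_ext fun ω => ?_) t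
  cases v <;> simp [Pw] at h1 h2 ⊢

/-- `P` only counts letters, so it kills the commutator created by `whT`, and it kills any word
containing `bk`, `gap` or `whT`. Thus `P` is at once the target of the third contraction and the
invariant that detects its classes. -/
theorem P_δ (t : T k) : P (δ t) = 0 := by
  have e1 := P_of_ne (k := k) (v := bk) (by simp) (by simp)
  have e2 := P_of_ne (k := k) (v := whT) (by simp) (by simp)
  have e3 := P_of_ne (k := k) (v := gap) (by simp) (by simp)
  refine LinearMap.congr_fun (f := P ∘ₗ δ) (g := 0) (T_ext fun ω => ?_) t
  simp only [LinearMap.comp_apply, LinearMap.zero_apply, δ_wd]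
  induction ω with
  | nil => simp [δw]
  | cons v ω ih =>
    cases v <;> simp only [δw, map_sub, map_add, map_neg, ← cons_wd, e1, e2, e3, P_wh, P_bkT, ih,
      map_zero, sub_zero, add_zero, neg_zero, Finsupp.lmapDomain_apply,
      ← Finsupp.mapDomain_comp]
    exact sub_self _

/-- The correction term of the third homotopy, on normal forms. -/
def Kw : ℕ → ℕ → T k
  | 0, _ => 0
  | j + 1, n => wd (whT :: nfw j n) + cons bkT (Kw j n)

/-- The correction term of the third homotopy. -/
def K : (ℕ × ℕ →₀ k) →ₗ[k] T k := Finsupp.linearCombination k fun a => Kw a.1 a.2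

@[simp] theorem K_single (a : ℕ × ℕ) : K (Finsupp.single a 1 : ℕ × ℕ →₀ k) = Kw a.1 a.2 := by
  simp [K, Finsupp.linearCombination_single]

/-- The contraction onto normal forms of words in the letters `wh`, `bkT` and `whT`, on words. -/
def sw : List Letter → T k
  | [] => 0
  | wh :: u => -cons wh (sw u) - K (Pw u)
  | bkT :: u => cons bkT (sw u)
  | whT :: u => cons whT (sw u)
  | _ => 0

/-- The contraction onto normal forms of words in the letters `wh`, `bkT` and `whT`. -/
def s : T k →ₗ[k] T k := ext sw

@[simp] theorem s_wd (ω : List Letter) : s (wd ω : T k) = sw ω := ext_wd _ _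

theorem s_wh (t : T k) : s (cons wh t) = -cons wh (s t) - K (P t) := by
  refine LinearMap.congr_fun (f := s ∘ₗ cons wh) 
    (g := -((cons wh : T k →ₗ[k] T k) ∘ₗ s) - K ∘ₗ P)
    (T_ext fun ω => ?_) t
  simp [sw]

theorem s_bkT (t : T k) : s (cons bkT t) = cons bkT (s t) := by
  refine LinearMap.congr_fun (f := s ∘ₗ cons bkT) (g := cons bkT ∘ₗ s) (T_ext fun ω => ?_) t
  simp [sw]

theorem s_whT (t : T k) : s (cons whT t) = cons whT (s t) := by
  refine LinearMap.congr_fun (f := s ∘ₗ cons whT) (g := cons whT ∘ₗ s) (T_ext fun ω => ?_) t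
  simp [sw]

theorem P_ext {M : Type*} [AddCommMonoid M] [Module k M] {f g : (ℕ × ℕ →₀ k) →ₗ[k] M}
    (h : ∀ j n, f (Finsupp.single (j, n) 1) = g (Finsupp.single (j, n) 1)) : f = g :=
  Finsupp.lhom_ext' fun a => LinearMap.ext_ring (h a.1 a.2)

theorem δw_replicate_wh (n : ℕ) : δw (List.replicate n wh) = (0 : T k) := by
  induction n with
  | zero => rfl
  | succ n ih => simp [List.replicate_succ, δw, ih]

theorem δw_nfw (j n : ℕ) : δw (nfw j n) = (0 : T k) := by
  induction j with
  | zero => simp [nfw, δw_replicate_wh]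
  | succ j ih =>
    rw [nfw, List.replicate_succ, List.cons_append, δw, ← nfw, ih, map_zero]

theorem nfw_succ_left (j n : ℕ) : nfw (j + 1) n = bkT :: nfw j n := rfl

/-- `Kw j n` is the sum of the words in which one of the `j` letters `bkT` is replaced by `whT` and
the last `n` letters are `wh`. Its differential telescopes and moves one `wh` from the front across
all the `bkT`. -/
theorem δ_Kw (j n : ℕ) : δ (Kw j n : T k) = wd (nfw j (n + 1)) - wd (wh :: nfw j n) := by
  induction j with
  | zero => simp [Kw, nfw, List.replicate_succ]
  | succ j ih =>
    rw [Kw, map_add, δ_wd, δ_bkT, ih, δw, δw_nfw, nfw_succ_left, nfw_succ_left, map_sub]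
    simp

theorem δ_K (q : ℕ × ℕ →₀ k) : δ (K q) =
    nf (Finsupp.lmapDomain k k (fun a : ℕ × ℕ => (a.1, a.2 + 1)) q) - cons wh (nf q) := by
  refine LinearMap.congr_fun (f := δ ∘ₗ K)
    (g := nf ∘ₗ Finsupp.lmapDomain k k (fun a : ℕ × ℕ => (a.1, a.2 + 1)) - cons wh ∘ₗ nf)
    (P_ext fun j n => ?_) q
  simp [δ_Kw]

theorem nf_shift_bkT (q : ℕ × ℕ →₀ k) :
    nf (Finsupp.lmapDomain k k (fun a : ℕ × ℕ => (a.1 + 1, a.2)) q) = cons bkT (nf q) := by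
  refine LinearMap.congr_fun
    (f := nf ∘ₗ Finsupp.lmapDomain k k (fun a : ℕ × ℕ => (a.1 + 1, a.2)))
    (g := cons bkT ∘ₗ nf) (P_ext fun j n => ?_) q
  simp [nfw_succ_left]

theorem K_shift_bkT (q : ℕ × ℕ →₀ k) :
    K (Finsupp.lmapDomain k k (fun a : ℕ × ℕ => (a.1 + 1, a.2)) q) =
      cons whT (nf q) + cons bkT (K q) := by
  refine LinearMap.congr_fun
    (f := K ∘ₗ Finsupp.lmapDomain k k (fun a : ℕ × ℕ => (a.1 + 1, a.2)))
    (g := cons whT ∘ₗ nf + cons bkT ∘ₗ K) (P_ext fun j n => ?_) q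
  simp [Kw]

/-- Words in the letters `wh`, `bkT` and `whT`. -/
def IsPure (ω : List Letter) : Prop := bk ∉ ω ∧ gap ∉ ω

/-- The letter `whT` imposes up to homotopy that `bkT` and `wh` commute. Prepending `bkT` preserves
normal forms, while prepending `wh` does not; the term `K` in `sw` corrects this. -/
theorem s_identity_wd {ω : List Letter} (hω : IsPure ω) :
    δ (sw ω) + s (δw ω : T k) = wd ω - nf (Pw ω) := by
  induction ω with
  | nil => simp [sw, δw, Pw, nfw]
  | cons v ω ih =>
    have ih := ih ⟨fun h => hω.1 (by simp [h]), fun h => hω.2 (by simp [h])⟩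
    have key : ∀ v : Letter, cons v (δ (sw ω)) =
        wd (v :: ω) - cons v (nf (Pw ω)) - cons v (s (δw ω) : T k) := fun v => by
      rw [← cons_wd, ← map_sub, ← map_sub, ← ih, add_sub_cancel_right]
    -- With this the correction term `K ∘ P` contributes nothing when `s` is applied after `δ`.
    have hPδ : P (δw ω : T k) = 0 := by rw [← δ_wd, P_δ]
    cases v with
    | bk => exact absurd (by simp) hω.1
    | gap => exact absurd (by simp) hω.2
    | wh =>
      simp only [sw, δw, map_sub, map_neg, δ_wh, key, s_wh, hPδ, map_zero, δ_K, Pw]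
      abel
    | bkT =>
      simp only [sw, δw, δ_bkT, key, s_bkT, Pw, nf_shift_bkT]
      abel
    | whT =>
      simp only [sw, δw, δ_whT, key, map_sub, map_add, ← cons_wd, s_wh, s_bkT, s_whT, P_bkT,
        K_shift_bkT, P_wd, s_wd, Pw, map_zero, map_neg]
      abel

end WordModel

end

noncomputable section

/-! ### Valid words and the cohomology of the word complex. -/

namespace WordModel

open Letter

variable {k : Type u} [CommRing k]

/-- Words which describe bamboos: no gap at the ends, and no two consecutive gaps. -/
inductive Valid : List Letter → Prop
  | single {v : Letter} : v ≠ gap → Valid [v]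
  | edge {v : Letter} {ω : List Letter} : v ≠ gap → Valid ω → Valid (v :: ω)
  | gap {v : Letter} {ω : List Letter} : v ≠ gap → Valid ω → Valid (v :: gap :: ω)

theorem Valid.ne_nil {ω : List Letter} (h : Valid ω) : ω ≠ [] := by cases h <;> simp

theorem Valid.head_ne_gap {ω : List Letter} (h : Valid ω) : ω.head? ≠ some Letter.gap := by
  cases h <;> simpa

theorem Valid.not_gap_cons {ω : List Letter} : ¬ Valid (Letter.gap :: ω) :=
  fun h => h.head_ne_gap rfl

theorem Valid.tail {v : Letter} {ω : List Letter} (h : Valid (v :: ω)) :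
    ω = [] ∨ Valid ω ∨ ∃ ω', ω = Letter.gap :: ω' ∧ Valid ω' := by
  cases h with
  | single _ => exact Or.inl rfl
  | edge _ h => exact Or.inr (Or.inl h)
  | gap _ h => exact Or.inr (Or.inr ⟨_, rfl, h⟩)

theorem Valid.ne_gap {v : Letter} {ω : List Letter} (h : Valid (v :: ω)) : v ≠ Letter.gap := by
  rintro rfl; exact Valid.not_gap_cons h

theorem valid_of_isPure {ω : List Letter} (h : IsPure ω) (hne : ω ≠ []) : Valid ω := by
  induction ω with
  | nil => exact absurd rfl hne
  | cons v ω ih =>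
    have hv : v ≠ Letter.gap := by rintro rfl; exact h.2 (by simp)
    rcases ω with _ | ⟨v', ω⟩
    · exact .single hv
    · exact .edge hv (ih ⟨fun h' => h.1 (by simp [h']), fun h' => h.2 (by simp [h'])⟩ (by simp))

variable (k) in
/-- Linear combinations of the words which satisfy a predicate. -/
abbrev supp (S : List Letter → Prop) : Submodule k (T k) := Finsupp.supported k k {ω | S ω}

theorem wd_mem {S : List Letter → Prop} {ω : List Letter} (h : S ω) : wd ω ∈ supp k S :=
  Finsupp.single_mem_supported k 1 h

theorem supp_mono {S S' : List Letter → Prop} (h : ∀ ω, S ω → S' ω) : supp k S ≤ supp k S' :=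
  Finsupp.supported_mono h

theorem map_mem_of_supp {M : Type*} [AddCommMonoid M] [Module k M] {S : List Letter → Prop}
    {N : Submodule k M} (f : T k →ₗ[k] M) (h : ∀ ω, S ω → f (wd ω) ∈ N) {t : T k}
    (ht : t ∈ supp k S) : f t ∈ N := by
  have hle : supp k S ≤ N.comap f := by
    rw [supp, Finsupp.supported_eq_span_single, Submodule.span_le]
    rintro _ ⟨ω, hω, rfl⟩
    exact h ω hω
  exact hle ht

theorem eq_of_supp {M : Type*} [AddCommGroup M] [Module k M] {S : List Letter → Prop}
    {f g : T k →ₗ[k] M} (h : ∀ ω, S ω → f (wd ω) = g (wd ω)) {t : T k}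
    (ht : t ∈ supp k S) : f t = g t :=
  sub_eq_zero.1 ((Submodule.mem_bot k).1 (map_mem_of_supp (N := ⊥) (f - g) (fun ω hω => by
    rw [Submodule.mem_bot, LinearMap.sub_apply, h ω hω, sub_self]) ht))

theorem cons_mem {S S' : List Letter → Prop} {v : Letter} (h : ∀ ω, S ω → S' (v :: ω)) {t : T k}
    (ht : t ∈ supp k S) : cons v t ∈ supp k S' :=
  map_mem_of_supp (cons v) (fun ω hω => by rw [cons_wd]; exact wd_mem (h ω hω)) ht

theorem δw_mem_head {ω : List Letter} {v : Letter} (hv : v ≠ gap) :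
    δw (v :: ω) ∈ supp k (fun ω' => ω'.head? ≠ some gap) := by
  have h : ∀ (v : Letter), v ≠ gap → ∀ t : T k,
      cons v t ∈ supp k (fun ω' => ω'.head? ≠ some gap) := fun v hv t =>
    cons_mem (S := fun _ => True) (fun ω _ => by simpa) (by simp [supp])
  cases v with
  | bk => exact sub_mem (wd_mem (by simp)) (h _ (by simp) _)
  | wh => exact neg_mem (h _ (by simp) _)
  | bkT => exact h _ (by simp) _
  | whT => exact add_mem (sub_mem (wd_mem (by simp)) (wd_mem (by simp))) (h _ (by simp) _)
  | gap => exact absurd rfl hv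

/-- Words which are valid, or valid after removal of a gap in front. -/
def SemiValid (ω : List Letter) : Prop := Valid ω ∨ ∃ ω', ω = gap :: ω' ∧ Valid ω'

theorem SemiValid.cons {v : Letter} (hv : v ≠ gap) {ω : List Letter} (h : SemiValid ω) :
    Valid (v :: ω) := by
  rcases h with h | ⟨ω', rfl, h⟩
  · exact .edge hv h
  · exact .gap hv h

theorem cons_mem_valid {v : Letter} (hv : v ≠ gap) {t : T k} (ht : t ∈ supp k SemiValid) :
    cons v t ∈ supp k Valid := cons_mem (fun _ h => h.cons hv) ht

theorem supp_valid_le : supp k Valid ≤ supp k SemiValid := supp_mono fun _ h => Or.inl h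

theorem δw_mem_semiValid {ω : List Letter} (hω : SemiValid ω) : δw ω ∈ supp k SemiValid := by
  suffices H : ∀ ω, Valid ω → δw ω ∈ supp k Valid by
    rcases hω with h | ⟨ω', rfl, h⟩
    · exact supp_valid_le (H _ h)
    · refine sub_mem (add_mem (supp_valid_le (wd_mem (.gap (by simp) h)))
        (wd_mem (Or.inr ⟨_, rfl, .edge (by simp) h⟩)))
        (cons_mem (fun ω hω => Or.inr ⟨ω, rfl, hω⟩) (H _ h))
  intro ω hω
  induction hω with
  | @single v hv =>
    cases v <;> simp only [δw, map_zero, neg_zero, sub_zero, add_zero] <;>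
      first
      | exact zero_mem _
      | exact absurd rfl hv
      | exact wd_mem (.edge (by simp) (.single (by simp)))
      | exact sub_mem (wd_mem (.edge (by simp) (.single (by simp))))
          (wd_mem (.edge (by simp) (.single (by simp))))
  | @edge v ω hv hω ih =>
    have h := supp_valid_le ih
    cases v with
    | bk => exact sub_mem (wd_mem (.edge (by simp) (.edge (by simp) hω))) (cons_mem_valid hv h)
    | wh => exact neg_mem (cons_mem_valid hv h)
    | bkT => exact cons_mem_valid hv h
    | whT => exact add_mem (sub_mem (wd_mem (.edge (by simp) (.edge (by simp) hω)))
        (wd_mem (.edge (by simp) (.edge (by simp) hω)))) (cons_mem_valid hv h)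
    | gap => exact absurd rfl hv
  | @gap v ω hv hω ih =>
    have h : δw (Letter.gap :: ω) ∈ supp k SemiValid :=
      sub_mem (add_mem (supp_valid_le (wd_mem (.gap (by simp) hω)))
        (wd_mem (Or.inr ⟨_, rfl, .edge (by simp) hω⟩)))
        (cons_mem (fun ω hω => Or.inr ⟨ω, rfl, hω⟩) ih)
    cases v with
    | bk => exact sub_mem (wd_mem (.edge (by simp) (.gap (by simp) hω))) (cons_mem_valid hv h)
    | wh => exact neg_mem (cons_mem_valid hv h)
    | bkT => exact cons_mem_valid hv h
    | whT => exact add_mem (sub_mem (wd_mem (.edge (by simp) (.gap (by simp) hω)))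
        (wd_mem (.edge (by simp) (.gap (by simp) hω)))) (cons_mem_valid hv h)
    | gap => exact absurd rfl hv

theorem δw_mem_valid {ω : List Letter} (hω : Valid ω) : δw ω ∈ supp k Valid := by
  have h1 := Finsupp.mem_supported k (δw ω) |>.1 (δw_mem_semiValid (k := k) (Or.inl hω))
  rcases ω with _ | ⟨v, ω⟩
  · exact absurd rfl hω.ne_nil
  have h2 := Finsupp.mem_supported k (δw (v :: ω)) |>.1 (δw_mem_head (k := k) (ω := ω) hω.ne_gap)
  refine (Finsupp.mem_supported k _).2 fun ω' hω' => ?_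
  rcases h1 hω' with h | ⟨ω'', rfl, _⟩
  · exact h
  · exact absurd rfl (h2 hω')

theorem δ_mem_valid {t : T k} (ht : t ∈ supp k Valid) : δ t ∈ supp k Valid :=
  map_mem_of_supp δ (fun ω hω => by rw [δ_wd]; exact δw_mem_valid hω) ht

/-- Validity can fail only for a word starting with `bk gap`, where the removal of `bk` leaves a
leading gap; inside a word the preceding vertex still protects the gap. -/
theorem hw_mem {ω : List Letter} (hω : Valid ω) : hw ω ∈ supp k SemiValid := by
  induction ω with
  | nil => exact zero_mem _
  | cons v ω ih =>
    have hv := hω.ne_gap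
    have step : v ≠ bk → cons v (hw ω) ∈ supp k SemiValid := by
      intro _
      rcases hω.tail with rfl | h | ⟨ω', rfl, h⟩
      · simp [hw]
      · exact supp_valid_le (cons_mem_valid hv (ih h))
      · simp [hw]
    cases v with
    | bk =>
      rcases hω.tail with rfl | h | ⟨ω', rfl, h⟩
      · exact zero_mem _
      · rcases ω with _ | ⟨_ | _ | _ | _ | _, ω⟩ <;> simp only [hw] <;>
          first | exact zero_mem _ | exact wd_mem (Or.inl h)
      · exact wd_mem (Or.inr ⟨ω', rfl, h⟩)
    | wh => exact neg_mem (step (by simp))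
    | bkT => exact step (by simp)
    | whT => exact step (by simp)
    | gap => exact absurd rfl hv

theorem exists_of_mem_semiValid {t : T k} (ht : t ∈ supp k SemiValid) :
    ∃ y ∈ supp k Valid, ∃ z ∈ supp k Valid, t = y + cons gap z := by
  have h := map_mem_of_supp (N := supp k Valid ⊔ (supp k Valid).map (cons gap)) LinearMap.id
    (fun ω hω => by
      rcases hω with hω | ⟨ω', rfl, hω⟩
      · exact Submodule.mem_sup_left (wd_mem hω)
      · refine Submodule.mem_sup_right ⟨wd ω', wd_mem hω, cons_wd _ _⟩) ht
  obtain ⟨y, hy, _, ⟨z, hz, rfl⟩, e⟩ := Submodule.mem_sup.1 h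
  exact ⟨y, hy, z, hz, e.symm⟩

theorem eq_zero_of_cons_gap_mem {t : T k} (ht : cons gap t ∈ supp k Valid) : t = 0 := by
  ext ω
  rw [Finsupp.mem_supported'] at ht
  have := ht (gap :: ω) Valid.not_gap_cons
  rwa [cons, Finsupp.lmapDomain_apply,
    Finsupp.mapDomain_apply (fun _ _ h => (List.cons.inj h).2)] at this

theorem πw_eq (ω : List Letter) : (IsPure ω ∧ πw ω = (wd ω : T k)) ∨ πw ω = (0 : T k) := by
  induction ω with
  | nil => exact Or.inl ⟨by simp [IsPure], rfl⟩
  | cons v ω ih =>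
    rcases ih with ⟨h, e⟩ | e <;> cases v <;> simp_all [πw, IsPure]

theorem Kw_mem (j n : ℕ) : Kw j n ∈ supp k (fun ω => IsPure ω ∧ ω ≠ []) := by
  have h : ∀ j n, IsPure (nfw j n) := fun j n => by simp [IsPure, nfw]
  induction j with
  | zero => exact zero_mem _
  | succ j ih =>
    refine add_mem (wd_mem ⟨?_, by simp⟩) (cons_mem (fun ω hω => ⟨?_, by simp⟩) ih)
    · exact ⟨by simpa using (h j n).1, by simpa using (h j n).2⟩
    · exact ⟨by simpa using hω.1.1, by simpa using hω.1.2⟩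

theorem K_mem (q : ℕ × ℕ →₀ k) : K q ∈ supp k (fun ω => IsPure ω ∧ ω ≠ []) := by
  rw [K, Finsupp.linearCombination_apply]
  exact sum_mem fun a _ => Submodule.smul_mem _ _ (Kw_mem _ _)

theorem sw_mem {ω : List Letter} (hω : IsPure ω) :
    sw ω ∈ supp k (fun ω => IsPure ω ∧ ω ≠ []) := by
  induction ω with
  | nil => exact zero_mem _
  | cons v ω ih =>
    have ih := ih ⟨fun h => hω.1 (by simp [h]), fun h => hω.2 (by simp [h])⟩
    have step : ∀ v : Letter, v ≠ bk → v ≠ gap →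
        cons v (sw ω) ∈ supp k (fun ω => IsPure ω ∧ ω ≠ []) := fun v h1 h2 =>
      cons_mem (fun ω hω => ⟨⟨by simpa [h1.symm] using hω.1.1, by simpa [h2.symm] using hω.1.2⟩,
        by simp⟩) ih
    cases v with
    | bk => exact zero_mem _
    | gap => exact zero_mem _
    | wh => exact sub_mem (neg_mem (step _ (by simp) (by simp))) (K_mem _)
    | bkT => exact step _ (by simp) (by simp)
    | whT => exact step _ (by simp) (by simp)

/-- The only valid word sent outside the span of valid words is `bk`, which becomes the empty word
up to sign. This exception is the source of the class of `γ`. -/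
theorem h'w_mem {ω : List Letter} (hω : Valid ω) :
    h'w ω ∈ supp k Valid ⊔ Submodule.span k {wd []} := by
  rcases ω with _ | ⟨_ | _ | _ | _ | _, ω⟩
  any_goals exact zero_mem _
  rcases hω.tail with rfl | h | ⟨ω', rfl, h⟩
  · exact neg_mem (Submodule.mem_sup_right (Submodule.mem_span_singleton_self _))
  · rcases ω with _ | ⟨_ | _ | _ | _ | _, ω⟩
    any_goals exact neg_mem (Submodule.mem_sup_left (wd_mem h))
    · exact absurd h Valid.not_gap_cons
  · exact zero_mem _

/-- Cocycles which become trivial after the connection to a black vertex on the left. -/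
theorem exists_of_δ_eq_bk {z : T k} (hz : z ∈ supp k Valid) (e : δ z = cons bk z) :
    ∃ y ∈ supp k Valid, ∃ c : k, z = δ y - cons bk y - c • wd [bk] := by
  have h1 := eq_of_supp (S := Valid) 
    (f := (δ : T k →ₗ[k] T k) ∘ₗ h' - (cons bk : T k →ₗ[k] T k) ∘ₗ h' +
      (h' : T k →ₗ[k] T k) ∘ₗ (δ - cons bk))
    (g := LinearMap.id) (fun ω hω => by simpa using h'_identity_wd (k := k) hω.head_ne_gap) hz
  have h2 := map_mem_of_supp h' (fun ω hω => by rw [h'_wd]; exact h'w_mem hω) hz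
  obtain ⟨y, hy, _, hc, e2⟩ := Submodule.mem_sup.1 h2
  obtain ⟨c, rfl⟩ := Submodule.mem_span_singleton.1 hc
  refine ⟨y, hy, c, ?_⟩
  -- On the empty word `δ - bk` takes the value `-bk`, whence the last term.
  simp only [LinearMap.add_apply, LinearMap.sub_apply, LinearMap.comp_apply, e, sub_self, map_zero,
    add_zero, LinearMap.id_apply, ← e2, map_add, map_smul, δ_wd, δw, smul_zero, cons_wd] at h1
  rw [← h1]
  abel

/-- Write `h x = y + gap z` with `y`, `z` valid. Then `x = π x + δ y + δ (gap z)`, and comparison of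
the words starting with a gap forces `δ z = bk z`, leaving the term `bk gap z`. Solving for `z` by
`exists_of_δ_eq_bk` turns this term into a coboundary plus a multiple of `bk gap bk`. Finally `s`
reduces `π x` to normal forms. -/
theorem exists_primitive {x : T k} (hx : x ∈ supp k Valid) (hd : δ x = 0) :
    ∃ y ∈ supp k Valid, ∃ (q : ℕ × ℕ →₀ k) (c : k),
      x = nf q + c • wd [bk, gap, bk] + δ y := by
  have h1 := δ_h_add_h_δ x
  rw [hd, map_zero, add_zero] at h1
  obtain ⟨y, hy, z, hz, e⟩ := exists_of_mem_semiValid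
    (map_mem_of_supp h (fun ω hω => by rw [h_wd]; exact hw_mem hω) hx)
  have hπ : π x ∈ supp k (fun ω => IsPure ω ∧ Valid ω) := map_mem_of_supp π (fun ω hω => by
    rw [π_wd]
    rcases πw_eq (k := k) ω with ⟨hp, e⟩ | e <;> rw [e]
    · exact wd_mem ⟨hp, hω⟩
    · exact zero_mem _) hx
  rw [e, map_add, δ_gap] at h1
  -- Every other term of the identity for `x` is valid, so the part beginning with a gap must
  -- vanish.
  have hz0 : cons bk z - δ z = 0 := by
    refine eq_zero_of_cons_gap_mem ?_
    have : cons gap (cons bk z - δ z) = x - π x - δ y - cons bk (cons gap z) := by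
      rw [← h1, map_sub]; abel
    rw [this]
    refine sub_mem (sub_mem (sub_mem hx (supp_mono (fun ω h => h.2) hπ)) (δ_mem_valid hy))
      (cons_mem_valid (by simp) (cons_mem (fun ω hω => Or.inr ⟨ω, rfl, hω⟩) hz))
  rw [sub_eq_zero] at hz0
  obtain ⟨y', hy', c, e'⟩ := exists_of_δ_eq_bk hz hz0.symm
  -- The differential of `bk gap y'` is `bk gap (δ y' - bk y')`: the two terms `bk bk gap y'`
  -- cancel.
  have h2 : cons bk (cons gap z) = δ (cons bk (cons gap y')) - c • wd [bk, gap, bk] := by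
    rw [e', δ_bk, δ_gap]
    simp only [map_sub, map_add, map_smul, cons_wd]
    abel
  have h3 : x = π x + δ (y + cons bk (cons gap y')) - c • wd [bk, gap, bk] := by
    rw [map_add, add_sub_assoc, add_sub_assoc, ← h2, ← sub_eq_iff_eq_add', ← h1, hz0]
    abel
  -- The rest of `h3` consists of cocycles, so `π x` is one as well and the term `s (δ (π x))`
  -- disappears.
  have hdπ : δ (π x) = 0 := by
    have h4 := congrArg δ h3
    have h5 : δw [bk, gap, bk] = (0 : T k) := by simp [δw]
    rw [hd, map_sub, map_add, δ_δ, map_smul, δ_wd, h5, smul_zero, add_zero, sub_zero] at h4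
    exact h4.symm
  have h4 := eq_of_supp (S := fun ω => IsPure ω ∧ Valid ω) (f := δ ∘ₗ s + s ∘ₗ δ)
    (g := LinearMap.id - nf ∘ₗ P) (fun ω hω => by simpa using s_identity_wd hω.1) hπ
  simp only [LinearMap.add_apply, LinearMap.sub_apply, LinearMap.comp_apply, hdπ, map_zero,
    add_zero, LinearMap.id_apply] at h4
  refine ⟨s (π x) + (y + cons bk (cons gap y')), add_mem ?_ (add_mem hy
    (cons_mem_valid (by simp) (cons_mem (fun ω hω => Or.inr ⟨ω, rfl, hω⟩) hy'))), P (π x), -c, ?_⟩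
  · exact supp_mono (S := fun ω => IsPure ω ∧ ω ≠ []) (fun ω h => valid_of_isPure h.1 h.2)
      (map_mem_of_supp s (fun ω hω => by rw [s_wd]; exact sw_mem hω.1) hπ)
  · rw [map_add, h4]
    conv_lhs => rw [h3]
    rw [neg_smul]
    abel

/-! #### The gradings -/

/-- The number of white vertices. -/
def nW : List Letter → ℕ
  | [] => 0
  | bk :: u => nW u
  | wh :: u => nW u + 1
  | bkT :: u => nW u
  | whT :: u => nW u + 1
  | gap :: u => nW u

/-- The number of gaps. -/
def nG : List Letter → ℕ
  | [] => 0
  | gap :: u => nG u + 1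
  | _ :: u => nG u

/-- The number of vertices and tadpoles. -/
def nD : List Letter → ℕ
  | [] => 0
  | bk :: u => nD u + 1
  | wh :: u => nD u + 1
  | bkT :: u => nD u + 2
  | whT :: u => nD u + 2
  | gap :: u => nD u

theorem δw_mem_grade (ω : List Letter) :
    δw ω ∈ supp k (fun ω' => nW ω' = nW ω ∧ nG ω' = nG ω ∧ nD ω' = nD ω + 1) := by
  induction ω with
  | nil => exact zero_mem _
  | cons v ω ih =>
    have step : ∀ v : Letter, cons v (δw ω) ∈ supp k (fun ω' => nW ω' = nW (v :: ω) ∧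
        nG ω' = nG (v :: ω) ∧ nD ω' = nD (v :: ω) + 1) := fun v =>
      cons_mem (fun ω' h => by cases v <;> simp only [nW, nG, nD] <;> omega) ih
    have gen : ∀ {ω₁ : List Letter} (v : Letter), nW ω₁ = nW (v :: ω) → nG ω₁ = nG (v :: ω) →
        nD ω₁ = nD (v :: ω) + 1 → (wd ω₁ : T k) ∈ supp k (fun ω' => nW ω' = nW (v :: ω) ∧
        nG ω' = nG (v :: ω) ∧ nD ω' = nD (v :: ω) + 1) := fun v h1 h2 h3 => wd_mem ⟨h1, h2, h3⟩
    cases v with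
    | bk => exact sub_mem (gen bk rfl rfl rfl) (step _)
    | wh => exact neg_mem (step _)
    | bkT => exact step _
    | whT => exact add_mem (sub_mem (gen whT rfl rfl rfl) (gen whT rfl rfl rfl)) (step _)
    | gap => exact sub_mem (add_mem (gen gap rfl rfl rfl) (gen gap rfl rfl rfl)) (step _)

open Classical in
/-- The restriction to the words which satisfy a predicate. -/
def restr (S : List Letter → Prop) : T k →ₗ[k] T k :=
  ext fun ω => if S ω then wd ω else 0

theorem restr_wd_of {S : List Letter → Prop} {ω : List Letter} (h : S ω) :
    restr S (wd ω : T k) = wd ω := by rw [restr, ext_wd, if_pos h]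

theorem restr_wd_of_not {S : List Letter → Prop} {ω : List Letter} (h : ¬ S ω) :
    restr S (wd ω : T k) = 0 := by rw [restr, ext_wd, if_neg h]

theorem restr_of_mem {S : List Letter → Prop} {t : T k} (ht : t ∈ supp k S) : restr S t = t :=
  eq_of_supp (f := restr S) (g := LinearMap.id) (fun _ hω => restr_wd_of hω) ht

theorem restr_of_mem_not {S : List Letter → Prop} {t : T k} (ht : t ∈ supp k fun ω => ¬ S ω) :
    restr S t = 0 :=
  eq_of_supp (f := restr S) (g := 0) (fun _ hω => restr_wd_of_not hω) ht

theorem restr_mem {S S' : List Letter → Prop} {t : T k} (ht : t ∈ supp k S') :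
    restr S t ∈ supp k fun ω => S' ω ∧ S ω :=
  map_mem_of_supp (restr S) (fun ω hω => by
    by_cases h : S ω
    · rw [restr_wd_of h]; exact wd_mem ⟨hω, h⟩
    · rw [restr_wd_of_not h]; exact zero_mem _) ht

/-- Homogeneity of `δ`. The condition `nD ω + 1 = d` avoids `d - 1`, so that nothing is selected on
the left when `d = 0`. -/
theorem δ_restr (n d s : ℕ) (t : T k) :
    δ (restr (fun ω => nW ω = n ∧ nG ω = s ∧ nD ω + 1 = d) t) =
      restr (fun ω => nW ω = n ∧ nG ω = s ∧ nD ω = d) (δ t) := by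
  set S₁ : List Letter → Prop := fun ω => nW ω = n ∧ nG ω = s ∧ nD ω + 1 = d with hS₁
  set S₂ : List Letter → Prop := fun ω => nW ω = n ∧ nG ω = s ∧ nD ω = d with hS₂
  refine LinearMap.congr_fun (f := (δ : T k →ₗ[k] T k) ∘ₗ (restr S₁ : T k →ₗ[k] T k)) (g := (restr S₂ : T k →ₗ[k] T k) ∘ₗ (δ : T k →ₗ[k] T k))
    (T_ext fun ω => ?_) t
  simp only [LinearMap.comp_apply, δ_wd]
  by_cases h : S₁ ω
  · rw [restr_wd_of h, δ_wd, restr_of_mem]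
    exact supp_mono (k := k) (S := fun ω' => nW ω' = nW ω ∧ nG ω' = nG ω ∧ nD ω' = nD ω + 1) (fun ω' h' => ⟨h'.1.trans h.1, h'.2.1.trans h.2.1, h'.2.2.trans h.2.2⟩)
      (δw_mem_grade ω)
  · rw [restr_wd_of_not h, map_zero, restr_of_mem_not]
    refine supp_mono (k := k) (S' := fun ω' => ¬ S₂ ω') (S := fun ω' => nW ω' = nW ω ∧ nG ω' = nG ω ∧ nD ω' = nD ω + 1)
      (fun ω' h' h'' => h ⟨?_, ?_, ?_⟩) (δw_mem_grade ω)
    · exact h'.1.symm.trans h''.1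
    · exact h'.2.1.symm.trans h''.2.1
    · exact h'.2.2.symm.trans h''.2.2

theorem nW_nfw (j n : ℕ) : nW (nfw j n) = n := by
  induction j with
  | zero => induction n with
    | zero => rfl
    | succ n ih => simpa [nfw, List.replicate_succ, nW] using ih
  | succ j ih => rw [nfw_succ_left, nW, ih]

theorem nG_nfw (j n : ℕ) : nG (nfw j n) = 0 := by
  induction j with
  | zero => induction n with
    | zero => rfl
    | succ n ih => simpa [nfw, List.replicate_succ, nG] using ih
  | succ j ih => rw [nfw_succ_left]; exact ih

theorem nD_nfw (j n : ℕ) : nD (nfw j n) = n + 2 * j := by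
  induction j with
  | zero => induction n with
    | zero => rfl
    | succ n ih => simpa [nfw, List.replicate_succ, nD] using ih
  | succ j ih => rw [nfw_succ_left, nD, ih]; ring

open Classical in
variable (k) in
/-- The generator of the cohomology in a given grade. -/
def gen (n d s : ℕ) : T k :=
  if s = 0 ∧ n + 2 * ((d - n) / 2) = d then wd (nfw ((d - n) / 2) n)
  else if n = 0 ∧ d = 2 ∧ s = 1 then wd [bk, gap, bk] else 0

/-- The numbers `n` and `d` determine `j` through `d = n + 2 j`, so a grade contains at most one
normal form. -/
theorem restr_nf_mem (n d s : ℕ) (q : ℕ × ℕ →₀ k) :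
    restr (fun ω => nW ω = n ∧ nG ω = s ∧ nD ω = d) (nf q) ∈ Submodule.span k {gen k n d s} := by
  induction q using Finsupp.induction_linear with
  | zero => simp
  | add q q' hq hq' => rw [map_add, map_add]; exact add_mem hq hq'
  | single a c =>
    have : (Finsupp.single a c : ℕ × ℕ →₀ k) = c • Finsupp.single (a.1, a.2) 1 := by simp
    rw [this, map_smul, map_smul, nf_single]
    refine Submodule.smul_mem _ _ ?_
    by_cases h : nW (nfw a.1 a.2) = n ∧ nG (nfw a.1 a.2) = s ∧ nD (nfw a.1 a.2) = d
    · rw [restr_wd_of h]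
      rw [nW_nfw, nG_nfw, nD_nfw] at h
      obtain ⟨rfl, rfl, rfl⟩ := h
      have e : (a.2 + 2 * a.1 - a.2) / 2 = a.1 := by omega
      rw [gen, e, if_pos ⟨rfl, rfl⟩]
      exact Submodule.mem_span_singleton_self _
    · rw [restr_wd_of_not h]
      exact zero_mem _

theorem exists_primitive_graded {n d s : ℕ} {x : T k}
    (hx : x ∈ supp k fun ω => Valid ω ∧ nW ω = n ∧ nG ω = s ∧ nD ω = d) (hd : δ x = 0) :
    ∃ y ∈ supp k fun ω => Valid ω ∧ nW ω = n ∧ nG ω = s ∧ nD ω + 1 = d, ∃ c : k,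
      x = c • gen k n d s + δ y := by
  obtain ⟨y, hy, q, c, e⟩ := exists_primitive (supp_mono (fun ω h => h.1) hx) hd
  have e' := congrArg (restr fun ω => nW ω = n ∧ nG ω = s ∧ nD ω = d) e
  rw [restr_of_mem (supp_mono (fun ω h => h.2) hx), map_add, ← δ_restr, map_add, map_smul] at e'
  have h1 := restr_nf_mem n d s q
  have h2 : restr (fun ω => nW ω = n ∧ nG ω = s ∧ nD ω = d) (wd [bk, gap, bk]) ∈
      Submodule.span k {gen k n d s} := by
    by_cases h : n = 0 ∧ d = 2 ∧ s = 1
    · rw [restr_wd_of (by simp [nW, nG, nD, h])]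
      obtain ⟨rfl, rfl, rfl⟩ := h
      rw [gen, if_neg (by simp), if_pos (by simp)]
      exact Submodule.mem_span_singleton_self _
    · rw [restr_wd_of_not]
      · exact zero_mem _
      · simp only [nW, nG, nD]; omega
  obtain ⟨c', hc'⟩ := Submodule.mem_span_singleton.1 (add_mem h1 (Submodule.smul_mem _ c h2))
  exact ⟨_, supp_mono (fun ω h => ⟨h.1, h.2⟩) (restr_mem hy), c', by rw [hc']; exact e'⟩

end WordModel

end

noncomputable section

/-! ### From words to bamboos: comparison of the differentials. -/

namespace WordModel

open Letter NcBV

variable {k : Type u} [CommRing k]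

/-- The pattern of black and white vertices of a word. -/
def col : List Letter → List Bool
  | [] => []
  | bk :: u => false :: col u
  | wh :: u => true :: col u
  | bkT :: u => false :: col u
  | whT :: u => true :: col u
  | gap :: u => col u

variable (k) in
/-- The tadpole of a letter at the vertex `i`, if there is one. -/
def tad (i : ℕ) : Letter → Ext k
  | bk => 1
  | wh => 1
  | bkT => tE k i
  | whT => tE k i
  | gap => 1

variable (k) in
/-- The bamboo described by a word, with vertices numbered from `i`. -/
def bamAt : ℕ → List Letter → Ext k
  | _, [] => 1
  | i, [v] => tad k i v
  | i, v :: gap :: u => tad k i v * bamAt (i + 1) u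
  | i, v :: v' :: u => tad k i v * (eE k i * bamAt (i + 1) (v' :: u))

theorem bamAt_edge (i : ℕ) {v : Letter} {u : List Letter} (hu : Valid u) :
    bamAt k i (v :: u) = tad k i v * (eE k i * bamAt k (i + 1) u) := by
  rcases u with _ | ⟨v', u⟩
  · exact absurd rfl hu.ne_nil
  · cases v' with
    | gap => exact absurd hu Valid.not_gap_cons
    | _ => rfl

theorem bamAt_gap (i : ℕ) (v : Letter) (u : List Letter) :
    bamAt k i (v :: gap :: u) = tad k i v * bamAt k (i + 1) u := rfl

theorem map_shiftMap_tad (i : ℕ) (v : Letter) :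
    ExteriorAlgebra.map (shiftMap k 1) (tad k i v) = tad k (i + 1) v := by
  cases v <;> simp [tad, tE, add_comm]

theorem map_shiftMap_eE (i j : ℕ) :
    ExteriorAlgebra.map (shiftMap k i) (eE k j) = eE k (i + j) := by
  simp [eE]

theorem map_shiftMap_bamAt {ω : List Letter} (hω : Valid ω) (i : ℕ) :
    ExteriorAlgebra.map (shiftMap k 1) (bamAt k i ω) = bamAt k (i + 1) ω := by
  induction hω generalizing i with
  | single hv => exact map_shiftMap_tad _ _
  | edge hv hω ih =>
    rw [bamAt_edge _ hω, bamAt_edge _ hω, map_mul, map_mul, ih, map_shiftMap_tad, map_shiftMap_eE,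
      add_comm 1 i]
  | gap hv hω ih => rw [bamAt_gap, bamAt_gap, map_mul, ih, map_shiftMap_tad]

/-- The series of bamboos described by a combination of words. -/
def RT : T k →ₗ[k] Fam k := ext fun ω => pl (col ω) (bamAt k 0 ω)

@[simp] theorem RT_wd (ω : List Letter) : RT (wd ω : T k) = pl (col ω) (bamAt k 0 ω) := ext_wd _ _

theorem col_ne_nil {ω : List Letter} (hω : Valid ω) : col ω ≠ [] := by
  cases hω with
  | @single v hv => cases v <;> first | exact absurd rfl hv | simp [col]
  | @edge v _ hv _ => cases v <;> first | exact absurd rfl hv | simp [col]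
  | @gap v _ hv _ => cases v <;> first | exact absurd rfl hv | simp [col]

theorem count_true_col (ω : List Letter) : (col ω).count true = nW ω := by
  induction ω with
  | nil => rfl
  | cons v ω ih => cases v <;> simp [col, nW, ih]

theorem length_col_le (ω : List Letter) : (col ω).length ≤ nD ω := by
  induction ω with
  | nil => exact le_rfl
  | cons v ω ih => cases v <;> simp only [col, nD, List.length_cons] <;> omega

theorem eE_mul_eE (i : ℕ) : eE k i * eE k i = 0 := ExteriorAlgebra.ι_sq_zero _

theorem eE_mul_eE_mul (i : ℕ) (x : Ext k) : eE k i * (eE k i * x) = 0 := by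
  rw [← mul_assoc, eE_mul_eE, zero_mul]

theorem tE_mul_eE (i j : ℕ) : tE k i * eE k j = -(eE k j * tE k i) := ι_mul_ι _ _

theorem tE_mul_eE_mul (i j : ℕ) (x : Ext k) :
    tE k i * (eE k j * x) = -(eE k j * (tE k i * x)) := by
  rw [← mul_assoc, tE_mul_eE, neg_mul, mul_assoc]

theorem eE_mul_tE_mul (i j : ℕ) (x : Ext k) :
    eE k i * (tE k j * x) = -(tE k j * (eE k i * x)) := by rw [tE_mul_eE_mul, neg_neg]

theorem eE_mul_eE_comm (i j : ℕ) : eE k i * eE k j = -(eE k j * eE k i) := ι_mul_ι _ _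

theorem bk_ne : bk ≠ gap := nofun

theorem wh_ne : wh ≠ gap := nofun

theorem bkT_ne : bkT ≠ gap := nofun

theorem whT_ne : whT ≠ gap := nofun

/-- The operator which adds a vertex on the left of a bamboo. -/
def consPl (c : Bool) (A : Ext k) : Fam k →ₗ[k] Fam k where
  toFun f
    | [] => 0
    | c' :: u => if c' = c then A * ExteriorAlgebra.map (shiftMap k 1) (f u) else 0
  map_add' f g := by
    funext u
    rcases u with _ | ⟨c', u⟩
    · simp
    · simp only [Pi.add_apply]; split_ifs <;> simp [mul_add]
  map_smul' a f := by
    funext u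
    rcases u with _ | ⟨c', u⟩
    · simp
    · simp only [Pi.smul_apply, RingHom.id_apply]; split_ifs <;> simp

theorem consPl_pl (c : Bool) (A : Ext k) (u : List Bool) (X : Ext k) :
    consPl c A (pl u X) = pl (c :: u) (A * ExteriorAlgebra.map (shiftMap k 1) X) := by
  funext w
  rcases w with _ | ⟨c', w⟩
  · rw [pl_ne (by simp)]; rfl
  · change (if c' = c then A * ExteriorAlgebra.map (shiftMap k 1) (pl u X w) else 0) = _
    by_cases h : w = u
    · subst h
      by_cases hc : c' = c
      · subst hc; rw [if_pos rfl, pl_same, pl_same]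
      · rw [if_neg hc, pl_ne (by simpa using hc)]
    · rw [pl_ne h, pl_ne (by simp [h])]; simp

theorem consPl_splitPl (c : Bool) (A : Ext k) (l : List Bool) (c' : Bool) (r : List Bool)
    (X : Ext k) : consPl c A (splitPl l c' r X) =
      splitPl (c :: l) c' r (A * ExteriorAlgebra.map (shiftMap k 1) X) := by
  cases c' <;> simp [splitPl, consPl_pl]

/-- The part of the differential which does not add a black vertex on the left. -/
def dRight (u : List Bool) (X : Ext k) : Fam k :=
  pl (u ++ [false]) (eE k (u.length - 1) * X) - letterSum u fun l c r =>
    splitPl l c r (eE k l.length * ExteriorAlgebra.map (insertMap k l.length 2) X)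

/-- Here `A` is the contribution of a new first vertex: its tadpole, if any, and the edge to the
next vertex, if any. Splitting a later vertex leaves `A` unchanged and only moves an edge past it,
with sign `s`; the remaining term is the splitting of the new vertex. -/
theorem dRight_cons {u : List Bool} (hu : u ≠ []) (c : Bool) {A : Ext k} {s : k}
    (h1 : ∀ i, ExteriorAlgebra.map (insertMap k (i + 1) 2) A = A)
    (h2 : ∀ j, eE k (j + 1) * A = s • (A * eE k (j + 1))) (X : Ext k) :
    dRight (c :: u) (A * ExteriorAlgebra.map (shiftMap k 1) X) =
      s • consPl c A (dRight u X) - splitPl [] c u (eE k 0 *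
        (ExteriorAlgebra.map (insertMap k 0 2) A * ExteriorAlgebra.map (shiftMap k 2) X)) := by
  have hl : u.length - 1 + 1 = u.length :=
    Nat.sub_add_cancel (List.length_pos_iff.2 hu)
  have key : ∀ (l : List Bool) c' r, splitPl (c :: l) c' r (eE k (c :: l).length *
      ExteriorAlgebra.map (insertMap k (c :: l).length 2)
        (A * ExteriorAlgebra.map (shiftMap k 1) X)) =
      s • consPl c A (splitPl l c' r (eE k l.length *
        ExteriorAlgebra.map (insertMap k l.length 2) X)) := by
    intro l c' r
    have := insertMap_comp_shiftMap (k := k) 1 l.length 2 two_pos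
    rw [add_comm 1] at this
    rw [consPl_splitPl, ← map_smul, map_mul (ExteriorAlgebra.map (insertMap k _ 2)),
      map_mul (ExteriorAlgebra.map (shiftMap k 1)), List.length_cons, h1, extMap_comp,
      ← mul_assoc, h2, smul_mul_assoc, map_shiftMap_eE, mul_assoc, extMap_comp, add_comm 1 l.length,
      this]
  rw [dRight, dRight, map_sub, consPl_pl, map_mul (ExteriorAlgebra.map (shiftMap k 1)),
    map_shiftMap_eE, add_comm 1, hl, smul_sub, map_letterSum, smul_letterSum, letterSum,
    ← letterSum_congr (fun l c' r _ => key l c' r), ← map_smul (pl (c :: (u ++ [false]))),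
    ← mul_assoc A, ← smul_mul_assoc, ← hl, ← h2, hl, List.length_cons, Nat.add_sub_cancel, mul_assoc]
  have h3 := insertMap_comp_shiftMap_of_lt (k := k) 2 zero_lt_one
  rw [List.length_nil, map_mul (ExteriorAlgebra.map (insertMap k _ 2)), extMap_comp, h3,
    List.cons_append]
  exact sub_add_eq_sub_sub_swap _ _ _

theorem map_insertMap_tE_zero : ExteriorAlgebra.map (insertMap k 0 2) (tE k 0) =
    tE k 0 + tE k 1 + eE k 0 := by
  simp [tE, eE, insertMap_tadpole_eq, Finset.sum_range_succ]

theorem map_insertMap_eE_zero : ExteriorAlgebra.map (insertMap k 0 2) (eE k 0) = eE k 1 := by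
  simp [eE, insertMap_edge_ge]

theorem map_insertMap_succ_tE (i : ℕ) :
    ExteriorAlgebra.map (insertMap k (i + 1) 2) (tE k 0) = tE k 0 := by
  simp [tE, insertMap_tadpole_lt]

theorem map_insertMap_succ_eE (i : ℕ) :
    ExteriorAlgebra.map (insertMap k (i + 1) 2) (eE k 0) = eE k 0 := by
  simp [eE, insertMap_edge_lt]

theorem consPl_RT {t : T k} {v : Letter} {c : Bool} (hv : v ≠ gap) (hc : col [v] = [c])
    (ht : t ∈ supp k Valid) : consPl c (tad k 0 v * eE k 0) (RT t) = RT (cons v t) := by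
  refine eq_of_supp (f := consPl c (tad k 0 v * eE k 0) ∘ₗ RT) (g := RT ∘ₗ cons v)
    (fun ω hω => ?_) ht
  have h : col (v :: ω) = c :: col ω := by
    cases v <;> simp_all [col]
  rw [LinearMap.comp_apply, LinearMap.comp_apply, cons_wd, RT_wd, RT_wd, consPl_pl, h,
    map_shiftMap_bamAt hω, bamAt_edge _ hω, mul_assoc]

theorem consPl_RT_gap {t : T k} {v : Letter} {c : Bool} (hv : v ≠ gap) (hc : col [v] = [c])
    (ht : t ∈ supp k Valid) : consPl c (tad k 0 v) (RT t) = RT (cons v (cons gap t)) := by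
  refine eq_of_supp (f := consPl c (tad k 0 v) ∘ₗ RT) (g := RT ∘ₗ cons v ∘ₗ cons gap)
    (fun ω hω => ?_) ht
  have h : col (v :: gap :: ω) = c :: col ω := by
    cases v <;> simp_all [col]
  rw [LinearMap.comp_apply, LinearMap.comp_apply, LinearMap.comp_apply, cons_wd, cons_wd, RT_wd,
    RT_wd, consPl_pl, h, map_shiftMap_bamAt hω, bamAt_gap]

theorem splitPl_true (l r : List Bool) (X : Ext k) :
    splitPl l true r X = pl (l ++ false :: true :: r) X + pl (l ++ true :: false :: r) X := rfl

theorem splitPl_false (l r : List Bool) (X : Ext k) :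
    splitPl l false r X = pl (l ++ false :: false :: r) X := rfl

/-- When the vertex carries a tadpole, its split contains the two tadpoles and the new edge. The
edge summand vanishes against the edge already present, and what remains for `whT` is the
commutator. -/
theorem dRight_single {v : Letter} (hv : v ≠ gap) :
    dRight (col [v]) (bamAt k 0 [v]) = RT (δw [v] - wd [bk, v]) := by
  cases v with
  | gap => exact absurd rfl hv
  | _ =>
    simp only [dRight, col, bamAt, tad, letterSum, splitPl_true, splitPl_false, δw, map_sub, RT_wd,
      map_zero, map_add, List.nil_append, List.length_nil, List.length_singleton, Nat.sub_self,
      mul_one, one_mul, map_one, map_insertMap_tE_zero, mul_add, eE_mul_eE, add_zero, neg_zero,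
      List.cons_append, zero_add, tE_mul_eE, map_neg]
    abel

/-- By induction from the right end. The term added at the right end of the tail is cancelled or
completed by the splits of the vertices before it. The word `bk :: ω` is subtracted because `dRight`
omits the black vertex on the left. -/
theorem dRight_col {ω : List Letter} (hω : Valid ω) :
    dRight (col ω) (bamAt k 0 ω) = RT (δw ω - wd (bk :: ω)) := by
  induction hω with
  | single hv => exact dRight_single hv
  | @edge v ω hv hω ih =>
    have hmem : δw ω - wd (bk :: ω) ∈ supp k Valid :=
      sub_mem (δw_mem_valid hω) (wd_mem (.edge (by simp) hω))
    obtain ⟨c, hc⟩ : ∃ c, col [v] = [c] := by cases v <;> simp_all [col]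
    have hcol : col (v :: ω) = c :: col ω := by cases v <;> simp_all [col]
    have hR := consPl_RT hv hc hmem
    rw [← ih] at hR
    have e : bamAt k 0 (v :: ω) =
        (tad k 0 v * eE k 0) * ExteriorAlgebra.map (shiftMap k 1) (bamAt k 0 ω) := by
      rw [bamAt_edge _ hω, map_shiftMap_bamAt hω, mul_assoc]
    have e2 : ExteriorAlgebra.map (shiftMap k 2) (bamAt k 0 ω) = bamAt k 2 ω := by
      rw [← map_shiftMap_bamAt hω 1, ← map_shiftMap_bamAt hω 0, extMap_comp, shiftMap_comp]
    have hb : ∀ v v' : Letter, v' ≠ gap → bamAt k 0 (v :: v' :: ω) =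
        tad k 0 v * (eE k 0 * (tad k 1 v' * (eE k 1 * bamAt k 2 ω))) := fun v v' h => by
      rw [bamAt_edge _ (.edge h hω), bamAt_edge _ hω]
    cases v with
    | gap => exact absurd rfl hv
    | _ =>
      obtain rfl := (List.cons.inj hc).1
      -- The factor `A` is a single edge for a letter without tadpole, so it anticommutes with
      -- edges; with a tadpole it has two factors and commutes with them.
      first
      | rw [hcol, e, dRight_cons (col_ne_nil hω) _ (s := -1), hR]
        rotate_left
        · intro i; simp only [tad, one_mul, map_insertMap_succ_eE]; done
        · intro j; simp only [tad, one_mul, neg_smul, one_smul]; exact ι_mul_ι _ _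
      | rw [hcol, e, dRight_cons (col_ne_nil hω) _ (s := 1), hR]
        rotate_left
        · intro i; simp only [tad, map_mul, map_insertMap_succ_eE, map_insertMap_succ_tE]
        · intro j
          rw [tad, one_smul, eE_mul_tE_mul, eE_mul_eE_comm, mul_neg, neg_neg, mul_assoc]
      simp only [tad, δw, map_sub, map_neg, map_add, cons_wd, RT_wd, col, splitPl_true,
        splitPl_false, hb _ _ bk_ne, hb _ _ wh_ne, hb _ _ bkT_ne, hb _ _ whT_ne, e2, one_mul,
        neg_smul, one_smul, map_insertMap_eE_zero, List.nil_append, map_mul,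
        map_insertMap_tE_zero, add_mul, mul_add, mul_assoc, tE_mul_eE_mul, eE_mul_eE_mul, add_zero]
      abel
  | @gap v ω hv hω ih =>
    have hmem : δw ω - wd (bk :: ω) ∈ supp k Valid :=
      sub_mem (δw_mem_valid hω) (wd_mem (.edge (by simp) hω))
    obtain ⟨c, hc⟩ : ∃ c, col [v] = [c] := by cases v <;> simp_all [col]
    have hcol : col (v :: gap :: ω) = c :: col ω := by cases v <;> simp_all [col]
    have hR := consPl_RT_gap hv hc hmem
    rw [← ih] at hR
    have e : bamAt k 0 (v :: gap :: ω) =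
        tad k 0 v * ExteriorAlgebra.map (shiftMap k 1) (bamAt k 0 ω) := by
      rw [bamAt_gap, map_shiftMap_bamAt hω]
    have e2 : ExteriorAlgebra.map (shiftMap k 2) (bamAt k 0 ω) = bamAt k 2 ω := by
      rw [← map_shiftMap_bamAt hω 1, ← map_shiftMap_bamAt hω 0, extMap_comp, shiftMap_comp]
    have hb : ∀ v v' : Letter, v' ≠ gap → bamAt k 0 (v :: v' :: gap :: ω) =
        tad k 0 v * (eE k 0 * (tad k 1 v' * bamAt k 2 ω)) := fun v v' h => by
      rw [bamAt_edge _ (.gap h hω), bamAt_gap]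
    have hb' : ∀ v v' : Letter, v' ≠ gap → bamAt k 0 (v :: gap :: v' :: ω) =
        tad k 0 v * (tad k 1 v' * (eE k 1 * bamAt k 2 ω)) := fun v v' h => by
      rw [bamAt_gap, bamAt_edge _ hω]
    cases v with
    | gap => exact absurd rfl hv
    | _ =>
      obtain rfl := (List.cons.inj hc).1
      -- Before a gap there is no edge in `A`, so the parities are reversed: `A` is `1` or a single
      -- tadpole.
      first
      | rw [hcol, e, dRight_cons (col_ne_nil hω) _ (s := 1), hR]
        rotate_left
        · intro i; rw [tad, map_one]
        · intro j; rw [tad, one_mul, mul_one, one_smul]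
      | rw [hcol, e, dRight_cons (col_ne_nil hω) _ (s := -1), hR]
        rotate_left
        · intro i; rw [tad, map_insertMap_succ_tE]
        · intro j; rw [tad, neg_smul, one_smul]; exact ι_mul_ι _ _
      simp only [tad, δw, map_sub, map_neg, map_add, cons_wd, RT_wd, col, splitPl_true,
        splitPl_false, hb _ _ bk_ne, hb _ _ wh_ne, hb _ _ bkT_ne, hb _ _ whT_ne, hb' _ _ bk_ne, e2,
        one_mul, neg_smul, one_smul, map_one, List.nil_append,
        map_insertMap_tE_zero, add_mul, mul_add, tE_mul_eE_mul, eE_mul_eE_mul, add_zero]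
      abel

end WordModel

end

noncomputable section

/-! ### Valid words correspond to coloured bamboos. -/

namespace WordModel

open Letter NcBV

variable {k : Type u} [CommRing k]

/-- The tadpole of a letter at the vertex `i`, as a set. -/
def tadSet (i : ℕ) : Letter → Finset Slot
  | bk => ∅
  | wh => ∅
  | bkT => {tadpole i}
  | whT => {tadpole i}
  | gap => ∅

/-- The edges and tadpoles of the bamboo described by a word, with vertices numbered from `i`. -/
def slAt : ℕ → List Letter → Finset Slot
  | _, [] => ∅
  | i, [v] => tadSet i v
  | i, v :: gap :: u => tadSet i v ∪ slAt (i + 1) u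
  | i, v :: v' :: u => tadSet i v ∪ insert (edge i) (slAt (i + 1) (v' :: u))

theorem slAt_edge (i : ℕ) {v : Letter} {u : List Letter} (hu : Valid u) :
    slAt i (v :: u) = tadSet i v ∪ insert (edge i) (slAt (i + 1) u) := by
  rcases u with _ | ⟨v', u⟩
  · exact absurd rfl hu.ne_nil
  · cases v' with
    | gap => exact absurd hu Valid.not_gap_cons
    | _ => rfl

theorem slAt_gap (i : ℕ) (v : Letter) (u : List Letter) :
    slAt i (v :: gap :: u) = tadSet i v ∪ slAt (i + 1) u := rfl

theorem edge_inj {i j : ℕ} : edge i = edge j ↔ i = j := by simp [edge]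

theorem edge_ne_tadpole (i j : ℕ) : edge i ≠ tadpole j := by simp [edge, tadpole]

theorem edge_notMem_tadSet (i j : ℕ) (v : Letter) : edge i ∉ tadSet j v := by
  cases v <;> simp [tadSet]

theorem tadpole_mem_tadSet {i j : ℕ} {v : Letter} (h : tadpole i ∈ tadSet j v) : i = j := by
  cases v <;> simp_all [tadSet]

theorem slAt_bound {ω : List Letter} (hω : Valid ω) (i : ℕ) :
    (∀ j, edge j ∈ slAt i ω → i ≤ j ∧ j + 1 < i + (col ω).length) ∧
      ∀ j, tadpole j ∈ slAt i ω → i ≤ j ∧ j < i + (col ω).length := by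
  have hlen : ∀ {v : Letter} (u : List Letter), v ≠ gap →
      (col (v :: u)).length = (col u).length + 1 := by
    intro v u hv; cases v <;> simp_all [col]
  induction hω generalizing i with
  | @single v hv =>
    refine ⟨fun j h => absurd h (edge_notMem_tadSet _ _ _), fun j h => ?_⟩
    rw [hlen _ hv]
    obtain rfl := tadpole_mem_tadSet h
    omega
  | @edge v ω hv hω ih =>
    rw [slAt_edge _ hω, hlen _ hv]
    have hp := List.length_pos_iff.2 (col_ne_nil hω)
    refine ⟨fun j h => ?_, fun j h => ?_⟩
    · rw [Finset.mem_union, Finset.mem_insert, edge_inj] at h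
      rcases h with h | rfl | h
      · exact absurd h (edge_notMem_tadSet _ _ _)
      · omega
      · have := (ih (i + 1)).1 j h; omega
    · rw [Finset.mem_union, Finset.mem_insert] at h
      rcases h with h | h | h
      · obtain rfl := tadpole_mem_tadSet h; omega
      · exact absurd h.symm (edge_ne_tadpole _ _)
      · have := (ih (i + 1)).2 j h; omega
  | @gap v ω hv hω ih =>
    rw [slAt_gap, hlen _ hv]
    have e : col (Letter.gap :: ω) = col ω := rfl
    rw [e]
    refine ⟨fun j h => ?_, fun j h => ?_⟩
    · rw [Finset.mem_union] at h
      rcases h with h | h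
      · exact absurd h (edge_notMem_tadSet _ _ _)
      · have := (ih (i + 1)).1 j h; omega
    · rw [Finset.mem_union] at h
      rcases h with h | h
      · obtain rfl := tadpole_mem_tadSet h; omega
      · have := (ih (i + 1)).2 j h; omega

theorem slAt_subset {ω : List Letter} (hω : Valid ω) : slAt 0 ω ⊆ slots (col ω).length := by
  intro a ha
  rcases slot_cases a with ⟨j, rfl⟩ | ⟨j, rfl⟩
  · have := (slAt_bound hω 0).1 j ha
    exact edge_mem_slots.2 (by omega)
  · have := (slAt_bound hω 0).2 j ha
    exact tadpole_mem_slots.2 (by omega)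

theorem tadSet_disjoint {ω : List Letter} (hω : Valid ω) (i : ℕ) (v : Letter) :
    Disjoint (tadSet i v) (slAt (i + 1) ω) ∧
      Disjoint (tadSet i v) (insert (edge i) (slAt (i + 1) ω)) ∧ edge i ∉ slAt (i + 1) ω := by
  have h : ∀ a ∈ tadSet i v, a = tadpole i := by intro a; cases v <;> simp [tadSet]
  refine ⟨Finset.disjoint_left.2 fun a ha h' => ?_, Finset.disjoint_left.2 fun a ha h' => ?_,
    fun h' => ?_⟩
  · obtain rfl := h a ha
    have := (slAt_bound hω (i + 1)).2 i h'; omega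
  · obtain rfl := h a ha
    rcases Finset.mem_insert.1 h' with h' | h'
    · exact edge_ne_tadpole _ _ h'.symm
    · have := (slAt_bound hω (i + 1)).2 i h'; omega
  · have := (slAt_bound hω (i + 1)).1 i h'; omega

theorem card_slAt {ω : List Letter} (hω : Valid ω) (i : ℕ) :
    (slAt i ω).card + 1 + nG ω = nD ω := by
  induction hω generalizing i with
  | @single v hv => cases v <;> first | exact absurd rfl hv | simp [slAt, tadSet, nG, nD]
  | @edge v ω hv hω ih =>
    have h := tadSet_disjoint hω i v
    rw [slAt_edge _ hω, Finset.card_union_of_disjoint h.2.1, Finset.card_insert_of_notMem h.2.2]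
    have := ih (i + 1)
    cases v <;> first | exact absurd rfl hv | (simp [tadSet, nG, nD]; omega)
  | @gap v ω hv hω ih =>
    have h := tadSet_disjoint hω i v
    rw [slAt_gap, Finset.card_union_of_disjoint h.1]
    have := ih (i + 1)
    cases v <;> first | exact absurd rfl hv | (simp [tadSet, nG, nD]; omega)

theorem exists_mul_bamboo {a : Slot} {s : Finset Slot} (ha : a ∉ s) (x : Ext k)
    (hx : ∃ e : ℤˣ, x = e • bamboo k s) :
    ∃ e : ℤˣ, ExteriorAlgebra.ι k (Finsupp.single a 1) * x = e • bamboo k (insert a s) := by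
  obtain ⟨e, rfl⟩ := hx
  rcases bamboo_mul (k := k) a s with ⟨h, _⟩ | ⟨_, e', h⟩
  · exact absurd h ha
  · refine ⟨e * e', ?_⟩
    rw [mul_smul_comm, ← bamboo_singleton, h, smul_smul]

theorem exists_tad_mul_bamboo {i : ℕ} {v : Letter} {s : Finset Slot} (h : Disjoint (tadSet i v) s)
    (x : Ext k) (hx : ∃ e : ℤˣ, x = e • bamboo k s) :
    ∃ e : ℤˣ, tad k i v * x = e • bamboo k (tadSet i v ∪ s) := by
  have h' : tadSet i v = {tadpole i} → ∃ e : ℤˣ,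
      tE k i * x = e • bamboo k (tadSet i v ∪ s) := by
    intro e
    rw [e] at h ⊢
    exact exists_mul_bamboo (Finset.disjoint_singleton_left.1 h) x hx
  cases v with
  | bkT => exact h' rfl
  | whT => exact h' rfl
  | _ => simpa [tad, tadSet] using hx

/-- The product along a word interleaves tadpoles and edges from left to right; it involves each
slot once and differs from the default order by a permutation, hence by a sign. -/
theorem exists_bamAt_eq {ω : List Letter} (hω : Valid ω) (i : ℕ) :
    ∃ e : ℤˣ, bamAt k i ω = e • bamboo k (slAt i ω) := by
  induction hω generalizing i with
  | @single v hv =>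
    have := exists_tad_mul_bamboo (k := k) (i := i) (v := v) (s := ∅) (by simp) 1
      ⟨1, by rw [bamboo_empty, one_smul]⟩
    rwa [mul_one, Finset.union_empty] at this
  | @edge v ω hv hω ih =>
    have h := tadSet_disjoint hω i v
    rw [slAt_edge _ hω, bamAt_edge _ hω]
    exact exists_tad_mul_bamboo h.2.1 _ (exists_mul_bamboo h.2.2 _ (ih _))
  | @gap v ω hv hω ih =>
    exact exists_tad_mul_bamboo (tadSet_disjoint hω i v).1 _ (ih _)

theorem units_smul_mem {M : Type*} [AddCommGroup M] [Module k M] (S : Submodule k M) (e : ℤˣ)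
    {x : M} (hx : x ∈ S) : e • x ∈ S := by
  rw [Units.smul_def]
  exact zsmul_mem hx _

theorem bamAt_mem {ω : List Letter} (hω : Valid ω) {p : ℕ} (hp : p + 1 + nG ω = nD ω) :
    bamAt k 0 ω ∈ component k (col ω).length p := by
  obtain ⟨e, he⟩ := exists_bamAt_eq (k := k) hω 0
  rw [he]
  have := card_slAt hω 0
  exact units_smul_mem _ _ (bamboo_mem_component _ (List.length_pos_iff.2 (col_ne_nil hω))
    (slAt_subset hω) (by omega))

theorem RT_wd_mem {ω : List Letter} (hω : Valid ω) {p : ℕ} (hp : p + 1 + nG ω = nD ω) :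
    RT (wd ω : T k) ∈ famOf k (nW ω) p := by
  rw [RT_wd]
  exact pl_mem (count_true_col ω) (bamAt_mem hω hp)

/-- Graded commutativity moves the new edge to the front and absorbs the sign `(-1) ^ p` of the
differential. The black vertex added on the left is the word `bk :: ω` that was missing in
`dRight_col`. -/
theorem dFam_RT_wd {ω : List Letter} (hω : Valid ω) {n p : ℕ} (hn : nW ω = n)
    (hp : p + 1 + nG ω = nD ω) : dFam n p (RT (wd ω)) = RT (δw ω : T k) := by
  have h := dRight_col (k := k) hω
  have hX := bamAt_mem (k := k) hω hp
  rw [map_sub, eq_sub_iff_add_eq'] at h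
  rw [← h, RT_wd, dFam_pl p (by rw [count_true_col, hn]), RT_wd]
  have hl : (col ω).length - 1 = 0 + (col ω).length - 1 := by omega
  have h1 : compExt 1 (col ω).length (eE k 0) (bamAt k 0 ω) = bamAt k 0 (bk :: ω) := by
    rw [compExt, map_shiftMap_bamAt hω, bamAt_edge _ hω, tad, one_mul, eE,
      ExteriorAlgebra.map_apply_ι, insertMap_edge_lt one_pos]
  have h2 : compExt 0 (col ω).length (eE k 0) (bamAt k 0 ω) =
      eE k ((col ω).length - 1) * bamAt k 0 ω := by
    rw [compExt, hl, shiftMap_zero, ExteriorAlgebra.map_id, eE, ExteriorAlgebra.map_apply_ι,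
      insertMap_edge_ge le_rfl]
    rfl
  -- The image under the insertion is again a product of `p` slots, so moving one more edge across
  -- it costs exactly `(-1) ^ p`.
  have h3 : ∀ i < (col ω).length, (-1 : k) ^ p • compExt i 2 (bamAt k 0 ω) (eE k 0) =
      eE k i * ExteriorAlgebra.map (insertMap k i 2) (bamAt k 0 ω) := by
    intro i hi
    have hm : ExteriorAlgebra.map (insertMap k i 2) (bamAt k 0 ω) ∈
        slotSpan k ((col ω).length + 1) ^ p := by
      have := compExt_mem (k := k) i hi (n := 2) (l := (col ω).length + 1) rfl (add_zero p) hX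
        (y := 1) (by
          rw [← bamboo_empty]; exact bamboo_mem_component ∅ two_pos (by simp) rfl)
      rw [compExt, map_one, mul_one] at this
      exact component_le _ _ this
    rw [show eE k i = ExteriorAlgebra.ι k (se k i) from rfl, ι_mul_of_mem _ hm, compExt, eE,
      ExteriorAlgebra.map_apply_ι, shiftMap_edge, add_zero]
  rw [h1, h2, dRight, smul_letterSum, letterSum_congr (G := fun l c r =>
    splitPl l c r (eE k l.length * ExteriorAlgebra.map (insertMap k l.length 2) (bamAt k 0 ω)))]
  · change _ = pl (false :: col ω) _ + _
    abel
  · intro l c r e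
    rw [← map_smul, h3 _ (by rw [e]; simp)]

theorem supp_grade_induction {n p s : ℕ} {M : Type*} [AddCommGroup M] [Module k M]
    {f g : T k →ₗ[k] M} (h : ∀ ω, Valid ω → nW ω = n → p + 1 + nG ω = nD ω →
      f (wd ω) = g (wd ω)) {t : T k}
    (ht : t ∈ supp k fun ω => Valid ω ∧ nW ω = n ∧ nG ω = s ∧ nD ω = p + 1 + s) : f t = g t :=
  eq_of_supp (fun ω hω => h ω hω.1 hω.2.1 (by rw [hω.2.2.1, hω.2.2.2])) ht

theorem dFam_RT {n p s : ℕ} {t : T k}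
    (ht : t ∈ supp k fun ω => Valid ω ∧ nW ω = n ∧ nG ω = s ∧ nD ω = p + 1 + s) :
    dFam n p (RT t) = RT (δ t) :=
  supp_grade_induction (f := dFam n p ∘ₗ RT) (g := (RT : T k →ₗ[k] Fam k) ∘ₗ δ)
    (fun ω h1 h2 h3 => by simpa using dFam_RT_wd h1 h2 h3) ht

/-! #### Reading a word off a bamboo -/

open Classical in
/-- The letter of a vertex. -/
def letterOf (c : Bool) (t : Prop) : Letter :=
  if t then (if c = true then whT else bkT) else (if c = true then wh else bk)

theorem letterOf_ne (c : Bool) (t : Prop) : letterOf c t ≠ gap := by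
  unfold letterOf; split_ifs <;> simp

theorem mem_tadSet_letterOf (c : Bool) (t : Prop) (i : ℕ) :
    tadpole i ∈ tadSet i (letterOf c t) ↔ t := by
  unfold letterOf; split_ifs <;> simp_all [tadSet]

theorem col_cons_letterOf (c : Bool) (t : Prop) (ω : List Letter) :
    col (letterOf c t :: ω) = c :: col ω := by
  unfold letterOf; split_ifs <;> simp_all [col]

theorem letterOf_of_col {v : Letter} {c : Bool} {u : List Letter} {u' : List Bool} (hv : v ≠ gap)
    (h : col (v :: u) = c :: u') (i : ℕ) : letterOf c (tadpole i ∈ tadSet i v) = v := by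
  unfold letterOf; cases v <;> simp_all [tadSet, col]

open Classical in
/-- The word of a bamboo with given vertices and given edges and tadpoles, where vertices are
numbered from `i`. -/
def readAt (S : Finset Slot) : ℕ → List Bool → List Letter
  | _, [] => []
  | i, [c] => [letterOf c (tadpole i ∈ S)]
  | i, c :: c' :: u => letterOf c (tadpole i ∈ S) ::
      (if edge i ∈ S then readAt S (i + 1) (c' :: u) else gap :: readAt S (i + 1) (c' :: u))

theorem valid_readAt (S : Finset Slot) (i : ℕ) {u : List Bool} (hu : u ≠ []) :
    Valid (readAt S i u) ∧ col (readAt S i u) = u := by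
  induction u generalizing i with
  | nil => exact absurd rfl hu
  | cons c u ih =>
    rcases u with _ | ⟨c', u⟩
    · exact ⟨.single (letterOf_ne _ _), col_cons_letterOf _ _ _⟩
    · have ih := ih (i + 1) (by simp)
      rw [readAt, col_cons_letterOf]
      split_ifs
      · exact ⟨.edge (letterOf_ne _ _) ih.1, by rw [ih.2]⟩
      · exact ⟨.gap (letterOf_ne _ _) ih.1, by rw [col, ih.2]⟩

theorem mem_slAt_readAt (S : Finset Slot) (i : ℕ) (u : List Bool) :
    (∀ j, edge j ∈ slAt i (readAt S i u) ↔ i ≤ j ∧ j + 1 < i + u.length ∧ edge j ∈ S) ∧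
      ∀ j, tadpole j ∈ slAt i (readAt S i u) ↔ i ≤ j ∧ j < i + u.length ∧ tadpole j ∈ S := by
  have ht : ∀ c j, tadpole j ∈ tadSet i (letterOf c (tadpole i ∈ S)) ↔ i = j ∧ tadpole j ∈ S := by
    intro c j
    refine ⟨fun h => ?_, ?_⟩
    · obtain rfl := tadpole_mem_tadSet h
      exact ⟨rfl, (mem_tadSet_letterOf _ _ _).1 h⟩
    · rintro ⟨rfl, h⟩
      exact (mem_tadSet_letterOf _ _ _).2 h
  induction u generalizing i with
  | nil =>
    exact ⟨fun j => ⟨fun h => absurd h (Finset.notMem_empty _), fun h => absurd h.2.1 (by simp; omega)⟩,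
      fun j => ⟨fun h => absurd h (Finset.notMem_empty _), fun h => absurd h.2.1 (by simp; omega)⟩⟩
  | cons c u ih =>
    rcases u with _ | ⟨c', u⟩
    · refine ⟨fun j => ?_, fun j => ?_⟩
      · simp only [readAt, slAt, edge_notMem_tadSet, List.length_singleton, false_iff]; omega
      · simp only [readAt, slAt, ht, List.length_singleton, ← and_assoc]
        refine and_congr_left fun _ => ⟨fun h => ?_, fun h => ?_⟩ <;> omega
    · have ih := ih (i + 1) (fun c j => by
        refine ⟨fun h => ?_, ?_⟩
        · obtain rfl := tadpole_mem_tadSet h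
          exact ⟨rfl, (mem_tadSet_letterOf _ _ _).1 h⟩
        · rintro ⟨rfl, h⟩
          exact (mem_tadSet_letterOf _ _ _).2 h)
      have hv := (valid_readAt S (i + 1) (u := c' :: u) (by simp)).1
      rw [readAt]
      split_ifs with he
      · rw [slAt_edge _ hv]
        refine ⟨fun j => ?_, fun j => ?_⟩
        · simp only [Finset.mem_union, Finset.mem_insert, edge_notMem_tadSet, false_or, edge_inj,
            ih.1, List.length_cons]
          constructor
          · rintro (rfl | ⟨h1, h2, h3⟩)
            · exact ⟨le_rfl, by omega, he⟩
            · exact ⟨by omega, by omega, h3⟩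
          · rintro ⟨h1, h2, h3⟩
            rcases h1.eq_or_lt with h | h
            · exact Or.inl h.symm
            · exact Or.inr ⟨by omega, by omega, h3⟩
        · simp only [Finset.mem_union, Finset.mem_insert, ht, ih.2, List.length_cons,
            (edge_ne_tadpole _ _).symm, false_or]
          constructor
          · rintro (⟨rfl, h⟩ | ⟨h1, h2, h3⟩)
            · exact ⟨le_rfl, by omega, h⟩
            · exact ⟨by omega, by omega, h3⟩
          · rintro ⟨h1, h2, h3⟩
            rcases h1.eq_or_lt with h | h
            · exact Or.inl ⟨h, h3⟩
            · exact Or.inr ⟨by omega, by omega, h3⟩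
      · rw [slAt_gap]
        refine ⟨fun j => ?_, fun j => ?_⟩
        · simp only [Finset.mem_union, edge_notMem_tadSet, false_or, ih.1, List.length_cons]
          constructor
          · rintro ⟨h1, h2, h3⟩
            exact ⟨by omega, by omega, h3⟩
          · rintro ⟨h1, h2, h3⟩
            rcases h1.eq_or_lt with rfl | h
            · exact absurd h3 he
            · exact ⟨by omega, by omega, h3⟩
        · simp only [Finset.mem_union, ht, ih.2, List.length_cons]
          constructor
          · rintro (⟨rfl, h⟩ | ⟨h1, h2, h3⟩)
            · exact ⟨le_rfl, by omega, h⟩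
            · exact ⟨by omega, by omega, h3⟩
          · rintro ⟨h1, h2, h3⟩
            rcases h1.eq_or_lt with h | h
            · exact Or.inl ⟨h, h3⟩
            · exact Or.inr ⟨by omega, by omega, h3⟩

theorem slAt_readAt {S : Finset Slot} {u : List Bool} (hS : S ⊆ slots u.length) :
    slAt 0 (readAt S 0 u) = S := by
  ext a
  rcases slot_cases a with ⟨j, rfl⟩ | ⟨j, rfl⟩
  · rw [(mem_slAt_readAt S 0 u).1]
    refine ⟨fun h => h.2.2, fun h => ⟨by omega, ?_, h⟩⟩
    have := edge_mem_slots.1 (hS h); omega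
  · rw [(mem_slAt_readAt S 0 u).2]
    refine ⟨fun h => h.2.2, fun h => ⟨by omega, ?_, h⟩⟩
    have := tadpole_mem_slots.1 (hS h); omega

/-- The hypotheses concern only slots from `i` on, so the same set `S` serves for all tails in the
induction. -/
theorem readAt_slAt {ω : List Letter} (hω : Valid ω) (i : ℕ) (S : Finset Slot)
    (h1 : ∀ j, i ≤ j → (edge j ∈ S ↔ edge j ∈ slAt i ω))
    (h2 : ∀ j, i ≤ j → (tadpole j ∈ S ↔ tadpole j ∈ slAt i ω)) : readAt S i (col ω) = ω := by
  have hcol : ∀ (v : Letter) (u : List Letter), v ≠ gap → ∃ c, col (v :: u) = c :: col u := by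
    intro v u hv; cases v <;> simp_all [col]
  induction hω generalizing i with
  | @single v hv =>
    obtain ⟨c, hc⟩ := hcol v [] hv
    have := letterOf_of_col hv hc i
    rw [hc]
    change [letterOf c (tadpole i ∈ S)] = _
    rw [propext (h2 i le_rfl)]
    exact congrArg (fun x => [x]) this
  | @edge v ω hv hω ih =>
    obtain ⟨c, hc⟩ := hcol v ω hv
    have hl := letterOf_of_col hv hc i
    have hd := tadSet_disjoint hω i v
    rw [slAt_edge _ hω] at h1 h2
    have ih := ih (i + 1) (fun j hj => by
      rw [h1 j (by omega), Finset.mem_union, Finset.mem_insert, edge_inj]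
      simp only [edge_notMem_tadSet, false_or]
      exact ⟨fun h => h.resolve_left (by omega), Or.inr⟩) (fun j hj => by
      rw [h2 j (by omega), Finset.mem_union, Finset.mem_insert]
      refine ⟨fun h => (h.resolve_left fun h => ?_).resolve_left
        (edge_ne_tadpole _ _).symm, fun h => Or.inr (Or.inr h)⟩
      have := tadpole_mem_tadSet h; omega)
    obtain ⟨c', u, hu⟩ := List.exists_cons_of_ne_nil (col_ne_nil hω)
    rw [hc, hu, readAt, if_pos ((h1 i le_rfl).2 (by simp)), ← hu, ih, propext (h2 i le_rfl)]
    have : tadpole i ∈ tadSet i v ∪ insert (edge i) (slAt (i + 1) ω) ↔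
        tadpole i ∈ tadSet i v := by
      rw [Finset.mem_union, or_iff_left]
      intro h
      rcases Finset.mem_insert.1 h with h | h
      · exact edge_ne_tadpole _ _ h.symm
      · have := (slAt_bound hω (i + 1)).2 i h; omega
    rw [propext this, hl]
  | @gap v ω hv hω ih =>
    obtain ⟨c, hc⟩ := hcol v (Letter.gap :: ω) hv
    have hl := letterOf_of_col hv hc i
    have hd := tadSet_disjoint hω i v
    rw [slAt_gap] at h1 h2
    have ih := ih (i + 1) (fun j hj => by
      rw [h1 j (by omega), Finset.mem_union]
      simp only [edge_notMem_tadSet, false_or]) (fun j hj => by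
      rw [h2 j (by omega), Finset.mem_union]
      refine ⟨fun h => h.resolve_left fun h => ?_, Or.inr⟩
      have := tadpole_mem_tadSet h; omega)
    obtain ⟨c', u, hu⟩ := List.exists_cons_of_ne_nil (col_ne_nil hω)
    have he : edge i ∉ S := by
      rw [h1 i le_rfl, Finset.mem_union]
      exact fun h => h.elim (edge_notMem_tadSet _ _ _) hd.2.2
    have hc' : col (Letter.gap :: ω) = c' :: u := hu
    rw [hc, hc', readAt, if_neg he, ← hu, ih, propext (h2 i le_rfl)]
    have : tadpole i ∈ tadSet i v ∪ slAt (i + 1) ω ↔ tadpole i ∈ tadSet i v := by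
      rw [Finset.mem_union, or_iff_left]
      intro h
      have := (slAt_bound hω (i + 1)).2 i h; omega
    rw [propext this, hl]

theorem word_injective {ω ω' : List Letter} (hω : Valid ω) (hω' : Valid ω') (h : col ω = col ω')
    (h' : slAt 0 ω = slAt 0 ω') : ω = ω' := by
  rw [← readAt_slAt hω 0 (slAt 0 ω) (fun _ _ => Iff.rfl) (fun _ _ => Iff.rfl), h, h',
    readAt_slAt hω' 0 (slAt 0 ω') (fun _ _ => Iff.rfl) (fun _ _ => Iff.rfl)]

end WordModel

end

noncomputable section

/-! ### Coefficients, the splitting by the number of gaps, and `d² = 0`. -/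

namespace WordModel

open Letter NcBV

variable {k : Type u} [CommRing k]

theorem exists_smul_bamboo {ω : List Letter} (hω : Valid ω) :
    ∃ e : k, e * e = 1 ∧ bamAt k 0 ω = e • bamboo k (slAt 0 ω) := by
  obtain ⟨e, he⟩ := exists_bamAt_eq (k := k) hω 0
  refine ⟨((e : ℤ) : k), ?_, ?_⟩
  · rw [← Int.cast_mul, ← Units.val_mul, Int.units_mul_self]; simp
  · rw [he, Units.smul_def, Int.cast_smul_eq_zsmul]

open Classical in
/-- The sign of a valid word: the bamboo of the word is this multiple of a basis vector. -/
def wordSign (ω : List Letter) : k :=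
  if hω : Valid ω then (exists_smul_bamboo hω).choose else 0

theorem wordSign_spec {ω : List Letter} (hω : Valid ω) : (wordSign ω : k) * wordSign ω = 1 ∧
    bamAt k 0 ω = (wordSign ω : k) • bamboo k (slAt 0 ω) := by
  rw [wordSign, dif_pos hω]
  exact (exists_smul_bamboo hω).choose_spec

/-- The coefficient of a series of bamboos at a word. -/
def cf (ω : List Letter) : Fam k →ₗ[k] k :=
  (wordSign ω : k) • ((Module.Basis.coord (Module.Basis.ExteriorAlgebra
    (Finsupp.basisSingleOne : Module.Basis Slot k (Gen k))) (slAt 0 ω)) ∘ₗ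
    LinearMap.proj (col ω))

theorem cf_congr {ω : List Letter} {f g : Fam k} (h : f (col ω) = g (col ω)) :
    cf ω f = cf ω g := by
  simp [cf, h]

/-- Multiplying by the sign of the word a second time cancels it, and distinct valid words with
equal colours have distinct slot sets; hence the coefficient is exactly a Kronecker symbol. -/
theorem cf_RT_wd {ω ω' : List Letter} (hω : Valid ω) (hω' : Valid ω') :
    cf ω (RT (wd ω')) = (wd ω' : T k) ω := by
  rw [RT_wd, cf, LinearMap.smul_apply, LinearMap.comp_apply, LinearMap.proj_apply]
  by_cases hc : col ω = col ω'
  · rw [hc, pl_same, (wordSign_spec hω').2, map_smul, bamboo, Module.Basis.coord_apply,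
      Module.Basis.repr_self]
    by_cases h : ω = ω'
    · subst h
      simp [(wordSign_spec (k := k) hω).1]
    · rw [Finsupp.single_eq_of_ne fun e => h (word_injective hω hω' hc e), wd,
        Finsupp.single_eq_of_ne h, smul_zero, smul_zero]
  · rw [pl_ne hc, map_zero, smul_zero, wd, Finsupp.single_eq_of_ne]
    rintro rfl
    exact hc rfl

theorem cf_RT {ω : List Letter} (hω : Valid ω) {t : T k} (ht : t ∈ supp k Valid) :
    cf ω (RT t) = t ω :=
  eq_of_supp (f := cf ω ∘ₗ RT) (g := Finsupp.lapply ω) (fun ω' hω' => by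
    simpa using cf_RT_wd hω hω') ht

/-- Each basis bamboo, together with the colours of its vertices, is read as a valid word by
`readAt`, and the sign is again absorbed. -/
theorem exists_RT_eq_pl {p : ℕ} {u : List Bool} {X : Ext k} (hX : X ∈ component k u.length p) :
    ∃ t ∈ supp k fun ω => Valid ω ∧ col ω = u ∧ p + 1 + nG ω = nD ω, RT t = pl u X := by
  have hle : component k u.length p ≤ ((supp k fun ω => Valid ω ∧ col ω = u ∧
      p + 1 + nG ω = nD ω).map RT).comap (pl u) := by
    refine Submodule.span_le.2 ?_
    rintro _ ⟨S, ⟨h0, hS, hp⟩, rfl⟩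
    have hv := valid_readAt S 0 (List.length_pos_iff.1 h0)
    have hs := wordSign_spec (k := k) hv.1
    rw [slAt_readAt hS] at hs
    refine ⟨(wordSign (readAt S 0 u) : k) • wd (readAt S 0 u), Submodule.smul_mem _ _
      (wd_mem ⟨hv.1, hv.2, ?_⟩), ?_⟩
    · have := card_slAt hv.1 0
      rwa [slAt_readAt hS, hp] at this
    · rw [map_smul, RT_wd, hv.2, hs.2, map_smul, smul_smul, hs.1, one_smul]
  exact hle hX

theorem eq_zero_of_cf {n p : ℕ} {f : Fam k} (hf : f ∈ famOf k n p)
    (h : ∀ ω, Valid ω → nW ω = n → p + 1 + nG ω = nD ω → cf ω f = 0) : f = 0 := by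
  funext u
  rw [mem_famOf] at hf
  by_cases hu : u.count true = n
  swap
  · exact (hf u).2 hu
  obtain ⟨t, ht, e⟩ := exists_RT_eq_pl (hf u).1
  have ht0 : t = 0 := by
    ext ω
    by_cases hω : Valid ω ∧ col ω = u ∧ p + 1 + nG ω = nD ω
    · rw [← cf_RT hω.1 (supp_mono (fun _ h => h.1) ht), e, cf_congr (g := f)]
      · exact h ω hω.1 (by rw [← count_true_col, hω.2.1, hu]) hω.2.2
      · rw [hω.2.1, pl_same]
    · exact (Finsupp.mem_supported' k t).1 ht ω hω
  have := congrFun e u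
  rw [ht0, map_zero, pl_same] at this
  exact this.symm

/-- The valid words with `n` white vertices, `s` gaps and degree `p`. -/
def Grade (n p s : ℕ) (ω : List Letter) : Prop :=
  Valid ω ∧ nW ω = n ∧ nG ω = s ∧ nD ω = p + 1 + s

theorem length_le (ω : List Letter) : ω.length ≤ nD ω + nG ω := by
  induction ω with
  | nil => simp
  | cons v ω ih => cases v <;> simp only [List.length_cons, nD, nG] <;> omega

instance : Finite Letter :=
  Finite.of_injective (fun v : Letter => match v with
    | bk => (0 : Fin 5) | wh => 1 | bkT => 2 | whT => 3 | gap => 4)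
    (by intro v v'; cases v <;> cases v' <;> simp)

/-- With the number of gaps fixed, the degree bounds the length of a word. Without this there would
be infinitely many words, such as `bk gap bk gap bk` and its prolongations, all of arity and degree
`0`. -/
theorem finite_grade (n p s : ℕ) : {ω | Grade n p s ω}.Finite :=
  (List.finite_length_le Letter (p + 1 + s + s)).subset fun ω h => by
    have h1 := length_le ω
    have h2 := h.2.2.1
    have h3 := h.2.2.2
    change ω.length ≤ _
    omega

/-- The component of a series of bamboos with a given number of gaps. -/
def gapPart (n p s : ℕ) : Fam k →ₗ[k] T k :=
  ∑ ω ∈ (finite_grade n p s).toFinset, (cf ω).smulRight (wd ω)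

theorem gapPart_mem (n p s : ℕ) (f : Fam k) : gapPart n p s f ∈ supp k (Grade n p s) := by
  rw [gapPart, LinearMap.sum_apply]
  refine sum_mem fun ω hω => ?_
  rw [LinearMap.smulRight_apply]
  exact Submodule.smul_mem _ _ (wd_mem ((finite_grade n p s).mem_toFinset.1 hω))

theorem gapPart_apply {n p s : ℕ} {ω : List Letter} (hω : Grade n p s ω) (f : Fam k) :
    gapPart n p s f ω = cf ω f := by
  classical
  rw [gapPart, LinearMap.sum_apply, Finsupp.finsetSum_apply,
    Finset.sum_eq_single_of_mem ω ((finite_grade n p s).mem_toFinset.2 hω)]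
  · simp
  · intro ω' _ h
    simp [Finsupp.single_eq_of_ne h.symm]

theorem gapPart_RT {n p s : ℕ} {t : T k} (ht : t ∈ supp k Valid) :
    gapPart n p s (RT t) = restr (fun ω => nW ω = n ∧ nG ω = s ∧ nD ω = p + 1 + s) t := by
  have h1 := gapPart_mem n p s (RT t)
  have h2 := restr_mem (S := fun ω => nW ω = n ∧ nG ω = s ∧ nD ω = p + 1 + s) ht
  rw [Finsupp.mem_supported'] at h1 h2
  ext ω
  by_cases hω : Grade n p s ω
  · rw [gapPart_apply hω, cf_RT hω.1 ht]
    have h3 : t - restr (fun ω => nW ω = n ∧ nG ω = s ∧ nD ω = p + 1 + s) t ∈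
        supp k fun ω => ¬ Grade n p s ω :=
      map_mem_of_supp (LinearMap.id - restr (fun ω => nW ω = n ∧ nG ω = s ∧ nD ω = p + 1 + s))
        (fun ω hω => by
          rw [LinearMap.sub_apply, LinearMap.id_apply]
          by_cases h : nW ω = n ∧ nG ω = s ∧ nD ω = p + 1 + s
          · rw [restr_wd_of h, sub_self]; exact zero_mem _
          · rw [restr_wd_of_not h, sub_zero]; exact wd_mem fun h' => h h'.2) ht
    have := (Finsupp.mem_supported' k _).1 h3 ω (not_not.2 hω)
    exact sub_eq_zero.1 this
  · rw [h1 ω hω, h2 ω hω]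

/-- The words of the grade have at most `p + 1 + s` vertices, so `gapPart` does not see longer
colour words. -/
theorem isLocal_comp_gapPart (n p s : ℕ) (G : T k →ₗ[k] Fam k) : IsLocal (G ∘ₗ gapPart n p s) := by
  refine ⟨p + 1 + s, fun N f hf w _ => ?_⟩
  have : gapPart n p s f = 0 := by
    rw [gapPart, LinearMap.sum_apply]
    refine Finset.sum_eq_zero fun ω hω => ?_
    have h := (finite_grade n p s).mem_toFinset.1 hω
    have h1 := length_col_le ω
    have h2 := h.2.2.2
    rw [LinearMap.smulRight_apply, cf_congr (g := 0), map_zero, zero_smul]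
    exact hf _ (by omega)
  rw [LinearMap.comp_apply, this, map_zero]
  rfl

theorem RT_injOn {t : T k} (ht : t ∈ supp k Valid) (h : RT t = 0) : t = 0 := by
  ext ω
  by_cases hω : Valid ω
  · rw [← cf_RT hω ht, h, map_zero, Finsupp.zero_apply]
  · exact (Finsupp.mem_supported' k t).1 ht ω hω

theorem δw_mem_Grade {n p s : ℕ} {ω : List Letter} (hω : Grade n p s ω) :
    δw ω ∈ supp k (Grade n (p + 1) s) := by
  have h1 := (Finsupp.mem_supported k _).1 (δw_mem_valid (k := k) hω.1)
  have h2 := (Finsupp.mem_supported k _).1 (δw_mem_grade (k := k) ω)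
  refine (Finsupp.mem_supported k _).2 fun ω' h => ⟨h1 h, (h2 h).1.trans hω.2.1,
    (h2 h).2.1.trans hω.2.2.1, (h2 h).2.2.trans ?_⟩
  have := hω.2.2.2
  omega

/-- By locality it suffices to treat a family concentrated at one colour word. Such a family is the
image of a combination of words, on which the differential is `δ`. -/
theorem dFam_dFam {n p : ℕ} {f : Fam k} (hf : f ∈ famOf k n p) :
    dFam n (p + 1) (dFam n p f) = 0 := by
  rw [← LinearMap.comp_apply]
  refine IsLocal.eq_zero ((isLocal_dFam _ _).comp (isLocal_dFam _ _)) (fun u X hu hX => ?_) hf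
  obtain ⟨t, ht, e⟩ := exists_RT_eq_pl hX
  have key : ((dFam n (p + 1) ∘ₗ dFam n p) ∘ₗ RT) t = (0 : T k →ₗ[k] Fam k) t := by
    refine eq_of_supp (f := (dFam n (p + 1) ∘ₗ dFam n p) ∘ₗ RT) (g := 0) (fun ω hω => ?_) ht
    have hn : nW ω = n := by rw [← count_true_col, hω.2.1, hu]
    rw [LinearMap.comp_apply, LinearMap.comp_apply, dFam_RT_wd hω.1 hn hω.2.2,
      dFam_RT (δw_mem_Grade ⟨hω.1, hn, rfl, hω.2.2.symm⟩), ← δ_wd, δ_δ, map_zero,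
      LinearMap.zero_apply]
  rwa [LinearMap.comp_apply, e, LinearMap.zero_apply] at key

/-- The differential preserves the number of gaps. Both sides are compared after applying `RT`,
which is injective on valid words and makes locality applicable. -/
theorem δ_gapPart {n p : ℕ} (s : ℕ) {f : Fam k} (hf : f ∈ famOf k n p) :
    δ (gapPart n p s f) = gapPart n (p + 1) s (dFam n p f) := by
  have hmem := fun g : Fam k => supp_mono (S' := Valid) (fun _ h => h.1) (gapPart_mem n (p + 1) s g)
  have hmem' := fun g : Fam k =>
    δ_mem_valid (supp_mono (S' := Valid) (fun _ h => h.1) (gapPart_mem n p s g))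
  refine sub_eq_zero.1 (RT_injOn (sub_mem (hmem' f) (hmem _)) ?_)
  have key : (((RT : T k →ₗ[k] Fam k) ∘ₗ δ) ∘ₗ gapPart n p s) f =
      (((RT : T k →ₗ[k] Fam k) ∘ₗ gapPart n (p + 1) s) ∘ₗ dFam n p) f := by
    refine IsLocal.eq (isLocal_comp_gapPart _ _ _ _)
      ((isLocal_comp_gapPart _ _ _ _).comp (isLocal_dFam _ _)) (fun u X hu hX => ?_) hf
    obtain ⟨t, ht, e⟩ := exists_RT_eq_pl hX
    have key : ((((RT : T k →ₗ[k] Fam k) ∘ₗ δ) ∘ₗ gapPart n p s) ∘ₗ RT) t =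
        ((((RT : T k →ₗ[k] Fam k) ∘ₗ gapPart n (p + 1) s) ∘ₗ dFam n p) ∘ₗ RT) t := by
      refine eq_of_supp (fun ω hω => ?_) ht
      have hn : nW ω = n := by rw [← count_true_col, hω.2.1, hu]
      have hgr : (fun ω' => nW ω' = n ∧ nG ω' = s ∧ nD ω' + 1 = p + 1 + 1 + s) =
          fun ω' => nW ω' = n ∧ nG ω' = s ∧ nD ω' = p + 1 + s := by
        funext ω'
        refine propext ⟨fun h => ⟨h.1, h.2.1, ?_⟩, fun h => ⟨h.1, h.2.1, ?_⟩⟩ <;> omega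
      have := δ_restr (k := k) n (p + 1 + 1 + s) s (wd ω)
      rw [hgr] at this
      simp only [LinearMap.comp_apply]
      rw [dFam_RT_wd hω.1 hn hω.2.2, gapPart_RT (wd_mem hω.1), gapPart_RT (δw_mem_valid hω.1),
        ← δ_wd, this]
    rwa [LinearMap.comp_apply, LinearMap.comp_apply _ RT, e] at key
  rw [map_sub, sub_eq_zero]
  simpa only [LinearMap.comp_apply] using key

end WordModel

end

noncomputable section

/-! ### Primitives of series and functionals detecting the classes. -/

namespace WordModel

open Letter NcBV

variable {k : Type u} [CommRing k]

theorem isPure_nfw (j n : ℕ) : IsPure (nfw j n) := by simp [IsPure, nfw]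

theorem valid_nfw {j n : ℕ} (h : 0 < j + n) : Valid (nfw j n) := by
  refine valid_of_isPure (isPure_nfw j n) fun h' => ?_
  have := congrArg List.length h'
  simp [nfw] at this
  omega

theorem valid_bk_gap_bk : Valid [bk, gap, bk] := .gap bk_ne (.single bk_ne)

/-- A valid word has fewer gaps than vertices. Thus at a given colour word only finitely many gap
numbers occur, and sums over all gap numbers make sense. -/
theorem nG_lt {ω : List Letter} (hω : Valid ω) : nG ω < (col ω).length := by
  induction hω with
  | @single v hv => cases v <;> first | exact absurd rfl hv | simp [nG, col]
  | @edge v ω hv hω ih =>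
    cases v <;> first | exact absurd rfl hv | (simp only [nG, col, List.length_cons]; omega)
  | @gap v ω hv hω ih =>
    cases v <;> first | exact absurd rfl hv | (simp only [nG, col, List.length_cons]; omega)

theorem gen_mem (n p s : ℕ) : gen k n (p + 1 + s) s ∈ supp k (Grade n p s) := by
  unfold gen
  split_ifs with h1 h2
  · obtain ⟨rfl, h⟩ := h1
    refine wd_mem ⟨valid_nfw (by omega), nW_nfw _ _, nG_nfw _ _, ?_⟩
    rw [nD_nfw, h]
  · obtain ⟨rfl, h, rfl⟩ := h2
    exact wd_mem ⟨valid_bk_gap_bk, rfl, rfl, h.symm⟩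
  · exact zero_mem _

theorem gen_eq_zero {n d s : ℕ} (hs : 2 ≤ s) : gen k n d s = 0 := by
  rw [gen, if_neg (by omega), if_neg (by omega)]

theorem supp_grade_le (n p s : ℕ) : supp k (Grade n p s) ≤ supp k Valid :=
  supp_mono fun _ h => h.1

theorem RT_mem {n p s : ℕ} {t : T k} (ht : t ∈ supp k (Grade n p s)) : RT t ∈ famOf k n p :=
  map_mem_of_supp RT (fun ω hω => by
    have := RT_wd_mem (k := k) hω.1 (p := p) (by rw [hω.2.2.1, hω.2.2.2])
    rwa [hω.2.1] at this) ht

theorem gapPart_RT_self {n p s : ℕ} {t : T k} (ht : t ∈ supp k (Grade n p s)) :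
    gapPart n p s (RT t) = t := by
  rw [gapPart_RT (supp_grade_le _ _ _ ht), restr_of_mem (supp_mono (fun _ h => h.2) ht)]

theorem gapPart_RT_of_ne {n p s s' : ℕ} (h : s ≠ s') {t : T k} (ht : t ∈ supp k (Grade n p s)) :
    gapPart n p s' (RT t) = 0 := by
  rw [gapPart_RT (supp_grade_le _ _ _ ht), restr_of_mem_not]
  exact supp_mono (S' := fun ω => ¬ (nW ω = n ∧ nG ω = s' ∧ nD ω = p + 1 + s'))
    (fun ω hω h' => h (hω.2.2.1.symm.trans h'.2.1)) ht

theorem eq_zero_of_gapPart {n p : ℕ} {f : Fam k} (hf : f ∈ famOf k n p)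
    (h : ∀ s, gapPart n p s f = 0) : f = 0 := by
  refine eq_zero_of_cf hf fun ω hω hn hp => ?_
  rw [← gapPart_apply (s := nG ω) ⟨hω, hn, rfl, hp.symm⟩, h, Finsupp.zero_apply]

theorem exists_gapPart_eq {n p : ℕ} (t : ℕ → T k) (ht : ∀ s, t s ∈ supp k (Grade n p s)) :
    ∃ f ∈ famOf k n p, ∀ s, gapPart n p s f = t s := by
  refine ⟨fun w => ∑ s ∈ Finset.range w.length, RT (t s) w, ?_, fun s => ?_⟩
  · rw [mem_famOf]
    intro w
    have h := fun s => mem_famOf.1 (RT_mem (ht s)) w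
    exact ⟨sum_mem fun s _ => (h s).1, fun hw => Finset.sum_eq_zero fun s _ => (h s).2 hw⟩
  · ext ω
    by_cases hω : Grade n p s ω
    · rw [gapPart_apply hω, cf_congr (g := ∑ s ∈ Finset.range (col ω).length, RT (t s))
        (by rw [Finset.sum_apply]), map_sum]
      rw [Finset.sum_eq_single_of_mem s]
      · exact cf_RT hω.1 (supp_grade_le _ _ _ (ht s))
      · have := nG_lt hω.1
        rw [hω.2.2.1] at this
        exact Finset.mem_range.2 this
      · intro s' _ hs'
        rw [cf_RT hω.1 (supp_grade_le _ _ _ (ht s'))]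
        exact (Finsupp.mem_supported' k _).1 (ht s') ω fun h => hs' (h.2.2.1.symm.trans hω.2.2.1)
    · rw [(Finsupp.mem_supported' k _).1 (gapPart_mem n p s _) ω hω,
        (Finsupp.mem_supported' k _).1 (ht s) ω hω]

theorem dFam_mem {n p : ℕ} {f : Fam k} (hf : f ∈ famOf k n p) :
    dFam n p f ∈ famOf k n (p + 1) := by
  obtain ⟨x, rfl⟩ := exists_val_eq hf
  rw [← val_d (k := k) (rfl : p + 1 = p + 1)]
  exact val_mem _

/-- The word complex is solved separately for each number of gaps and the primitives are assembled.
Generators occur only for `0` and `1` gaps. The condition that `y` vanish for `p = 0` neutralises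
the truncated `p - 1`. -/
theorem exists_primitive_family {n p : ℕ} {x : Fam k} (hx : x ∈ famOf k n p)
    (hd : dFam n p x = 0) : ∃ (c c' : k) (y : Fam k), y ∈ famOf k n (p - 1) ∧
      (p = 0 → y = 0) ∧
      x = c • RT (gen k n (p + 1) 0) + c' • RT (gen k n (p + 2) 1) + dFam n (p - 1) y := by
  have h : ∀ s, ∃ y ∈ supp k fun ω => Valid ω ∧ nW ω = n ∧ nG ω = s ∧ nD ω + 1 = p + 1 + s,
      ∃ c : k, gapPart n p s x = c • gen k n (p + 1 + s) s + δ y := fun s =>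
    exists_primitive_graded (gapPart_mem n p s x) (by rw [δ_gapPart s hx, hd, map_zero])
  choose t ht c hc using h
  obtain ⟨y, hy, hy0, hyt⟩ : ∃ y ∈ famOf k n (p - 1), (p = 0 → y = 0) ∧
      ∀ s, gapPart n p s (dFam n (p - 1) y) = δ (t s) := by
    rcases p with _ | q
    · refine ⟨0, zero_mem _, fun _ => rfl, fun s => ?_⟩
      -- A primitive in degree `-1` would have as many gaps as vertices and tadpoles together,
      -- contradicting `nG_lt`.
      have : t s = 0 := by
        rw [← restr_of_mem (ht s), restr_of_mem_not]
        refine supp_mono (fun ω h1 _ => ?_) (ht s)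
        have h2 := nG_lt h1.1
        have h3 := length_col_le ω
        have h4 := h1.2.2
        omega
      rw [this, map_zero, map_zero, map_zero]
    · obtain ⟨y, hy, e⟩ := exists_gapPart_eq t fun s => supp_mono (S' := Grade n q s)
        (fun ω h1 => ⟨h1.1, h1.2.1, h1.2.2.1, by have := h1.2.2.2; omega⟩) (ht s)
      refine ⟨y, hy, fun h => by omega, fun s => ?_⟩
      rw [← e s]
      exact (δ_gapPart s hy).symm
  have hdy : dFam n (p - 1) y ∈ famOf k n p := by
    rcases p with _ | q
    · rw [hy0 rfl, map_zero]; exact zero_mem _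
    · exact dFam_mem hy
  have g0 : gen k n (p + 1) 0 ∈ supp k (Grade n p 0) := gen_mem n p 0
  have g1 : gen k n (p + 2) 1 ∈ supp k (Grade n p 1) := gen_mem n p 1
  refine ⟨c 0, c 1, y, hy, hy0, ?_⟩
  rw [← sub_eq_zero]
  refine eq_zero_of_gapPart (n := n) (p := p) (sub_mem hx (add_mem (add_mem
    (Submodule.smul_mem _ _ (RT_mem g0)) (Submodule.smul_mem _ _ (RT_mem g1))) hdy)) fun s => ?_
  rw [map_sub, map_add, map_add, map_smul, map_smul, hyt, hc]
  -- The grades with no gap and with one gap each see one of the two generators; with at least two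
  -- gaps `gen` is zero.
  rcases s with _ | _ | s
  · rw [gapPart_RT_self g0, gapPart_RT_of_ne one_ne_zero g1, smul_zero, add_zero, add_zero]
    exact sub_self (G := T k) _
  · have h1 := gapPart_RT_of_ne zero_ne_one g0
    have h2 := gapPart_RT_self g1
    simp only [Nat.zero_add] at *
    rw [h1, h2, smul_zero, zero_add]
    exact sub_self _
  · rw [gapPart_RT_of_ne (by omega) g0, gapPart_RT_of_ne (by omega) g1, gen_eq_zero (by omega)]
    simp

theorem Pw_mem (ω : List Letter) :
    Pw ω ∈ Finsupp.supported k k {a : ℕ × ℕ | a.1 = (col ω).count false} := by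
  have key : ∀ (A B : Set (ℕ × ℕ)) (φ : ℕ × ℕ → ℕ × ℕ), (∀ a ∈ A, φ a ∈ B) →
      ∀ x ∈ Finsupp.supported k k A, Finsupp.lmapDomain k k φ x ∈ Finsupp.supported k k B := by
    intro A B φ h x hx
    have := Submodule.mem_map_of_mem (f := Finsupp.lmapDomain k k φ) hx
    rw [Finsupp.lmapDomain_supported] at this
    exact Finsupp.supported_mono (Set.image_subset_iff.2 h) this
  induction ω with
  | nil => exact Finsupp.single_mem_supported k 1 rfl
  | cons v ω ih =>
    cases v with
    | wh => exact key _ _ _ (fun a h => by simpa [col] using h) _ ih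
    | bkT =>
      refine key _ _ _ (fun a h => ?_) _ ih
      rw [Set.mem_ofPred_eq] at h ⊢
      rw [col, List.count_cons_self, ← h]
    | _ => exact zero_mem _

theorem Pw_nfw (j n : ℕ) : Pw (nfw j n) = Finsupp.single (j, n) (1 : k) := by
  induction j with
  | zero =>
    induction n with
    | zero => rfl
    | succ n ih =>
      have e : nfw 0 (n + 1) = wh :: nfw 0 n := by simp [nfw, List.replicate_succ]
      rw [e, Pw, ih, Finsupp.lmapDomain_apply, Finsupp.mapDomain_single]
  | succ j ih => rw [nfw_succ_left, Pw, ih, Finsupp.lmapDomain_apply, Finsupp.mapDomain_single]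

theorem gapPart_eq_sum (n p s : ℕ) (f : Fam k) : gapPart n p s f =
    ∑ ω ∈ (finite_grade n p s).toFinset, cf ω f • wd ω := by
  rw [gapPart, LinearMap.sum_apply]; rfl

theorem grade_nfw {j n p : ℕ} (h : n + 2 * j = p + 1) : Grade n p 0 (nfw j n) :=
  ⟨valid_nfw (by omega), nW_nfw _ _, nG_nfw _ _, by rw [nD_nfw, h]⟩

/-- The functional is the coefficient at `(j, n)` of the symmetrization of the part without gaps. It
kills coboundaries by `P_δ`, and it only sees words with exactly `j` black vertices, which gives
compatibility with the filtration. -/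
theorem exists_functional_nfw {j n p : ℕ} (h : n + 2 * j = p + 1) :
    ∃ φ : Fam k →ₗ[k] k, φ (RT (wd (nfw j n))) = 1 ∧
      (∀ q, q + 1 = p → ∀ f ∈ famOf k n q, φ (dFam n q f) = 0) ∧
      ∀ f, (∀ w : List Bool, w.count false ≤ j → f w = 0) → φ f = 0 := by
  refine ⟨Finsupp.lapply (j, n) ∘ₗ P ∘ₗ gapPart n p 0, ?_, ?_, fun f hf => ?_⟩
  · rw [LinearMap.comp_apply, LinearMap.comp_apply, gapPart_RT_self (wd_mem (grade_nfw h)), P_wd,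
      Pw_nfw]
    simp
  · rintro q rfl f hf
    rw [LinearMap.comp_apply, LinearMap.comp_apply, ← δ_gapPart 0 hf, P_δ, map_zero]
  · rw [LinearMap.comp_apply, LinearMap.comp_apply, gapPart_eq_sum, map_sum, map_sum]
    refine Finset.sum_eq_zero fun ω _ => ?_
    rw [map_smul, map_smul, P_wd, Finsupp.lapply_apply]
    by_cases hc : j = (col ω).count false
    · rw [cf_congr (g := 0) (hf _ hc.ge), map_zero, zero_smul]
    · rw [(Finsupp.mem_supported' k _).1 (Pw_mem ω) (j, n) hc, smul_zero]

/-- In degree `0` there are no nonzero coboundaries, so a single coefficient will do. -/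
theorem exists_functional_bk_gap_bk :
    ∃ φ : Fam k →ₗ[k] k, φ (RT (wd [bk, gap, bk])) = 1 ∧
      ∀ f, (∀ w : List Bool, w.count false ≤ 2 → f w = 0) → φ f = 0 := by
  refine ⟨cf [bk, gap, bk], ?_, fun f hf => ?_⟩
  · rw [cf_RT_wd valid_bk_gap_bk valid_bk_gap_bk]; simp
  · rw [cf_congr (g := 0) (hf _ (by decide)), map_zero]

end WordModel

end

noncomputable section

/-! ### Completeness of quotients and of cohomology. -/

namespace NSOp

variable {k : Type u} [CommRing k]

/-- A filtration which vanishes eventually is complete. -/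
theorem existsUnique_limit {M : Type*} [AddCommGroup M] [Module k M] (F : ℕ → Submodule k M)
    (hF : Antitone F) {N : ℕ} (hN : F N = ⊥) (x : ℕ → M) (hx : ∀ a, x (a + 1) - x a ∈ F a) :
    ∃! y : M, ∀ a, y - x a ∈ F a := by
  have h : ∀ a b, x (a + b) - x a ∈ F a := by
    intro a b
    induction b with
    | zero => simp
    | succ b ih =>
      have := add_mem (hF (Nat.le_add_right a b) (hx (a + b))) ih
      rwa [sub_add_sub_cancel] at this
  refine ⟨x N, fun a => ?_, fun y hy => ?_⟩
  · rcases le_total a N with h' | h'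
    · obtain ⟨b, rfl⟩ := Nat.exists_eq_add_of_le h'
      exact h a b
    · obtain ⟨b, rfl⟩ := Nat.exists_eq_add_of_le h'
      have := h N b
      rw [hN, Submodule.mem_bot, sub_eq_zero] at this
      rw [this, sub_self]
      exact zero_mem _
  · have := hy N
    rwa [hN, Submodule.mem_bot, sub_eq_zero] at this

theorem quot_F_eq_bot {P : NSOp k} (R : ∀ n p : ℕ, P.V n p → Prop) {n p a : ℕ}
    (h : P.F n p a = ⊥) : (P.quot R).F n p a = ⊥ := by
  change (P.F n p a).map (P.ideal R n p).mkQ = ⊥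
  rw [h, Submodule.map_bot]

/-- The algebraic laws descend to representatives. Completeness is deduced from `hF`: in each arity
and degree the filtration vanishes eventually, also in the quotient. -/
theorem quot_isCompleteDGOperad {P : NSOp k} (h : P.IsCompleteDGOperad)
    (R : ∀ n p : ℕ, P.V n p → Prop) (hF : ∀ n p, ∃ a, P.F n p a = ⊥) :
    (P.quot R).IsCompleteDGOperad where
  one_comp x := by
    obtain ⟨x, rfl⟩ := Submodule.mkQ_surjective _ x
    exact congrArg (P.ideal R _ _).mkQ (h.one_comp x)
  comp_one x i hi := by
    obtain ⟨x, rfl⟩ := Submodule.mkQ_surjective _ x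
    exact congrArg (P.ideal R _ _).mkQ (h.comp_one x i hi)
  comp_seq i j hi hj hij hl he ht he' h₁ h₂ h₃ h₄ x y z := by
    obtain ⟨x, rfl⟩ := Submodule.mkQ_surjective _ x
    obtain ⟨y, rfl⟩ := Submodule.mkQ_surjective _ y
    obtain ⟨z, rfl⟩ := Submodule.mkQ_surjective _ z
    exact congrArg (P.ideal R _ _).mkQ (h.comp_seq i j hi hj hij hl he ht he' h₁ h₂ h₃ h₄ x y z)
  comp_par i j j' hij hj hj' hi hjl hit hl he ht he' h₁ h₂ h₃ h₄ x y z := by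
    obtain ⟨x, rfl⟩ := Submodule.mkQ_surjective _ x
    obtain ⟨y, rfl⟩ := Submodule.mkQ_surjective _ y
    obtain ⟨z, rfl⟩ := Submodule.mkQ_surjective _ z
    exact congrArg (P.ideal R _ _).mkQ
      (h.comp_par i j j' hij hj hj' hi hjl hit hl he ht he' h₁ h₂ h₃ h₄ x y z)
  d_d hp hq x := by
    obtain ⟨x, rfl⟩ := Submodule.mkQ_surjective _ x
    exact congrArg (P.ideal R _ _).mkQ (h.d_d hp hq x)
  d_one hq := congrArg (P.ideal R _ _).mkQ (h.d_one hq)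
  d_comp i hi hl hr hp' hq' hr' h₁ h₂ x y := by
    obtain ⟨x, rfl⟩ := Submodule.mkQ_surjective _ x
    obtain ⟨y, rfl⟩ := Submodule.mkQ_surjective _ y
    exact congrArg (P.ideal R _ _).mkQ (h.d_comp i hi hl hr hp' hq' hr' h₁ h₂ x y)
  F_zero n p := by
    change (P.F n p 0).map (P.ideal R n p).mkQ = ⊤
    rw [h.F_zero, Submodule.map_top, Submodule.range_mkQ]
  F_antitone n p := fun a b hab => Submodule.map_mono (h.F_antitone n p hab)
  comp_F i hi hl hr := by
    rintro _ _ ⟨x, hx, rfl⟩ ⟨y, hy, rfl⟩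
    exact ⟨_, h.comp_F i hi hl hr x y hx hy, rfl⟩
  d_F hq := by
    rintro _ ⟨x, hx, rfl⟩
    exact ⟨_, h.d_F hq x hx, rfl⟩
  complete n p := by
    obtain ⟨a, ha⟩ := hF n p
    refine existsUnique_limit _ (fun a b hab => Submodule.map_mono (h.F_antitone n p hab))
      (quot_F_eq_bot R ha)

theorem cohomology_isCompleteDGOperad {P : NSOp k} (h : P.IsCompleteDGOperad)
    (hF : ∀ n p, ∃ a, (P.cohomology h).F n p a = ⊥) :
    (P.cohomology h).IsCompleteDGOperad where
  one_comp x := by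
    obtain ⟨x, rfl⟩ := Submodule.mkQ_surjective _ x
    exact congrArg (P.coboundaries _ _).mkQ (Subtype.ext (h.one_comp x.1))
  comp_one x i hi := by
    obtain ⟨x, rfl⟩ := Submodule.mkQ_surjective _ x
    exact congrArg (P.coboundaries _ _).mkQ (Subtype.ext (h.comp_one x.1 i hi))
  comp_seq i j hi hj hij hl he ht he' h₁ h₂ h₃ h₄ x y z := by
    obtain ⟨x, rfl⟩ := Submodule.mkQ_surjective _ x
    obtain ⟨y, rfl⟩ := Submodule.mkQ_surjective _ y
    obtain ⟨z, rfl⟩ := Submodule.mkQ_surjective _ z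
    exact congrArg (P.coboundaries _ _).mkQ
      (Subtype.ext (h.comp_seq i j hi hj hij hl he ht he' h₁ h₂ h₃ h₄ x.1 y.1 z.1))
  comp_par i j j' hij hj hj' hi hjl hit hl he ht he' h₁ h₂ h₃ h₄ x y z := by
    obtain ⟨x, rfl⟩ := Submodule.mkQ_surjective _ x
    obtain ⟨y, rfl⟩ := Submodule.mkQ_surjective _ y
    obtain ⟨z, rfl⟩ := Submodule.mkQ_surjective _ z
    exact congrArg (P.coboundaries _ _).mkQ (Subtype.ext
      (h.comp_par i j j' hij hj hj' hi hjl hit hl he ht he' h₁ h₂ h₃ h₄ x.1 y.1 z.1))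
  d_d _ _ _ := rfl
  d_one _ := rfl
  d_comp i hi hl hr hp' hq' hr' h₁ h₂ x y := by
    have e : ∀ {n p q : ℕ} (hq : p + 1 = q) (x : (P.cohomology h).V n p),
        (P.cohomology h).d hq x = 0 := fun _ _ => rfl
    rw [e, e, e, map_zero, map_zero, LinearMap.zero_apply, smul_zero, add_zero]
  F_zero n p := by
    change ((P.F n p 0).comap (P.cocycles n p).subtype).map (P.coboundaries n p).mkQ = ⊤
    rw [h.F_zero, Submodule.comap_top, Submodule.map_top, Submodule.range_mkQ]
  F_antitone n p := fun a b hab => Submodule.map_mono (Submodule.comap_mono (h.F_antitone n p hab))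
  comp_F i hi hl hr := by
    rintro _ _ ⟨x, hx, rfl⟩ ⟨y, hy, rfl⟩
    exact ⟨_, h.comp_F i hi hl hr x.1 y.1 hx hy, rfl⟩
  d_F hq x _ := zero_mem _
  complete n p := by
    obtain ⟨a, ha⟩ := hF n p
    exact existsUnique_limit _ (fun a b hab =>
      Submodule.map_mono (Submodule.comap_mono (h.F_antitone n p hab))) ha

end NSOp

/-! ### Trees -/

namespace BTree

theorem graft_leaf (s : BTree) (i : ℕ) : s.graft i .leaf = s := by
  induction s generalizing i with
  | leaf => rfl
  | γ => rfl
  | ζ => rfl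
  | b s t ihs iht => rw [graft, ihs, iht, ite_self]

theorem weight_graft (w : ℕ) (s : BTree) (i : ℕ) (u : BTree) (h : i < s.arity) :
    (s.graft i u).weight w = s.weight w + u.weight w := by
  induction s generalizing i with
  | leaf => simp [graft, weight]
  | γ => simp [arity] at h
  | ζ => simp [arity] at h
  | b s t ihs iht =>
    simp only [graft, weight, arity] at h ⊢
    split_ifs with h'
    · have := ihs i h'
      simp only [weight]; omega
    · have := iht (i - s.arity) (by omega)
      simp only [weight]; omega

/-- A tree of degree `p` has at most `p` binary vertices, hence at most `p + 1` nullary ones, each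
of weight at most `w + 1`. -/
theorem weight_le (w : ℕ) (t : BTree) : t.weight w ≤ (w + 1) * (t.degree + 1) := by
  induction t with
  | leaf => simp [weight]
  | γ => simp [weight, degree]
  | ζ => simp only [weight, degree]; omega
  | b s t ihs iht =>
    simp only [weight, degree]
    nlinarith

/-- The second equation records how the Koszul signs behave: a leaf of the grafted tree `t` is
followed by the later vertices of `t` and by those of `s` after the leaf `i`. -/
theorem graft_graft {s t : BTree} {i j : ℕ} (u : BTree) (hi : i < s.arity) (hj : j < t.arity) :
    (s.graft i t).graft (i + j) u = s.graft i (t.graft j u) ∧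
      (s.graft i t).degreeAfter (i + j) = t.degreeAfter j + s.degreeAfter i := by
  induction s generalizing i with
  | leaf =>
    simp only [arity, Nat.lt_one_iff] at hi
    subst hi
    simp [graft, degreeAfter]
  | γ => simp [arity] at hi
  | ζ => simp [arity] at hi
  | b s s' ihs ihs' =>
    simp only [arity] at hi
    by_cases h : i < s.arity
    · have h1 := s.arity_graft i t h
      obtain ⟨h2, h3⟩ := ihs h
      rw [graft, graft, degreeAfter, if_pos h, if_pos h, if_pos h, graft, degreeAfter,
        if_pos (by omega), if_pos (by omega), h2, h3]
      exact ⟨rfl, by omega⟩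
    · obtain ⟨h2, h3⟩ := ihs' (i := i - s.arity) (by omega)
      rw [graft, graft, degreeAfter, if_neg h, if_neg h, if_neg h, graft, degreeAfter,
        if_neg (by omega), if_neg (by omega), show i + j - s.arity = i - s.arity + j by omega, h2,
        h3]
      exact ⟨rfl, rfl⟩

/-- Only the leaf `i` on the left sees the tree grafted at `j`, so its `degreeAfter` grows by the
degree of `u`. This asymmetry is the Koszul sign of the parallel axiom. -/
theorem graft_comm {s : BTree} {i j j' : ℕ} (t u : BTree) (hij : i < j) (hj : j < s.arity)
    (hj' : j' + 1 = j + t.arity) :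
    (s.graft i t).graft j' u = (s.graft j u).graft i t ∧
      (s.graft i t).degreeAfter j' = s.degreeAfter j ∧
      (s.graft j u).degreeAfter i = s.degreeAfter i + u.degree := by
  induction s generalizing i j j' with
  | leaf => simp only [arity] at hj; omega
  | γ => simp [arity] at hj
  | ζ => simp [arity] at hj
  | b s s' ihs ihs' =>
    simp only [arity] at hj
    by_cases h : j < s.arity
    · have h0 : i < s.arity := by omega
      have h1 := s.arity_graft i t h0
      have h1' := s.arity_graft j u h
      obtain ⟨h2, h3, h4⟩ := ihs hij h hj'
      simp only [graft, degreeAfter, if_pos h, if_pos h0]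
      rw [if_pos (by omega), if_pos (by omega), if_pos (by omega), if_pos (by omega), h2, h3, h4]
      exact ⟨rfl, rfl, by omega⟩
    · by_cases h0 : i < s.arity
      · have h1 := s.arity_graft i t h0
        have h5 := s'.degree_graft (j - s.arity) u (by omega)
        simp only [graft, degreeAfter, if_neg h, if_pos h0]
        rw [if_neg (by omega), if_neg (by omega),
          show j' - (s.graft i t).arity = j - s.arity by omega, h5]
        exact ⟨rfl, rfl, by omega⟩
      · obtain ⟨h2, h3, h4⟩ := ihs' (i := i - s.arity) (j := j - s.arity) (j' := j' - s.arity)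
          (by omega) (by omega) (by omega)
        simp only [graft, degreeAfter, if_neg h, if_neg h0]
        rw [if_neg (by omega), if_neg (by omega), h2, h3, h4]
        exact ⟨rfl, rfl, rfl⟩

end BTree

end

noncomputable section

/-! ### The free operad on `b`, `γ`, `ζ` is a complete operad. -/

namespace FreeOp

variable {k : Type u} [CommRing k] {w : ℕ}

variable (k w) in
/-- A tree as an element of the free operad. -/
def tree (t : BTree) {n p : ℕ} (hn : t.arity = n) (hp : t.degree = p) : (FreeOp k w).V n p :=
  Finsupp.single ⟨t, hn, hp⟩ 1

theorem induction {n p : ℕ} {C : (FreeOp k w).V n p → Prop} (h0 : C 0)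
    (hadd : ∀ x y, C x → C y → C (x + y)) (hsmul : ∀ (c : k) x, C x → C (c • x))
    (htree : ∀ t hn hp, C (tree k w t hn hp)) (x : (FreeOp k w).V n p) : C x := by
  refine Finsupp.induction_linear x h0 hadd fun t c => ?_
  have : (Finsupp.single t c : {t : BTree // t.arity = n ∧ t.degree = p} →₀ k) =
      c • Finsupp.single t 1 := by simp
  rw [this]
  exact hsmul c _ (htree t.1 t.2.1 t.2.2)

theorem linearCombination_linearCombination_single {A B C : Type*} (g : A → B → C)
    (c : A → B → k) (a : A) (b : B) :
    Finsupp.linearCombination k (fun s => Finsupp.linearCombination k fun t =>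
      Finsupp.single (g s t) (c s t)) (Finsupp.single a 1) (Finsupp.single b 1) =
      c a b • Finsupp.single (g a b) 1 := by
  simp

theorem comp_tree {m n l p q r : ℕ} (i : ℕ) (hi : i < m) (hl : m + n = l + 1) (hr : p + q = r)
    (s t : BTree) (hs : s.arity = m) (hs' : s.degree = p) (ht : t.arity = n) (ht' : t.degree = q) :
    (FreeOp k w).comp i hi hl hr (tree k w s hs hs') (tree k w t ht ht') =
      (-1 : k) ^ (t.degree * s.degreeAfter i) • tree k w (s.graft i t)
        (by have := s.arity_graft i t (by omega); omega)
        (by have := s.degree_graft i t (by omega); omega) := by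
  exact linearCombination_linearCombination_single
    (A := {t : BTree // t.arity = m ∧ t.degree = p})
    (B := {t : BTree // t.arity = n ∧ t.degree = q})
    (C := {t : BTree // t.arity = l ∧ t.degree = r}) _ _ ⟨s, hs, hs'⟩ ⟨t, ht, ht'⟩

theorem tree_congr {s t : BTree} (h : s = t) {n p : ℕ} (hn : s.arity = n) (hp : s.degree = p) :
    tree k w s hn hp = tree k w t (h ▸ hn) (h ▸ hp) := by subst h; rfl

theorem tree_mem_F (t : BTree) {n p a : ℕ} (hn : t.arity = n) (hp : t.degree = p)
    (ha : a ≤ t.weight w) : tree k w t hn hp ∈ (FreeOp k w).F n p a :=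
  Finsupp.single_mem_supported k 1 ha

theorem F_induction {n p a : ℕ} {C : (FreeOp k w).V n p → Prop} (h0 : C 0)
    (hadd : ∀ x y, C x → C y → C (x + y)) (hsmul : ∀ (c : k) x, C x → C (c • x))
    (htree : ∀ t hn hp, a ≤ t.weight w → C (tree k w t hn hp)) {x : (FreeOp k w).V n p}
    (hx : x ∈ (FreeOp k w).F n p a) : C x := by
  change x ∈ Finsupp.supported k k _ at hx
  rw [Finsupp.supported_eq_span_single] at hx
  refine Submodule.span_induction (p := fun x _ => C x) ?_ h0 (fun x y _ _ => hadd x y)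
    (fun c x _ => hsmul c x) hx
  rintro _ ⟨t, ht, rfl⟩
  exact htree t.1 t.2.1 t.2.2 ht

variable (k w) in
theorem F_eq_bot (n p : ℕ) : (FreeOp k w).F n p ((w + 1) * (p + 1) + 1) = ⊥ := by
  refine (Submodule.eq_bot_iff _).2 fun x hx => ?_
  refine F_induction (C := fun x => x = 0) rfl (fun x y hx hy => by rw [hx, hy, add_zero])
    (fun c x hx => by rw [hx, smul_zero]) (fun t hn hp ht => ?_) hx
  have := t.weight_le w
  rw [hp] at this
  omega

variable (k w) in
theorem isCompleteDGOperad : (FreeOp k w).IsCompleteDGOperad where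
  one_comp {n p} x := by
    refine induction (C := fun x => (FreeOp k w).comp 0 one_pos (Nat.add_comm 1 n)
      (Nat.zero_add p) (FreeOp k w).one x = x) (map_zero _)
      (fun x y hx hy => by rw [map_add, hx, hy]) (fun c x hx => by rw [map_smul, hx])
      (fun t hn hp => ?_) x
    refine (comp_tree 0 one_pos _ _ .leaf t rfl rfl hn hp).trans ?_
    rw [BTree.degreeAfter, mul_zero, pow_zero, one_smul]
    rfl
  comp_one {n p} x i hi := by
    refine induction (C := fun x => (FreeOp k w).comp i hi rfl (Nat.add_zero p) x
      (FreeOp k w).one = x) (by rw [map_zero, LinearMap.zero_apply])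
      (fun x y hx hy => by rw [map_add, LinearMap.add_apply, hx, hy])
      (fun c x hx => by rw [map_smul, LinearMap.smul_apply, hx])
      (fun t hn hp => ?_) x
    refine (comp_tree i hi _ _ t .leaf hn hp rfl rfl).trans ?_
    have h : (-1 : k) ^ (BTree.leaf.degree * t.degreeAfter i) = 1 := by
      rw [show BTree.leaf.degree = 0 from rfl, zero_mul, pow_zero]
    exact (congrArg₂ _ h (tree_congr (t.graft_leaf i) _ _)).trans (one_smul k _)
  comp_seq i j hi hj hij hl he ht he' h₁ h₂ h₃ h₄ x y z := by
    refine induction (C := fun x => (FreeOp k w).comp (i + j) hij he h₂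
      ((FreeOp k w).comp i hi hl h₁ x y) z = (FreeOp k w).comp i hi he' h₄ x
      ((FreeOp k w).comp j hj ht h₃ y z)) (by simp only [map_zero, LinearMap.zero_apply])
      (fun x y hx hy => by simp only [map_add, LinearMap.add_apply, hx, hy])
      (fun c x hx => by simp only [map_smul, LinearMap.smul_apply, hx]) (fun s hs hs' => ?_) x
    refine induction (C := fun y => (FreeOp k w).comp (i + j) hij he h₂
      ((FreeOp k w).comp i hi hl h₁ _ y) z = (FreeOp k w).comp i hi he' h₄ _
      ((FreeOp k w).comp j hj ht h₃ y z)) (by simp only [map_zero, LinearMap.zero_apply])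
      (fun x y hx hy => by simp only [map_add, LinearMap.add_apply, hx, hy])
      (fun c x hx => by simp only [map_smul, LinearMap.smul_apply, hx]) (fun t htt ht' => ?_) y
    refine induction (C := fun z => (FreeOp k w).comp (i + j) hij he h₂
      ((FreeOp k w).comp i hi hl h₁ _ _) z = (FreeOp k w).comp i hi he' h₄ _
      ((FreeOp k w).comp j hj ht h₃ _ z)) (by simp only [map_zero])
      (fun x y hx hy => by simp only [map_add, hx, hy])
      (fun c x hx => by simp only [map_smul, hx]) (fun u hu hu' => ?_) z
    obtain ⟨key, key'⟩ := BTree.graft_graft (s := s) (t := t) u (i := i) (j := j) (by omega) (by omega)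
    rw [comp_tree, comp_tree, map_smul, map_smul, LinearMap.smul_apply, comp_tree, comp_tree,
      tree_congr key, key', smul_smul, smul_smul, ← pow_add, ← pow_add]
    -- On both sides the degree of `u` is counted after `j` in `t` and after `i` in `s`, and the
    -- degree of `t` after `i` in `s`.
    congr 2
    rw [t.degree_graft j u (by omega)]
    ring
  comp_par i j j' hij hj hj' hi hjl hit hl he ht he' h₁ h₂ h₃ h₄ x y z := by
    refine induction (C := fun x => (FreeOp k w).comp j' hjl he h₂
      ((FreeOp k w).comp i hi hl h₁ x y) z = (-1 : k) ^ _ • (FreeOp k w).comp i hit he' h₄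
      ((FreeOp k w).comp j hj ht h₃ x z) y)
      (by simp only [map_zero, LinearMap.zero_apply, smul_zero])
      (fun x y hx hy => by simp only [map_add, LinearMap.add_apply, hx, hy, smul_add])
      (fun c x hx => by simp only [map_smul, LinearMap.smul_apply, hx]; rw [smul_comm])
      (fun s hs hs' => ?_) x
    refine induction (C := fun y => (FreeOp k w).comp j' hjl he h₂
      ((FreeOp k w).comp i hi hl h₁ _ y) z = (-1 : k) ^ _ • (FreeOp k w).comp i hit he' h₄
      ((FreeOp k w).comp j hj ht h₃ _ z) y)
      (by simp only [map_zero, LinearMap.zero_apply, smul_zero])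
      (fun x y hx hy => by simp only [map_add, LinearMap.add_apply, hx, hy, smul_add])
      (fun c x hx => by simp only [map_smul, LinearMap.smul_apply, hx]; rw [smul_comm])
      (fun t htt ht' => ?_) y
    refine induction (C := fun z => (FreeOp k w).comp j' hjl he h₂
      ((FreeOp k w).comp i hi hl h₁ _ _) z = (-1 : k) ^ _ • (FreeOp k w).comp i hit he' h₄
      ((FreeOp k w).comp j hj ht h₃ _ z) _)
      (by simp only [map_zero, LinearMap.zero_apply, smul_zero])
      (fun x y hx hy => by simp only [map_add, LinearMap.add_apply, hx, hy, smul_add])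
      (fun c x hx => by simp only [map_smul, LinearMap.smul_apply, hx]; rw [smul_comm])
      (fun u hu hu' => ?_) z
    obtain ⟨key, key', key''⟩ := BTree.graft_comm (s := s) (i := i) (j := j) (j' := j') t u hij (by omega)
      (by omega)
    rw [comp_tree, comp_tree, map_smul, map_smul, LinearMap.smul_apply, LinearMap.smul_apply,
      comp_tree, comp_tree, tree_congr key, key', key'', smul_smul, smul_smul, smul_smul,
      ← pow_add, ← pow_add, ← pow_add]
    congr 1
    -- The exponents differ by twice the product of the degrees of `t` and `u`: once from the axiom,
    -- once from the growth of `degreeAfter`.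
    rw [← hu', ← ht', show t.degree * s.degreeAfter i + u.degree * s.degreeAfter j = 0 + (t.degree *
      s.degreeAfter i + u.degree * s.degreeAfter j) by ring, show t.degree * u.degree +
      u.degree * s.degreeAfter j + t.degree * (s.degreeAfter i + u.degree) =
      2 * (t.degree * u.degree) + (t.degree * s.degreeAfter i + u.degree * s.degreeAfter j) by ring,
      pow_add, pow_add _ (2 * _), pow_mul, neg_one_sq, one_pow, pow_zero]
  d_d _ _ _ := rfl
  d_one _ := rfl
  d_comp i hi hl hr hp' hq' hr' h₁ h₂ x y := by
    have e : ∀ {n p q : ℕ} (hq : p + 1 = q) (x : (FreeOp k w).V n p),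
        (FreeOp k w).d hq x = 0 := fun _ _ => rfl
    rw [e, e, e, map_zero, map_zero, LinearMap.zero_apply, smul_zero, add_zero]
  F_zero n p := (Submodule.eq_top_iff'.2 fun x => induction (zero_mem _)
    (fun _ _ => add_mem) (fun c _ => Submodule.smul_mem _ c)
    (fun t hn hp => tree_mem_F t hn hp (Nat.zero_le _)) x)
  F_antitone n p := fun a b hab => Finsupp.supported_mono fun t ht => hab.trans ht
  comp_F i hi hl hr x y hx hy := by
    refine F_induction (C := fun x => (FreeOp k w).comp i hi hl hr x y ∈ (FreeOp k w).F _ _ _)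
      (by rw [map_zero, LinearMap.zero_apply]; exact zero_mem _)
      (fun x y hx hy => by rw [map_add, LinearMap.add_apply]; exact add_mem hx hy)
      (fun c x hx => by
        rw [map_smul, LinearMap.smul_apply]; exact Submodule.smul_mem _ _ hx)
      (fun s hs hs' hw => ?_) hx
    refine F_induction (C := fun y => (FreeOp k w).comp i hi hl hr _ y ∈ (FreeOp k w).F _ _ _)
      (by rw [map_zero]; exact zero_mem _)
      (fun x y hx hy => by rw [map_add]; exact add_mem hx hy)
      (fun c x hx => by rw [map_smul]; exact Submodule.smul_mem _ _ hx)
      (fun t ht ht' hw' => ?_) hy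
    rw [comp_tree]
    refine Submodule.smul_mem _ _ (tree_mem_F _ _ _ ?_)
    rw [s.weight_graft w i t (by omega)]
    omega
  d_F _ _ _ := zero_mem _
  complete n p := NSOp.existsUnique_limit _
    (fun a b hab => Finsupp.supported_mono fun t ht => hab.trans ht) (F_eq_bot k w n p)

end FreeOp

theorem SAsγζ_isCompleteDGOperad (k : Type u) [CommRing k] (w : ℕ) :
    (SAsγζ k w).IsCompleteDGOperad :=
  NSOp.quot_isCompleteDGOperad (FreeOp.isCompleteDGOperad k w) _
    fun n p => ⟨_, FreeOp.F_eq_bot k w n p⟩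

theorem SAsPP_isCompleteDGOperad (k : Type u) [CommRing k] (w : ℕ) :
    (SAsPP k w).IsCompleteDGOperad :=
  NSOp.quot_isCompleteDGOperad (SAsγζ_isCompleteDGOperad k w) _
    fun n p => ⟨_, NSOp.quot_F_eq_bot _ (FreeOp.F_eq_bot k w n p)⟩

end

/-! ### The cohomology of the twisted operad: components of rank at most one. -/

noncomputable section

/-- A generator of a cyclic free module which survives in the quotients by all filtration steps
beyond the `m`-th one. -/
structure IsFreeGenerator {k : Type u} [CommRing k] {M : Type*} [AddCommGroup M] [Module k M]
    (F : ℕ → Submodule k M) (g : M) (m : ℕ) : Prop where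
  span : ∀ x : M, ∃ c : k, x = c • g
  detect : ∃ φ : M →ₗ[k] k, φ g = 1 ∧ ∀ x ∈ F (m + 1), φ x = 0

theorem IsFreeGenerator.eq_zero {k : Type u} [CommRing k] {M : Type*} [AddCommGroup M] [Module k M]
    {F : ℕ → Submodule k M} {g : M} {m : ℕ} (h : IsFreeGenerator F g m) {x : M}
    (hx : x ∈ F (m + 1)) : x = 0 := by
  obtain ⟨c, rfl⟩ := h.span x
  obtain ⟨φ, h1, h2⟩ := h.detect
  have := h2 _ hx
  rw [map_smul, h1, smul_eq_mul, mul_one] at this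
  rw [this, zero_smul]

theorem IsFreeGenerator.smul_eq_zero {k : Type u} [CommRing k] {M : Type*} [AddCommGroup M]
    [Module k M] {F : ℕ → Submodule k M} {g : M} {m : ℕ} (h : IsFreeGenerator F g m) {c : k}
    (hc : c • g = 0) : c = 0 := by
  obtain ⟨φ, h1, -⟩ := h.detect
  have := congrArg φ hc
  rwa [map_smul, h1, smul_eq_mul, mul_one, map_zero] at this

namespace TwNcBV

open NcBV WordModel Letter

variable {k : Type u} [CommRing k]

variable (k) in
theorem isCompleteDGOperad : (TwNcBV k).IsCompleteDGOperad :=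
  TwNcBV_isCompleteDGOperad fun _ _ _ hf => dFam_dFam hf

variable (k) in
/-- The cohomology of the twisted operad. -/
abbrev H : NSOp k := (TwNcBV k).cohomology (isCompleteDGOperad k)

/-- The cohomology class of a cocycle. -/
abbrev cls {n p : ℕ} (x : (TwNcBV k).V n p) (hx : (TwNcBV k).d rfl x = 0) : (H k).V n p :=
  (TwNcBV k).cohomologyClass (isCompleteDGOperad k) x hx

theorem exists_cls_eq {n p : ℕ} (x : (H k).V n p) : ∃ y hy, cls (k := k) y hy = x := by
  obtain ⟨⟨y, hy⟩, rfl⟩ := Submodule.mkQ_surjective _ x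
  exact ⟨y, hy, rfl⟩

/-- In degree `0` the index `p - 1` is truncated, so `y` is required to vanish and the difference is
the zero coboundary. -/
theorem cls_eq_smul {n p : ℕ} {x ρ : (TwNcBV k).V n p} (hx : (TwNcBV k).d rfl x = 0)
    (hρ : (TwNcBV k).d rfl ρ = 0) {c : k} {y : Fam k} (hy : y ∈ famOf k n (p - 1))
    (hy0 : p = 0 → y = 0) (e : val x = c • val ρ + dFam n (p - 1) y) :
    cls x hx = c • cls ρ hρ := by
  refine (Submodule.Quotient.eq _).2 (show (⟨x, hx⟩ : (TwNcBV k).cocycles n p) - c • ⟨ρ, hρ⟩ ∈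
    (TwNcBV k).coboundaries n p from ?_)
  rcases p with _ | q
  · refine Or.inl (val_injective ?_)
    rw [hy0 rfl, map_zero, add_zero] at e
    change val (x - c • ρ) = val 0
    rw [map_sub, map_smul, e, sub_self, map_zero]
  · obtain ⟨y', rfl⟩ := exists_val_eq hy
    refine Or.inr ⟨q, rfl, y', val_injective ?_⟩
    change _ = val (x - c • ρ)
    rw [map_sub, map_smul, e, val_d, add_sub_cancel_left]
    rfl

theorem dFam_val_eq_zero {n p : ℕ} {x : (TwNcBV k).V n p} (hx : (TwNcBV k).d rfl x = 0) :
    dFam n p (val x) = 0 := by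
  rw [← val_d rfl, hx, map_zero]

theorem exists_detect {n p m : ℕ} {ρ : (TwNcBV k).V n p} (hρ : (TwNcBV k).d rfl ρ = 0)
    (φ : Fam k →ₗ[k] k) (h1 : φ (val ρ) = 1)
    (h2 : ∀ q, q + 1 = p → ∀ f ∈ famOf k n q, φ (dFam n q f) = 0)
    (h3 : ∀ f, (∀ w : List Bool, w.count false ≤ m → f w = 0) → φ f = 0) :
    ∃ φ : (H k).V n p →ₗ[k] k, φ (cls ρ hρ) = 1 ∧ ∀ x ∈ (H k).F n p (m + 1), φ x = 0 := by
  refine ⟨((TwNcBV k).coboundaries n p).liftQ (φ ∘ₗ val ∘ₗ ((TwNcBV k).cocycles n p).subtype) ?_,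
    h1, ?_⟩
  · rintro ⟨x, hx⟩ (h | ⟨q, hq, y, h⟩)
    · change φ (val x) = 0
      rw [show x = 0 from h, map_zero, map_zero]
    · change φ (val x) = 0
      rw [← show (TwNcBV k).d hq y = x from h, val_d]
      exact h2 q hq _ (val_mem y)
  · rintro _ ⟨⟨x, hx⟩, hF, rfl⟩
    exact h3 (val x) fun w hw => mem_F_iff.1 hF w (Nat.lt_succ_of_le hw)

theorem isFreeGenerator_nfw {j n p : ℕ} (h : n + 2 * j = p + 1) {ρ : (TwNcBV k).V n p}
    (hρ : (TwNcBV k).d rfl ρ = 0) (e : val ρ = RT (wd (nfw j n))) :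
    IsFreeGenerator ((H k).F n p) (cls ρ hρ) j where
  span x := by
    obtain ⟨x, hx, rfl⟩ := exists_cls_eq x
    obtain ⟨c, c', y, hy, hy0, hc⟩ := exists_primitive_family (val_mem x) (dFam_val_eq_zero hx)
    refine ⟨c, cls_eq_smul hx hρ hy hy0 ?_⟩
    have hj : (p + 1 - n) / 2 = j := by omega
    have g0 : gen k n (p + 1) 0 = wd (nfw j n) := by
      rw [gen, hj, if_pos ⟨rfl, h⟩]
    -- The generator with one gap needs `n = p = 0`, where `n + 2 * j = p + 1` fails by parity.
    have g1 : gen k n (p + 2) 1 = 0 := by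
      rw [gen, if_neg (by omega), if_neg (by omega)]
    rw [hc, g0, g1, e, map_zero, smul_zero, add_zero]
  detect := by
    obtain ⟨φ, h1, h2, h3⟩ := exists_functional_nfw (k := k) h
    exact exists_detect hρ φ (by rw [e, h1]) h2 h3

theorem isFreeGenerator_bk_gap_bk {ρ : (TwNcBV k).V 0 0}
    (hρ : (TwNcBV k).d rfl ρ = 0) (e : val ρ = RT (wd [bk, gap, bk])) :
    IsFreeGenerator ((H k).F 0 0) (cls ρ hρ) 2 where
  span x := by
    obtain ⟨x, hx, rfl⟩ := exists_cls_eq x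
    obtain ⟨c, c', y, hy, hy0, hc⟩ := exists_primitive_family (val_mem x) (dFam_val_eq_zero hx)
    refine ⟨c', cls_eq_smul hx hρ hy hy0 ?_⟩
    have g0 : gen k 0 1 0 = 0 := by
      rw [gen, if_neg (by omega), if_neg (by omega)]
    have g1 : gen k 0 2 1 = wd [bk, gap, bk] := by
      rw [gen, if_neg (by omega), if_pos (by omega)]
    rw [hc, g0, g1, e, map_zero, smul_zero, zero_add]
  detect := by
    obtain ⟨φ, h1, h3⟩ := exists_functional_bk_gap_bk (k := k)
    exact exists_detect hρ φ (by rw [e, h1]) (fun q hq => by omega) h3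

theorem cohomology_eq_zero {n p : ℕ} (h : ∀ j, n + 2 * j ≠ p + 1) (h' : ¬ (n = 0 ∧ p = 0))
    (x : (H k).V n p) : x = 0 := by
  obtain ⟨x, hx, rfl⟩ := exists_cls_eq x
  obtain ⟨c, c', y, hy, hy0, hc⟩ := exists_primitive_family (val_mem x) (dFam_val_eq_zero hx)
  have h0 : (TwNcBV k).d rfl (0 : (TwNcBV k).V n p) = 0 := map_zero _
  refine (cls_eq_smul (c := 0) hx h0 hy hy0 ?_).trans (zero_smul k _)
  have g0 : gen k n (p + 1) 0 = 0 := by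
    rw [gen, if_neg fun h0 => h _ h0.2, if_neg (by omega)]
  have g1 : gen k n (p + 2) 1 = 0 := by
    rw [gen, if_neg (by omega), if_neg (by omega)]
  rw [hc, g0, g1]
  simp

theorem exists_val_eq_RT {n p s : ℕ} {t : T k} (ht : t ∈ supp k (Grade n p s)) :
    ∃ x : (TwNcBV k).V n p, val x = RT t := exists_val_eq (RT_mem ht)

theorem d_eq_zero_of_δ {n p s : ℕ} {t : T k} (ht : t ∈ supp k (Grade n p s)) (hδ : δ t = 0)
    {x : (TwNcBV k).V n p} (hx : val x = RT t) : (TwNcBV k).d rfl x = 0 :=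
  val_injective (by rw [val_d, hx, dFam_RT ht, hδ, map_zero, map_zero])

theorem δw_bk_gap_bk : δw [bk, gap, bk] = (0 : T k) := by simp [δw]

-- Each component is generated by one class that is detected modulo some step of the filtration, so
-- that step is zero; the remaining components vanish. This is all that completeness of the
-- cohomology requires.
variable (k) in
theorem exists_cohomology_F_eq_bot (n p : ℕ) : ∃ a, (H k).F n p a = ⊥ := by
  by_cases h : ∃ j, n + 2 * j = p + 1
  · obtain ⟨j, h⟩ := h
    obtain ⟨x, hx⟩ := exists_val_eq_RT (wd_mem (k := k) (grade_nfw h))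
    have hd := d_eq_zero_of_δ (wd_mem (grade_nfw h)) (by rw [δ_wd, δw_nfw]) hx
    exact ⟨j + 1, (Submodule.eq_bot_iff _).2 fun y hy => (isFreeGenerator_nfw h hd hx).eq_zero hy⟩
  by_cases h' : n = 0 ∧ p = 0
  · obtain ⟨rfl, rfl⟩ := h'
    have hg : Grade 0 0 1 [bk, gap, bk] := ⟨valid_bk_gap_bk, rfl, rfl, rfl⟩
    obtain ⟨x, hx⟩ := exists_val_eq_RT (wd_mem (k := k) hg)
    have hd := d_eq_zero_of_δ (wd_mem hg) (by rw [δ_wd, δw_bk_gap_bk]) hx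
    exact ⟨2 + 1, (Submodule.eq_bot_iff _).2 fun y hy => (isFreeGenerator_bk_gap_bk hd hx).eq_zero hy⟩
  · push Not at h
    exact ⟨0, (Submodule.eq_bot_iff _).2 fun y _ => cohomology_eq_zero h h' y⟩

variable (k) in
theorem cohomology_isCompleteDGOperad : (H k).IsCompleteDGOperad :=
  NSOp.cohomology_isCompleteDGOperad _ (exists_cohomology_F_eq_bot k)

end TwNcBV

end

/-! ### Evaluation of trees and the universal property. -/

noncomputable section

theorem BTree.arity_b (s t : BTree) : s.arity + t.arity = (b s t).arity := rfl

theorem BTree.degree_b (s t : BTree) : 1 + s.degree + t.degree = (b s t).degree := rfl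

namespace NSOp

variable {k : Type u} [CommRing k]

theorem IsCompleteDGOperad.eq_zero {P : NSOp k} (h : P.IsCompleteDGOperad) {n p : ℕ} {x : P.V n p}
    (hx : ∀ a, x ∈ P.F n p a) : x = 0 := by
  obtain ⟨y, -, hy⟩ := h.complete n p (fun _ => 0) (fun a => by rw [sub_zero]; exact zero_mem _)
  rw [hy x fun a => by rw [sub_zero]; exact hx a, hy 0 fun a => by rw [sub_zero]; exact zero_mem _]

theorem Hom.eq_zero_of_mem_ideal {P Q : NSOp k} (hQ : Q.IsCompleteDGOperad) (f : Hom P Q)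
    {R : ∀ n p : ℕ, P.V n p → Prop} (hR : ∀ n p x, R n p x → f.toFun n p x = 0) {n p : ℕ}
    {x : P.V n p} (hx : InIdeal P R x) : f.toFun n p x = 0 := by
  induction hx with
  | of x h => exact hR _ _ x h
  | zero => exact map_zero _
  | add x y _ _ hx hy => rw [map_add, hx, hy, add_zero]
  | smul c x _ hx => rw [map_smul, hx, smul_zero]
  | comp_left i hi hl hr x y _ hx => rw [f.map_comp, hx, map_zero, LinearMap.zero_apply]
  | comp_right i hi hl hr x y _ hy => rw [f.map_comp, hy, map_zero]
  | d hq x _ hx => rw [f.map_d, hx, map_zero]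
  | closed x y _ hxy hy =>
    -- Closed ideals are killed because the complete target is separated.
    refine hQ.eq_zero fun a => ?_
    have := f.map_F _ (hxy a)
    rwa [map_sub, hy, sub_zero] at this

/-- The morphism on a quotient induced by a morphism which vanishes on the relations. -/
def Hom.quotLift {P Q : NSOp k} (hQ : Q.IsCompleteDGOperad) (f : Hom P Q)
    (R : ∀ n p : ℕ, P.V n p → Prop) (hR : ∀ n p x, R n p x → f.toFun n p x = 0) :
    Hom (P.quot R) Q where
  toFun n p := (P.ideal R n p).liftQ (f.toFun n p) fun _ hx =>
    LinearMap.mem_ker.2 (f.eq_zero_of_mem_ideal hQ hR hx)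
  map_one := f.map_one
  map_comp i hi hl hr x y := by
    obtain ⟨x, rfl⟩ := Submodule.mkQ_surjective _ x
    obtain ⟨y, rfl⟩ := Submodule.mkQ_surjective _ y
    exact f.map_comp i hi hl hr x y
  map_d hq x := by
    obtain ⟨x, rfl⟩ := Submodule.mkQ_surjective _ x
    exact f.map_d hq x
  map_F := by
    rintro n p a _ ⟨x, hx, rfl⟩
    exact f.map_F x hx

/-- The composition of a morphism on a quotient with the projection. -/
def Hom.compProj {P Q : NSOp k} {R : ∀ n p : ℕ, P.V n p → Prop} (f : Hom (P.quot R) Q) :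
    Hom P Q where
  toFun n p := f.toFun n p ∘ₗ P.proj R
  map_one := f.map_one
  map_comp i hi hl hr x y := f.map_comp i hi hl hr (P.proj R x) (P.proj R y)
  map_d hq x := f.map_d hq (P.proj R x)
  map_F x hx := f.map_F (P.proj R x) ⟨x, hx, rfl⟩

theorem Hom.eq_of_compProj {P Q : NSOp k} {R : ∀ n p : ℕ, P.V n p → Prop} {f g : Hom (P.quot R) Q}
    (h : f.compProj = g.compProj) : f = g := by
  refine Hom.ext (funext fun n => funext fun p => LinearMap.ext fun x => ?_)
  obtain ⟨x, rfl⟩ := Submodule.mkQ_surjective _ x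
  exact LinearMap.congr_fun (congrFun (congrFun (congrArg Hom.toFun h) n) p) x


/-- The product of two operations defined by an operation `b` of arity `2` and degree `1`. -/
def bin (P : NSOp k) (b : P.V 2 1) {n m l p q r : ℕ} (hl : n + m = l) (hr : 1 + p + q = r) :
    P.V n p →ₗ[k] P.V m q →ₗ[k] P.V l r :=
  P.comp (m := n + 1) n (Nat.lt_succ_self n) (by omega) hr ∘ₗ
    P.comp 0 two_pos (by omega) rfl b

theorem bin_apply (P : NSOp k) (b : P.V 2 1) {n m l p q r s t : ℕ} (hl : n + m = l)
    (hr : 1 + p + q = r) (h : n < s) (h1 : 2 + n = s + 1) (h2 : 1 + p = t) (h3 : s + m = l + 1)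
    (h4 : t + q = r) (x : P.V n p) (y : P.V m q) :
    P.bin b hl hr x y = P.comp n h h3 h4 (P.comp 0 two_pos h1 h2 b x) y := by
  subst h2
  obtain rfl : s = n + 1 := by omega
  rfl

theorem Hom.map_bin {P Q : NSOp k} (f : Hom P Q) (b : P.V 2 1) {n m l p q r : ℕ} (hl : n + m = l)
    (hr : 1 + p + q = r) (x : P.V n p) (y : P.V m q) :
    f.toFun l r (P.bin b hl hr x y) =
      Q.bin (f.toFun 2 1 b) hl hr (f.toFun n p x) (f.toFun m q y) := by
  rw [bin_apply P b hl hr (Nat.lt_succ_self n) (by omega) rfl (by omega) hr,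
    bin_apply Q _ hl hr (Nat.lt_succ_self n) (by omega) rfl (by omega) hr, f.map_comp, f.map_comp]

theorem neg_one_pow_smul_smul {M : Type*} [AddCommGroup M] [Module k M] (e : ℕ) (x : M) :
    (-1 : k) ^ e • (-1 : k) ^ e • x = x := by
  rw [smul_smul, ← mul_pow, neg_one_mul, neg_neg, one_pow, one_smul]

namespace IsCompleteDGOperad

variable {P : NSOp k} (hP : P.IsCompleteDGOperad)

theorem bin_mem_F (hP : P.IsCompleteDGOperad) {b : P.V 2 1} {n m l p q r a c : ℕ} (hl : n + m = l)
    (hr : 1 + p + q = r) {x : P.V n p} {y : P.V m q} (hx : x ∈ P.F n p a) (hy : y ∈ P.F m q c) :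
    P.bin b hl hr x y ∈ P.F l r (a + c) := by
  have hb : b ∈ P.F 2 1 0 := by rw [hP.F_zero]; trivial
  have := hP.comp_F 0 two_pos (show 2 + n = n + 1 + 1 by omega) (rfl : 1 + p = _) b x hb hx
  rw [zero_add] at this
  exact hP.comp_F n (Nat.lt_succ_self n) (by omega) hr _ y this hy

theorem d_bin (hP : P.IsCompleteDGOperad) {b : P.V 2 1} {n m l p q r : ℕ} (hl : n + m = l)
    (hr : 1 + p + q = r) {x : P.V n p} {y : P.V m q} (hb : P.d rfl b = 0) (hx : P.d rfl x = 0)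
    (hy : P.d rfl y = 0) : P.d rfl (P.bin b hl hr x y) = 0 := by
  rw [bin_apply P b hl hr (Nat.lt_succ_self n) (by omega) rfl (by omega) hr,
    hP.d_comp n _ _ hr rfl rfl rfl (by omega) (by omega), hy, map_zero, smul_zero, add_zero,
    hP.d_comp 0 two_pos (by omega) rfl rfl rfl rfl (by omega) (by omega), hx, hb]
  simp

/-- The composition at an input of the left factor exchanges `z` with `y`, which costs the Koszul
sign; at an input of the right factor there is nothing to exchange. -/
theorem comp_bin_left (hP : P.IsCompleteDGOperad) {b : P.V 2 1} {n m l s e t p q r u v c : ℕ}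
    (i : ℕ) (hi : i < n) (hl : n + m = l) (hr : 1 + p + q = r) (hi' : i < l) (he : l + s = e + 1)
    (hv : r + u = v) (ht : n + s = t + 1) (hc : p + u = c) (h1 : t + m = e) (h2 : 1 + c + q = v)
    (x : P.V n p) (y : P.V m q) (z : P.V s u) :
    P.comp i hi' he hv (P.bin b hl hr x y) z =
      (-1 : k) ^ (q * u) • P.bin b h1 h2 (P.comp i hi ht hc x z) y := by
  rw [bin_apply P b hl hr (Nat.lt_succ_self n) (by omega) rfl (by omega) hr,
    bin_apply P b h1 h2 (Nat.lt_succ_self t) (by omega) rfl (by omega) h2]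
  have h3 := hP.comp_seq (l := n + 1) (e := t + 1) (pq := 1 + p) (pqr := 1 + c) 0 i two_pos hi
    (by omega) (by omega) (by omega) ht (by omega) rfl (by omega) hc rfl b x z
  simp only [zero_add] at h3
  have h4 := hP.comp_par (m := n + 1) (n := s) (s := m) (l := t + 1) (e := e) (t := l)
    (pq := 1 + c) (pr := r) (pqr := v) i n t hi
    (by omega) (by omega) (by omega) (by omega) hi' (by omega) (by omega) (by omega) he (by omega)
    (by omega) (by omega) hv (P.comp 0 two_pos (by omega) rfl b x) z y
  rw [← h3, h4, mul_comm u q, neg_one_pow_smul_smul]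

theorem comp_bin_right (hP : P.IsCompleteDGOperad) {b : P.V 2 1} {n m l s e t p q r u v c : ℕ}
    (i j : ℕ) (hj : j < m) (hij : i = n + j) (hl : n + m = l) (hr : 1 + p + q = r) (hi' : i < l)
    (he : l + s = e + 1) (hv : r + u = v) (ht : m + s = t + 1) (hc : q + u = c) (h1 : n + t = e)
    (h2 : 1 + p + c = v) (x : P.V n p) (y : P.V m q) (z : P.V s u) :
    P.comp i hi' he hv (P.bin b hl hr x y) z = P.bin b h1 h2 x (P.comp j hj ht hc y z) := by
  subst hij
  rw [bin_apply P b hl hr (Nat.lt_succ_self n) (by omega) rfl (by omega) hr,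
    bin_apply P b h1 h2 (Nat.lt_succ_self n) (by omega) rfl (by omega) h2]
  exact hP.comp_seq n j _ hj hi' _ he ht _ _ hv hc h2 _ y z

theorem bin_one_left (hP : P.IsCompleteDGOperad) {b : P.V 2 1} {m l q r : ℕ} (hl : 1 + m = l)
    (hr : 1 + 0 + q = r) (h1 : 2 + m = l + 1) (h2 : 1 + q = r) (y : P.V m q) :
    P.bin b hl hr P.one y = P.comp 1 one_lt_two h1 h2 b y := by
  rw [bin_apply P b hl hr (s := 2) (t := 1) one_lt_two rfl rfl (by omega) (by omega),
    hP.comp_one b 0 two_pos]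

end IsCompleteDGOperad

/-- The value of a tree in an operad. -/
def evalTree (P : NSOp k) (b : P.V 2 1) (γ : P.V 0 0) (ζ : P.V 0 1) :
    ∀ t : BTree, P.V t.arity t.degree
  | .leaf => P.one
  | .γ => γ
  | .ζ => ζ
  | .b s t => P.bin b rfl rfl (evalTree P b γ ζ s) (evalTree P b γ ζ t)

/-- The value of a tree in an operad, with free indices. -/
def evalAt (P : NSOp k) (b : P.V 2 1) (γ : P.V 0 0) (ζ : P.V 0 1) (t : BTree) {n p : ℕ}
    (hn : t.arity = n) (hp : t.degree = p) : P.V n p :=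
  hn ▸ hp ▸ evalTree P b γ ζ t

section eval

variable {P : NSOp k} {b : P.V 2 1} {γ : P.V 0 0} {ζ : P.V 0 1}

theorem evalAt_congr {s t : BTree} (h : s = t) {n p : ℕ} (hn : s.arity = n) (hp : s.degree = p) :
    P.evalAt b γ ζ s hn hp = P.evalAt b γ ζ t (h ▸ hn) (h ▸ hp) := by subst h; rfl

theorem evalAt_b (s t : BTree) {a p m q n d : ℕ} (hs : s.arity = a) (hs' : s.degree = p)
    (ht : t.arity = m) (ht' : t.degree = q) (hn : a + m = n) (hd : 1 + p + q = d) :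
    P.evalAt b γ ζ (.b s t) (by rw [BTree.arity, hs, ht, hn]) (by rw [BTree.degree, hs', ht', hd]) =
      P.bin b hn hd (P.evalAt b γ ζ s hs hs') (P.evalAt b γ ζ t ht ht') := by
  subst hs hs' ht ht' hn hd
  rfl

theorem evalAt_b_rfl (s t : BTree) : P.evalAt b γ ζ (.b s t) rfl rfl =
    P.bin b (s.arity_b t) (s.degree_b t)
      (P.evalAt b γ ζ s rfl rfl) (P.evalAt b γ ζ t rfl rfl) := rfl

theorem Hom.map_evalAt {Q : NSOp k} (f : Hom P Q) (t : BTree) {n p : ℕ} (hn : t.arity = n)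
    (hp : t.degree = p) : f.toFun n p (P.evalAt b γ ζ t hn hp) =
      Q.evalAt (f.toFun 2 1 b) (f.toFun 0 0 γ) (f.toFun 0 1 ζ) t hn hp := by
  subst hn hp
  induction t with
  | leaf => exact f.map_one
  | γ => rfl
  | ζ => rfl
  | b s t hs ht =>
    rw [evalAt_b_rfl, evalAt_b_rfl, f.map_bin, hs,
      ht]

/-- By induction on the tree. Descending into a left branch, the grafted tree passes the right
branch, whose degree is precisely the additional term in `degreeAfter`. -/
theorem comp_evalAt (hP : P.IsCompleteDGOperad) {s t : BTree} {m p n q l r : ℕ} (i : ℕ) (hi : i < m)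
    (hl : m + n = l + 1) (hr : p + q = r) (hs : s.arity = m) (hs' : s.degree = p) (ht : t.arity = n)
    (ht' : t.degree = q) (hn : (s.graft i t).arity = l) (hd : (s.graft i t).degree = r) :
    P.comp i hi hl hr (P.evalAt b γ ζ s hs hs') (P.evalAt b γ ζ t ht ht') =
      (-1 : k) ^ (t.degree * s.degreeAfter i) • P.evalAt b γ ζ (s.graft i t) hn hd := by
  induction s generalizing i m p l r with
  | leaf =>
    subst hs hs' ht ht'
    simp only [BTree.arity, Nat.lt_one_iff] at hi
    subst hi
    obtain rfl : l = t.arity := hn.symm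
    obtain rfl : r = t.degree := hd.symm
    rw [BTree.degreeAfter, mul_zero, pow_zero, one_smul]
    exact hP.one_comp _
  | γ => subst hs; simp [BTree.arity] at hi
  | ζ => subst hs; simp [BTree.arity] at hi
  | b s s' ihs ihs' =>
    have hm : s.arity + s'.arity = m := hs
    have hp : 1 + s.degree + s'.degree = p := hs'
    rw [evalAt_b s s' rfl rfl rfl rfl hm hp]
    by_cases h : i < s.arity
    · have hg := s.arity_graft i t h
      have hg' := s.degree_graft i t h
      rw [hP.comp_bin_left (t := s.arity + n - 1) (c := s.degree + q) i h hm hp hi hl hr (by omega)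
        rfl (by omega) (by omega), ihs i h (by omega) rfl rfl rfl (by omega) (by omega), map_smul,
        LinearMap.smul_apply, ← evalAt_b (s.graft i t) s' (by omega) (by omega) rfl rfl, smul_smul,
        ← pow_add, BTree.degreeAfter, if_pos h]
      congr 1
      · rw [ht']; congr 1; ring
      · exact evalAt_congr (by rw [BTree.graft, if_pos h]) _ _
    · have hg := s'.arity_graft (i - s.arity) t (by omega)
      have hg' := s'.degree_graft (i - s.arity) t (by omega)
      rw [hP.comp_bin_right (t := s'.arity + n - 1) (c := s'.degree + q) i (i - s.arity) (by omega)
        (by omega) hm hp hi hl hr (by omega) rfl (by omega) (by omega), ihs' (i - s.arity) (by omega)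
        (by omega) rfl rfl rfl (by omega) (by omega), map_smul,
        ← evalAt_b s (s'.graft (i - s.arity) t) rfl rfl (by omega) (by omega), BTree.degreeAfter,
        if_neg h]
      congr 1
      exact evalAt_congr (by rw [BTree.graft, if_neg h]) _ _

theorem d_evalAt (hP : P.IsCompleteDGOperad) (hb : P.d rfl b = 0) (hγ : P.d rfl γ = 0)
    (hζ : P.d rfl ζ = 0) (t : BTree) {n p : ℕ} (hn : t.arity = n) (hp : t.degree = p) :
    P.d rfl (P.evalAt b γ ζ t hn hp) = 0 := by
  subst hn hp
  induction t with
  | leaf => exact hP.d_one rfl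
  | γ => exact hγ
  | ζ => exact hζ
  | b s t hs ht =>
    rw [evalAt_b_rfl]
    exact hP.d_bin _ _ hb hs ht

theorem evalAt_mem_F (hP : P.IsCompleteDGOperad) {w : ℕ} (hγ : γ ∈ P.F 0 0 w) (hζ : ζ ∈ P.F 0 1 1)
    (t : BTree) {n p : ℕ} (hn : t.arity = n) (hp : t.degree = p) :
    P.evalAt b γ ζ t hn hp ∈ P.F n p (t.weight w) := by
  subst hn hp
  induction t with
  | leaf => rw [BTree.weight, hP.F_zero]; trivial
  | γ => exact hγ
  | ζ => exact hζ
  | b s t hs ht =>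
    rw [evalAt_b_rfl]
    exact hP.bin_mem_F _ _ hs ht

end eval

end NSOp

namespace FreeOp

open NSOp

variable {k : Type u} [CommRing k] {w : ℕ}

/-- The linear extension of the evaluation of trees. -/
def eval (P : NSOp k) (b : P.V 2 1) (γ : P.V 0 0) (ζ : P.V 0 1) (n p : ℕ) :
    (FreeOp k w).V n p →ₗ[k] P.V n p :=
  Finsupp.linearCombination k fun t : {t : BTree // t.arity = n ∧ t.degree = p} =>
    P.evalAt b γ ζ t.1 t.2.1 t.2.2

theorem eval_tree {P : NSOp k} {b : P.V 2 1} {γ : P.V 0 0} {ζ : P.V 0 1} (t : BTree) {n p : ℕ}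
    (hn : t.arity = n) (hp : t.degree = p) :
    eval P b γ ζ n p (tree k w t hn hp) = P.evalAt b γ ζ t hn hp :=
  (Finsupp.linearCombination_single k 1 _).trans (one_smul k _)

/-- The morphism on the free operad with given values on the generators. -/
def evalHom {P : NSOp k} (hP : P.IsCompleteDGOperad) {b : P.V 2 1} {γ : P.V 0 0} {ζ : P.V 0 1}
    (hb : P.d rfl b = 0) (hdγ : P.d rfl γ = 0) (hdζ : P.d rfl ζ = 0) (hγ : γ ∈ P.F 0 0 w)
    (hζ : ζ ∈ P.F 0 1 1) : Hom (FreeOp k w) P where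
  toFun := eval P b γ ζ
  map_one := eval_tree .leaf rfl rfl
  map_comp {m n l p q r} i hi hl hr x y := by
    refine induction (C := fun x => eval P b γ ζ l r ((FreeOp k w).comp i hi hl hr x y) =
      P.comp i hi hl hr (eval P b γ ζ m p x) (eval P b γ ζ n q y))
      (by simp only [map_zero, LinearMap.zero_apply])
      (fun x y hx hy => by simp only [map_add, LinearMap.add_apply, hx, hy])
      (fun c x hx => by simp only [map_smul, LinearMap.smul_apply, hx]) (fun s hs hs' => ?_) x
    refine induction (C := fun y => eval P b γ ζ l r ((FreeOp k w).comp i hi hl hr _ y) =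
      P.comp i hi hl hr (eval P b γ ζ m p _) (eval P b γ ζ n q y)) (by simp only [map_zero])
      (fun x y hx hy => by simp only [map_add, hx, hy])
      (fun c x hx => by simp only [map_smul, hx]) (fun t ht ht' => ?_) y
    have h1 := s.arity_graft i t (by omega)
    have h2 := s.degree_graft i t (by omega)
    rw [comp_tree, map_smul, eval_tree, eval_tree, eval_tree,
      comp_evalAt hP i hi hl hr hs hs' ht ht' (by omega) (by omega)]
  map_d {n p q} hq x := by
    subst hq
    refine induction (C := fun x => eval P b γ ζ n (p + 1) ((FreeOp k w).d rfl x) =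
      P.d rfl (eval P b γ ζ n p x)) (by simp only [map_zero])
      (fun x y hx hy => by simp only [map_add, hx, hy])
      (fun c x hx => by simp only [map_smul, hx]) (fun t ht ht' => ?_) x
    rw [eval_tree, d_evalAt hP hb hdγ hdζ]
    exact map_zero _
  map_F {n p a} x hx := by
    refine F_induction (C := fun x => eval P b γ ζ n p x ∈ P.F n p a)
      (by rw [map_zero]; exact zero_mem _)
      (fun x y hx hy => by rw [map_add]; exact add_mem hx hy)
      (fun c x hx => by rw [map_smul]; exact Submodule.smul_mem _ _ hx) (fun t hn hp ht => ?_) hx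
    rw [eval_tree]
    exact hP.F_antitone _ _ ht (evalAt_mem_F hP hγ hζ t hn hp)

theorem bin_tree {n m l p q r : ℕ} (hl : n + m = l) (hr : 1 + p + q = r) (s t : BTree)
    (hs : s.arity = n) (hs' : s.degree = p) (ht : t.arity = m) (ht' : t.degree = q) :
    (FreeOp k w).bin (FreeOp.b k w) hl hr (tree k w s hs hs') (tree k w t ht ht') =
      tree k w (.b s t) (by rw [BTree.arity, hs, ht, hl]) (by rw [BTree.degree, hs', ht', hr]) := by
  subst hs hs' ht ht' hl hr
  have h1 : (BTree.b .leaf .leaf).arity = 2 := rfl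
  have h2 : (BTree.b .leaf .leaf).degree = 1 := rfl
  rw [bin_apply _ _ rfl rfl (Nat.lt_succ_self _) (by omega) rfl (by omega) rfl,
    show FreeOp.b k w = tree k w (.b .leaf .leaf) h1 h2 from rfl, comp_tree, map_smul,
    LinearMap.smul_apply, comp_tree, smul_smul, ← pow_add]
  have e : ((BTree.b .leaf .leaf).graft 0 s).graft s.arity t = .b s t := by
    simp [BTree.graft, BTree.arity]
  rw [tree_congr e]
  simp [BTree.degreeAfter, BTree.graft, BTree.arity, BTree.degree]

/-- Evaluation at the generators of the free operad itself is tautological. Hence a morphism out of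
it is determined by three values, see `hom_tree` and `hom_ext`. -/
theorem evalAt_eq_tree (t : BTree) {n p : ℕ} (hn : t.arity = n) (hp : t.degree = p) :
    (FreeOp k w).evalAt (FreeOp.b k w) (FreeOp.γ k w) (FreeOp.ζ k w) t hn hp = tree k w t hn hp := by
  subst hn hp
  induction t with
  | leaf => rfl
  | γ => rfl
  | ζ => rfl
  | b s t hs ht => rw [evalAt_b_rfl, hs, ht, bin_tree]

theorem hom_tree {P : NSOp k} (f : Hom (FreeOp k w) P) (t : BTree) {n p : ℕ} (hn : t.arity = n)
    (hp : t.degree = p) : f.toFun n p (tree k w t hn hp) =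
      P.evalAt (f.toFun 2 1 (FreeOp.b k w)) (f.toFun 0 0 (FreeOp.γ k w))
        (f.toFun 0 1 (FreeOp.ζ k w)) t hn hp := by
  rw [← evalAt_eq_tree, f.map_evalAt]

theorem hom_ext {P : NSOp k} {f g : Hom (FreeOp k w) P}
    (hb : f.toFun 2 1 (FreeOp.b k w) = g.toFun 2 1 (FreeOp.b k w))
    (hγ : f.toFun 0 0 (FreeOp.γ k w) = g.toFun 0 0 (FreeOp.γ k w))
    (hζ : f.toFun 0 1 (FreeOp.ζ k w) = g.toFun 0 1 (FreeOp.ζ k w)) : f = g := by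
  refine Hom.ext (funext fun n => funext fun p => LinearMap.ext fun x => ?_)
  refine induction (C := fun x => f.toFun n p x = g.toFun n p x) (by simp only [map_zero])
    (fun x y hx hy => by simp only [map_add, hx, hy])
    (fun c x hx => by simp only [map_smul, hx]) (fun t ht ht' => ?_) x
  rw [hom_tree, hom_tree, hb, hγ, hζ]

end FreeOp

namespace NSOp

variable {k : Type u} [CommRing k] {w : ℕ}

theorem evalAt_b_leaf_leaf {P : NSOp k} (hP : P.IsCompleteDGOperad) {b : P.V 2 1} {γ : P.V 0 0}
    {ζ : P.V 0 1} : P.evalAt b γ ζ (n := 2) (p := 1) (.b .leaf .leaf) rfl rfl = b := by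
  exact (hP.bin_one_left rfl rfl rfl rfl P.one).trans (hP.comp_one b 1 one_lt_two)

theorem Hom.map_assoc {P Q : NSOp k} (f : Hom P Q) (b : P.V 2 1) :
    f.toFun 3 2 (P.assoc b) = Q.assoc (f.toFun 2 1 b) := by
  rw [assoc, assoc, map_add, f.map_comp, f.map_comp]

theorem existsUnique_hom_SAsγζ {P : NSOp k} (hP : P.IsCompleteDGOperad) {b : P.V 2 1} {γ : P.V 0 0}
    {ζ : P.V 0 1} (h : P.assoc b = 0) (hb : P.d rfl b = 0) (hdγ : P.d rfl γ = 0)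
    (hdζ : P.d rfl ζ = 0) (hγ : γ ∈ P.F 0 0 w) (hζ : ζ ∈ P.F 0 1 1) :
    ∃! f : Hom (SAsγζ k w) P, f.toFun 2 1 (SAsγζ.b k w) = b ∧ f.toFun 0 0 (SAsγζ.γ k w) = γ ∧
      f.toFun 0 1 (SAsγζ.ζ k w) = ζ := by
  let f := FreeOp.evalHom hP hb hdγ hdζ hγ hζ
  have fb : f.toFun 2 1 (FreeOp.b k w) = b :=
    (FreeOp.eval_tree _ rfl rfl).trans (evalAt_b_leaf_leaf hP)
  have fγ : f.toFun 0 0 (FreeOp.γ k w) = γ := FreeOp.eval_tree .γ rfl rfl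
  have fζ : f.toFun 0 1 (FreeOp.ζ k w) = ζ := FreeOp.eval_tree .ζ rfl rfl
  have hR : ∀ n p x, AssocRel k w n p x → f.toFun n p x = 0 := by
    rintro _ _ _ ⟨⟩
    rw [f.map_assoc, fb, h]
  refine ⟨f.quotLift hP _ hR, ⟨fb, fγ, fζ⟩, fun g ⟨gb, gγ, gζ⟩ => ?_⟩
  refine Hom.eq_of_compProj (FreeOp.hom_ext ?_ ?_ ?_)
  · exact gb.trans fb.symm
  · exact gγ.trans fγ.symm
  · exact gζ.trans fζ.symm

end NSOp

end

noncomputable section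

/-! ### Reduction of trees to right combs modulo the relations. -/

namespace BTree

/-- A leaf or a vertex `ζ`. -/
def atom (c : Bool) : BTree := if c then leaf else ζ

/-- The right comb on a nonempty list of leaves and vertices `ζ`. -/
def comb : List Bool → BTree
  | [] => γ
  | [c] => atom c
  | c :: c' :: l => b (atom c) (comb (c' :: l))

theorem comb_cons {c : Bool} {l : List Bool} (hl : l ≠ []) : comb (c :: l) = b (atom c) (comb l) := by
  cases l with
  | nil => exact absurd rfl hl
  | cons c' l => rfl

theorem arity_comb (l : List Bool) : (comb l).arity = l.count true := by
  induction l with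
  | nil => rfl
  | cons c l ih =>
    rcases eq_or_ne l [] with rfl | hl
    · cases c <;> rfl
    · rw [comb_cons hl, arity, ih]
      cases c <;> simp [atom, arity]
      omega

/-- Each leaf accounts for one `b` and each `ζ` for one `b` and its own degree; the last letter of
the comb comes without a `b`. -/
theorem degree_comb {l : List Bool} (hl : l ≠ []) :
    (comb l).degree + 1 = l.count true + 2 * l.count false := by
  induction l with
  | nil => exact absurd rfl hl
  | cons c l ih =>
    rcases eq_or_ne l [] with rfl | hl
    · cases c <;> rfl
    · have := ih hl
      rw [comb_cons hl, degree]
      cases c <;> simp [atom, degree] <;> omega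

theorem weight_comb (w : ℕ) {l : List Bool} (hl : l ≠ []) : (comb l).weight w = l.count false := by
  induction l with
  | nil => exact absurd rfl hl
  | cons c l ih =>
    rcases eq_or_ne l [] with rfl | hl
    · cases c <;> rfl
    · rw [comb_cons hl, weight, ih hl]
      cases c <;> simp [atom, weight]
      omega

theorem perm_replicate (l : List Bool) :
    l.Perm (List.replicate (l.count false) false ++ List.replicate (l.count true) true) := by
  refine List.perm_iff_count.2 fun c => ?_
  cases c <;> simp [List.count_replicate]

end BTree

namespace NSOp

variable {k : Type u} [CommRing k]

section tree

open BTree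

variable (P : NSOp k) (b : P.V 2 1) (γ : P.V 0 0) (ζ : P.V 0 1)

/-- Two trees have the same value in an operad, up to sign. -/
structure TreeEq (s t : BTree) : Prop where
  arity : s.arity = t.arity
  degree : s.degree = t.degree
  eval : ∀ {n p : ℕ} (hn : s.arity = n) (hp : s.degree = p) (hn' : t.arity = n)
    (hp' : t.degree = p), ∃ e : ℕ, P.evalAt b γ ζ s hn hp = (-1 : k) ^ e • P.evalAt b γ ζ t hn' hp'

/-- The value of a tree in an operad vanishes. -/
def TreeZero (t : BTree) : Prop :=
  ∀ {n p : ℕ} (hn : t.arity = n) (hp : t.degree = p), P.evalAt b γ ζ t hn hp = 0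

variable {P b γ ζ}

theorem TreeEq.refl (t : BTree) : TreeEq P b γ ζ t t :=
  ⟨rfl, rfl, fun _ _ _ _ => ⟨0, by rw [pow_zero, one_smul]⟩⟩

theorem TreeEq.symm {s t : BTree} (h : TreeEq P b γ ζ s t) : TreeEq P b γ ζ t s :=
  ⟨h.arity.symm, h.degree.symm, fun hn hp hn' hp' => by
    obtain ⟨e, he⟩ := h.eval hn' hp' hn hp
    exact ⟨e, by rw [he, neg_one_pow_smul_smul]⟩⟩

theorem TreeEq.trans {s t u : BTree} (h : TreeEq P b γ ζ s t) (h' : TreeEq P b γ ζ t u) :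
    TreeEq P b γ ζ s u :=
  ⟨h.arity.trans h'.arity, h.degree.trans h'.degree, fun hn hp hn' hp' => by
    obtain ⟨e, he⟩ := h.eval hn hp (h'.arity.trans hn') (h'.degree.trans hp')
    obtain ⟨e', he'⟩ := h'.eval (h'.arity.trans hn') (h'.degree.trans hp') hn' hp'
    exact ⟨e + e', by rw [he, he', smul_smul, pow_add]⟩⟩

theorem TreeEq.b_congr {s t s' t' : BTree} (h : TreeEq P b γ ζ s s') (h' : TreeEq P b γ ζ t t') :
    TreeEq P b γ ζ (.b s t) (.b s' t') := by
  refine ⟨by rw [BTree.arity, h.arity, h'.arity, BTree.arity],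
    by rw [BTree.degree, h.degree, h'.degree, BTree.degree], fun {n p} hn hp hn' hp' => ?_⟩
  obtain ⟨e, he⟩ := h.eval rfl rfl h.arity.symm h.degree.symm
  obtain ⟨e', he'⟩ := h'.eval rfl rfl h'.arity.symm h'.degree.symm
  refine ⟨e + e', ?_⟩
  rw [evalAt_b s t rfl rfl rfl rfl hn hp, he, he', map_smul, map_smul, LinearMap.smul_apply,
    evalAt_b s' t' h.arity.symm h.degree.symm h'.arity.symm h'.degree.symm hn hp, smul_smul,
    pow_add, mul_comm]

theorem TreeZero.b_left {s : BTree} (h : TreeZero P b γ ζ s) (t : BTree) :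
    TreeZero P b γ ζ (.b s t) := fun hn hp => by
  rw [evalAt_b s t rfl rfl rfl rfl hn hp, h, map_zero, LinearMap.zero_apply]

theorem TreeZero.b_right (s : BTree) {t : BTree} (h : TreeZero P b γ ζ t) :
    TreeZero P b γ ζ (.b s t) := fun hn hp => by
  rw [evalAt_b s t rfl rfl rfl rfl hn hp, h, map_zero]

variable (P b γ ζ) in
/-- The relations of `S⁻¹As⁺⁺`. -/
structure PPRelations : Prop where
  assoc : P.assoc b = 0
  γ_left : P.comp (l := 1) (r := 1) 0 two_pos (by omega) (by omega) b γ = 0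
  γ_right : P.comp (l := 1) (r := 1) 1 one_lt_two (by omega) (by omega) b γ = 0
  ζ_comm : P.comp (l := 1) (r := 2) 0 two_pos (by omega) (by omega) b ζ
    + P.comp 1 one_lt_two (by omega) (by omega) b ζ = 0

/-- A product with a nullary factor is a composite with a unary operation such as `b(ζ, -)`; in this
form the relations, which live in arity `1`, apply to arbitrary trees. -/
theorem bin_nullary_left {n p q r s : ℕ} (hr : 1 + q + p = r)
    (hs : 1 + q = s) (hs' : s + p = r) (x : P.V 0 q) (y : P.V n p) :
    P.bin b (zero_add n) hr x y =
      P.comp 0 one_pos (add_comm 1 n) hs' (P.comp 0 two_pos (by omega) hs b x) y := by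
  subst hs
  rfl

theorem bin_nullary_right (hP : P.IsCompleteDGOperad) {n p q r s : ℕ} (hr : 1 + p + q = r)
    (hs : 1 + q = s) (hs' : s + p = r) (x : P.V 0 q) (y : P.V n p) :
    P.bin b (add_zero n) hr y x = (-1 : k) ^ (p * q) •
      P.comp 0 one_pos (add_comm 1 n) hs' (P.comp 1 one_lt_two (by omega) hs b x) y := by
  rw [bin_apply P b (add_zero n) hr (Nat.lt_succ_self n) (by omega) rfl (by omega) hr]
  exact hP.comp_par 0 1 n one_pos one_lt_two (by omega) two_pos (Nat.lt_succ_self n) one_pos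
    (by omega) (by omega) (by omega) (by omega) rfl hr hs hs' b y x

/-- Both products are composites of a three-fold operation with `x`, `y`, `z`: of `b ∘₁ b` on the
left, and of `b ∘₂ b` on the right after moving the inner `b` past `x`. This move gives `(-1) ^ p`,
and the relation gives one more sign. -/
theorem bin_bin (hP : P.IsCompleteDGOperad) (h : P.assoc b = 0) {n m s p q r nm ms l pq qr d : ℕ}
    (h1 : n + m = nm) (h2 : 1 + p + q = pq) (h3 : nm + s = l) (h4 : 1 + pq + r = d)
    (h5 : m + s = ms) (h6 : 1 + q + r = qr) (h7 : n + ms = l) (h8 : 1 + p + qr = d)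
    (x : P.V n p) (y : P.V m q) (z : P.V s r) :
    P.bin b h3 h4 (P.bin b h1 h2 x y) z = (-1 : k) ^ (p + 1) • P.bin b h7 h8 x (P.bin b h5 h6 y z) := by
  have e1 : P.comp 0 two_pos (show 2 + nm = nm + 1 + 1 by omega) (rfl : 1 + pq = _) b
      (P.bin b h1 h2 x y) = P.comp n (show n < n + 2 by omega) (by omega) (by omega)
        (P.comp 0 (show 0 < 3 by omega) (by omega) (rfl : 2 + p = 2 + p)
          (P.comp 0 two_pos (by omega) rfl b b) x) y := by
    rw [bin_apply P b h1 h2 (Nat.lt_succ_self n) (by omega) rfl (by omega) h2]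
    have a1 := hP.comp_seq (l := n + 2) (e := nm + 1) (t := nm) (pq := 2 + p) (pqr := 1 + pq) 0 n
      two_pos (Nat.lt_succ_self n) (by omega) (by omega) (by omega) (by omega) (by omega) (by omega)
      (by omega) (by omega) rfl b (P.comp 0 two_pos (by omega) rfl b x) y
    have a2 := hP.comp_seq (l := 3) (e := n + 2) (t := n + 1) (pq := 2) (qr := 1 + p) (pqr := 2 + p)
      0 0 two_pos two_pos (by omega) rfl (by omega) (by omega) (by omega) rfl rfl rfl (by omega) b b x
    simp only [zero_add] at a1
    rw [← a1]
    congr 2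
    exact a2.symm
  have e3 : P.comp (l := l) n (Nat.lt_succ_self n) (by omega) h8 (P.comp 0 two_pos
      (show 2 + n = n + 1 + 1 by omega) (rfl : 1 + p = _) b x) (P.bin b h5 h6 y z) =
      P.comp nm (show nm < nm + 1 by omega) (by omega) (show 1 + pq + r = d by omega)
        (P.comp n (show n < n + 2 by omega) (by omega) (by omega)
          (P.comp n (show n < n + 1 by omega) (by omega) (show 1 + p + 1 = 2 + p by omega)
            (P.comp 0 two_pos (show 2 + n = n + 1 + 1 by omega) (rfl : 1 + p = _) b x) b) y) z := by
    rw [bin_apply P b h5 h6 (Nat.lt_succ_self m) (by omega) rfl (by omega) h6]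
    have a1 := hP.comp_seq (m := n + 1) (n := m + 1) (s := s) (l := nm + 1) (e := l) (t := ms)
      (pq := 1 + pq) (pqr := d) (qr := qr) n m (Nat.lt_succ_self n) (Nat.lt_succ_self m) (by omega)
      (by omega) (by omega) (by omega) (by omega) (by omega) h4 h6 h8
      (P.comp 0 two_pos (by omega) rfl b x) (P.comp 0 two_pos (by omega) rfl b y) z
    have a2 := hP.comp_seq (m := n + 1) (n := 2) (s := m) (l := n + 2) (e := nm + 1) (t := m + 1)
      (pq := 2 + p) (pqr := 1 + pq) (qr := 1 + q) n 0 (Nat.lt_succ_self n) two_pos (by omega)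
      (by omega) (by omega) (by omega) (by omega) (by omega) (by omega) rfl (by omega)
      (P.comp 0 two_pos (by omega) rfl b x) b y
    subst h1
    simp only [add_zero] at a2
    rw [← a1, ← a2]
  -- The parallel axiom moves the second `b` past `x`; it is the only source of a sign besides the
  -- relation.
  have e4 : P.comp n (show n < n + 1 by omega) (show n + 1 + 2 = n + 2 + 1 by omega)
      (show 1 + p + 1 = 2 + p by omega)
      (P.comp 0 two_pos (show 2 + n = n + 1 + 1 by omega) (rfl : 1 + p = _) b x) b =
      (-1 : k) ^ (p * 1) • P.comp 0 (show 0 < 3 by omega) (by omega) (rfl : 2 + p = 2 + p)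
          (P.comp 1 one_lt_two (by omega) rfl b b) x :=
    hP.comp_par 0 1 n one_pos one_lt_two (by omega) two_pos (Nat.lt_succ_self n) (by omega)
    (by omega) (by omega) (by omega) (by omega) rfl _ rfl rfl b x b
  rw [bin_apply P b h3 h4 (Nat.lt_succ_self nm) (by omega) rfl (by omega) h4, e1,
    bin_apply P b h7 h8 (Nat.lt_succ_self n) (by omega) rfl (by omega) h8, e3, e4,
    eq_neg_of_add_eq_zero_left h]
  simp only [map_neg, map_smul, LinearMap.neg_apply, LinearMap.smul_apply, mul_one]
  rw [smul_smul, ← pow_add, show p + 1 + p = 2 * p + 1 by ring, pow_succ, pow_mul, neg_one_sq,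
    one_pow, one_mul, neg_one_smul]

theorem treeEq_assoc (hP : P.IsCompleteDGOperad) (h : PPRelations P b γ ζ) (r s t : BTree) :
    TreeEq P b γ ζ (.b (.b r s) t) (.b r (.b s t)) := by
  have e1 : (BTree.b (.b r s) t).arity = (BTree.b r (.b s t)).arity := by
    simp only [BTree.arity]; omega
  have e2 : (BTree.b (.b r s) t).degree = (BTree.b r (.b s t)).degree := by
    simp only [BTree.degree]; omega
  refine ⟨e1, e2, fun hn hp hn' hp' => ⟨r.degree + 1, ?_⟩⟩
  rw [evalAt_b (.b r s) t rfl rfl rfl rfl hn hp, evalAt_b r (.b s t) rfl rfl rfl rfl hn' hp',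
    evalAt_b_rfl, evalAt_b_rfl]
  exact bin_bin hP h.assoc _ _ _ _ _ _ _ _ _ _ _

theorem bin_ζ_comm (hP : P.IsCompleteDGOperad) (h : PPRelations P b γ ζ) {n p r : ℕ}
    (h1 : 1 + 1 + p = r) (h2 : 1 + p + 1 = r) (y : P.V n p) :
    P.bin b (zero_add n) h1 ζ y = (-1 : k) ^ (p + 1) • P.bin b (add_zero n) h2 y ζ := by
  rw [bin_nullary_left (s := 2) h1 (by omega) h1, bin_nullary_right hP (s := 2) h2 (by omega) h1,
    eq_neg_of_add_eq_zero_left h.ζ_comm, map_neg, LinearMap.neg_apply, smul_smul, ← pow_add,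
    show p + 1 + p * 1 = 2 * p + 1 by ring, pow_succ, pow_mul, neg_one_sq, one_pow, one_mul,
    neg_one_smul]

theorem treeEq_ζ_comm (hP : P.IsCompleteDGOperad) (h : PPRelations P b γ ζ) (t : BTree) :
    TreeEq P b γ ζ (.b .ζ t) (.b t .ζ) := by
  have e1 : (BTree.b .ζ t).arity = (BTree.b t .ζ).arity := by simp only [BTree.arity]; omega
  have e2 : (BTree.b .ζ t).degree = (BTree.b t .ζ).degree := by simp only [BTree.degree]; omega
  refine ⟨e1, e2, fun {n p} hn hp hn' hp' => ⟨t.degree + 1, ?_⟩⟩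
  have ht : t.arity = n := hn'
  rw [evalAt_b .ζ t (a := 0) (p := 1) rfl rfl ht rfl (zero_add n) hp,
    evalAt_b t .ζ (m := 0) (q := 1) ht rfl rfl rfl (add_zero n) hp']
  exact bin_ζ_comm hP h _ _ _

theorem treeZero_γ_left (h : PPRelations P b γ ζ) (t : BTree) :
    TreeZero P b γ ζ (.b .γ t) := fun {n p} hn hp => by
  have ht : t.arity = n := (zero_add _).symm.trans hn
  have h1 : 1 + 0 + t.degree = p := hp
  rw [evalAt_b .γ t (a := 0) (p := 0) rfl rfl ht rfl (zero_add n) hp]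
  refine (bin_nullary_left (s := 1) h1 (by omega) (by omega) _ _).trans ?_
  change P.comp 0 _ _ _ (P.comp 0 _ _ _ b γ) _ = _
  rw [h.γ_left, map_zero, LinearMap.zero_apply]

theorem treeZero_γ_right (hP : P.IsCompleteDGOperad) (h : PPRelations P b γ ζ) (t : BTree) :
    TreeZero P b γ ζ (.b t .γ) := fun {n p} hn hp => by
  have ht : t.arity = n := hn
  have h1 : 1 + t.degree + 0 = p := hp
  rw [evalAt_b t .γ (m := 0) (q := 0) ht rfl rfl rfl (add_zero n) hp]
  refine (bin_nullary_right hP (s := 1) h1 (by omega) (by omega) _ _).trans ?_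
  change _ • P.comp 0 _ _ _ (P.comp 1 _ _ _ b γ) _ = _
  rw [h.γ_right, map_zero, LinearMap.zero_apply, smul_zero]

theorem treeEq_comb_append (hP : P.IsCompleteDGOperad) (h : PPRelations P b γ ζ) {l l' : List Bool}
    (hl : l ≠ []) (hl' : l' ≠ []) :
    TreeEq P b γ ζ (.b (comb l) (comb l')) (comb (l ++ l')) := by
  induction l with
  | nil => exact absurd rfl hl
  | cons c l ih =>
    rcases eq_or_ne l [] with rfl | hl
    · rw [List.singleton_append, comb_cons hl']
      exact TreeEq.refl _
    · rw [List.cons_append, comb_cons (l := l ++ l') (by simp [hl]), comb_cons hl]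
      exact (treeEq_assoc hP h _ _ _).trans ((TreeEq.refl _).b_congr (ih hl))

/-- Two equal atoms need no exchange; only a `ζ` has to pass a leaf or conversely, so leaves are
never permuted among themselves. -/
theorem treeEq_atom_swap (hP : P.IsCompleteDGOperad) (h : PPRelations P b γ ζ) (c c' : Bool) :
    TreeEq P b γ ζ (.b (atom c) (atom c')) (.b (atom c') (atom c)) := by
  cases c <;> cases c'
  · exact TreeEq.refl _
  · exact treeEq_ζ_comm hP h _
  · exact (treeEq_ζ_comm hP h _).symm
  · exact TreeEq.refl _

theorem treeEq_comb_perm (hP : P.IsCompleteDGOperad) (h : PPRelations P b γ ζ) {l l' : List Bool}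
    (hl : l.Perm l') : TreeEq P b γ ζ (comb l) (comb l') := by
  induction hl with
  | nil => exact TreeEq.refl _
  | @cons c l l' hl ih =>
    rcases eq_or_ne l [] with rfl | hl0
    · rw [List.nil_perm.1 hl]
      exact TreeEq.refl _
    · rw [comb_cons hl0, comb_cons fun h => hl0 (List.perm_nil.1 (h ▸ hl))]
      exact (TreeEq.refl _).b_congr ih
  | swap c c' l =>
    rcases eq_or_ne l [] with rfl | hl
    · exact treeEq_atom_swap hP h _ _
    · rw [comb_cons (by simp), comb_cons hl, comb_cons (by simp), comb_cons hl]
      exact (treeEq_assoc hP h _ _ _).symm.trans (((treeEq_atom_swap hP h _ _).b_congr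
        (TreeEq.refl _)).trans (treeEq_assoc hP h _ _ _))
  | trans _ _ h1 h2 => exact h1.trans h2

/-- A product with `γ` vanishes, so `γ` survives only as the whole tree. All other products of combs
are combs by associativity. -/
theorem tree_cases (hP : P.IsCompleteDGOperad) (h : PPRelations P b γ ζ) (t : BTree) :
    t = .γ ∨ TreeZero P b γ ζ t ∨ ∃ l : List Bool, l ≠ [] ∧ TreeEq P b γ ζ t (comb l) := by
  induction t with
  | leaf => exact Or.inr (Or.inr ⟨[true], by simp, TreeEq.refl _⟩)
  | γ => exact Or.inl rfl
  | ζ => exact Or.inr (Or.inr ⟨[false], by simp, TreeEq.refl _⟩)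
  | b s t hs ht =>
    refine Or.inr ?_
    rcases hs with rfl | hs | ⟨l, hl, hs⟩
    · exact Or.inl (treeZero_γ_left h t)
    · exact Or.inl (hs.b_left t)
    rcases ht with rfl | ht | ⟨l', hl', ht⟩
    · exact Or.inl (treeZero_γ_right hP h s)
    · exact Or.inl (TreeZero.b_right s ht)
    exact Or.inr ⟨l ++ l', by simp [hl], (hs.b_congr ht).trans (treeEq_comb_append hP h hl hl')⟩

end tree

end NSOp

end

noncomputable section

/-! ### Generators and relations in the cohomology of `Tw ncBV`. -/

namespace NSOp

variable {k : Type u} [CommRing k]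

/-- The projection onto a quotient as a morphism. -/
def projHom (P : NSOp k) (R : ∀ n p : ℕ, P.V n p → Prop) : Hom P (P.quot R) where
  toFun _ _ := P.proj R
  map_one := rfl
  map_comp _ _ _ _ _ _ := rfl
  map_d _ _ := rfl
  map_F x hx := ⟨x, hx, rfl⟩

/-- The morphism to the cohomology induced by a morphism whose values are cocycles. -/
def Hom.toCohomology {P Q : NSOp k} (f : Hom P Q) (hQ : Q.IsCompleteDGOperad)
    (hP : ∀ {n p q : ℕ} (hq : p + 1 = q) (x : P.V n p), P.d hq x = 0)
    (hf : ∀ {n p : ℕ} (x : P.V n p), Q.d rfl (f.toFun n p x) = 0) : Hom P (Q.cohomology hQ) where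
  toFun n p := (Q.coboundaries n p).mkQ ∘ₗ (f.toFun n p).codRestrict (Q.cocycles n p) hf
  map_one := congrArg (Q.coboundaries 1 0).mkQ (Subtype.ext f.map_one)
  map_comp {m n l p q r} i hi hl hr x y :=
    congrArg (Q.coboundaries l r).mkQ (Subtype.ext (f.map_comp i hi hl hr x y))
  map_d hq x := by rw [hP]; exact map_zero _
  map_F x hx := ⟨⟨f.toFun _ _ x, hf x⟩, f.map_F x hx, rfl⟩

end NSOp

namespace TwNcBV

open NcBV WordModel Letter NSOp

variable {k : Type u} [CommRing k]

variable (k) in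
theorem val_b : val (TwNcBV.b k) = pl [true, true] (eE k 0) := by
  rw [← bamboo_edge]
  exact val_plugTw (n := 2) [true, true] rfl (ncBV.b k)

variable (k) in
theorem val_γ : val (TwNcBV.γ k) = pl [false, false] (1 : Ext k) := by
  rw [← bamboo_empty]
  exact val_plugTw (n := 0) [false, false] rfl (ncBV.points k)

variable (k) in
theorem val_ζ : val (TwNcBV.ζ k) = pl [false] (tE k 0) := by
  rw [show tE k 0 = bamboo k {tadpole 0} from (bamboo_singleton _).symm]
  exact val_plugTw (n := 0) [false] rfl (ncBV.loop k)

variable (k) in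
theorem val_b_eq_RT : val (TwNcBV.b k) = RT (wd [wh, wh]) := by
  rw [val_b, RT_wd]; simp [bamAt, tad, col]

variable (k) in
theorem val_γ_eq_RT : val (TwNcBV.γ k) = RT (wd [bk, gap, bk]) := by
  rw [val_γ, RT_wd]; simp [bamAt, tad, col]

variable (k) in
theorem val_ζ_eq_RT : val (TwNcBV.ζ k) = RT (wd [bkT]) := by
  rw [val_ζ, RT_wd]; simp [bamAt, tad, col]

variable (k) in
theorem d_b : (TwNcBV k).d rfl (TwNcBV.b k) = 0 :=
  d_eq_zero_of_δ (s := 0) (wd_mem ⟨valid_nfw (j := 0) (n := 2) (by omega), rfl, rfl, rfl⟩)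
    (by rw [δ_wd, δw_nfw]) (val_b_eq_RT k)

variable (k) in
theorem d_γ : (TwNcBV k).d rfl (TwNcBV.γ k) = 0 :=
  d_eq_zero_of_δ (s := 1) (wd_mem ⟨valid_bk_gap_bk, rfl, rfl, rfl⟩)
    (by simp [δw]) (val_γ_eq_RT k)

variable (k) in
theorem d_ζ : (TwNcBV k).d rfl (TwNcBV.ζ k) = 0 :=
  d_eq_zero_of_δ (s := 0) (wd_mem ⟨valid_nfw (j := 1) (n := 0) (by omega), rfl, rfl, rfl⟩)
    (by rw [δ_wd, δw_nfw]) (val_ζ_eq_RT k)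

theorem γ_mem_F {w : ℕ} (hw : w ≤ 2) : TwNcBV.γ k ∈ (TwNcBV k).F 0 0 w := by
  refine mem_F_iff.2 fun u hu => ?_
  rw [val_γ, pl_ne]
  rintro rfl
  change 2 < w at hu
  omega

variable (k) in
theorem ζ_mem_F : TwNcBV.ζ k ∈ (TwNcBV k).F 0 1 1 := by
  refine mem_F_iff.2 fun u hu => ?_
  rw [val_ζ, pl_ne]
  rintro rfl
  exact absurd hu (by decide)

theorem compExt_eE_zero (n : ℕ) (x : Ext k) :
    compExt 1 n (eE k 0) x = eE k 0 * ExteriorAlgebra.map (shiftMap k 1) x := by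
  simp [compExt, eE, insertMap]

theorem compExt_eE_zero_mul_tE_zero (n : ℕ) (x : Ext k) :
    compExt 1 n (eE k 0 * tE k 0) x = eE k 0 * tE k 0 * ExteriorAlgebra.map (shiftMap k 1) x := by
  simp [compExt, eE, tE, insertMap]

/-- The composition at the left vertex of `b`. -/
theorem famComp_b_zero {n : ℕ} {v : List Bool} (hn : v.count true = n) (X : Ext k) :
    famComp 0 n (pl [true, true] (eE k 0)) (pl v X) =
      pl (v ++ [true]) (compExt 0 v.length (eE k 0) X) :=
  famComp_pl' (l := []) (r := [true]) rfl hn _ _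

/-- The composition at the right vertex of `b`. -/
theorem famComp_b_one {n : ℕ} {v : List Bool} (hn : v.count true = n) (X : Ext k) :
    famComp 1 n (pl [true, true] (eE k 0)) (pl v X) =
      pl (true :: v) (eE k 0 * ExteriorAlgebra.map (shiftMap k 1) X) := by
  rw [← compExt_eE_zero v.length]
  refine (famComp_pl' (l := [true]) (r := []) rfl hn _ _).trans ?_
  rw [List.append_nil]
  rfl

theorem val_comp_b_ζ : famComp 0 0 (val (TwNcBV.b k)) (val (TwNcBV.ζ k)) =
    pl [false, true] (eE k 0 * tE k 0) := by
  rw [val_b, val_ζ, famComp_b_zero (n := 0) rfl]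
  congr 1
  simp [compExt, eE, tE]

theorem val_bin_ζ {n p l r : ℕ} (hl : 0 + n = l) (hr : 1 + 1 + p = r) (y : (TwNcBV k).V n p)
    {ω : List Letter} (hω : Valid ω) (hn : nW ω = n) (hy : val y = RT (wd ω)) :
    val ((TwNcBV k).bin (TwNcBV.b k) hl hr (TwNcBV.ζ k) y) = -RT (wd (bkT :: ω)) := by
  rw [bin_apply _ _ hl hr (s := 1) (t := 2) one_pos (by omega) rfl (by omega) (by omega), val_comp,
    val_comp, val_comp_b_ζ, hy, RT_wd, RT_wd, bamAt_edge 0 hω]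
  refine (famComp_pl' (l := [false]) (r := []) rfl (by rw [count_true_col, hn]) _ _).trans ?_
  rw [List.length_singleton, compExt_eE_zero_mul_tE_zero, map_shiftMap_bamAt hω, List.append_nil,
    tad, tE_mul_eE_mul, map_neg, neg_neg, mul_assoc]
  rfl

theorem val_bin_one {n p l r : ℕ} (hl : 1 + n = l) (hr : 1 + 0 + p = r) (y : (TwNcBV k).V n p)
    {ω : List Letter} (hω : Valid ω) (hn : nW ω = n) (hy : val y = RT (wd ω)) :
    val ((TwNcBV k).bin (TwNcBV.b k) hl hr (TwNcBV k).one y) = RT (wd (wh :: ω)) := by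
  rw [(isCompleteDGOperad k).bin_one_left hl hr (by omega) (by omega), val_comp, val_b, hy, RT_wd,
    RT_wd, bamAt_edge 0 hω, famComp_b_one (by rw [count_true_col, hn]), map_shiftMap_bamAt hω, tad,
    one_mul]
  rfl

variable (k) in
theorem assoc_b : (TwNcBV k).assoc (TwNcBV.b k) = 0 := by
  refine val_injective ?_
  rw [assoc, map_add, val_comp, val_comp, val_b, famComp_b_zero (n := 2) rfl, famComp_b_one (n := 2) rfl, map_zero,
    map_shiftMap_eE, compExt, shiftMap_zero, ExteriorAlgebra.map_id, List.length_cons,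
    List.length_singleton, map_insertMap_eE_zero, AlgHom.id_apply, eE_mul_eE_comm 0 (1 + 0), map_neg]
  exact add_neg_cancel _

theorem cls_eq_zero_of_δ {n p q s : ℕ} (hq : p + 1 = q) {t : T k} (ht : t ∈ supp k (Grade n p s))
    {x : (TwNcBV k).V n q} (hx : (TwNcBV k).d rfl x = 0) (e : val x = RT (δ t)) : cls x hx = 0 := by
  subst hq
  have h0 : (TwNcBV k).d rfl (0 : (TwNcBV k).V n (p + 1)) = 0 := map_zero _
  refine (cls_eq_smul (c := 0) hx h0 (RT_mem ht) (fun h => absurd h (Nat.succ_ne_zero p)) ?_).trans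
    (zero_smul k _)
  rw [e, zero_smul, zero_add]
  exact (dFam_RT ht).symm

/-- The composite is the word `bk gap bk wh`, and the differential of `bk gap wh` is its negative.
-/
theorem cls_comp_b_γ_zero {x : (TwNcBV k).V 1 1} (hx : (TwNcBV k).d rfl x = 0)
    (e : x = (TwNcBV k).comp 0 two_pos (by omega) (by omega) (TwNcBV.b k) (TwNcBV.γ k)) :
    cls x hx = 0 := by
  have hg : Grade 1 0 1 [bk, gap, wh] :=
    ⟨.gap bk_ne (.single wh_ne), rfl, rfl, rfl⟩
  refine cls_eq_zero_of_δ (s := 1) rfl (neg_mem (wd_mem (k := k) hg)) hx ?_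
  rw [e, val_comp, val_b, val_γ, famComp_b_zero (n := 0) rfl]
  simp [δw, bamAt, tad, col, compExt, map_insertMap_eE_zero]

/-- The mirror image: `wh bk gap bk` is the negative of the differential of `wh gap bk`. -/
theorem cls_comp_b_γ_one {x : (TwNcBV k).V 1 1} (hx : (TwNcBV k).d rfl x = 0)
    (e : x = (TwNcBV k).comp 1 one_lt_two (by omega) (by omega) (TwNcBV.b k) (TwNcBV.γ k)) :
    cls x hx = 0 := by
  have hg : Grade 1 0 1 [wh, gap, bk] :=
    ⟨.gap wh_ne (.single bk_ne), rfl, rfl, rfl⟩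
  refine cls_eq_zero_of_δ (s := 1) rfl (neg_mem (wd_mem (k := k) hg)) hx ?_
  rw [e, val_comp, val_b, val_γ, famComp_b_one (n := 0) rfl]
  simp [δw, bamAt, tad, col]

/-- The relation is bounded by a white vertex with a tadpole: `δ whT` is the commutator of `bkT` and
`wh`, and the first composite carries a sign since the edge precedes the tadpole. -/
theorem cls_comp_b_ζ {x : (TwNcBV k).V 1 2} (hx : (TwNcBV k).d rfl x = 0)
    (e : x = (TwNcBV k).comp 0 two_pos (by omega) (by omega) (TwNcBV.b k) (TwNcBV.ζ k) +
      (TwNcBV k).comp 1 one_lt_two (by omega) (by omega) (TwNcBV.b k) (TwNcBV.ζ k)) :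
    cls x hx = 0 := by
  have hg : Grade 1 1 0 [whT] := ⟨.single whT_ne, rfl, rfl, rfl⟩
  refine cls_eq_zero_of_δ (s := 0) rfl (neg_mem (wd_mem (k := k) hg)) hx ?_
  rw [e, map_add, val_comp, val_comp, val_comp_b_ζ, val_b, val_ζ, famComp_b_one (n := 0) rfl, map_neg, δ_wd]
  have e1 : ExteriorAlgebra.map (shiftMap k 1) (tE k 0) = tE k 1 := by simp [tE]
  rw [e1]
  simp only [δw, bamAt, tad, col, tE_mul_eE, RT_wd, map_neg, map_add, map_sub, map_zero, mul_one,
    one_mul]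
  abel

/-- The letter of a leaf or of a vertex `ζ`. -/
def letter (c : Bool) : Letter := if c then wh else bkT

theorem letter_ne (c : Bool) : letter c ≠ gap := by cases c <;> exact nofun

theorem valid_map_letter {l : List Bool} (hl : l ≠ []) : Valid (l.map letter) := by
  induction l with
  | nil => exact absurd rfl hl
  | cons c l ih =>
    rcases eq_or_ne l [] with rfl | hl
    · exact .single (letter_ne c)
    · exact .edge (letter_ne c) (ih hl)

theorem nW_map_letter (l : List Bool) : nW (l.map letter) = l.count true := by
  induction l with
  | nil => rfl
  | cons c l ih => cases c <;> simp [letter, nW, ih]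

theorem map_letter_replicate (j n : ℕ) :
    (List.replicate j false ++ List.replicate n true).map letter = nfw j n := by
  simp [nfw, letter]

/-- A leaf becomes a white vertex and `ζ` a black vertex with a tadpole, all connected. Each product
with `ζ` on the left reverses the sign, because an edge passes a tadpole. -/
theorem val_evalAt_comb {l : List Bool} (hl : l ≠ []) {n p : ℕ} (hn : (BTree.comb l).arity = n)
    (hp : (BTree.comb l).degree = p) : ∃ e : ℕ,
    val ((TwNcBV k).evalAt (TwNcBV.b k) (TwNcBV.γ k) (TwNcBV.ζ k) (BTree.comb l) hn hp) =
      (-1 : k) ^ e • RT (wd (l.map letter)) := by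
  induction l generalizing n p with
  | nil => exact absurd rfl hl
  | cons c l ih =>
    rcases eq_or_ne l [] with rfl | hl
    · subst hn hp
      refine ⟨0, ?_⟩
      rw [pow_zero, one_smul]
      cases c
      · exact val_ζ_eq_RT k
      · refine val_one.trans ?_
        simp [letter, bamAt, tad, col]
    · obtain ⟨e, he⟩ := ih hl rfl rfl
      have ha := (nW_map_letter l).trans (BTree.arity_comb l).symm
      have hv := valid_map_letter hl
      set y := (TwNcBV k).evalAt (TwNcBV.b k) (TwNcBV.γ k) (TwNcBV.ζ k) (BTree.comb l) rfl rfl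
      have hy : val ((-1 : k) ^ e • y) = RT (wd (l.map letter)) := by
        rw [map_smul, he, neg_one_pow_smul_smul]
      have hy' : y = (-1 : k) ^ e • (-1 : k) ^ e • y := (neg_one_pow_smul_smul e y).symm
      rw [evalAt_congr (BTree.comb_cons hl)]
      rw [BTree.comb_cons hl] at hn hp
      cases c
      · refine ⟨e + 1, ?_⟩
        have hn' : 0 + (BTree.comb l).arity = n := hn
        have hp' : 1 + 1 + (BTree.comb l).degree = p := hp
        rw [evalAt_b (BTree.atom false) (BTree.comb l) (a := 0) (p := 1) rfl rfl rfl rfl hn' hp']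
        change val ((TwNcBV k).bin _ hn' hp' (TwNcBV.ζ k) y) = _
        rw [hy', map_smul, map_smul, val_bin_ζ _ _ _ hv ha hy, pow_succ, mul_neg_one, neg_smul,
          smul_neg]
        rfl
      · refine ⟨e, ?_⟩
        have hn' : 1 + (BTree.comb l).arity = n := hn
        have hp' : 1 + 0 + (BTree.comb l).degree = p := hp
        rw [evalAt_b (BTree.atom true) (BTree.comb l) (a := 1) (p := 0) rfl rfl rfl rfl hn' hp']
        change val ((TwNcBV k).bin _ hn' hp' (TwNcBV k).one y) = _
        rw [hy', map_smul, map_smul, val_bin_one _ _ _ hv ha hy]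
        rfl

end TwNcBV

end

/-! ### The comparison morphism and its bijectivity. -/

noncomputable section

/-- A linear map which sends a generator to a free generator of a filtered module is bijective. -/
theorem IsFreeGenerator.bijective {k : Type u} [CommRing k] {M N : Type*} [AddCommGroup M]
    [Module k M] [AddCommGroup N] [Module k N] {F : ℕ → Submodule k N} {f : M →ₗ[k] N} {g : M}
    {m : ℕ} (hg : ∀ x, ∃ c : k, x = c • g) (h : IsFreeGenerator F (f g) m) :
    Function.Bijective f := by
  refine ⟨(injective_iff_map_eq_zero f).2 fun x hx => ?_, fun y => ?_⟩
  · obtain ⟨c, rfl⟩ := hg x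
    rw [map_smul] at hx
    rw [h.smul_eq_zero hx, zero_smul]
  · obtain ⟨c, rfl⟩ := h.span y
    exact ⟨c • g, map_smul _ _ _⟩

/-- Beyond step `m` the filtration of the target is zero, and up to step `m` the generator itself
lies in `S`. No finer knowledge of the filtrations is needed. -/
theorem IsFreeGenerator.exists_mem {k : Type u} [CommRing k] {M N : Type*} [AddCommGroup M]
    [Module k M] [AddCommGroup N] [Module k N] {F : ℕ → Submodule k N} (hF : Antitone F)
    {f : M →ₗ[k] N} {g : M} {m : ℕ} (h : IsFreeGenerator F (f g) m) {S : Submodule k M} {c : ℕ}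
    (hS : c ≤ m → g ∈ S) {y : N} (hy : y ∈ F c) : ∃ x ∈ S, f x = y := by
  rcases Nat.lt_or_ge m c with hc | hc
  · exact ⟨0, zero_mem _, by rw [map_zero, h.eq_zero (hF hc hy)]⟩
  · obtain ⟨t, rfl⟩ := h.span y
    exact ⟨t • g, Submodule.smul_mem _ _ (hS hc), map_smul _ _ _⟩

theorem IsFreeGenerator.neg_one_pow_smul {k : Type u} [CommRing k] {M : Type*} [AddCommGroup M]
    [Module k M] {F : ℕ → Submodule k M} {g : M} {m : ℕ} (h : IsFreeGenerator F g m) (e : ℕ) :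
    IsFreeGenerator F ((-1 : k) ^ e • g) m where
  span x := by
    obtain ⟨c, rfl⟩ := h.span x
    exact ⟨c * (-1) ^ e, by rw [mul_smul, NSOp.neg_one_pow_smul_smul]⟩
  detect := by
    obtain ⟨φ, h1, h2⟩ := h.detect
    refine ⟨(-1 : k) ^ e • φ, ?_, fun x hx => ?_⟩
    · rw [map_smul, LinearMap.smul_apply, NSOp.neg_one_pow_smul_smul, h1]
    · rw [LinearMap.smul_apply, h2 x hx, smul_zero]

open NSOp

variable {k : Type u} [CommRing k] {w : ℕ}

theorem SAsγζ_d {n p q : ℕ} (hq : p + 1 = q) (x : (SAsγζ k w).V n p) : (SAsγζ k w).d hq x = 0 := by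
  obtain ⟨x, rfl⟩ := Submodule.mkQ_surjective _ x
  exact map_zero ((FreeOp k w).ideal (AssocRel k w) n q).mkQ

namespace SAsPP

variable (k w)

/-- The image of the generator `b`. -/
def b : (SAsPP k w).V 2 1 := (SAsγζ k w).proj (PPRel k w) (SAsγζ.b k w)

/-- The image of the generator `γ`. -/
def γ : (SAsPP k w).V 0 0 := (SAsγζ k w).proj (PPRel k w) (SAsγζ.γ k w)

/-- The image of the generator `ζ`. -/
def ζ : (SAsPP k w).V 0 1 := (SAsγζ k w).proj (PPRel k w) (SAsγζ.ζ k w)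

theorem γ_mem_F : γ k w ∈ (SAsPP k w).F 0 0 w :=
  ⟨_, ⟨_, FreeOp.tree_mem_F .γ rfl rfl le_rfl, rfl⟩, rfl⟩

theorem ζ_mem_F : ζ k w ∈ (SAsPP k w).F 0 1 1 :=
  ⟨_, ⟨_, FreeOp.tree_mem_F .ζ rfl rfl le_rfl, rfl⟩, rfl⟩

theorem proj_eq_zero {n p : ℕ} {x : (SAsγζ k w).V n p} (h : PPRel k w n p x) :
    (SAsγζ k w).proj (PPRel k w) x = 0 :=
  (Submodule.Quotient.mk_eq_zero _).2 (InIdeal.of x h)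

theorem relations : PPRelations (SAsPP k w) (b k w) (γ k w) (ζ k w) where
  assoc := by
    have h : (SAsγζ k w).assoc (SAsγζ.b k w) = 0 :=
      ((projHom (FreeOp k w) (AssocRel k w)).map_assoc (FreeOp.b k w)).symm.trans
        ((Submodule.Quotient.mk_eq_zero _).2 (InIdeal.of _ .assoc))
    exact ((projHom (SAsγζ k w) (PPRel k w)).map_assoc (SAsγζ.b k w)).symm.trans
      ((congrArg _ h).trans (map_zero ((SAsγζ k w).proj (PPRel k w))))
  γ_left := proj_eq_zero k w .γ_left
  γ_right := proj_eq_zero k w .γ_right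
  ζ_comm := proj_eq_zero k w .ζ_comm

variable {k w}

/-- The projection from the free operad. -/
def ofFree (n p : ℕ) : (FreeOp k w).V n p →ₗ[k] (SAsPP k w).V n p :=
  (SAsγζ k w).proj (PPRel k w) ∘ₗ (FreeOp k w).proj (AssocRel k w)

theorem ofFree_tree (t : BTree) {n p : ℕ} (hn : t.arity = n) (hp : t.degree = p) :
    ofFree n p (FreeOp.tree k w t hn hp) =
      (SAsPP k w).evalAt (b k w) (γ k w) (ζ k w) t hn hp := by
  rw [← FreeOp.evalAt_eq_tree]
  exact (congrArg _ ((projHom (FreeOp k w) (AssocRel k w)).map_evalAt t hn hp)).trans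
    ((projHom (SAsγζ k w) (PPRel k w)).map_evalAt t hn hp)

theorem induction {n p : ℕ} {C : (SAsPP k w).V n p → Prop} (h0 : C 0)
    (hadd : ∀ x y, C x → C y → C (x + y)) (hsmul : ∀ (c : k) x, C x → C (c • x))
    (htree : ∀ t hn hp, C ((SAsPP k w).evalAt (b k w) (γ k w) (ζ k w) t hn hp))
    (x : (SAsPP k w).V n p) : C x := by
  obtain ⟨x, rfl⟩ := Submodule.mkQ_surjective _ x
  obtain ⟨x, rfl⟩ := Submodule.mkQ_surjective _ x
  refine FreeOp.induction (C := fun x => C (ofFree n p x)) (by rw [map_zero]; exact h0)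
    (fun x y hx hy => by rw [map_add]; exact hadd _ _ hx hy)
    (fun c x hx => by rw [map_smul]; exact hsmul c _ hx) (fun t hn hp => ?_) x
  rw [ofFree_tree]
  exact htree t hn hp

/-- The tree with `j` vertices `ζ` and `n` leaves, in this order, which is a right comb. -/
def nfTree (j n : ℕ) : BTree := BTree.comb (List.replicate j false ++ List.replicate n true)

theorem arity_nfTree (j n : ℕ) : (nfTree j n).arity = n := by
  rw [nfTree, BTree.arity_comb]; simp [List.count_replicate]

theorem replicate_ne_nil {j n p : ℕ} (h : n + 2 * j = p + 1) :
    List.replicate j false ++ List.replicate n true ≠ [] := by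
  intro h'
  have := congrArg List.length h'
  simp only [List.length_append, List.length_replicate, List.length_nil] at this
  omega

theorem degree_nfTree {j n p : ℕ} (h : n + 2 * j = p + 1) : (nfTree j n).degree = p := by
  have h1 := BTree.degree_comb (replicate_ne_nil h)
  rw [nfTree]
  simp only [List.count_append, List.count_replicate] at h1
  simp at h1
  omega

theorem weight_nfTree {j n p : ℕ} (h : n + 2 * j = p + 1) : (nfTree j n).weight w = j := by
  rw [nfTree, BTree.weight_comb w (replicate_ne_nil h)]
  simp [List.count_replicate]

/-- Arity and degree count the leaves and the `ζ` of a comb. Sorting the `ζ` to the front therefore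
leaves only one candidate in each component. -/
theorem evalAt_cases (t : BTree) {n p : ℕ} (hn : t.arity = n) (hp : t.degree = p) :
    t = .γ ∨ (SAsPP k w).evalAt (b k w) (γ k w) (ζ k w) t hn hp = 0 ∨
      ∃ (j : ℕ) (h : n + 2 * j = p + 1) (e : ℕ), (SAsPP k w).evalAt (b k w) (γ k w) (ζ k w) t hn hp =
        (-1 : k) ^ e • (SAsPP k w).evalAt (b k w) (γ k w) (ζ k w) (nfTree j n) (arity_nfTree j n)
          (degree_nfTree h) := by
  have hP := SAsPP_isCompleteDGOperad k w
  rcases tree_cases hP (relations k w) t with h | h | ⟨l, hl, h⟩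
  · exact Or.inl h
  · exact Or.inr (Or.inl (h hn hp))
  · refine Or.inr (Or.inr ?_)
    have h1 : l.count true = n := by rw [← BTree.arity_comb, ← h.arity, hn]
    have h2 : n + 2 * l.count false = p + 1 := by
      rw [← h1, ← BTree.degree_comb hl, ← h.degree, hp]
    have h3 := h.trans (treeEq_comb_perm hP (relations k w) (BTree.perm_replicate l))
    rw [h1] at h3
    exact ⟨_, h2, h3.eval hn hp (arity_nfTree _ n) (degree_nfTree h2)⟩

theorem exists_eq_smul_nfTree {j n p : ℕ} (h : n + 2 * j = p + 1) (x : (SAsPP k w).V n p) :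
    ∃ c : k, x = c • (SAsPP k w).evalAt (b k w) (γ k w) (ζ k w) (nfTree j n) (arity_nfTree j n)
      (degree_nfTree h) := by
  refine induction (C := fun x => ∃ c : k, x = c • _) ⟨0, (zero_smul _ _).symm⟩ ?_ ?_
    (fun t hn hp => ?_) x
  · rintro _ _ ⟨c, rfl⟩ ⟨c', rfl⟩
    exact ⟨c + c', (add_smul _ _ _).symm⟩
  · rintro a _ ⟨c, rfl⟩
    exact ⟨a * c, (mul_smul _ _ _).symm⟩
  · rcases evalAt_cases (k := k) (w := w) t hn hp with rfl | h' | ⟨j', h', e, he⟩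
    · change 0 = n at hn
      change 0 = p at hp
      omega
    · exact ⟨0, by rw [h', zero_smul]⟩
    · obtain rfl : j' = j := by omega
      exact ⟨_, he⟩

theorem exists_eq_smul_γ (x : (SAsPP k w).V 0 0) : ∃ c : k, x = c • γ k w := by
  refine induction (C := fun x => ∃ c : k, x = c • _) ⟨0, (zero_smul _ _).symm⟩ ?_ ?_
    (fun t hn hp => ?_) x
  · rintro _ _ ⟨c, rfl⟩ ⟨c', rfl⟩
    exact ⟨c + c', (add_smul _ _ _).symm⟩
  · rintro a _ ⟨c, rfl⟩
    exact ⟨a * c, (mul_smul _ _ _).symm⟩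
  · rcases evalAt_cases (k := k) (w := w) t hn hp with rfl | h' | ⟨j', h', e, he⟩
    · exact ⟨1, (one_smul _ _).symm⟩
    · exact ⟨0, by rw [h', zero_smul]⟩
    · omega

theorem eq_zero {n p : ℕ} (h : ∀ j, n + 2 * j ≠ p + 1) (h' : ¬ (n = 0 ∧ p = 0))
    (x : (SAsPP k w).V n p) : x = 0 := by
  refine induction (C := fun x => x = 0) rfl (fun x y hx hy => by rw [hx, hy, add_zero])
    (fun c x hx => by rw [hx, smul_zero]) (fun t hn hp => ?_) x
  rcases evalAt_cases (k := k) (w := w) t hn hp with rfl | h1 | ⟨j, h1, -⟩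
  · exact absurd ⟨hn.symm, hp.symm⟩ h'
  · exact h1
  · exact absurd h1 (h j)

end SAsPP

namespace TwNcBV

open NcBV WordModel Letter

section hom

variable {Φ : Hom (SAsγζ k w) (TwNcBV k)}

theorem d_map (Φ : Hom (SAsγζ k w) (TwNcBV k)) {n p : ℕ} (x : (SAsγζ k w).V n p) :
    (TwNcBV k).d rfl (Φ.toFun n p x) = 0 := by
  rw [← Φ.map_d rfl, SAsγζ_d, map_zero]

/-- The cohomology classes of the values of a morphism. -/
def classHom (Φ : Hom (SAsγζ k w) (TwNcBV k)) : Hom (SAsγζ k w) (H k) :=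
  Φ.toCohomology (isCompleteDGOperad k) SAsγζ_d (d_map Φ)

theorem classHom_apply (Φ : Hom (SAsγζ k w) (TwNcBV k)) {n p : ℕ} (x : (SAsγζ k w).V n p) :
    (classHom Φ).toFun n p x = cls (Φ.toFun n p x) (d_map Φ x) := rfl

theorem classHom_eq_zero (hb : Φ.toFun 2 1 (SAsγζ.b k w) = TwNcBV.b k)
    (hγ : Φ.toFun 0 0 (SAsγζ.γ k w) = TwNcBV.γ k) (hζ : Φ.toFun 0 1 (SAsγζ.ζ k w) = TwNcBV.ζ k)
    (n p : ℕ) (x : (SAsγζ k w).V n p) (h : PPRel k w n p x) : (classHom Φ).toFun n p x = 0 := by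
  rw [classHom_apply]
  cases h with
  | γ_left => exact cls_comp_b_γ_zero _ (by rw [Φ.map_comp, hb, hγ])
  | γ_right => exact cls_comp_b_γ_one _ (by rw [Φ.map_comp, hb, hγ])
  | ζ_comm => exact cls_comp_b_ζ _ (by rw [map_add, Φ.map_comp, Φ.map_comp, hb, hζ])

variable (hb : Φ.toFun 2 1 (SAsγζ.b k w) = TwNcBV.b k)
  (hγ : Φ.toFun 0 0 (SAsγζ.γ k w) = TwNcBV.γ k) (hζ : Φ.toFun 0 1 (SAsγζ.ζ k w) = TwNcBV.ζ k)

/-- The morphism from `S⁻¹As⁺⁺` to the cohomology of `Tw ncBV`. -/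
def comparison : Hom (SAsPP k w) (H k) :=
  (classHom Φ).quotLift (cohomology_isCompleteDGOperad k) (PPRel k w) (classHom_eq_zero hb hγ hζ)

theorem comparison_evalAt (t : BTree) {n p : ℕ} (hn : t.arity = n) (hp : t.degree = p) :
    ∃ hd, (comparison hb hγ hζ).toFun n p
        ((SAsPP k w).evalAt (SAsPP.b k w) (SAsPP.γ k w) (SAsPP.ζ k w) t hn hp) =
      cls ((TwNcBV k).evalAt (TwNcBV.b k) (TwNcBV.γ k) (TwNcBV.ζ k) t hn hp) hd := by
  have h1 : (TwNcBV k).evalAt (TwNcBV.b k) (TwNcBV.γ k) (TwNcBV.ζ k) t hn hp =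
      Φ.toFun n p ((SAsγζ k w).evalAt (SAsγζ.b k w) (SAsγζ.γ k w) (SAsγζ.ζ k w) t hn hp) := by
    rw [Φ.map_evalAt, hb, hγ, hζ]
  have h2 : (SAsPP k w).evalAt (SAsPP.b k w) (SAsPP.γ k w) (SAsPP.ζ k w) t hn hp =
      (SAsγζ k w).proj (PPRel k w)
        ((SAsγζ k w).evalAt (SAsγζ.b k w) (SAsγζ.γ k w) (SAsγζ.ζ k w) t hn hp) :=
    ((projHom (SAsγζ k w) (PPRel k w)).map_evalAt t hn hp).symm
  rw [h1, h2]
  exact ⟨d_map Φ _, rfl⟩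

theorem isFreeGenerator_comparison_nfTree {j n p : ℕ} (h : n + 2 * j = p + 1) :
    IsFreeGenerator ((H k).F n p) ((comparison hb hγ hζ).toFun n p
      ((SAsPP k w).evalAt (SAsPP.b k w) (SAsPP.γ k w) (SAsPP.ζ k w) (SAsPP.nfTree j n)
        (SAsPP.arity_nfTree j n) (SAsPP.degree_nfTree h))) j := by
  obtain ⟨hd, e1⟩ := comparison_evalAt hb hγ hζ (SAsPP.nfTree j n) (SAsPP.arity_nfTree j n)
    (SAsPP.degree_nfTree h)
  obtain ⟨e, e2⟩ := val_evalAt_comb (k := k) (SAsPP.replicate_ne_nil h) (SAsPP.arity_nfTree j n)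
    (SAsPP.degree_nfTree h)
  rw [map_letter_replicate] at e2
  rw [e1]
  obtain ⟨x, hx⟩ := exists_val_eq_RT (wd_mem (k := k) (grade_nfw h))
  have hdx := d_eq_zero_of_δ (wd_mem (grade_nfw h)) (by rw [δ_wd, δw_nfw]) hx
  have e3 : (TwNcBV k).evalAt (TwNcBV.b k) (TwNcBV.γ k) (TwNcBV.ζ k) (SAsPP.nfTree j n)
      (SAsPP.arity_nfTree j n) (SAsPP.degree_nfTree h) = (-1 : k) ^ e • x :=
    val_injective (by rw [map_smul, hx]; exact e2)
  have e4 : cls _ hd = (-1 : k) ^ e • cls x hdx :=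
    congrArg ((TwNcBV k).coboundaries n p).mkQ (Subtype.ext e3)
  rw [e4]
  exact (isFreeGenerator_nfw h hdx hx).neg_one_pow_smul e

theorem isFreeGenerator_comparison_γ :
    IsFreeGenerator ((H k).F 0 0) ((comparison hb hγ hζ).toFun 0 0 (SAsPP.γ k w)) 2 := by
  obtain ⟨hd, e⟩ := comparison_evalAt hb hγ hζ .γ rfl rfl
  have e' : (comparison hb hγ hζ).toFun 0 0 (SAsPP.γ k w) = cls (TwNcBV.γ k) (d_γ k) := e
  rw [e']
  exact isFreeGenerator_bk_gap_bk (d_γ k) (val_γ_eq_RT k)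

/-- Source and target vanish in the same arities and degrees. Elsewhere the source is spanned by one
element, whose image is a free generator. -/
theorem bijective_comparison (n p : ℕ) : Function.Bijective ((comparison hb hγ hζ).toFun n p) := by
  by_cases h : ∃ j, n + 2 * j = p + 1
  · obtain ⟨j, h⟩ := h
    exact IsFreeGenerator.bijective (SAsPP.exists_eq_smul_nfTree h)
      (isFreeGenerator_comparison_nfTree hb hγ hζ h)
  by_cases h' : n = 0 ∧ p = 0
  · obtain ⟨rfl, rfl⟩ := h'
    exact IsFreeGenerator.bijective SAsPP.exists_eq_smul_γ (isFreeGenerator_comparison_γ hb hγ hζ)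
  · push Not at h
    refine ⟨fun x y _ => ?_, fun y => ⟨0, ?_⟩⟩
    · rw [SAsPP.eq_zero h h' x, SAsPP.eq_zero h h' y]
    · rw [cohomology_eq_zero h h' y, map_zero]

theorem exists_mem_F_comparison (hw : w ≤ 2) {n p a c : ℕ} (hc : c + w = a + 2) {y : (H k).V n p}
    (hy : y ∈ (H k).F n p c) :
    ∃ x ∈ (SAsPP k w).F n p a, (comparison hb hγ hζ).toFun n p x = y := by
  have hF := (cohomology_isCompleteDGOperad k).F_antitone n p
  have hP := SAsPP_isCompleteDGOperad k w
  by_cases h : ∃ j, n + 2 * j = p + 1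
  · obtain ⟨j, h⟩ := h
    -- The comb has weight `j` and its class `j` black vertices. As `w ≤ 2`, the bound `c ≤ j`
    -- implies `a ≤ j`.
    refine (isFreeGenerator_comparison_nfTree hb hγ hζ h).exists_mem hF (fun hj => ?_) hy
    have h1 := evalAt_mem_F (b := SAsPP.b k w) hP (SAsPP.γ_mem_F k w) (SAsPP.ζ_mem_F k w)
      (SAsPP.nfTree j n) (SAsPP.arity_nfTree j n) (SAsPP.degree_nfTree h)
    rw [SAsPP.weight_nfTree h] at h1
    exact hP.F_antitone n p (by omega) h1
  by_cases h' : n = 0 ∧ p = 0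
  · obtain ⟨rfl, rfl⟩ := h'
    -- The class of `γ` lives in step `2` and `γ` in step `w`; here the relation `c + w = a + 2` is
    -- sharp.
    exact (isFreeGenerator_comparison_γ hb hγ hζ).exists_mem hF
      (fun hj => hP.F_antitone 0 0 (by omega) (SAsPP.γ_mem_F k w)) hy
  · push Not at h
    exact ⟨0, zero_mem _, by rw [cohomology_eq_zero h h' y, map_zero]⟩

end hom

theorem exists_hom (hw : w ≤ 2) : ∃! Φ : Hom (SAsγζ k w) (TwNcBV k),
    Φ.toFun 2 1 (SAsγζ.b k w) = TwNcBV.b k ∧ Φ.toFun 0 0 (SAsγζ.γ k w) = TwNcBV.γ k ∧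
      Φ.toFun 0 1 (SAsγζ.ζ k w) = TwNcBV.ζ k :=
  existsUnique_hom_SAsγζ (isCompleteDGOperad k) (assoc_b k) (d_b k) (d_γ k) (d_ζ k) (γ_mem_F hw)
    (ζ_mem_F k)

end TwNcBV

end

theorem mainTheorem11 (k : Type u) [CommRing k] :
    (ncBV k).IsCompleteDGOperad ∧ (ncBV k).assoc (ncBV.b k) = 0 ∧
    ∃ hTw : (TwNcBV k).IsCompleteDGOperad,
      ((TwNcBV k).cohomology hTw).IsCompleteDGOperad ∧
      ∀ w : ℕ, w = 1 ∨ w = 2 →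
        (SAsγζ k w).IsCompleteDGOperad ∧ (SAsPP k w).IsCompleteDGOperad ∧
        (∀ P : NSOp.{u} k, P.IsCompleteDGOperad →
          ∀ (b : P.V 2 1) (γ : P.V 0 0) (ζ : P.V 0 1), P.assoc b = 0 →
            P.d rfl b = 0 → P.d rfl γ = 0 → P.d rfl ζ = 0 → γ ∈ P.F 0 0 w → ζ ∈ P.F 0 1 1 →
            ∃! f : NSOp.Hom (SAsγζ k w) P, f.toFun 2 1 (SAsγζ.b k w) = b ∧
              f.toFun 0 0 (SAsγζ.γ k w) = γ ∧ f.toFun 0 1 (SAsγζ.ζ k w) = ζ) ∧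
        ∃ Φ : NSOp.Hom (SAsγζ k w) (TwNcBV k),
          (Φ.toFun 2 1 (SAsγζ.b k w) = TwNcBV.b k ∧
            Φ.toFun 0 0 (SAsγζ.γ k w) = TwNcBV.γ k ∧
            Φ.toFun 0 1 (SAsγζ.ζ k w) = TwNcBV.ζ k) ∧
          (∀ Φ' : NSOp.Hom (SAsγζ k w) (TwNcBV k),
            Φ'.toFun 2 1 (SAsγζ.b k w) = TwNcBV.b k →
            Φ'.toFun 0 0 (SAsγζ.γ k w) = TwNcBV.γ k →
            Φ'.toFun 0 1 (SAsγζ.ζ k w) = TwNcBV.ζ k → Φ' = Φ) ∧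
          ∃ Ψ : NSOp.Hom (SAsPP k w) ((TwNcBV k).cohomology hTw),
            (∀ (n p : ℕ) (x : (SAsγζ k w).V n p), ∃ hx : (TwNcBV k).d rfl (Φ.toFun n p x) = 0,
              Ψ.toFun n p ((SAsγζ k w).proj (PPRel k w) x)
                = (TwNcBV k).cohomologyClass hTw (Φ.toFun n p x) hx) ∧
            (∀ n p : ℕ, Function.Bijective (Ψ.toFun n p)) ∧
            (∀ n p a c : ℕ, c + w = a + 2 →
              ∀ y ∈ ((TwNcBV k).cohomology hTw).F n p c,
                ∃ x ∈ (SAsPP k w).F n p a, Ψ.toFun n p x = y) := by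
  refine ⟨ncBV_isCompleteDGOperad k, ncBV_assoc k, TwNcBV.isCompleteDGOperad k,
    TwNcBV.cohomology_isCompleteDGOperad k, fun w hw => ⟨SAsγζ_isCompleteDGOperad k w,
    SAsPP_isCompleteDGOperad k w, fun P hP b γ ζ h hb hdγ hdζ hγ hζ =>
      NSOp.existsUnique_hom_SAsγζ hP h hb hdγ hdζ hγ hζ, ?_⟩⟩
  have hw' : w ≤ 2 := by omega
  obtain ⟨Φ, ⟨hb, hγ, hζ⟩, huniq⟩ := TwNcBV.exists_hom (k := k) hw'
  exact ⟨Φ, ⟨hb, hγ, hζ⟩, fun Φ' h1 h2 h3 => huniq Φ' ⟨h1, h2, h3⟩, TwNcBV.comparison hb hγ hζ,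
    fun n p x => ⟨TwNcBV.d_map Φ x, rfl⟩, TwNcBV.bijective_comparison hb hγ hζ,
    fun n p a c hc y hy => TwNcBV.exists_mem_F_comparison hb hγ hζ hw' hc hy⟩
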